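/- **Notation.** Let $n\ge 1$. For a measurable function $g$ put $\lambda_g(y)=|\{|g|>y\}|$, $g^*(t)=\sup\{y\in(0,\infty):\lambda_g(y)>t\}$ (with $\sup\emptyset=0$), and $$\|g\|^*_{L^{p,q}}=\Big(\tfrac qp\int_0^\infty[t^{1/p}g^*(t)]^q\tfrac{dt}{t}\Big)^{1/q}\ (p,q<\infty),\qquad \|g\|^*_{L^{p,\infty}}=\sup_{t>0}t^{1/p}g^*(t)\ (p\le\infty).$$ Moreover $\|g\|^*_{L^{\overline\infty,\infty}}=\sup_x|g(x)|$, where $\overline\infty>\infty$ is an additional exponent and $\frac1\infty=\frac1{\overline\infty}=0$. $L^{p,q}=L^{p,q}(\mathbb R^n)$ is the space of measurable $g$ with $\|g\|^*_{L^{p,q}}<\infty$. Write $g=_ph$ if $g=h$ almost everywhere (when $p\in[1,\infty]$), respectively everywhere (when $p=\overline\infty$). For $T\in(0,\infty]$ and measurable $u:(0,T)\times\mathbb R^n\to\mathbb R^n$ let $$\|u\|_{\mathcal L^{\alpha,\beta}_{p,q}(T)}^*=\big\|\mathbf 1_{(0,T)}(t)\,\|u(t)\|^*_{L^{p,q}}\big\|^*_{L^{\alpha,\beta}(\mathbb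 R)},\qquad \|u\|^*_{\mathcal J^\sigma_{p,q}(T)}=\sup_{t\in(0,T)}t^{-\sigma/2}\|u(t)\|^*_{L^{p,q}},$$ let $\mathcal L^{\alpha,\beta}_{p,q}(T)$, $\mathcal J^\sigma_{p,q}(T)$ be the spaces where these are finite, and $\mathcal L^{\alpha,\beta}_{p,q}(T_-)=\bigcap_{T'\in(0,T)}\mathcal L^{\alpha,\beta}_{p,q}(T')$, $\mathcal J^\sigma_{p,q}(T_-)=\bigcap_{T'\in(0,T)}\mathcal J^\sigma_{p,q}(T')$. Write $u=_r^{\mathrm{a.e.}}v$ on $(0,T)$ if $u(t)=_rv(t)$ for almost every $t\in(0,T)$. Finally let $\Phi(t,x)=(4\pi t)^{-n/2}e^{-|x|^2/4t}$, $\mathcal T_{ij}(t,x)=(2\pi)^{-n}\int e^{ix\cdot\xi-t|\xi|^2}\big(\delta_{ij}-\tfrac{\xi_i\xi_j}{|\xi|^2}\big)d\xi$, and (summing over repeated indices) $$S_i[f](t,x)=\int\Phi(t,x-y)f_i(y)\,dy,\qquad B_i[u,v](t,x)=\int_0^t\!\!\int\nabla_k\mathcal T_{ij}(t-s,x-y)\,u_j(s,y)v_k(s,y)\,dy\,ds;$$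 an equation $u=S[f]-B[u,u]$ includes the claim that the integrals converge absolutely at the points in question. **Statement.** There are a constant $C_n$ and, for every $r\in(n,\infty]$, a constant $\eta_{n,r}$ with $$0<\eta_{n,r}\le C_n\,r'\int_0^1(1-s)^{-1/2}s^{-n/r}\,ds,\qquad \tfrac1r+\tfrac1{r'}=1,$$ such that the following local existence property and (i) below hold. *Local existence:* if $p\in(1,\infty]$, $q\in[1,\infty]$ ($p=\infty\Rightarrow q=\infty$), $T\in(0,\infty)$, $f\in L^{p,q}\cap L^{r,\infty}$ and $4\eta_{n,r}T^{\frac12(1-\frac nr)}\|f\|^*_{L^{r,\infty}}<1$, then there is $u\in\mathcal J^0_{p,q}(T)\cap\mathcal J^{-n/r}_{\overline\infty,\infty}(T)$ with $u=S[f]-B[u,u]$ everywhere on $(0,T)\times\mathbb R^n$. Let $f\in\bigcup_{p\in(n,\infty]}L^{p,\infty}(\mathbb R^n)$, $f:\mathbb R^n\to\mathbb R^n$. There is a maximal $T_*\in(0,\infty]$ for which there exists $u_*\in\bigcup_{\sigma\in(-1,\infty)}\mathcal J^\sigma_{\overline\infty,\infty}({T_*}_-)$ satisfying $u_*=S[f]-B[u_*,u_*]$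 everywhere on $(0,T_*)\times\mathbb R^n$; this $u_*$ is unique, and: (i) If $T_*<\infty$, then $$\|u_*(t_0)\|^*_{L^{r,\infty}}\ge\frac1{4\eta_{n,r}(T_*-t_0)^{\frac12(1-\frac nr)}}\quad\text{for all }r\in(n,\infty]\text{ and }t_0\in(0,T_*),$$ where the left side is $\infty$ if $u_*(t_0)\notin L^{r,\infty}$. (ii) If $r_0\in(n,\infty]$ and $f\in L^{r_0,\infty}$, then $$u_*\in\mathcal J^0_{r_0,\infty}({T_*}_-)\cap\mathcal J^{-n/r_0}_{\overline\infty,\infty}({T_*}_-)\cap\bigcap_{r\in(r_0,\infty)}\mathcal J^{\frac nr-\frac n{r_0}}_{r,1}({T_*}_-).$$ Moreover, if $r\in[r_0,\overline\infty]$, $\alpha\in(2,\infty)$, $\beta\in[1,\infty)$, $\frac n{r_0}<\frac2\alpha+\frac nr\le1$, $T\in(0,\infty]$, and $v\in\mathcal L^{\alpha,\beta}_{r,\infty}(T_-)$ satisfies $v=_r^{\mathrm{a.e.}}S[f]-B[v,v]$ on $(0,T)$, then $T\le T_*$ and $u_*=_r^{\mathrm{a.e.}}v$ on $(0,T)$.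 (iii) If $r_0\in(n,\infty]$, $p\in(1,r_0]$, $q\in[1,\infty]$ ($p=\infty\Rightarrow q=\infty$) and $f\in L^{p,q}\cap L^{r_0,\infty}$, then $$u_*\in\mathcal J^0_{p,q}({T_*}_-)\cap\bigcap_{r\in(p,r_0)}\mathcal J^0_{r,1}({T_*}_-).$$ -/

import Mathlib

open MeasureTheory Set
open scoped ENNReal

noncomputable section

namespace NSLorentz

/-- Euclidean space `ℝⁿ`. -/
abbrev Sp (n : ℕ) := EuclideanSpace ℝ (Fin n)

/-! ### Lorentz quasinorms -/

/-- The distribution function `λ_g(y) = μ {g > y}`, for a nonnegative function `g`. -/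
def distrib {X : Type*} [MeasurableSpace X] (μ : Measure X) (g : X → ℝ≥0∞) (y : ℝ≥0∞) : ℝ≥0∞ :=
  μ {x | y < g x}

/-- The decreasing rearrangement `g^*(t) = sup {y ∈ (0,∞) : λ_g(y) > t}`. -/
def rearr {X : Type*} [MeasurableSpace X] (μ : Measure X) (g : X → ℝ≥0∞) (t : ℝ) : ℝ≥0∞ :=
  sSup {y : ℝ≥0∞ | 0 < y ∧ y < ∞ ∧ ENNReal.ofReal t < distrib μ g y}

/-- The Lorentz quasinorm `‖g‖^*_{L^{p,q}(μ)}` of a nonnegative function `g`: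
`((q/p) ∫₀^∞ [t^{1/p} g^*(t)]^q dt/t)^{1/q}` if `q < ∞`, and `sup_{t>0} t^{1/p} g^*(t)` if `q = ∞`
(with `1/∞ = 0`). It is meant for `p, q ∈ [1,∞]` such that `p = ∞` implies `q = ∞`. -/
def lorentzNorm {X : Type*} [MeasurableSpace X] (μ : Measure X) (p q : ℝ≥0∞) (g : X → ℝ≥0∞) :
    ℝ≥0∞ :=
  if q = ∞ then
    ⨆ t ∈ Ioi (0 : ℝ), ENNReal.ofReal t ^ (p⁻¹).toReal * rearr μ g t
  else
    (q / p * ∫⁻ t in Ioi (0 : ℝ),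
      (ENNReal.ofReal t ^ (p⁻¹).toReal * rearr μ g t) ^ q.toReal / ENNReal.ofReal t)
        ^ (q.toReal)⁻¹

/-- The exponents `[0,∞] ∪ {∞̄}`. The top element `⊤` is the exponent `∞̄`, which stands for the
pointwise supremum; the exponent `∞` is `((∞ : ℝ≥0∞) : Expo)`, and `∞ < ∞̄`. -/
abbrev Expo := WithTop ℝ≥0∞

/-- `1/r` as a real number, with `1/∞ = 1/∞̄ = 0`. -/
def Expo.inv : Expo → ℝ
  | none => 0
  | some r => (r⁻¹).toReal

/-- The quasinorm `‖f‖^*_{L^{p,q}(ℝⁿ)}` of a vector field, where `p` may be `∞̄`. -/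
def spNorm {n : ℕ} (p : Expo) (q : ℝ≥0∞) (f : Sp n → Sp n) : ℝ≥0∞ :=
  match p with
  | none => ⨆ x, ‖f x‖ₑ
  | some p => lorentzNorm volume p q (fun x => ‖f x‖ₑ)

/-- `f ∈ L^{p,q}(ℝⁿ)`. -/
def MemLorentz {n : ℕ} (p : Expo) (q : ℝ≥0∞) (f : Sp n → Sp n) : Prop :=
  Measurable f ∧ spNorm p q f < ∞

/-- `P` holds for all `x` if `p = ∞̄`, and for almost every `x` otherwise. In particular
`Holds p (fun x => f x = g x)` is the relation `f =_p g`. -/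
def Holds {n : ℕ} (p : Expo) (P : Sp n → Prop) : Prop :=
  match p with
  | none => ∀ x, P x
  | some _ => ∀ᵐ x ∂(volume : Measure (Sp n)), P x

/-! ### Path spaces -/

/-- The time interval `(0,T)`, for `T ∈ [0,∞]`. -/
def timeI (T : ℝ≥0∞) : Set ℝ := {t | 0 < t ∧ ENNReal.ofReal t < T}

/-- `u` is measurable on `(0,T) × ℝⁿ`. -/
def MeasOn {n : ℕ} (T : ℝ≥0∞) (u : ℝ → Sp n → Sp n) : Prop :=
  Measurable ((timeI T ×ˢ (univ : Set (Sp n))).indicator (fun z : ℝ × Sp n => u z.1 z.2))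

/-- `u ∈ 𝓛^{α,β}_{p,q}(T)`. -/
def MemL {n : ℕ} (α β : ℝ≥0∞) (p : Expo) (q T : ℝ≥0∞) (u : ℝ → Sp n → Sp n) : Prop :=
  MeasOn T u ∧
    lorentzNorm (volume : Measure ℝ) α β ((timeI T).indicator fun t => spNorm p q (u t)) < ∞

/-- `u ∈ 𝓙^σ_{p,q}(T)`. -/
def MemJ {n : ℕ} (σ : ℝ) (p : Expo) (q T : ℝ≥0∞) (u : ℝ → Sp n → Sp n) : Prop :=
  MeasOn T u ∧
    (⨆ t ∈ timeI T, ENNReal.ofReal t ^ (-σ / 2) * spNorm p q (u t)) < ∞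

/-- `u ∈ 𝓛^{α,β}_{p,q}(T₋)`, the intersection of the spaces `𝓛^{α,β}_{p,q}(T')`, `T' ∈ (0,T)`. -/
def MemLm {n : ℕ} (α β : ℝ≥0∞) (p : Expo) (q T : ℝ≥0∞) (u : ℝ → Sp n → Sp n) : Prop :=
  ∀ T' : ℝ≥0∞, 0 < T' → T' < T → MemL α β p q T' u

/-- `u ∈ 𝓙^σ_{p,q}(T₋)`, the intersection of the spaces `𝓙^σ_{p,q}(T')`, `T' ∈ (0,T)`. -/
def MemJm {n : ℕ} (σ : ℝ) (p : Expo) (q T : ℝ≥0∞) (u : ℝ → Sp n → Sp n) : Prop :=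
  ∀ T' : ℝ≥0∞, 0 < T' → T' < T → MemJ σ p q T' u

/-! ### Kernels and the integral equation -/

/-- The heat kernel `Φ(t,x)`. -/
def heatK {n : ℕ} (t : ℝ) (x : Sp n) : ℝ :=
  1 / (4 * Real.pi * t) ^ ((n : ℝ) / 2) * Real.exp (-‖x‖ ^ 2 / (4 * t))

/-- The Oseen kernel
`𝒯_{ij}(t,x) = (2π)^{-n} ∫ e^{i x·ξ - t|ξ|²} (δ_{ij} - ξ_i ξ_j / |ξ|²) dξ`.
The integral is a real number, by the symmetry `ξ ↦ -ξ`, so that taking the real part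
only changes its type. -/
def oseenK {n : ℕ} (i j : Fin n) (t : ℝ) (x : Sp n) : ℝ :=
  (1 / (2 * (Real.pi : ℂ)) ^ n * ∫ ξ : Sp n,
    Complex.exp (Complex.I * ((inner ℝ x ξ : ℝ) : ℂ) - (t : ℂ) * ((‖ξ‖ ^ 2 : ℝ) : ℂ)) *
      (((if i = j then 1 else 0) - ξ i * ξ j / ‖ξ‖ ^ 2 : ℝ) : ℂ)).re

/-- The spatial derivative `∇_k 𝒯_{ij}(t,x)`. -/
def gradOseenK {n : ℕ} (i j k : Fin n) (t : ℝ) (x : Sp n) : ℝ :=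
  fderiv ℝ (fun z : Sp n => oseenK i j t z) x (EuclideanSpace.single k (1 : ℝ))

/-- `S[f](t,x)`. -/
def heatS {n : ℕ} (f : Sp n → Sp n) (t : ℝ) (x : Sp n) : Sp n :=
  WithLp.toLp 2 fun i => ∫ y : Sp n, heatK t (x - y) * f y i

/-- The integrals in `S[f](t,x)` are defined. -/
def HeatDefined {n : ℕ} (f : Sp n → Sp n) (t : ℝ) (x : Sp n) : Prop :=
  ∀ i : Fin n, Integrable fun y : Sp n => heatK t (x - y) * f y i

/-- The integrand `∇_k 𝒯_{ij}(t-s,x-y) u_j(s,y) v_k(s,y)` of `B_i[u,v](t,x)`, summed over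
`j` and `k`. -/
def bilinIntegrand {n : ℕ} (u v : ℝ → Sp n → Sp n) (i : Fin n) (t : ℝ) (x : Sp n) (s : ℝ)
    (y : Sp n) : ℝ :=
  ∑ j : Fin n, ∑ k : Fin n, gradOseenK i j k (t - s) (x - y) * (u s y j * v s y k)

/-- `B[u,v](t,x)`. -/
def bilinB {n : ℕ} (u v : ℝ → Sp n → Sp n) (t : ℝ) (x : Sp n) : Sp n :=
  WithLp.toLp 2 fun i => ∫ s in Ioo 0 t, ∫ y : Sp n, bilinIntegrand u v i t x s y

/-- The integrals in `B[u,v](t,x)` are defined. -/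
def BilinDefined {n : ℕ} (u v : ℝ → Sp n → Sp n) (t : ℝ) (x : Sp n) : Prop :=
  ∀ i : Fin n, IntegrableOn (fun z : ℝ × Sp n => bilinIntegrand u v i t x z.1 z.2)
    (Ioo 0 t ×ˢ (univ : Set (Sp n)))

/-- `S[f]` and `B[u,u]` are defined at `(t,x)`, and `u = S[f] - B[u,u]` there. -/
def MildAt {n : ℕ} (f : Sp n → Sp n) (u : ℝ → Sp n → Sp n) (t : ℝ) (x : Sp n) : Prop :=
  HeatDefined f t x ∧ BilinDefined u u t x ∧ u t x = heatS f t x - bilinB u u t x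

/-- The equation `u = S[f] - B[u,u]` at every point of `(0,T) × ℝⁿ`. -/
def MildEverywhere {n : ℕ} (f : Sp n → Sp n) (T : ℝ≥0∞) (u : ℝ → Sp n → Sp n) : Prop :=
  ∀ t ∈ timeI T, ∀ x, MildAt f u t x

/-- The equation `u =_r^{a.e.} S[f] - B[u,u]` on `(0,T)`. -/
def MildAE {n : ℕ} (r : Expo) (f : Sp n → Sp n) (T : ℝ≥0∞) (u : ℝ → Sp n → Sp n) : Prop :=
  ∀ᵐ t ∂(volume : Measure ℝ), t ∈ timeI T → Holds r fun x => MildAt f u t x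

/-- `u` is a solution of `u = S[f] - B[u,u]`, everywhere on `(0,T) × ℝⁿ`, in the class
`⋃_{σ > -1} 𝓙^σ_{∞̄,∞}(T₋)`. -/
def IsSol {n : ℕ} (f : Sp n → Sp n) (T : ℝ≥0∞) (u : ℝ → Sp n → Sp n) : Prop :=
  (∃ σ : ℝ, -1 < σ ∧ MemJm σ ⊤ ∞ T u) ∧ MildEverywhere f T u

/-- `T` is the maximal time for which there is a solution in `⋃_{σ > -1} 𝓙^σ_{∞̄,∞}(T₋)`, and `u`
is the unique such solution on `(0,T)`. -/
def IsMaximalSol {n : ℕ} (f : Sp n → Sp n) (T : ℝ≥0∞) (u : ℝ → Sp n → Sp n) : Prop :=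
  0 < T ∧ IsSol f T u ∧ (∀ T' v, IsSol f T' v → T' ≤ T) ∧
    ∀ v, IsSol f T v → ∀ t ∈ timeI T, ∀ x, v t x = u t x

/-- `η` is a constant of local existence for data in `L^{r,∞}(ℝⁿ)`: whenever
`f ∈ L^{p,q} ∩ L^{r,∞}` and `4 η T^{(1-n/r)/2} ‖f‖^*_{L^{r,∞}} < 1`, there is a solution on `(0,T)`
in `𝓙^0_{p,q}(T) ∩ 𝓙^{-n/r}_{∞̄,∞}(T)`. -/
def IsExistenceConst (n : ℕ) (r : ℝ≥0∞) (η : ℝ) : Prop :=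
  ∀ p q : ℝ≥0∞, 1 < p → 1 ≤ q → (p = ∞ → q = ∞) →
  ∀ T : ℝ, 0 < T → ∀ f : Sp n → Sp n, MemLorentz p q f → MemLorentz r ∞ f →
    ENNReal.ofReal (4 * η * T ^ ((1 - n * Expo.inv r) / 2)) * spNorm r ∞ f < 1 →
    ∃ u : ℝ → Sp n → Sp n,
      MemJ 0 p q (ENNReal.ofReal T) u ∧ MemJ (-(n * Expo.inv r)) ⊤ ∞ (ENNReal.ofReal T) u ∧
      MildEverywhere f (ENNReal.ofReal T) u

end NSLorentz

end

open NSLorentz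

noncomputable section

open MeasureTheory Set Filter
open scoped ENNReal Topology

namespace NSLorentz

/-! ### Distribution functions and decreasing rearrangements -/

section Rearrangement

variable {X : Type*} [MeasurableSpace X] {μ : Measure X}

/-! The equation is dominated pointwise by a scalar one. Let Q be the Duhamel integral against a
positive kernel `gradMaj` that majorizes every ∂_k 𝒯_ij, and iterate U ↦ n Φ∗|f| + Q(U²) from 0.
These iterates increase, and the increments of the Picard iterates are bounded by the increments of
U (`enorm_picSeq_sub_add_le`). Hence the Picard iteration converges to a solution at every point
wherever the limit of U is finite (`exists_mild_of_majLim_lt_top`); no contraction in a function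
space is needed, and every estimate on U is inherited by u.

The Lorentz quasinorms are awkward for sums and integrals, so the estimates are made on the
K-functional `kfun` of (L¹, L^∞) in dual form. It is sublinear, passes under integrals, and is
contracted by convolution with an L¹ kernel (`kfun_conv_le`). Hardy's inequality (`lorN_le`,
`lorN_le_of_kfun_le`) returns to the quasinorm at the cost of p'; this is the origin of r' in the
bound on η. Only two facts about the kernel are used (`exists_gradMaj_bound`): its L¹ norm is
O(t^{-1/2}) and its supremum is O(t^{-(n+1)/2}). The L¹ bound comes from writing |ξ|^{-2} e^{-t|ξ|²}
as the integral of e^{-τ|ξ|²} over τ > t (`multK_grad_eq`), which reduces it to derivatives of the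
heat kernel.

Local existence: for f in weak L^r the heat flow is at most α t^{-n/(2r)}, and the bound U ≤ 2α
t^{-n/(2r)} is preserved by the iteration exactly under the smallness condition (`majSeq_le_rpow`).
The L^{p,q} norm is propagated by estimating one factor of U² by this rate and the other in L^{p,q},
with an exponential weight in time instead of smallness (`exists_lorN_majSeq_le`).

Uniqueness: the weak L^r norm φ of a difference of solutions satisfies φ ≤ C I(ψφ), where I is
fractional integration of order 1/α in time and ψ is controlled by the norms of the two solutions.
Since I maps L^{α/2,∞} to L^{α,∞} (`kfun_fracK_le`), φ vanishes as soon as ψ is small in weak L^α on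
short intervals (`ae_eq_zero_of_volterra`, `mild_ae_unique`). Smallness holds for rates t^{-a} with
a < 1/α, and for L^{α,β} with β < ∞.

Global theory: the semigroup property lets a solution be restarted (`mildAt_restart`) and continued
(`RateSol.glue`). With uniqueness this gives the maximal solution (`exists_maximal`), and restarting
the local theory at t₀ gives the blow-up rate (`RateSol.blowup_rate`) and the persistence of norms
(`RateSol.propagate`). A function v in L^{α,β} in time cannot live past T_*: it would coincide with
u_* up to T_*, and the blow-up rate is too strong for L^{α,β} with β < ∞ (`RateSol.unique_lorentz`).
-/

theorem distrib_anti {g : X → ℝ≥0∞} {y z : ℝ≥0∞} (h : y ≤ z) : distrib μ g z ≤ distrib μ g y :=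
  measure_mono fun _ hx => lt_of_le_of_lt h hx

theorem distrib_mono {g h : X → ℝ≥0∞} (H : ∀ᵐ x ∂μ, g x ≤ h x) (y : ℝ≥0∞) :
    distrib μ g y ≤ distrib μ h y :=
  measure_mono_ae (by filter_upwards [H] with x hx hy using lt_of_lt_of_le hy hx)

theorem rearr_mono {g h : X → ℝ≥0∞} (H : ∀ᵐ x ∂μ, g x ≤ h x) (t : ℝ) :
    rearr μ g t ≤ rearr μ h t :=
  sSup_le_sSup fun _ hy => ⟨hy.1, hy.2.1, hy.2.2.trans_le (distrib_mono H _)⟩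

theorem rearr_anti {g : X → ℝ≥0∞} {s t : ℝ} (h : s ≤ t) : rearr μ g t ≤ rearr μ g s :=
  sSup_le_sSup fun _ hy => ⟨hy.1, hy.2.1, (ENNReal.ofReal_le_ofReal h).trans_lt hy.2.2⟩

/-- The distribution function is right-continuous, because {g > y} is the increasing union of {g >
w_k} for w_k ↓ y. This makes the strict inequalities equivalent, and it replaces every later
manipulation of the supremum. -/
theorem lt_rearr_iff {g : X → ℝ≥0∞} {y : ℝ≥0∞} {t : ℝ} :
    y < rearr μ g t ↔ ENNReal.ofReal t < distrib μ g y := by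
  constructor
  · intro h
    obtain ⟨z, hz, hyz⟩ := lt_sSup_iff.1 h
    exact hz.2.2.trans_le (distrib_anti hyz.le)
  · intro h
    have hy : y < ∞ := by
      rcases eq_or_ne y ∞ with rfl | h'
      · simp [distrib] at h
      · exact h'.lt_top
    obtain ⟨w, hw, hw', hlim⟩ := exists_seq_strictAnti_tendsto' hy
    have hU : {x | y < g x} = ⋃ k, {x | w k < g x} := by
      ext x
      simp only [mem_ofPred_eq, mem_iUnion]
      constructor
      · intro hx
        exact ((tendsto_order.1 hlim).2 _ hx).exists
      · rintro ⟨k, hk⟩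
        exact (hw' k).1.trans hk
    have hmono : Monotone fun k => {x | w k < g x} := fun i j hij x hx =>
      lt_of_le_of_lt (hw.antitone hij) hx
    rw [distrib, hU, hmono.measure_iUnion] at h
    obtain ⟨k, hk⟩ := lt_iSup_iff.1 h
    exact (hw' k).1.trans_le (le_sSup ⟨(zero_le).trans_lt (hw' k).1, (hw' k).2, hk⟩)

theorem rearr_le_iff {g : X → ℝ≥0∞} {y : ℝ≥0∞} {t : ℝ} :
    rearr μ g t ≤ y ↔ distrib μ g y ≤ ENNReal.ofReal t := by
  rw [← not_lt, lt_rearr_iff, not_lt]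

theorem volume_ofReal_lt (L : ℝ≥0∞) :
    volume {y : ℝ | 0 < y ∧ ENNReal.ofReal y < L} = L := by
  rcases eq_or_ne L ∞ with rfl | hL
  · have : {y : ℝ | 0 < y ∧ ENNReal.ofReal y < ∞} = Ioi 0 := by ext; simp
    rw [this, Real.volume_Ioi]
  · have : {y : ℝ | 0 < y ∧ ENNReal.ofReal y < L} = Ioo 0 L.toReal := by
      ext y
      simp only [mem_ofPred_eq, mem_Ioo]
      refine and_congr_right fun hy => ?_
      rw [ENNReal.ofReal_lt_iff_lt_toReal hy.le hL]
    rw [this, Real.volume_Ioo, sub_zero, ENNReal.ofReal_toReal hL]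

/-- The layer-cake formula for one extended number; it is applied both to values of g and to values
of its rearrangement. -/
theorem lintegral_ofReal_lt (L : ℝ≥0∞) :
    ∫⁻ y in Ioi (0 : ℝ), (if ENNReal.ofReal y < L then 1 else 0) = L := by
  have hm : MeasurableSet {y : ℝ | ENNReal.ofReal y < L} :=
    measurableSet_lt ENNReal.measurable_ofReal measurable_const
  have : (fun y : ℝ => (if ENNReal.ofReal y < L then (1 : ℝ≥0∞) else 0))
      = {y : ℝ | ENNReal.ofReal y < L}.indicator 1 := by
    ext y; simp [indicator]
  rw [this, lintegral_indicator_one hm, Measure.restrict_apply hm]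
  conv_rhs => rw [← volume_ofReal_lt L]
  congr 1; ext y; simp [and_comm]

theorem measurable_rearr {g : X → ℝ≥0∞} : Measurable (rearr μ g) :=
  Antitone.measurable fun _ _ h => rearr_anti h

theorem rearr_const_mul {g : X → ℝ≥0∞} {c : ℝ≥0∞} (h0 : c ≠ 0) (h1 : c ≠ ∞) (t : ℝ) :
    rearr μ (fun x => c * g x) t = c * rearr μ g t := by
  refine eq_of_forall_lt_iff fun y => ?_
  rw [lt_rearr_iff, mul_comm c, ← ENNReal.div_lt_iff (Or.inl h0) (Or.inl h1), lt_rearr_iff]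
  simp only [distrib]
  have : ∀ x, y < c * g x ↔ y / c < g x := fun x => by
    rw [mul_comm c, ← ENNReal.div_lt_iff (Or.inl h0) (Or.inl h1)]
  simp_rw [this]

theorem rearr_rpow {g : X → ℝ≥0∞} {a : ℝ} (ha : 0 < a) (t : ℝ) :
    rearr μ (fun x => g x ^ a) t = rearr μ g t ^ a := by
  refine eq_of_forall_lt_iff fun y => ?_
  have key : ∀ z : ℝ≥0∞, y < z ^ a ↔ y ^ a⁻¹ < z := fun z => by
    conv_lhs => rw [← ENNReal.rpow_inv_rpow ha.ne' y]
    exact ENNReal.rpow_lt_rpow_iff ha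
  rw [lt_rearr_iff, key, lt_rearr_iff]
  simp only [distrib, key]

end Rearrangement

/-! ### The `K`-functional -/

section KFunctional

variable {X : Type*} [MeasurableSpace X]

/-- The `K`-functional of the couple `(L¹, L^∞)`, in its dual form. -/
def kfun (μ : Measure X) (τ : ℝ≥0∞) (g : X → ℝ≥0∞) : ℝ≥0∞ :=
  ⨆ (h : X → ℝ≥0∞) (_ : Measurable h ∧ (∀ x, h x ≤ 1) ∧ ∫⁻ x, h x ∂μ ≤ τ), ∫⁻ x, g x * h x ∂μ

variable {μ : Measure X}

theorem le_kfun {τ : ℝ≥0∞} {g h : X → ℝ≥0∞} (hm : Measurable h) (h1 : ∀ x, h x ≤ 1)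
    (hτ : ∫⁻ x, h x ∂μ ≤ τ) : ∫⁻ x, g x * h x ∂μ ≤ kfun μ τ g :=
  le_iSup₂_of_le h ⟨hm, h1, hτ⟩ le_rfl

theorem kfun_le {τ c : ℝ≥0∞} {g : X → ℝ≥0∞}
    (H : ∀ h : X → ℝ≥0∞, Measurable h → (∀ x, h x ≤ 1) → ∫⁻ x, h x ∂μ ≤ τ →
      ∫⁻ x, g x * h x ∂μ ≤ c) : kfun μ τ g ≤ c :=
  iSup₂_le fun h hh => H h hh.1 hh.2.1 hh.2.2

theorem kfun_mono {τ : ℝ≥0∞} {g g' : X → ℝ≥0∞} (H : ∀ᵐ x ∂μ, g x ≤ g' x) :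
    kfun μ τ g ≤ kfun μ τ g' :=
  kfun_le fun h hm h1 hτ => le_trans
    (lintegral_mono_ae (by filter_upwards [H] with x hx using by gcongr)) (le_kfun hm h1 hτ)

theorem kfun_mono_left {τ τ' : ℝ≥0∞} {g : X → ℝ≥0∞} (H : τ ≤ τ') : kfun μ τ g ≤ kfun μ τ' g :=
  kfun_le fun _ hm h1 hτ => le_kfun hm h1 (hτ.trans H)

theorem kfun_add_le {τ : ℝ≥0∞} {g g' : X → ℝ≥0∞} (hg : Measurable g) :
    kfun μ τ (fun x => g x + g' x) ≤ kfun μ τ g + kfun μ τ g' :=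
  kfun_le fun h hm h1 hτ => by
    simp_rw [add_mul]
    rw [lintegral_add_left (by fun_prop)]
    exact add_le_add (le_kfun hm h1 hτ) (le_kfun hm h1 hτ)

theorem kfun_const_mul_le {τ c : ℝ≥0∞} {g : X → ℝ≥0∞} (hg : Measurable g) :
    kfun μ τ (fun x => c * g x) ≤ c * kfun μ τ g :=
  kfun_le fun h hm h1 hτ => by
    simp_rw [mul_assoc]
    rw [lintegral_const_mul _ (by fun_prop)]
    gcongr
    exact le_kfun hm h1 hτ

theorem kfun_le_of_le {τ c : ℝ≥0∞} {g : X → ℝ≥0∞} (H : ∀ᵐ x ∂μ, g x ≤ c) :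
    kfun μ τ g ≤ c * τ :=
  kfun_le fun h hm h1 hτ => by
    calc ∫⁻ x, g x * h x ∂μ ≤ ∫⁻ x, c * h x ∂μ :=
          lintegral_mono_ae (by filter_upwards [H] with x hx using by gcongr)
      _ = c * ∫⁻ x, h x ∂μ := lintegral_const_mul _ hm
      _ ≤ c * τ := by gcongr

theorem kfun_iSup_le {τ : ℝ≥0∞} {g : ℕ → X → ℝ≥0∞} (hg : ∀ m, Measurable (g m))
    (hmono : Monotone g) : kfun μ τ (fun x => ⨆ m, g m x) ≤ ⨆ m, kfun μ τ (g m) :=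
  kfun_le fun h hm h1 hτ => by
    simp_rw [ENNReal.iSup_mul]
    rw [lintegral_iSup (f := fun m x => g m x * h x) (fun m => (hg m).mul hm) fun i j hij x => by
      have := hmono hij x
      simp only; gcongr]
    exact iSup_mono fun m => le_kfun hm h1 hτ

/-- For a fixed test function this is Tonelli, and the supremum is taken inside afterwards. No
measurability of s ↦ K(τ, g_s) is required, since only monotonicity of the outer integral is used.
-/
theorem kfun_lintegral_le [SFinite μ] {S : Type*} [MeasurableSpace S] {ν : Measure S} [SFinite ν]
    {τ : ℝ≥0∞} {g : S → X → ℝ≥0∞} (hg : Measurable (Function.uncurry g)) :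
    kfun μ τ (fun x => ∫⁻ s, g s x ∂ν) ≤ ∫⁻ s, kfun μ τ (g s) ∂ν :=
  kfun_le fun h hm h1 hτ => by
    have : ∀ x, (∫⁻ s, g s x ∂ν) * h x = ∫⁻ s, g s x * h x ∂ν := fun x =>
      (lintegral_mul_const _ (hg.comp measurable_prodMk_right)).symm
    simp_rw [this]
    rw [lintegral_lintegral_swap]
    · exact lintegral_mono fun s => le_kfun hm h1 hτ
    · exact ((hg.comp measurable_swap).mul (hm.comp measurable_fst)).aemeasurable

/-- A kernel of height M and mass κ is M times an admissible test function of mass κ/M. -/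
theorem lintegral_mul_le_kfun {κ M : ℝ≥0∞} (hM0 : M ≠ 0) (hM : M ≠ ∞) {k g : X → ℝ≥0∞}
    (hk : Measurable k) (hkM : ∀ x, k x ≤ M) (hκ : ∫⁻ x, k x ∂μ ≤ κ) :
    ∫⁻ x, g x * k x ∂μ ≤ M * kfun μ (κ / M) g := by
  have h1 : ∀ x, g x * k x = M * (g x * (k x / M)) := fun x => by
    rw [mul_left_comm, ENNReal.mul_div_cancel hM0 hM]
  simp_rw [h1]
  rw [lintegral_const_mul' _ _ hM]
  gcongr
  refine le_kfun (hk.div_const _) (fun x => ENNReal.div_le_of_le_mul (by simpa using hkM x)) ?_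
  simp_rw [div_eq_mul_inv]
  rw [lintegral_mul_const _ hk]
  gcongr

/-- For y < g^*(t) the set {g > y} has measure above t, so a multiple of an indicator supported in
it is a test function of mass t. -/
theorem mul_rearr_le_kfun [SigmaFinite μ] {g : X → ℝ≥0∞} (hg : Measurable g) (t : ℝ) :
    ENNReal.ofReal t * rearr μ g t ≤ kfun μ (ENNReal.ofReal t) g := by
  rcases le_or_gt t 0 with ht | ht
  · simp [ENNReal.ofReal_of_nonpos ht]
  have key : ∀ y < rearr μ g t, ENNReal.ofReal t * y ≤ kfun μ (ENNReal.ofReal t) g := by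
    intro y hy
    rw [lt_rearr_iff] at hy
    have hms : MeasurableSet {x | y < g x} := measurableSet_lt measurable_const hg
    obtain ⟨s, hs, hsub, hts, hsf⟩ := Measure.exists_subset_measure_lt_top hms hy
    have ht0 : ENNReal.ofReal t ≠ 0 := by simpa using ht
    have hs0 : μ s ≠ 0 := (zero_le.trans_lt hts).ne'
    -- Lowering the height to t/μ(s) gives mass exactly t; a subset of measure exactly t need not
    -- exist when μ has atoms.
    set c := ENNReal.ofReal t / μ s
    calc ENNReal.ofReal t * y = ∫⁻ x, s.indicator (fun _ => y * c) x ∂μ := by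
          rw [lintegral_indicator hs, lintegral_const, Measure.restrict_apply_univ, mul_assoc,
            ENNReal.div_mul_cancel hs0 hsf.ne, mul_comm]
      _ ≤ ∫⁻ x, g x * s.indicator (fun _ => c) x ∂μ := by
          refine lintegral_mono fun x => ?_
          by_cases hx : x ∈ s
          · simp only [hx, indicator_of_mem]
            gcongr
            exact (hsub hx).le
          · simp [hx]
      _ ≤ _ := by
          refine le_kfun (measurable_const.indicator hs) (fun x => ?_) ?_
          · refine indicator_le' (g := fun _ => (1 : ℝ≥0∞)) (fun _ _ => ?_) (fun _ _ => zero_le) x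
            exact ENNReal.div_le_of_le_mul (by simpa using hts.le)
          · rw [lintegral_indicator hs, lintegral_const, Measure.restrict_apply_univ,
              ENNReal.div_mul_cancel hs0 hsf.ne]
  have ht0 : ENNReal.ofReal t ≠ 0 := by simpa using ht
  rw [mul_comm, ← ENNReal.le_div_iff_mul_le (Or.inl ht0) (Or.inl ENNReal.ofReal_ne_top)]
  refine le_of_forall_lt_imp_le_of_dense fun y hy => ?_
  rw [ENNReal.le_div_iff_mul_le (Or.inl ht0) (Or.inl ENNReal.ofReal_ne_top), mul_comm]
  exact key y hy

/-- Layer cake in g: the level set {g > y} contributes at most min(λ_g(y), t), by h ≤ 1 and by the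
mass of h. That minimum is the measure of those s < t with g^*(s) > y, so a second layer cake gives
the right-hand side. -/
theorem kfun_le_lintegral_rearr [SFinite μ] {g : X → ℝ≥0∞} (hg : Measurable g) (t : ℝ) :
    kfun μ (ENNReal.ofReal t) g ≤ ∫⁻ s in Ioo 0 t, rearr μ g s :=
  kfun_le fun h hm h1 hτ => by
    calc ∫⁻ x, g x * h x ∂μ
        = ∫⁻ x, (∫⁻ y in Ioi (0 : ℝ), (if ENNReal.ofReal y < g x then 1 else 0) * h x) ∂μ := by
          refine lintegral_congr fun x => ?_
          rw [lintegral_mul_const _ (Measurable.ite (measurableSet_lt ENNReal.measurable_ofReal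
            measurable_const) measurable_const measurable_const), lintegral_ofReal_lt]
      _ = ∫⁻ y in Ioi (0 : ℝ), ∫⁻ x, (if ENNReal.ofReal y < g x then 1 else 0) * h x ∂μ := by
          rw [lintegral_lintegral_swap]
          refine (Measurable.mul (Measurable.ite (measurableSet_lt
            (ENNReal.measurable_ofReal.comp measurable_snd) (hg.comp measurable_fst))
            measurable_const measurable_const) (hm.comp measurable_fst)).aemeasurable
      _ ≤ ∫⁻ y in Ioi (0 : ℝ), ∫⁻ s in Ioo 0 t, (if ENNReal.ofReal y < rearr μ g s then 1 else 0) := by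
          refine lintegral_mono fun y => ?_
          simp_rw [lt_rearr_iff]
          have hms : MeasurableSet {x | ENNReal.ofReal y < g x} :=
            measurableSet_lt measurable_const hg
          have e1 : ∀ s : ℝ, (if ENNReal.ofReal s < distrib μ g (ENNReal.ofReal y)
              then (1 : ℝ≥0∞) else 0)
              = {s : ℝ | ENNReal.ofReal s < distrib μ g (ENNReal.ofReal y)}.indicator 1 s := by
            intro s; simp [indicator]
          have hms' : MeasurableSet
              {s : ℝ | ENNReal.ofReal s < distrib μ g (ENNReal.ofReal y)} :=
            measurableSet_lt ENNReal.measurable_ofReal measurable_const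
          have e2 : ∫⁻ s in Ioo 0 t, (if ENNReal.ofReal s < distrib μ g (ENNReal.ofReal y)
              then (1 : ℝ≥0∞) else 0) = min (distrib μ g (ENNReal.ofReal y)) (ENNReal.ofReal t) := by
            simp_rw [e1]
            rw [lintegral_indicator_one hms', Measure.restrict_apply hms']
            conv_rhs => rw [← volume_ofReal_lt (min _ _)]
            congr 1; ext s
            simp only [mem_inter_iff, mem_ofPred_eq, mem_Ioo, lt_min_iff]
            constructor
            · rintro ⟨a, b, c⟩
              exact ⟨b, a, (ENNReal.ofReal_lt_ofReal_iff_of_nonneg b.le).2 c⟩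
            · rintro ⟨b, a, c⟩
              exact ⟨a, b, (ENNReal.ofReal_lt_ofReal_iff_of_nonneg b.le).1 c⟩
          rw [e2]
          refine le_min ?_ ?_
          · calc _ ≤ ∫⁻ x, {x | ENNReal.ofReal y < g x}.indicator 1 x ∂μ := by
                  refine lintegral_mono fun x => ?_
                  by_cases hx : ENNReal.ofReal y < g x <;> simp [hx, h1 x]
              _ = _ := lintegral_indicator_one hms
          · refine le_trans (lintegral_mono fun x => ?_) hτ
            split_ifs <;> simp
      _ = ∫⁻ s in Ioo 0 t, rearr μ g s := by
          rw [lintegral_lintegral_swap]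
          · exact lintegral_congr fun s => lintegral_ofReal_lt _
          · refine (Measurable.ite (measurableSet_lt
              (ENNReal.measurable_ofReal.comp measurable_fst) (measurable_rearr.comp measurable_snd))
              measurable_const measurable_const).aemeasurable

end KFunctional

/-! ### Convolution estimates for the K-functional -/

section Convolution

variable {G : Type*} [AddCommGroup G] [MeasurableSpace G] [MeasurableAdd₂ G] [MeasurableNeg G]
  {μ : Measure G} [μ.IsAddLeftInvariant] [μ.IsNegInvariant] [SFinite μ]

/-- Duality: moving the convolution onto the test function h gives κ times H, where H is again
bounded by 1 with mass at most τ. This is Young's inequality for all the Lorentz norms at once. -/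
theorem kfun_conv_le {κ τ : ℝ≥0∞} (h0 : κ ≠ 0) (hκt : κ ≠ ∞) {k g : G → ℝ≥0∞} (hk : Measurable k)
    (hg : Measurable g) (hκ : ∫⁻ x, k x ∂μ ≤ κ) :
    kfun μ τ (fun x => ∫⁻ y, k (x - y) * g y ∂μ) ≤ κ * kfun μ τ g :=
  kfun_le fun h hm h1 hτ => by
    have hsub : Measurable fun z : G × G => z.1 - z.2 := measurable_sub
    have m1 : Measurable fun z : G × G => k (z.1 - z.2) * h z.1 :=
      (hk.comp hsub).mul (hm.comp measurable_fst)
    set H : G → ℝ≥0∞ := fun y => κ⁻¹ * ∫⁻ x, k (x - y) * h x ∂μ with hH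
    have mI : Measurable fun y => ∫⁻ x, k (x - y) * h x ∂μ :=
      Measurable.lintegral_prod_right' (m1.comp measurable_swap)
    have hHm : Measurable H := mI.const_mul _
    have kx : ∀ y, ∫⁻ x, k (x - y) ∂μ = ∫⁻ x, k x ∂μ := fun y =>
      lintegral_sub_right_eq_self k y
    have ky : ∀ x, ∫⁻ y, k (x - y) ∂μ = ∫⁻ x, k x ∂μ := fun x =>
      lintegral_sub_left_eq_self k x
    calc ∫⁻ x, (∫⁻ y, k (x - y) * g y ∂μ) * h x ∂μ
        = ∫⁻ x, ∫⁻ y, k (x - y) * h x * g y ∂μ ∂μ := by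
          refine lintegral_congr fun x => ?_
          rw [← lintegral_mul_const _ (by fun_prop)]
          exact lintegral_congr fun y => by ring
      _ = ∫⁻ y, ∫⁻ x, k (x - y) * h x * g y ∂μ ∂μ :=
          lintegral_lintegral_swap (m1.mul (hg.comp measurable_snd)).aemeasurable
      _ = ∫⁻ y, κ * (g y * H y) ∂μ := by
          refine lintegral_congr fun y => ?_
          rw [lintegral_mul_const _ (by fun_prop), hH]
          simp only
          rw [mul_left_comm κ, ← mul_assoc κ, ENNReal.mul_inv_cancel h0 hκt, one_mul, mul_comm]
      _ = κ * ∫⁻ y, g y * H y ∂μ := lintegral_const_mul _ (hg.mul hHm)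
      _ ≤ κ * kfun μ τ g := by
          gcongr
          refine le_kfun hHm (fun y => ?_) ?_
          · simp only [hH]
            rw [ENNReal.inv_mul_le_iff h0 hκt, mul_one]
            calc ∫⁻ x, k (x - y) * h x ∂μ ≤ ∫⁻ x, k (x - y) ∂μ := by
                  refine lintegral_mono fun x => ?_
                  exact mul_le_of_le_one_right' (h1 x)
              _ ≤ κ := (kx y).trans_le hκ
          · simp only [hH]
            rw [lintegral_const_mul _ mI, ENNReal.inv_mul_le_iff h0 hκt]
            calc ∫⁻ y, ∫⁻ x, k (x - y) * h x ∂μ ∂μ = ∫⁻ x, ∫⁻ y, k (x - y) * h x ∂μ ∂μ :=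
                  (lintegral_lintegral_swap m1.aemeasurable).symm
              _ = ∫⁻ x, (∫⁻ z, k z ∂μ) * h x ∂μ := by
                  refine lintegral_congr fun x => ?_
                  rw [lintegral_mul_const _ (by fun_prop), ky]
              _ = (∫⁻ z, k z ∂μ) * ∫⁻ x, h x ∂μ := lintegral_const_mul _ hm
              _ ≤ κ * τ := by gcongr

set_option linter.unusedSectionVars false in
theorem conv_le_kfun {κ M : ℝ≥0∞} (hM0 : M ≠ 0) (hM : M ≠ ∞) {k g : G → ℝ≥0∞}
    (hk : Measurable k) (hkM : ∀ x, k x ≤ M) (hκ : ∫⁻ x, k x ∂μ ≤ κ) (x : G) :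
    ∫⁻ y, k (x - y) * g y ∂μ ≤ M * kfun μ (κ / M) g := by
  simp_rw [mul_comm (k _)]
  refine lintegral_mul_le_kfun hM0 hM (hk.comp (measurable_const.sub measurable_id))
    (fun y => hkM _) ?_
  rw [lintegral_sub_left_eq_self k x]
  exact hκ

end Convolution

end NSLorentz

end

/-! ### Integral inequalities for the Lorentz gauge -/

noncomputable section

open MeasureTheory Set Filter
open scoped ENNReal Topology

namespace NSLorentz

/-- Jensen's inequality for `x ↦ x ^ q` and the measure `w dν`. -/
theorem rpow_lintegral_mul_le {S : Type*} [MeasurableSpace S] {ν : Measure S} {q : ℝ} (hq : 1 ≤ q)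
    {w ρ : S → ℝ≥0∞} (hw : Measurable w) (hρ : Measurable ρ) :
    (∫⁻ s, w s * ρ s ∂ν) ^ q ≤ (∫⁻ s, w s ∂ν) ^ (q - 1) * ∫⁻ s, w s * ρ s ^ q ∂ν := by
  rcases hq.eq_or_lt with rfl | hq
  · simp
  have hc : (q.conjExponent).HolderConjugate q := (Real.HolderConjugate.conjExponent hq).symm
  have hq0 : 0 < q := by linarith
  have hp0 : 0 < q.conjExponent := hc.pos
  have hexp : 1 / q.conjExponent + 1 / q = 1 := by simpa using hc.inv_add_inv_eq_one
  -- Hölder after the splitting w ρ = w^{1/q'} · (w^{1/q} ρ).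
  have h := ENNReal.lintegral_mul_le_Lp_mul_Lq ν hc (f := fun s => w s ^ (1 / q.conjExponent))
    (g := fun s => w s ^ (1 / q) * ρ s) (hw.pow_const _).aemeasurable
    ((hw.pow_const _).mul hρ).aemeasurable
  have e1 : ∀ s, ((fun s => w s ^ (1 / q.conjExponent)) * fun s => w s ^ (1 / q) * ρ s) s
      = w s * ρ s := fun s => by
    simp only [Pi.mul_apply]
    rw [← mul_assoc, ← ENNReal.rpow_add_of_nonneg _ _ (by positivity) (by positivity), hexp,
      ENNReal.rpow_one]
  have e2 : ∀ s, (w s ^ (1 / q.conjExponent)) ^ q.conjExponent = w s := fun s => by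
    rw [← ENNReal.rpow_mul, one_div_mul_cancel hp0.ne', ENNReal.rpow_one]
  have e3 : ∀ s, (w s ^ (1 / q) * ρ s) ^ q = w s * ρ s ^ q := fun s => by
    rw [ENNReal.mul_rpow_of_nonneg _ _ hq0.le, ← ENNReal.rpow_mul, one_div_mul_cancel hq0.ne',
      ENNReal.rpow_one]
  simp_rw [e1, e2, e3] at h
  calc (∫⁻ s, w s * ρ s ∂ν) ^ q
      ≤ ((∫⁻ s, w s ∂ν) ^ (1 / q.conjExponent) * (∫⁻ s, w s * ρ s ^ q ∂ν) ^ (1 / q)) ^ q := by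
        gcongr
    _ = _ := by
        rw [ENNReal.mul_rpow_of_nonneg _ _ hq0.le, ← ENNReal.rpow_mul, ← ENNReal.rpow_mul,
          one_div_mul_cancel hq0.ne', ENNReal.rpow_one]
        congr 2
        have : 1 / q.conjExponent = 1 - 1 / q := by linarith
        rw [this]; field_simp

/-- The functional of a profile `ρ` on `(0,∞)` which defines the Lorentz quasinorms. -/
def lorGauge (p q : ℝ≥0∞) (ρ : ℝ → ℝ≥0∞) : ℝ≥0∞ :=
  if q = ∞ then
    ⨆ t ∈ Ioi (0 : ℝ), ENNReal.ofReal t ^ (p⁻¹).toReal * ρ t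
  else
    (q / p * ∫⁻ t in Ioi (0 : ℝ),
      (ENNReal.ofReal t ^ (p⁻¹).toReal * ρ t) ^ q.toReal / ENNReal.ofReal t) ^ (q.toReal)⁻¹

theorem lorentzNorm_eq_gauge {X : Type*} [MeasurableSpace X] (μ : Measure X) (p q : ℝ≥0∞)
    (g : X → ℝ≥0∞) : lorentzNorm μ p q g = lorGauge p q (rearr μ g) := rfl

theorem lorGauge_mono {p q : ℝ≥0∞} {ρ ρ' : ℝ → ℝ≥0∞} (H : ∀ t, 0 < t → ρ t ≤ ρ' t) :
    lorGauge p q ρ ≤ lorGauge p q ρ' := by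
  unfold lorGauge
  split_ifs
  · exact iSup₂_mono fun t ht => by gcongr; exact H t ht
  · gcongr ?_ ^ _
    gcongr _ * ?_
    refine setLIntegral_mono' measurableSet_Ioi fun t ht => ?_
    gcongr
    exact H t ht

theorem one_le_toReal {q : ℝ≥0∞} (h : 1 ≤ q) (h' : q ≠ ∞) : 1 ≤ q.toReal := by
  simpa using (ENNReal.toReal_le_toReal ENNReal.one_ne_top h').2 h

theorem measurable_weight (a : ℝ) : Measurable fun t : ℝ => ENNReal.ofReal t ^ a :=
  ENNReal.measurable_ofReal.pow_const _

theorem lorGauge_le_of_le {p q : ℝ≥0∞} (hq : q ≠ ∞) {ρ : ℝ → ℝ≥0∞} {M : ℝ≥0∞}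
    (H : q / p * ∫⁻ t in Ioi (0 : ℝ),
      (ENNReal.ofReal t ^ (p⁻¹).toReal * ρ t) ^ q.toReal / ENNReal.ofReal t ≤ M ^ q.toReal)
    (h1 : 1 ≤ q) : lorGauge p q ρ ≤ M := by
  have : 0 < q.toReal := by linarith [one_le_toReal h1 hq]
  rw [lorGauge, if_neg hq, ENNReal.rpow_inv_le_iff this]
  exact H

theorem lorGauge_rpow {p q : ℝ≥0∞} (hq : q ≠ ∞) (h1 : 1 ≤ q) (ρ : ℝ → ℝ≥0∞) :
    lorGauge p q ρ ^ q.toReal = q / p * ∫⁻ t in Ioi (0 : ℝ),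
      (ENNReal.ofReal t ^ (p⁻¹).toReal * ρ t) ^ q.toReal / ENNReal.ofReal t := by
  have : 0 < q.toReal := by linarith [one_le_toReal h1 hq]
  rw [lorGauge, if_neg hq, ENNReal.rpow_inv_rpow this.ne']

theorem lorGauge_const_mul {p q c : ℝ≥0∞} (h1 : 1 ≤ q) (hc : c ≠ ∞) (ρ : ℝ → ℝ≥0∞) :
    lorGauge p q (fun t => c * ρ t) = c * lorGauge p q ρ := by
  unfold lorGauge
  split_ifs with hq
  · simp_rw [ENNReal.mul_iSup, mul_left_comm]
  · have : 0 < q.toReal := by linarith [one_le_toReal h1 hq]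
    have e : ∀ t : ℝ, (ENNReal.ofReal t ^ (p⁻¹).toReal * (c * ρ t)) ^ q.toReal / ENNReal.ofReal t
        = c ^ q.toReal *
          ((ENNReal.ofReal t ^ (p⁻¹).toReal * ρ t) ^ q.toReal / ENNReal.ofReal t) := fun t => by
      rw [mul_left_comm, ENNReal.mul_rpow_of_nonneg _ _ this.le, mul_div_assoc]
    simp_rw [e]
    rw [lintegral_const_mul' _ _ (ENNReal.rpow_ne_top_of_nonneg this.le hc), mul_left_comm,
      ENNReal.mul_rpow_of_nonneg _ _ (by positivity), ENNReal.rpow_rpow_inv this.ne']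

theorem lorGauge_iSup_le {p q : ℝ≥0∞} (h1 : 1 ≤ q) {ρ : ℕ → ℝ → ℝ≥0∞}
    (hm : ∀ m, Measurable (ρ m)) (hmono : Monotone ρ) :
    lorGauge p q (fun t => ⨆ m, ρ m t) ≤ ⨆ m, lorGauge p q (ρ m) := by
  by_cases hq : q = ∞
  · simp only [lorGauge, if_pos hq]
    refine iSup₂_le fun t ht => ?_
    rw [ENNReal.mul_iSup]
    exact iSup_mono fun m => le_iSup₂_of_le t ht le_rfl
  · have h0 : 0 < q.toReal := by linarith [one_le_toReal h1 hq]
    refine lorGauge_le_of_le hq ?_ h1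
    have e : ∀ t : ℝ, (ENNReal.ofReal t ^ (p⁻¹).toReal * ⨆ m, ρ m t) ^ q.toReal / ENNReal.ofReal t
        = ⨆ m, (ENNReal.ofReal t ^ (p⁻¹).toReal * ρ m t) ^ q.toReal / ENNReal.ofReal t :=
      fun t => by
        rw [ENNReal.mul_iSup]
        have := (ENNReal.orderIsoRpow q.toReal h0).map_iSup
          (fun m => ENNReal.ofReal t ^ (p⁻¹).toReal * ρ m t)
        simp only [ENNReal.orderIsoRpow_apply] at this
        rw [this, ENNReal.iSup_div]
    simp_rw [e]
    rw [lintegral_iSup (fun m => by have := hm m; fun_prop) fun i j hij t => by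
        have := hmono hij t
        dsimp only; gcongr]
    rw [ENNReal.mul_iSup]
    refine iSup_le fun m => ?_
    rw [← lorGauge_rpow hq h1]
    gcongr
    exact le_iSup (fun m => lorGauge p q (ρ m)) m

/-- For q < ∞ the gauge is the L^q norm of t^{1/p} ρ(t) for the measure (q/p) dt/t, so this is the
triangle inequality in L^q. -/
theorem lorGauge_add_le {p q : ℝ≥0∞} (h1 : 1 ≤ q) {ρ ρ' : ℝ → ℝ≥0∞}
    (hm : Measurable ρ) (hm' : Measurable ρ') :
    lorGauge p q (fun t => ρ t + ρ' t) ≤ lorGauge p q ρ + lorGauge p q ρ' := by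
  by_cases hq : q = ∞
  · simp only [lorGauge, if_pos hq]
    refine iSup₂_le fun t ht => ?_
    rw [mul_add]
    exact add_le_add (le_iSup₂_of_le t ht le_rfl) (le_iSup₂_of_le t ht le_rfl)
  · have h1' := one_le_toReal h1 hq
    have h0 : 0 < q.toReal := by linarith
    set ν := (volume.restrict (Ioi (0 : ℝ))).withDensity
      (fun t => q / p * (ENNReal.ofReal t)⁻¹) with hν
    have e : ∀ σ : ℝ → ℝ≥0∞, Measurable σ → lorGauge p q σ
        = (∫⁻ t, (ENNReal.ofReal t ^ (p⁻¹).toReal * σ t) ^ q.toReal ∂ν) ^ (1 / q.toReal) := by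
      intro σ hσ
      rw [lorGauge, if_neg hq, one_div, hν, lintegral_withDensity_eq_lintegral_mul _
        (by fun_prop) (by fun_prop)]
      congr 1
      rw [← lintegral_const_mul _ (by fun_prop)]
      refine lintegral_congr fun t => ?_
      simp only [Pi.mul_apply, div_eq_mul_inv]
      ring
    rw [e _ hm, e _ hm', e (fun t => ρ t + ρ' t) (hm.add hm')]
    refine le_trans ?_ (ENNReal.lintegral_Lp_add_le
      ((measurable_weight _).mul hm).aemeasurable ((measurable_weight _).mul hm').aemeasurable h1')
    simp [mul_add]

/-- Minkowski's inequality for the gauge. -/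
theorem lorGauge_lintegral_le {p q : ℝ≥0∞} (h1 : 1 ≤ q) {S : Type*} [MeasurableSpace S]
    {ν : Measure S} [SFinite ν] {w : S → ℝ≥0∞} {ρ : S → ℝ → ℝ≥0∞} {M : ℝ≥0∞} (hw : Measurable w)
    (hρ : Measurable (Function.uncurry ρ)) (H : ∀ s, lorGauge p q (ρ s) ≤ M) :
    lorGauge p q (fun t => ∫⁻ s, w s * ρ s t ∂ν) ≤ (∫⁻ s, w s ∂ν) * M := by
  by_cases hq : q = ∞
  · simp only [lorGauge, if_pos hq] at H ⊢
    refine iSup₂_le fun t ht => ?_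
    have hρt : Measurable fun s => ρ s t := hρ.comp measurable_prodMk_right
    rw [← lintegral_const_mul _ (by fun_prop), ← lintegral_mul_const _ hw]
    refine lintegral_mono fun s => ?_
    rw [mul_left_comm]
    gcongr
    exact le_trans (le_iSup₂_of_le t ht le_rfl) (H s)
  · have h1' := one_le_toReal h1 hq
    have h0 : 0 < q.toReal := by linarith
    refine lorGauge_le_of_le hq ?_ h1
    set W := ∫⁻ s, w s ∂ν
    set a := (p⁻¹).toReal
    have hF : Measurable fun z : ℝ × S => w z.2 *
        ((ENNReal.ofReal z.1 ^ a * ρ z.2 z.1) ^ q.toReal / ENNReal.ofReal z.1) := by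
      have h2 : Measurable fun z : ℝ × S => ρ z.2 z.1 := hρ.comp measurable_swap
      have h3 : Measurable fun z : ℝ × S => ENNReal.ofReal z.1 ^ a :=
        (measurable_weight a).comp measurable_fst
      have h4 : Measurable fun z : ℝ × S => w z.2 := hw.comp measurable_snd
      exact h4.mul (((h3.mul h2).pow_const _).div (ENNReal.measurable_ofReal.comp measurable_fst))
    -- Jensen in s for fixed t, followed by Tonelli. Because all the gauges share the bound M, the
    -- factors W^{q-1} and W combine to W^q and the full mixed-norm inequality is unnecessary.
    calc q / p * ∫⁻ t in Ioi (0 : ℝ),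
          (ENNReal.ofReal t ^ a * ∫⁻ s, w s * ρ s t ∂ν) ^ q.toReal / ENNReal.ofReal t
        ≤ q / p * ∫⁻ t in Ioi (0 : ℝ), W ^ (q.toReal - 1) * ∫⁻ s, w s *
          ((ENNReal.ofReal t ^ a * ρ s t) ^ q.toReal / ENNReal.ofReal t) ∂ν := by
          gcongr with t
          have hρt : Measurable fun s => ρ s t := hρ.comp measurable_prodMk_right
          have e : ENNReal.ofReal t ^ a * ∫⁻ s, w s * ρ s t ∂ν
              = ∫⁻ s, w s * (ENNReal.ofReal t ^ a * ρ s t) ∂ν := by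
            rw [← lintegral_const_mul _ (by fun_prop)]
            exact lintegral_congr fun s => by ring
          rw [e]
          refine (ENNReal.div_le_div_right (rpow_lintegral_mul_le h1' hw
            (hρt.const_mul _)) _).trans_eq ?_
          rw [mul_div_assoc]
          congr 1
          simp_rw [div_eq_mul_inv]
          rw [← lintegral_mul_const _ (by fun_prop)]
          exact lintegral_congr fun s => by ring
      _ = W ^ (q.toReal - 1) * (q / p * ∫⁻ s, w s * (∫⁻ t in Ioi (0 : ℝ),
          (ENNReal.ofReal t ^ a * ρ s t) ^ q.toReal / ENNReal.ofReal t) ∂ν) := by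
          rw [lintegral_const_mul _ hF.lintegral_prod_right', mul_left_comm,
            lintegral_lintegral_swap hF.aemeasurable]
          congr 2
          refine lintegral_congr fun s => ?_
          have hρs : Measurable fun t => ρ s t := hρ.comp measurable_prodMk_left
          dsimp only
          rw [lintegral_const_mul _ (by fun_prop)]
      _ = W ^ (q.toReal - 1) * ∫⁻ s, w s * lorGauge p q (ρ s) ^ q.toReal ∂ν := by
          have hG : Measurable fun s => w s * ∫⁻ t in Ioi (0 : ℝ),
              (ENNReal.ofReal t ^ a * ρ s t) ^ q.toReal / ENNReal.ofReal t := by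
            refine hw.mul (Measurable.lintegral_prod_right' (f := fun z : S × ℝ =>
              (ENNReal.ofReal z.2 ^ a * ρ z.1 z.2) ^ q.toReal / ENNReal.ofReal z.2) ?_)
            have h3 : Measurable fun z : S × ℝ => ENNReal.ofReal z.2 ^ a :=
              (measurable_weight a).comp measurable_snd
            exact ((h3.mul hρ).pow_const _).div (ENNReal.measurable_ofReal.comp measurable_snd)
          rw [← lintegral_const_mul _ hG]
          congr 1
          refine lintegral_congr fun s => ?_
          rw [lorGauge_rpow hq h1, mul_left_comm]
      _ ≤ W ^ (q.toReal - 1) * (W * M ^ q.toReal) := by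
          gcongr
          rw [← lintegral_mul_const _ hw]
          gcongr with s
          exact H s
      _ = (W * M) ^ q.toReal := by
          rw [ENNReal.mul_rpow_of_nonneg _ _ h0.le, ← mul_assoc]
          congr 1
          conv_rhs => rw [show q.toReal = (q.toReal - 1) + 1 by ring,
            ENNReal.rpow_add_of_nonneg _ _ (by linarith) zero_le_one, ENNReal.rpow_one]

theorem setLIntegral_Ioi_comp_mul {θ : ℝ} (hθ : 0 < θ) {F : ℝ → ℝ≥0∞} (hF : Measurable F) :
    ∫⁻ t in Ioi (0 : ℝ), F (t * θ) = ENNReal.ofReal θ⁻¹ * ∫⁻ t in Ioi (0 : ℝ), F t := by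
  have h := Real.map_volume_mul_right hθ.ne'
  have hs : (fun t : ℝ => t * θ) ⁻¹' Ioi 0 = Ioi 0 := by
    ext t; simp [hθ]
  have hmr : (volume.restrict (Ioi (0 : ℝ))).map (fun t : ℝ => t * θ)
      = ENNReal.ofReal θ⁻¹ • volume.restrict (Ioi (0 : ℝ)) := by
    conv_lhs => rw [← hs]
    rw [← Measure.restrict_map (measurable_mul_const θ) measurableSet_Ioi, h,
      abs_of_pos (inv_pos.2 hθ), Measure.restrict_smul]
  rw [← lintegral_map hF (measurable_mul_const θ), hmr, lintegral_smul_measure, smul_eq_mul]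

/-- dt/t is invariant under dilations, and the weight t^{1/p} accounts for the factor θ^{1/p}. -/
theorem lorGauge_dilate {p q : ℝ≥0∞} (h1 : 1 ≤ q) {θ : ℝ} (hθ : 0 < θ) {ρ : ℝ → ℝ≥0∞}
    (hρ : Measurable ρ) :
    lorGauge p q (fun t => ENNReal.ofReal θ ^ (p⁻¹).toReal * ρ (t * θ)) ≤ lorGauge p q ρ := by
  have e : ∀ t : ℝ, 0 < t → ENNReal.ofReal t ^ (p⁻¹).toReal *
      (ENNReal.ofReal θ ^ (p⁻¹).toReal * ρ (t * θ))
      = ENNReal.ofReal (t * θ) ^ (p⁻¹).toReal * ρ (t * θ) := fun t ht => by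
    rw [ENNReal.ofReal_mul ht.le, ENNReal.mul_rpow_of_nonneg _ _ ENNReal.toReal_nonneg, mul_assoc]
  by_cases hq : q = ∞
  · simp only [lorGauge, if_pos hq]
    refine iSup₂_le fun t ht => ?_
    rw [e t ht]
    exact le_iSup₂_of_le (t * θ) (mul_pos ht hθ) le_rfl
  · refine lorGauge_le_of_le hq ?_ h1
    rw [lorGauge_rpow hq h1]
    gcongr q / p * ?_
    set F : ℝ → ℝ≥0∞ := fun t =>
      (ENNReal.ofReal t ^ (p⁻¹).toReal * ρ t) ^ q.toReal / ENNReal.ofReal t with hF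
    have hFm : Measurable F :=
      (((measurable_weight _).mul hρ).pow_const _).div ENNReal.measurable_ofReal
    have hθ0 : ENNReal.ofReal θ ≠ 0 := by simpa using hθ
    calc _ = ∫⁻ t in Ioi (0 : ℝ), ENNReal.ofReal θ * F (t * θ) := by
          refine setLIntegral_congr_fun (measurableSet_Ioi (a := (0 : ℝ))) fun t ht => ?_
          have ht0 : ENNReal.ofReal t ≠ 0 := by simpa using ht
          simp only [hF, e t ht]
          rw [ENNReal.ofReal_mul (le_of_lt ht), div_eq_mul_inv, div_eq_mul_inv,
            ENNReal.mul_inv (Or.inl ht0) (Or.inl ENNReal.ofReal_ne_top), mul_left_comm,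
            mul_left_comm (ENNReal.ofReal θ), ENNReal.mul_inv_cancel hθ0 ENNReal.ofReal_ne_top,
            mul_one]
      _ = ENNReal.ofReal θ * (ENNReal.ofReal θ⁻¹ * ∫⁻ t in Ioi (0 : ℝ), F t) := by
          rw [lintegral_const_mul _ (by fun_prop),
            setLIntegral_Ioi_comp_mul hθ hFm]
      _ = _ := by
          rw [ENNReal.ofReal_inv_of_pos hθ, ← mul_assoc,
            ENNReal.mul_inv_cancel hθ0 ENNReal.ofReal_ne_top, one_mul]
      _ ≤ _ := le_rfl

end NSLorentz

end

/-! ### The Lorentz norm built on the K-functional, and Hardy's inequality -/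

noncomputable section

open MeasureTheory Set Filter
open scoped ENNReal Topology

namespace NSLorentz

section

variable {X : Type*} [MeasurableSpace X] {μ : Measure X}

/-- The Lorentz norm built on the `K`-functional. -/
def lorN (μ : Measure X) (p q : ℝ≥0∞) (g : X → ℝ≥0∞) : ℝ≥0∞ :=
  lorGauge p q fun t => kfun μ (ENNReal.ofReal t) g / ENNReal.ofReal t

theorem measurable_kfun_div {g : X → ℝ≥0∞} :
    Measurable fun t : ℝ => kfun μ (ENNReal.ofReal t) g / ENNReal.ofReal t :=
  Measurable.div (Monotone.measurable fun _ _ h => kfun_mono_left (ENNReal.ofReal_le_ofReal h))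
    ENNReal.measurable_ofReal

theorem ofReal_ne_zero {t : ℝ} (ht : 0 < t) : ENNReal.ofReal t ≠ 0 := by simpa using ht

theorem lorentzNorm_le_lorN [SigmaFinite μ] {p q : ℝ≥0∞} {g : X → ℝ≥0∞} (hg : Measurable g) :
    lorentzNorm μ p q g ≤ lorN μ p q g :=
  lorGauge_mono fun t ht => by
    rw [ENNReal.le_div_iff_mul_le (Or.inl (ofReal_ne_zero ht)) (Or.inl ENNReal.ofReal_ne_top),
      mul_comm]
    exact mul_rearr_le_kfun hg t

theorem lorN_mono {p q : ℝ≥0∞} {g g' : X → ℝ≥0∞} (H : ∀ᵐ x ∂μ, g x ≤ g' x) :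
    lorN μ p q g ≤ lorN μ p q g' :=
  lorGauge_mono fun _ _ => ENNReal.div_le_div_right (kfun_mono H) _

theorem lorentzNorm_mono {p q : ℝ≥0∞} {g g' : X → ℝ≥0∞} (H : ∀ᵐ x ∂μ, g x ≤ g' x) :
    lorentzNorm μ p q g ≤ lorentzNorm μ p q g' :=
  lorGauge_mono fun _ _ => rearr_mono H _

theorem lorN_add_le {p q : ℝ≥0∞} (h1 : 1 ≤ q) {g g' : X → ℝ≥0∞} (hg : Measurable g) :
    lorN μ p q (fun x => g x + g' x) ≤ lorN μ p q g + lorN μ p q g' :=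
  le_trans (lorGauge_mono fun t _ => by
    rw [← ENNReal.add_div]
    exact ENNReal.div_le_div_right (kfun_add_le hg) _)
    (lorGauge_add_le h1 measurable_kfun_div measurable_kfun_div)

theorem lorN_iSup_le {p q : ℝ≥0∞} (h1 : 1 ≤ q) {g : ℕ → X → ℝ≥0∞} (hg : ∀ m, Measurable (g m))
    (hmono : Monotone g) : lorN μ p q (fun x => ⨆ m, g m x) ≤ ⨆ m, lorN μ p q (g m) := by
  refine le_trans (lorGauge_mono fun t _ => ?_) (lorGauge_iSup_le h1
    (fun m => measurable_kfun_div (g := g m)) fun i j hij t => ENNReal.div_le_div_right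
      (kfun_mono (ae_of_all _ (hmono hij))) _)
  rw [← ENNReal.iSup_div]
  exact ENNReal.div_le_div_right (kfun_iSup_le hg hmono) _

/-- By `lt_rearr_iff` the superlevel sets are described by distribution functions, whose dependence
on the parameter is measurable because they are measures of sections. -/
theorem measurable_rearr_prod [SFinite μ] {S : Type*} [MeasurableSpace S] {g : S → X → ℝ≥0∞}
    (hg : Measurable (Function.uncurry g)) :
    Measurable fun z : S × ℝ => rearr μ (g z.1) z.2 := by
  refine measurable_of_Ioi fun y => ?_
  have e : (fun z : S × ℝ => rearr μ (g z.1) z.2) ⁻¹' Ioi y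
      = {z | ENNReal.ofReal z.2 < distrib μ (g z.1) y} := by
    ext z
    simp only [mem_preimage, mem_Ioi, mem_ofPred_eq]
    exact lt_rearr_iff
  rw [e]
  refine measurableSet_lt (ENNReal.measurable_ofReal.comp measurable_snd) ?_
  have : Measurable fun s => distrib μ (g s) y :=
    measurable_measure_prodMk_left (ν := μ) (s := {z : S × X | y < g z.1 z.2})
      (measurableSet_lt measurable_const hg)
  exact this.comp measurable_fst

/-- The constant of Hardy's inequality in `L^{p,q}`. -/
def hardyC (p : ℝ≥0∞) : ℝ≥0∞ := ∫⁻ θ in Ioo (0 : ℝ) 1, ENNReal.ofReal θ ^ (-(p⁻¹).toReal)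

theorem setLIntegral_Ioo_rpow {a b : ℝ} (ha : -1 < a) (hb : 0 < b) :
    ∫⁻ θ in Ioo (0 : ℝ) b, ENNReal.ofReal θ ^ a = ENNReal.ofReal (b ^ (a + 1) / (a + 1)) := by
  have hi : IntegrableOn (fun θ : ℝ => θ ^ a) (Ioo 0 b) :=
    ((intervalIntegral.intervalIntegrable_rpow' ha (a := 0) (b := b)).1).mono_set
      Ioo_subset_Ioc_self
  calc ∫⁻ θ in Ioo (0 : ℝ) b, ENNReal.ofReal θ ^ a
      = ∫⁻ θ in Ioo (0 : ℝ) b, ENNReal.ofReal (θ ^ a) :=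
        setLIntegral_congr_fun measurableSet_Ioo fun θ hθ => ENNReal.ofReal_rpow_of_pos hθ.1
    _ = ENNReal.ofReal (∫ θ in Ioo (0 : ℝ) b, θ ^ a) :=
        (ofReal_integral_eq_lintegral_ofReal hi ((ae_restrict_mem measurableSet_Ioo).mono
          fun θ hθ => Real.rpow_nonneg hθ.1.le _)).symm
    _ = _ := by
        rw [← integral_Ioc_eq_integral_Ioo, ← intervalIntegral.integral_of_le hb.le,
          integral_rpow (Or.inl ha), Real.zero_rpow (by linarith), sub_zero]

theorem setLIntegral_Ioi_rpow {a b : ℝ} (ha : a < -1) (hb : 0 < b) :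
    ∫⁻ θ in Ioi b, ENNReal.ofReal θ ^ a = ENNReal.ofReal (-b ^ (a + 1) / (a + 1)) := by
  have hi : IntegrableOn (fun θ : ℝ => θ ^ a) (Ioi b) := integrableOn_Ioi_rpow_of_lt ha hb
  calc ∫⁻ θ in Ioi b, ENNReal.ofReal θ ^ a
      = ∫⁻ θ in Ioi b, ENNReal.ofReal (θ ^ a) :=
        setLIntegral_congr_fun measurableSet_Ioi fun θ hθ =>
          ENNReal.ofReal_rpow_of_pos (hb.trans hθ)
    _ = ENNReal.ofReal (∫ θ in Ioi b, θ ^ a) :=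
        (ofReal_integral_eq_lintegral_ofReal hi ((ae_restrict_mem measurableSet_Ioi).mono
          fun θ hθ => Real.rpow_nonneg (hb.trans hθ).le _)).symm
    _ = _ := by rw [integral_Ioi_rpow_of_lt ha hb]

theorem inv_toReal_lt_one {p : ℝ≥0∞} (hp : 1 < p) : (p⁻¹).toReal < 1 := by
  have : p⁻¹ < 1 := ENNReal.inv_lt_one.2 hp
  simpa using (ENNReal.toReal_lt_toReal this.ne_top ENNReal.one_ne_top).2 this

/-- Hardy's constant is the conjugate exponent p'; taken at p = r it is the factor r' in the bound
for the existence constant. -/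
theorem hardyC_eq {p : ℝ≥0∞} (hp : 1 < p) : hardyC p = ENNReal.ofReal (1 - (p⁻¹).toReal)⁻¹ := by
  have := inv_toReal_lt_one hp
  rw [hardyC, setLIntegral_Ioo_rpow (by linarith) one_pos, Real.one_rpow, one_div]
  congr 2; ring

theorem hardyC_ne_top {p : ℝ≥0∞} (hp : 1 < p) : hardyC p ≠ ∞ := by
  rw [hardyC_eq hp]; exact ENNReal.ofReal_ne_top

theorem setLIntegral_Ioo_scale {t : ℝ} (ht : 0 < t) {F : ℝ → ℝ≥0∞} (hF : Measurable F) :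
    ∫⁻ s in Ioo 0 t, F s = ENNReal.ofReal t * ∫⁻ θ in Ioo (0 : ℝ) 1, F (θ * t) := by
  have e1 : ∫⁻ s in Ioo 0 t, F s = ∫⁻ s in Ioi (0 : ℝ), (Iio t).indicator F s := by
    rw [setLIntegral_indicator measurableSet_Iio]
    congr 2; ext; simp [and_comm]
  have e2 : ∫⁻ θ in Ioo (0 : ℝ) 1, F (θ * t) = ∫⁻ θ in Ioi (0 : ℝ), (Iio t).indicator F (θ * t) := by
    have : ∀ θ, (Iio t).indicator F (θ * t) = (Iio 1).indicator (fun θ => F (θ * t)) θ := by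
      intro θ
      have : θ * t < t ↔ θ < 1 := by
        rw [mul_lt_iff_lt_one_left ht]
      simp [indicator, this]
    simp_rw [this]
    rw [setLIntegral_indicator measurableSet_Iio]
    congr 2; ext; simp [and_comm]
  rw [e1, e2, setLIntegral_Ioi_comp_mul ht (hF.indicator measurableSet_Iio), ← mul_assoc,
    ENNReal.ofReal_inv_of_pos ht, ENNReal.mul_inv_cancel (ofReal_ne_zero ht) ENNReal.ofReal_ne_top,
    one_mul]

theorem kfun_div_le [SFinite μ] {g : X → ℝ≥0∞} (hg : Measurable g) {t : ℝ} (ht : 0 < t) :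
    kfun μ (ENNReal.ofReal t) g / ENNReal.ofReal t ≤ ∫⁻ θ in Ioo (0 : ℝ) 1, rearr μ g (t * θ) := by
  rw [ENNReal.div_le_iff_le_mul (Or.inl (ofReal_ne_zero ht)) (Or.inl ENNReal.ofReal_ne_top)]
  refine (kfun_le_lintegral_rearr hg t).trans_eq ?_
  rw [setLIntegral_Ioo_scale ht measurable_rearr, mul_comm]
  simp_rw [mul_comm]

/-- If `K(τ,G)` is dominated by `∫ w(s) K(τ,g_s) ds`, then the `L^{p,q}` norm of `G` is dominated by
`∫ w(s) ‖g_s‖ ds`. -/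
theorem lorN_le_of_kfun_le [SFinite μ] {p q : ℝ≥0∞} (h1 : 1 ≤ q) {S : Type*}
    [MeasurableSpace S] {ν : Measure S} [SFinite ν] {w : S → ℝ≥0∞} (hw : Measurable w)
    {g : S → X → ℝ≥0∞} (hg : Measurable (Function.uncurry g)) {G : X → ℝ≥0∞} {M : ℝ≥0∞}
    (H : ∀ t : ℝ, 0 < t → kfun μ (ENNReal.ofReal t) G
      ≤ ∫⁻ s, w s * kfun μ (ENNReal.ofReal t) (g s) ∂ν)
    (hM : ∀ s, lorentzNorm μ p q (g s) ≤ M) :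
    lorN μ p q G ≤ hardyC p * (∫⁻ s, w s ∂ν) * M := by
  set a := (p⁻¹).toReal
  -- K(t, g_s)/t is at most the average over θ in (0,1) of g_s^*(tθ). Normalizing each dilate by
  -- θ^{1/p} keeps its gauge below M, and the compensating θ^{-1/p} in the weight integrates to
  -- `hardyC p`. The cutoff at θ ≤ 0 makes the bound hold for every parameter.
  set ρ : S × ℝ → ℝ → ℝ≥0∞ := fun z t =>
    if 0 < z.2 then ENNReal.ofReal z.2 ^ a * rearr μ (g z.1) (t * z.2) else 0 with hρ
  set W : S × ℝ → ℝ≥0∞ := fun z => w z.1 * ENNReal.ofReal z.2 ^ (-a) with hW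
  have hWm : Measurable W :=
    (hw.comp measurable_fst).mul ((measurable_weight _).comp measurable_snd)
  have hR := measurable_rearr_prod (μ := μ) hg
  have hρm : Measurable (Function.uncurry ρ) := by
    refine Measurable.ite (measurableSet_lt measurable_const
      (measurable_snd.comp measurable_fst)) (Measurable.mul ?_ ?_) measurable_const
    · exact (measurable_weight a).comp (measurable_snd.comp measurable_fst)
    · exact hR.comp (f := fun z : (S × ℝ) × ℝ => (z.1.1, z.2 * z.1.2)) (by fun_prop)
  have hρM : ∀ z, lorGauge p q (ρ z) ≤ M := by
    intro z
    by_cases hz : 0 < z.2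
    · simp only [hρ, if_pos hz]
      exact (lorGauge_dilate h1 hz measurable_rearr).trans (hM z.1)
    · have : ρ z = fun t => 0 * 0 := by ext t; simp [hρ, if_neg hz]
      rw [this, lorGauge_const_mul h1 ENNReal.zero_ne_top, zero_mul]
      exact zero_le
  have hmain := lorGauge_lintegral_le h1 (ν := ν.prod (volume.restrict (Ioo (0 : ℝ) 1))) hWm hρm hρM
  have hmass : ∫⁻ z, W z ∂(ν.prod (volume.restrict (Ioo (0 : ℝ) 1)))
      = hardyC p * ∫⁻ s, w s ∂ν := by
    rw [lintegral_prod_mul hw.aemeasurable (measurable_weight _).aemeasurable, mul_comm, hardyC]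
  rw [hmass] at hmain
  refine (lorGauge_mono fun t ht => ?_).trans hmain
  have hm : Measurable fun z => W z * ρ z t := hWm.mul (hρm.comp measurable_prodMk_right)
  rw [lintegral_prod (fun z => W z * ρ z t) hm.aemeasurable]
  calc kfun μ (ENNReal.ofReal t) G / ENNReal.ofReal t
      ≤ (∫⁻ s, w s * kfun μ (ENNReal.ofReal t) (g s) ∂ν) / ENNReal.ofReal t :=
        ENNReal.div_le_div_right (H t ht) _
    _ = ∫⁻ s, w s * (kfun μ (ENNReal.ofReal t) (g s) / ENNReal.ofReal t) ∂ν := by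
        simp_rw [div_eq_mul_inv]
        rw [← lintegral_mul_const' _ _ (ENNReal.inv_ne_top.2 (ofReal_ne_zero ht))]
        simp_rw [mul_assoc]
    _ ≤ ∫⁻ s, w s * (∫⁻ θ in Ioo (0 : ℝ) 1, rearr μ (g s) (t * θ)) ∂ν := by
        gcongr with s
        exact kfun_div_le (hg.comp measurable_prodMk_left) ht
    _ = _ := by
        refine lintegral_congr fun s => ?_
        rw [← lintegral_const_mul (f := fun θ => rearr μ (g s) (t * θ)) _
          (measurable_rearr.comp (measurable_const_mul t))]
        refine setLIntegral_congr_fun (measurableSet_Ioo) fun θ hθ => ?_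
        simp only [hW, hρ, if_pos hθ.1]
        rw [mul_assoc, ← mul_assoc (_ ^ (-a)), ← ENNReal.rpow_add _ _ (ofReal_ne_zero hθ.1)
          ENNReal.ofReal_ne_top]
        simp

/-- Hardy's inequality is the case of a one-point parameter space. -/
theorem lorN_le [SFinite μ] {p q : ℝ≥0∞} (h1 : 1 ≤ q) {g : X → ℝ≥0∞} (hg : Measurable g) :
    lorN μ p q g ≤ hardyC p * lorentzNorm μ p q g := by
  have := lorN_le_of_kfun_le (μ := μ) (p := p) (q := q) h1 (S := Unit) (ν := Measure.dirac ())
    (w := fun _ => 1) measurable_const (g := fun _ => g) (hg.comp measurable_snd) (G := g)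
    (M := lorentzNorm μ p q g) (fun t _ => by simp) (fun _ => le_rfl)
  simpa using this

end

end NSLorentz

end

/-! ### Weak Lebesgue spaces: products, embeddings, interpolation -/

noncomputable section

open MeasureTheory Set Filter
open scoped ENNReal Topology

namespace NSLorentz

section

variable {X : Type*} [MeasurableSpace X] {μ : Measure X}

theorem lorentzNorm_top_def (p : ℝ≥0∞) (g : X → ℝ≥0∞) : lorentzNorm μ p ∞ g =
    ⨆ t ∈ Ioi (0 : ℝ), ENNReal.ofReal t ^ (p⁻¹).toReal * rearr μ g t := if_pos rfl

theorem rpow_mul_rearr_le (p : ℝ≥0∞) (g : X → ℝ≥0∞) {t : ℝ} (ht : 0 < t) :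
    ENNReal.ofReal t ^ (p⁻¹).toReal * rearr μ g t ≤ lorentzNorm μ p ∞ g := by
  rw [lorentzNorm_top_def]; exact le_iSup₂_of_le t ht le_rfl

theorem rpow_mul_rpow_neg {t : ℝ} (ht : 0 < t) (a : ℝ) :
    ENNReal.ofReal t ^ a * ENNReal.ofReal t ^ (-a) = 1 := by
  rw [← ENNReal.rpow_add _ _ (ofReal_ne_zero ht) ENNReal.ofReal_ne_top, add_neg_cancel,
    ENNReal.rpow_zero]

theorem rpow_mul_le_iff {t : ℝ} (ht : 0 < t) (a : ℝ) {x y : ℝ≥0∞} :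
    ENNReal.ofReal t ^ a * x ≤ y ↔ x ≤ y * ENNReal.ofReal t ^ (-a) := by
  have h1 := rpow_mul_rpow_neg ht a
  constructor
  · intro h
    calc x = ENNReal.ofReal t ^ a * x * ENNReal.ofReal t ^ (-a) := by
          rw [mul_right_comm, h1, one_mul]
      _ ≤ _ := by gcongr
  · intro h
    calc _ ≤ ENNReal.ofReal t ^ a * (y * ENNReal.ofReal t ^ (-a)) := by gcongr
      _ = y := by rw [mul_left_comm, h1, mul_one]

theorem rearr_le_of_lorentzNorm (p : ℝ≥0∞) (g : X → ℝ≥0∞) {t : ℝ} (ht : 0 < t) :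
    rearr μ g t ≤ lorentzNorm μ p ∞ g * ENNReal.ofReal t ^ (-(p⁻¹).toReal) :=
  (rpow_mul_le_iff ht _).1 (rpow_mul_rearr_le p g ht)

theorem lorentzNorm_top_le {p : ℝ≥0∞} {g : X → ℝ≥0∞} {A : ℝ≥0∞}
    (H : ∀ t : ℝ, 0 < t → rearr μ g t ≤ A * ENNReal.ofReal t ^ (-(p⁻¹).toReal)) :
    lorentzNorm μ p ∞ g ≤ A := by
  rw [lorentzNorm_top_def]
  exact iSup₂_le fun t ht => (rpow_mul_le_iff ht _).2 (H t ht)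

theorem kfun_le_of_lorN {p : ℝ≥0∞} {g : X → ℝ≥0∞} {t : ℝ} (ht : 0 < t) :
    kfun μ (ENNReal.ofReal t) g ≤ lorN μ p ∞ g * ENNReal.ofReal t ^ (1 - (p⁻¹).toReal) := by
  have h : ENNReal.ofReal t ^ (p⁻¹).toReal * (kfun μ (ENNReal.ofReal t) g / ENNReal.ofReal t)
      ≤ lorN μ p ∞ g := by
    rw [lorN, lorGauge, if_pos rfl]
    exact le_iSup₂_of_le t ht le_rfl
  rw [rpow_mul_le_iff ht, ENNReal.div_le_iff_le_mul (Or.inl (ofReal_ne_zero ht))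
    (Or.inl ENNReal.ofReal_ne_top), mul_assoc] at h
  refine h.trans_eq ?_
  rw [sub_eq_neg_add, ENNReal.rpow_add _ _ (ofReal_ne_zero ht) ENNReal.ofReal_ne_top,
    ENNReal.rpow_one]

/-- A weak-type function has `K(t,g) ≲ t^{1-1/p}`. -/
theorem kfun_le_of_weak [SFinite μ] {p : ℝ≥0∞} {g : X → ℝ≥0∞} (hg : Measurable g) {t : ℝ}
    (ht : 0 < t) : kfun μ (ENNReal.ofReal t) g ≤
      hardyC p * lorentzNorm μ p ∞ g * ENNReal.ofReal t ^ (1 - (p⁻¹).toReal) :=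
  (kfun_le_of_lorN ht).trans (by gcongr; exact lorN_le le_top hg)

theorem lorentzNorm_top_le_of_kfun [SigmaFinite μ] {p : ℝ≥0∞} {g : X → ℝ≥0∞} (hg : Measurable g)
    {A : ℝ≥0∞} (H : ∀ t : ℝ, 0 < t → kfun μ (ENNReal.ofReal t) g
      ≤ A * ENNReal.ofReal t ^ (1 - (p⁻¹).toReal)) :
    lorentzNorm μ p ∞ g ≤ A := by
  refine lorentzNorm_top_le fun t ht => ?_
  have h := (mul_rearr_le_kfun (μ := μ) hg t).trans (H t ht)
  rw [← ENNReal.rpow_one (ENNReal.ofReal t)] at h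
  have h1 := (rpow_mul_le_iff ht 1).1 h
  refine h1.trans_eq ?_
  rw [ENNReal.rpow_one, mul_assoc, ← ENNReal.rpow_add _ _ (ofReal_ne_zero ht) ENNReal.ofReal_ne_top]
  congr 2; ring

theorem rearr_le_of_le {g : X → ℝ≥0∞} {c : ℝ≥0∞} (H : ∀ᵐ x ∂μ, g x ≤ c) (t : ℝ) :
    rearr μ g t ≤ c := by
  rw [rearr_le_iff, distrib]
  have : μ {x | c < g x} = 0 := by
    refine measure_mono_null (fun x hx => ?_) (ae_iff.1 H)
    simpa using hx
  rw [this]; exact zero_le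

theorem lorentzNorm_top_top_le {g : X → ℝ≥0∞} {c : ℝ≥0∞} (H : ∀ᵐ x ∂μ, g x ≤ c) :
    lorentzNorm μ ∞ ∞ g ≤ c :=
  lorentzNorm_top_le fun t _ => by simpa using rearr_le_of_le H t

theorem lorentzNorm_const_mul {p q c : ℝ≥0∞} (h1 : 1 ≤ q) (h0 : c ≠ 0) (hc : c ≠ ∞)
    (g : X → ℝ≥0∞) : lorentzNorm μ p q (fun x => c * g x) = c * lorentzNorm μ p q g := by
  rw [lorentzNorm_eq_gauge, lorentzNorm_eq_gauge, ← lorGauge_const_mul h1 hc]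
  congr 1; ext t; exact rearr_const_mul h0 hc t

theorem ae_eq_zero_of_lorentzNorm {p : ℝ≥0∞} {g : X → ℝ≥0∞} (h : lorentzNorm μ p ∞ g = 0) :
    ∀ᵐ x ∂μ, g x = 0 := by
  have h1 : ∀ t : ℝ, 0 < t → distrib μ g 0 ≤ ENNReal.ofReal t := fun t ht => by
    rw [← rearr_le_iff]
    have := rearr_le_of_lorentzNorm (μ := μ) p g ht
    rwa [h, zero_mul] at this
  have h2 : distrib μ g 0 = 0 := by
    refine le_antisymm (ENNReal.le_of_forall_pos_le_add fun ε hε _ => ?_) zero_le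
    simpa using h1 ε hε
  have h3 : {x | ¬ g x = 0} = {x | 0 < g x} := by ext x; simp [pos_iff_ne_zero]
  rw [ae_iff, h3]
  exact h2

/-- Hölder's inequality for the `K`-functional. -/
theorem kfun_mul_le {τ : ℝ≥0∞} {g h : X → ℝ≥0∞} (hg : Measurable g) (hh : Measurable h) :
    kfun μ τ (fun x => g x * h x) ≤
      kfun μ τ (fun x => g x ^ (2 : ℝ)) ^ (1 / 2 : ℝ) *
        kfun μ τ (fun x => h x ^ (2 : ℝ)) ^ (1 / 2 : ℝ) :=
  kfun_le fun φ hm h1 hτ => by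
    have H := ENNReal.lintegral_mul_le_Lp_mul_Lq μ (p := 2) (q := 2)
      (Real.holderConjugate_iff.2 ⟨by norm_num, by norm_num⟩)
      (f := fun x => g x * φ x ^ (1 / 2 : ℝ)) (g := fun x => h x * φ x ^ (1 / 2 : ℝ))
      (by fun_prop) (by fun_prop)
    have e1 : ∀ x, φ x ^ (1 / 2 : ℝ) * φ x ^ (1 / 2 : ℝ) = φ x := fun x => by
      rw [← ENNReal.rpow_add_of_nonneg _ _ (by norm_num) (by norm_num)]; norm_num
    have e2 : ∀ x, (φ x ^ (1 / 2 : ℝ)) ^ (2 : ℝ) = φ x := fun x => by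
      rw [← ENNReal.rpow_mul]; norm_num
    calc ∫⁻ x, g x * h x * φ x ∂μ
        = ∫⁻ x, ((fun x => g x * φ x ^ (1 / 2 : ℝ)) * fun x => h x * φ x ^ (1 / 2 : ℝ)) x ∂μ := by
          refine lintegral_congr fun x => ?_
          simp only [Pi.mul_apply]
          rw [mul_mul_mul_comm, e1]
      _ ≤ _ := H
      _ ≤ _ := by
          simp_rw [ENNReal.mul_rpow_of_nonneg _ _ (show (0 : ℝ) ≤ 2 by norm_num), e2]
          gcongr
          · exact le_kfun hm h1 hτ
          · exact le_kfun hm h1 hτ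

theorem half_inv_toReal (r : ℝ≥0∞) : ((r / 2)⁻¹).toReal = 2 * (r⁻¹).toReal := by
  rw [ENNReal.inv_div (by simp) (by simp), div_eq_mul_inv, ENNReal.toReal_mul]
  simp

theorem lorentzNorm_sq (r : ℝ≥0∞) (g : X → ℝ≥0∞) :
    lorentzNorm μ (r / 2) ∞ (fun x => g x ^ (2 : ℝ)) ≤ lorentzNorm μ r ∞ g ^ (2 : ℝ) := by
  refine lorentzNorm_top_le fun t ht => ?_
  rw [rearr_rpow two_pos, half_inv_toReal]
  calc _ ≤ (lorentzNorm μ r ∞ g * ENNReal.ofReal t ^ (-(r⁻¹).toReal)) ^ (2 : ℝ) := by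
        gcongr; exact rearr_le_of_lorentzNorm r g ht
    _ = _ := by
        rw [ENNReal.mul_rpow_of_nonneg _ _ two_pos.le, ← ENNReal.rpow_mul]
        congr 2; ring

theorem one_lt_half {r : ℝ≥0∞} (hr : 2 < r) : 1 < r / 2 := by
  rw [ENNReal.lt_div_iff_mul_lt (Or.inl (by simp)) (Or.inl (by simp))]
  simpa using hr

/-- The product of two functions in `L^{r,∞}`, `r > 2`. -/
theorem kfun_mul_le_weak [SFinite μ] {r : ℝ≥0∞} {g h : X → ℝ≥0∞}
    (hg : Measurable g) (hh : Measurable h) {t : ℝ} (ht : 0 < t) :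
    kfun μ (ENNReal.ofReal t) (fun x => g x * h x) ≤
      hardyC (r / 2) * (lorentzNorm μ r ∞ g * lorentzNorm μ r ∞ h) *
        ENNReal.ofReal t ^ (1 - 2 * (r⁻¹).toReal) := by
  -- Each factor enters through its square, which lies in L^{r/2,∞}; Hölder then takes the geometric
  -- mean of the two K-functionals.
  have key : ∀ g : X → ℝ≥0∞, Measurable g →
      kfun μ (ENNReal.ofReal t) (fun x => g x ^ (2 : ℝ)) ^ (1 / 2 : ℝ) ≤
        (hardyC (r / 2) * ENNReal.ofReal t ^ (1 - 2 * (r⁻¹).toReal)) ^ (1 / 2 : ℝ)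
          * lorentzNorm μ r ∞ g := by
    intro g hg
    have h1 := kfun_le_of_weak (μ := μ) (p := r / 2) (hg.pow_const (2 : ℝ)) ht
    rw [half_inv_toReal] at h1
    calc _ ≤ ((hardyC (r / 2) * ENNReal.ofReal t ^ (1 - 2 * (r⁻¹).toReal))
          * lorentzNorm μ r ∞ g ^ (2 : ℝ)) ^ (1 / 2 : ℝ) := by
          gcongr
          refine h1.trans ?_
          rw [mul_right_comm]
          gcongr
          exact lorentzNorm_sq r g
      _ = _ := by
          rw [ENNReal.mul_rpow_of_nonneg _ _ (by norm_num), ← ENNReal.rpow_mul]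
          norm_num
  refine (kfun_mul_le hg hh).trans ((mul_le_mul' (key g hg) (key h hh)).trans_eq ?_)
  have e : ∀ x : ℝ≥0∞, x ^ (1 / 2 : ℝ) * x ^ (1 / 2 : ℝ) = x := fun x => by
    rw [← ENNReal.rpow_add_of_nonneg _ _ (by norm_num) (by norm_num)]; norm_num
  rw [mul_mul_mul_comm, e]; ring

theorem div_toReal_inv {p q : ℝ≥0∞} : (q / p).toReal = (p⁻¹).toReal * q.toReal := by
  rw [div_eq_mul_inv, ENNReal.toReal_mul, mul_comm]

/-- The local form of the embedding `L^{p,q} ⊂ L^{p,∞}`. -/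
theorem rpow_rearr_le_local {p q : ℝ≥0∞} (hq1 : 1 ≤ q) (hq : q ≠ ∞) (hp0 : p ≠ 0) (hp : p ≠ ∞)
    (g : X → ℝ≥0∞) {t : ℝ} (ht : 0 < t) :
    (ENNReal.ofReal t ^ (p⁻¹).toReal * rearr μ g t) ^ q.toReal ≤
      q / p * ∫⁻ s in Ioo 0 t, (ENNReal.ofReal s ^ (p⁻¹).toReal * rearr μ g s) ^ q.toReal
        / ENNReal.ofReal s := by
  have hq0 : 0 < q.toReal := by linarith [one_le_toReal hq1 hq]
  have hp0' : 0 < (p⁻¹).toReal := ENNReal.toReal_pos (by simpa using hp) (by simpa using hp0)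
  set c := (p⁻¹).toReal * q.toReal with hc
  have hc0 : 0 < c := mul_pos hp0' hq0
  have hqp : q / p = ENNReal.ofReal c := by
    rw [hc, ← div_toReal_inv, ENNReal.ofReal_toReal]
    exact ENNReal.div_ne_top hq hp0
  -- t^{q/p} equals q/p times the integral of s^{q/p-1} over (0,t), and g^*(t) ≤ g^*(s) there.
  calc (ENNReal.ofReal t ^ (p⁻¹).toReal * rearr μ g t) ^ q.toReal
      = q / p * (rearr μ g t ^ q.toReal * ∫⁻ s in Ioo 0 t, ENNReal.ofReal s ^ (c - 1)) := by
        rw [setLIntegral_Ioo_rpow (by linarith) ht, sub_add_cancel, mul_left_comm, hqp,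
          ← ENNReal.ofReal_mul hc0.le, mul_div_cancel₀ _ hc0.ne', ← ENNReal.ofReal_rpow_of_pos ht,
          ENNReal.mul_rpow_of_nonneg _ _ hq0.le, ← ENNReal.rpow_mul, mul_comm]
    _ = q / p * ∫⁻ s in Ioo 0 t, rearr μ g t ^ q.toReal * ENNReal.ofReal s ^ (c - 1) := by
        rw [lintegral_const_mul _ (measurable_weight _)]
    _ ≤ _ := by
        gcongr q / p * ?_
        refine setLIntegral_mono' measurableSet_Ioo fun s hs => ?_
        have : ENNReal.ofReal s ^ (c - 1) = (ENNReal.ofReal s ^ (p⁻¹).toReal) ^ q.toReal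
            / ENNReal.ofReal s := by
          rw [ENNReal.rpow_sub _ _ (ofReal_ne_zero hs.1) ENNReal.ofReal_ne_top, ENNReal.rpow_one,
            ← ENNReal.rpow_mul]
        rw [this, ENNReal.mul_rpow_of_nonneg _ _ hq0.le, ← mul_div_assoc, mul_comm]
        gcongr
        exact rearr_anti hs.2.le

theorem lorentzNorm_weak_le {p q : ℝ≥0∞} (hq1 : 1 ≤ q) (hp0 : p ≠ 0) (hpq : p = ∞ → q = ∞)
    (g : X → ℝ≥0∞) : lorentzNorm μ p ∞ g ≤ lorentzNorm μ p q g := by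
  by_cases hq : q = ∞
  · rw [hq]
  have hq0 : 0 < q.toReal := by linarith [one_le_toReal hq1 hq]
  rw [lorentzNorm_top_def]
  refine iSup₂_le fun t ht => ?_
  rw [← ENNReal.rpow_le_rpow_iff hq0]
  refine (rpow_rearr_le_local hq1 hq hp0 (fun h => hq (hpq h)) g ht).trans ?_
  rw [lorentzNorm_eq_gauge, lorGauge_rpow hq hq1]
  gcongr q / p * ?_
  exact lintegral_mono_set Ioo_subset_Ioi_self

/-- The rearrangement of a function in `L^{p,q}`, `q < ∞`, is `o(t^{-1/p})` as `t → 0`. -/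
theorem exists_rpow_rearr_le {p q : ℝ≥0∞} (hq1 : 1 ≤ q) (hq : q ≠ ∞) (hp0 : p ≠ 0) (hp : p ≠ ∞)
    {g : X → ℝ≥0∞} (hg : lorentzNorm μ p q g ≠ ∞) {ε : ℝ≥0∞} (hε : 0 < ε) :
    ∃ δ > 0, ∀ t, 0 < t → t < δ → ENNReal.ofReal t ^ (p⁻¹).toReal * rearr μ g t ≤ ε := by
  have hq0 : 0 < q.toReal := by linarith [one_le_toReal hq1 hq]
  set F : ℝ → ℝ≥0∞ := fun s => (ENNReal.ofReal s ^ (p⁻¹).toReal * rearr μ g s) ^ q.toReal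
        / ENNReal.ofReal s with hF
  have hI : q / p * ∫⁻ s in Ioi (0 : ℝ), F s ≠ ∞ := by
    rw [hF, ← lorGauge_rpow hq hq1]
    exact ENNReal.rpow_ne_top_of_nonneg hq0.le hg
  have hqp0 : q / p ≠ 0 := (ENNReal.div_pos (zero_lt_one.trans_le hq1).ne' hp).ne'
  have hqpt : q / p ≠ ∞ := ENNReal.div_ne_top hq hp0
  have hI' : ∫⁻ s in Ioi (0 : ℝ), F s ≠ ∞ := fun h => hI (by rw [h, ENNReal.mul_top hqp0])
  -- Absolute continuity of a finite integral.
  have hlim : Tendsto (fun t : ℝ => ∫⁻ s in Ioo 0 t, F s ∂(volume.restrict (Ioi 0)))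
      (𝓝[>] 0) (𝓝 0) := by
    refine tendsto_setLIntegral_zero hI' ?_
    have : Tendsto (fun t : ℝ => ENNReal.ofReal t) (𝓝[>] 0) (𝓝 0) := by
      have := (ENNReal.continuous_ofReal.tendsto (0 : ℝ)).mono_left
        (nhdsWithin_le_nhds (s := Ioi 0))
      simpa using this
    refine tendsto_of_tendsto_of_tendsto_of_le_of_le tendsto_const_nhds this
      (fun _ => zero_le) fun t => ?_
    refine (Measure.restrict_apply_le _ _).trans ?_
    simp
  have hlim2 : Tendsto (fun t : ℝ => q / p * ∫⁻ s in Ioo 0 t, F s ∂(volume.restrict (Ioi 0)))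
      (𝓝[>] 0) (𝓝 0) := by
    simpa using ENNReal.Tendsto.const_mul hlim (Or.inr hqpt)
  have hev := (tendsto_order.1 hlim2).2 (ε ^ q.toReal) (ENNReal.rpow_pos_of_nonneg hε hq0.le)
  rw [eventually_nhdsWithin_iff, Metric.eventually_nhds_iff] at hev
  obtain ⟨δ, hδ, H⟩ := hev
  refine ⟨δ, hδ, fun t ht htδ => ?_⟩
  have := H (y := t) (by simpa [abs_of_pos ht] using htδ) ht
  rw [Measure.restrict_restrict measurableSet_Ioo, inter_eq_left.2 Ioo_subset_Ioi_self] at this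
  rw [← ENNReal.rpow_le_rpow_iff hq0]
  exact (rpow_rearr_le_local hq1 hq hp0 hp g ht).trans this.le

/-- Interpolation between weak spaces into `L^{r,1}`. -/
theorem lorentzNorm_one_le {p₀ p₁ r : ℝ≥0∞} (hp0 : p₀ ≠ 0) (h0 : p₀ < r) (h1 : r < p₁) : ∃ C : ℝ≥0∞, C ≠ ∞ ∧
    ∀ (g : X → ℝ≥0∞) (b : ℝ), 0 < b → lorentzNorm μ r 1 g ≤
      C * (lorentzNorm μ p₁ ∞ g * ENNReal.ofReal b ^ ((r⁻¹).toReal - (p₁⁻¹).toReal)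
        + lorentzNorm μ p₀ ∞ g * ENNReal.ofReal b ^ ((r⁻¹).toReal - (p₀⁻¹).toReal)) := by
  have hr0 : r ≠ 0 := (zero_le.trans_lt h0).ne'
  have hr : r ≠ ∞ := h1.ne_top
  have i0 : (r⁻¹).toReal < (p₀⁻¹).toReal :=
    (ENNReal.toReal_lt_toReal (by simpa using hr0) (by simpa using hp0)).2 (ENNReal.inv_lt_inv.2 h0)
  have i1 : (p₁⁻¹).toReal < (r⁻¹).toReal :=
    (ENNReal.toReal_lt_toReal (by simpa using (zero_le.trans_lt h1).ne') (by simpa using hr0)).2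
      (ENNReal.inv_lt_inv.2 h1)
  set a := (r⁻¹).toReal
  set a₀ := (p₀⁻¹).toReal
  set a₁ := (p₁⁻¹).toReal
  refine ⟨1 / r * (ENNReal.ofReal (a - a₁)⁻¹ + ENNReal.ofReal (a₀ - a)⁻¹),
    ENNReal.mul_ne_top (ENNReal.div_ne_top ENNReal.one_ne_top hr0) (by simp), fun g b hb => ?_⟩
  set A₀ := lorentzNorm μ p₀ ∞ g
  set A₁ := lorentzNorm μ p₁ ∞ g
  have hpt : ∀ (A : ℝ≥0∞) (c t : ℝ), 0 < t → rearr μ g t ≤ A * ENNReal.ofReal t ^ (-c) →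
      ENNReal.ofReal t ^ a * rearr μ g t / ENNReal.ofReal t
        ≤ A * ENNReal.ofReal t ^ (a - c - 1) := by
    intro A c t ht h
    rw [div_eq_mul_inv, ← ENNReal.rpow_neg_one]
    calc _ ≤ ENNReal.ofReal t ^ a * (A * ENNReal.ofReal t ^ (-c)) * ENNReal.ofReal t ^ (-1 : ℝ) := by
          gcongr
      _ = A * (ENNReal.ofReal t ^ a * ENNReal.ofReal t ^ (-c) * ENNReal.ofReal t ^ (-1 : ℝ)) := by
          ring
      _ = _ := by
          rw [← ENNReal.rpow_add _ _ (ofReal_ne_zero ht) ENNReal.ofReal_ne_top,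
            ← ENNReal.rpow_add _ _ (ofReal_ne_zero ht) ENNReal.ofReal_ne_top]
          congr 2
  -- Below b the larger exponent p₁ makes the integrand integrable at 0, above b the smaller
  -- exponent p₀ makes it integrable at infinity. The point b stays free so that the two
  -- contributions can be balanced in each application.
  have hsplit : Ioi (0 : ℝ) ⊆ Ioo 0 b ∪ (Ici b) := fun t ht => by
    rcases lt_or_ge t b with h | h
    exacts [Or.inl ⟨ht, h⟩, Or.inr h]
  rw [lorentzNorm_eq_gauge, lorGauge, if_neg ENNReal.one_ne_top]
  simp only [ENNReal.toReal_one, inv_one, ENNReal.rpow_one]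
  rw [mul_assoc]
  gcongr
  calc _ ≤ ∫⁻ t in Ioo 0 b ∪ Ici b, _ := lintegral_mono_set hsplit
    _ ≤ _ := lintegral_union_le _ _ _
    _ ≤ A₁ * ENNReal.ofReal (b ^ (a - a₁) / (a - a₁))
        + A₀ * ENNReal.ofReal (b ^ (a - a₀) / (a₀ - a)) := by
        gcongr
        · calc _ ≤ ∫⁻ t in Ioo 0 b, A₁ * ENNReal.ofReal t ^ (a - a₁ - 1) :=
                setLIntegral_mono' measurableSet_Ioo fun t ht => by
                  exact hpt A₁ a₁ t ht.1 (rearr_le_of_lorentzNorm p₁ g ht.1)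
            _ = _ := by
                rw [lintegral_const_mul _ (measurable_weight _),
                  setLIntegral_Ioo_rpow (by linarith) hb, sub_add_cancel]
        · calc _ ≤ ∫⁻ t in Ici b, A₀ * ENNReal.ofReal t ^ (a - a₀ - 1) :=
                setLIntegral_mono' measurableSet_Ici fun t ht => by
                  have ht0 : 0 < t := hb.trans_le ht
                  exact hpt A₀ a₀ t ht0 (rearr_le_of_lorentzNorm p₀ g ht0)
            _ = _ := by
                rw [lintegral_const_mul _ (measurable_weight _),
                  setLIntegral_congr Ioi_ae_eq_Ici.symm,
                  setLIntegral_Ioi_rpow (by linarith) hb, sub_add_cancel]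
                congr 2
                rw [← neg_sub a a₀, div_neg, neg_div]
    _ ≤ _ := by
        rw [div_eq_mul_inv, div_eq_mul_inv, ENNReal.ofReal_mul (by positivity),
          ENNReal.ofReal_mul (by positivity), ← ENNReal.ofReal_rpow_of_pos hb,
          ← ENNReal.ofReal_rpow_of_pos hb, add_mul, mul_comm (ENNReal.ofReal (a - a₁)⁻¹),
          mul_comm (ENNReal.ofReal (a₀ - a)⁻¹), ← mul_assoc, ← mul_assoc]
        gcongr
        · exact le_self_add
        · exact le_add_self

/-- The supremum may be restricted to rational arguments: a rational slightly below t has a larger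
rearrangement, and the power weight is continuous. A countable supremum of measurable functions
remains. -/
theorem measurable_lorentzNorm_weak [SFinite μ] {S : Type*} [MeasurableSpace S] (p : ℝ≥0∞)
    {g : S → X → ℝ≥0∞} (hg : Measurable (Function.uncurry g)) :
    Measurable fun s => lorentzNorm μ p ∞ (g s) := by
  have e : ∀ s, lorentzNorm μ p ∞ (g s) = ⨆ τ : {τ : ℚ // 0 < τ},
      ENNReal.ofReal ((τ : ℚ) : ℝ) ^ (p⁻¹).toReal * rearr μ (g s) ((τ : ℚ) : ℝ) := by
    intro s
    refine le_antisymm ?_ (iSup_le fun τ => rpow_mul_rearr_le p (g s) (by exact_mod_cast τ.2))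
    rw [lorentzNorm_top_def]
    refine iSup₂_le fun t ht => ?_
    have hlim : Tendsto (fun x : ℝ => ENNReal.ofReal x ^ (p⁻¹).toReal * rearr μ (g s) t)
        (𝓝 t) (𝓝 (ENNReal.ofReal t ^ (p⁻¹).toReal * rearr μ (g s) t)) := by
      refine ENNReal.Tendsto.mul_const ?_ (Or.inl ?_)
      · exact (ENNReal.continuous_rpow_const.comp ENNReal.continuous_ofReal).tendsto t
      · exact (ENNReal.rpow_pos (by simpa using ht) ENNReal.ofReal_ne_top).ne'
    refine le_of_forall_lt fun y hy => ?_
    have hev := (tendsto_order.1 hlim).1 y hy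
    rw [Metric.eventually_nhds_iff] at hev
    obtain ⟨δ, hδ, H⟩ := hev
    obtain ⟨τ, h1, h2⟩ := exists_rat_btwn (show max 0 (t - δ) < t from max_lt ht (by linarith))
    have hτ0 : (0 : ℝ) < τ := (le_max_left _ _).trans_lt h1
    have hτδ : t - δ < τ := (le_max_right _ _).trans_lt h1
    refine (H (y := (τ : ℝ)) ?_).trans_le (le_trans ?_
      (le_iSup (fun τ : {τ : ℚ // 0 < τ} => ENNReal.ofReal ((τ : ℚ) : ℝ) ^ (p⁻¹).toReal *
        rearr μ (g s) ((τ : ℚ) : ℝ)) ⟨τ, by exact_mod_cast hτ0⟩))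
    · rw [Real.dist_eq, abs_lt]; constructor <;> linarith
    · simp only
      gcongr
      exact rearr_anti h2.le
  simp_rw [e]
  exact Measurable.iSup fun τ => ((measurable_rearr_prod (μ := μ) hg).comp
    (measurable_prodMk_right (y := ((τ : ℚ) : ℝ)))).const_mul _

end

end NSLorentz

end

/-! ### Gaussian Fourier integrals with polynomially bounded symbols -/

noncomputable section

open MeasureTheory Set Filter
open scoped ENNReal Topology

namespace NSLorentz

variable {n : ℕ}

theorem le_exp_sq (y : ℝ) : y ≤ Real.exp (y ^ 2) :=
  le_trans (by nlinarith [sq_nonneg (y - 1)]) (Real.add_one_le_exp (y ^ 2))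

theorem mul_exp_neg_sq_le {b : ℝ} (hb : 0 < b) (y : ℝ) :
    y * Real.exp (-b * y ^ 2) ≤ (√b)⁻¹ := by
  have h := le_exp_sq (√b * y)
  rw [mul_pow, Real.sq_sqrt hb.le] at h
  have hs : 0 < √b := Real.sqrt_pos.2 hb
  rw [neg_mul, Real.exp_neg, ← div_eq_mul_inv, div_le_iff₀ (Real.exp_pos _), inv_mul_eq_div,
    le_div_iff₀ hs, mul_comm]
  exact h

theorem one_add_pow_four_mul_exp_le {t : ℝ} (ht : 0 < t) (y : ℝ) :
    (1 + y) ^ 4 * Real.exp (-t * y ^ 2) ≤ (8 + 64 / t ^ 2) * Real.exp (-(t / 2) * y ^ 2) := by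
  have h1 : (1 + y) ^ 4 ≤ 8 + 8 * y ^ 4 := by
    nlinarith [sq_nonneg (y - 1), sq_nonneg (y ^ 2 - 1),
    sq_nonneg (y ^ 2 - y), sq_nonneg (y ^ 2 - 2 * y + 1)]
  have h2 : y ^ 4 ≤ 8 / t ^ 2 * Real.exp (t / 2 * y ^ 2) := by
    have := Real.quadratic_le_exp_of_nonneg (show 0 ≤ t / 2 * y ^ 2 by positivity)
    have h3 : (t / 2 * y ^ 2) ^ 2 / 2 ≤ Real.exp (t / 2 * y ^ 2) := by
      nlinarith [show 0 ≤ t / 2 * y ^ 2 by positivity]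
    rw [div_mul_eq_mul_div, le_div_iff₀ (by positivity)]
    nlinarith
  have h4 : (1 : ℝ) ≤ Real.exp (t / 2 * y ^ 2) := Real.one_le_exp (by positivity)
  have h5 : (1 + y) ^ 4 ≤ (8 + 64 / t ^ 2) * Real.exp (t / 2 * y ^ 2) := by
    have : (64 : ℝ) / t ^ 2 = 8 * (8 / t ^ 2) := by ring
    rw [this, add_mul, mul_assoc]
    nlinarith
  calc (1 + y) ^ 4 * Real.exp (-t * y ^ 2)
      ≤ (8 + 64 / t ^ 2) * Real.exp (t / 2 * y ^ 2) * Real.exp (-t * y ^ 2) := by gcongr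
    _ = _ := by rw [mul_assoc, ← Real.exp_add]; congr 2; ring

theorem integrable_exp_neg_mul_sq {b : ℝ} (hb : 0 < b) :
    Integrable fun v : Sp n => Real.exp (-b * ‖v‖ ^ 2) := by
  have h := GaussianFourier.integrable_cexp_neg_mul_sq_norm_add (V := Sp n)
    (show 0 < (b : ℂ).re from hb) 0 0
  refine h.norm.congr (ae_of_all _ fun v => ?_)
  simp only [Complex.norm_exp]
  norm_cast
  simp

theorem integrable_one_add_pow {t : ℝ} (ht : 0 < t) :
    Integrable fun v : Sp n => (1 + ‖v‖) ^ 4 * Real.exp (-t * ‖v‖ ^ 2) := by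
  refine ((integrable_exp_neg_mul_sq (half_pos ht)).const_mul (8 + 64 / t ^ 2)).mono'
    (by fun_prop) (ae_of_all _ fun v => ?_)
  rw [Real.norm_of_nonneg (by positivity)]
  exact one_add_pow_four_mul_exp_le ht _

/-- The oscillating Gaussian `e^{i x·ξ - t|ξ|²}`. -/
def oscG (t : ℝ) (x ξ : Sp n) : ℂ :=
  Complex.exp (Complex.I * ((inner ℝ x ξ : ℝ) : ℂ) - (t : ℂ) * ((‖ξ‖ ^ 2 : ℝ) : ℂ))

theorem norm_oscG (t : ℝ) (x ξ : Sp n) : ‖oscG t x ξ‖ = Real.exp (-t * ‖ξ‖ ^ 2) := by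
  rw [oscG, Complex.norm_exp]
  congr 1
  rw [Complex.sub_re, ← Complex.ofReal_mul, Complex.ofReal_re, Complex.I_mul_re,
    Complex.ofReal_im]
  ring

theorem continuous_oscG : Continuous fun z : (ℝ × Sp n) × Sp n => oscG z.1.1 z.1.2 z.2 := by
  unfold oscG
  fun_prop

/-- The kernel of the Fourier multiplier `m(ξ) e^{-t|ξ|²}`. -/
def multK (m : Sp n → ℂ) (t : ℝ) (x : Sp n) : ℂ :=
  1 / (2 * (Real.pi : ℂ)) ^ n * ∫ ξ : Sp n, oscG t x ξ * m ξ

theorem integrable_oscG_mul {m : Sp n → ℂ} (hm : Measurable m) {M : ℝ}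
    (hM : ∀ ξ, ‖m ξ‖ ≤ M * (1 + ‖ξ‖) ^ 4) {t : ℝ} (ht : 0 < t) (x : Sp n) :
    Integrable fun ξ => oscG t x ξ * m ξ := by
  have hc : Continuous fun ξ : Sp n => oscG t x ξ :=
    continuous_oscG.comp (f := fun ξ : Sp n => ((t, x), ξ)) (by fun_prop)
  refine ((integrable_one_add_pow ht).const_mul M).mono'
    (hc.measurable.mul hm).aestronglyMeasurable (ae_of_all _ fun v => ?_)
  rw [norm_mul, norm_oscG, mul_comm, ← mul_assoc]
  gcongr
  exact hM v

theorem measurable_multK {m : Sp n → ℂ} (hm : Measurable m) :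
    Measurable fun z : ℝ × Sp n => multK m z.1 z.2 := by
  have h : StronglyMeasurable fun z : (ℝ × Sp n) × Sp n => oscG z.1.1 z.1.2 z.2 * m z.2 :=
    (continuous_oscG.measurable.mul (hm.comp measurable_snd)).stronglyMeasurable
  exact (h.integral_prod_right (ν := volume)).measurable.const_mul _

theorem pi_pow_ne_zero : (2 * (Real.pi : ℂ)) ^ n ≠ 0 := by
  refine pow_ne_zero _ (mul_ne_zero two_ne_zero ?_)
  exact_mod_cast Real.pi_ne_zero

theorem integral_oscG {t : ℝ} (ht : 0 < t) (x : Sp n) :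
    ∫ ξ, oscG t x ξ = ((Real.pi / t) ^ ((n : ℝ) / 2) * Real.exp (-‖x‖ ^ 2 / (4 * t)) : ℝ) := by
  have h := GaussianFourier.integral_cexp_neg_mul_sq_norm_add (V := Sp n)
    (show 0 < (t : ℂ).re from ht) Complex.I x
  have e : ∀ ξ : Sp n, oscG t x ξ
      = Complex.exp (-(t : ℂ) * (‖ξ‖ : ℂ) ^ 2 + Complex.I * ((inner ℝ x ξ : ℝ) : ℂ)) := fun ξ => by
    rw [oscG]; congr 1; push_cast; ring
  simp_rw [e]
  rw [h, finrank_euclideanSpace_fin]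
  push_cast
  rw [Complex.ofReal_cpow (by positivity), Complex.I_sq]
  push_cast
  congr 2
  ring

theorem multK_one {t : ℝ} (ht : 0 < t) (x : Sp n) :
    multK (fun _ => 1) t x = (heatK t x : ℂ) := by
  simp only [multK, mul_one]
  rw [integral_oscG ht, heatK]
  have hpi := Real.pi_pos
  have : (1 : ℂ) / (2 * (Real.pi : ℂ)) ^ n = ((1 / (2 * Real.pi) ^ n : ℝ) : ℂ) := by push_cast; rfl
  rw [this, ← Complex.ofReal_mul, ← mul_assoc]
  congr 2
  rw [← Real.rpow_natCast, one_div, one_div, ← Real.inv_rpow (by positivity),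
    ← Real.inv_rpow (by positivity)]
  have h2 : ((2 * Real.pi)⁻¹ : ℝ) ^ (n : ℝ) = ((2 * Real.pi)⁻¹ ^ 2) ^ ((n : ℝ) / 2) := by
    rw [← Real.rpow_natCast _ 2, ← Real.rpow_mul (by positivity)]
    congr 1; push_cast; ring
  rw [h2, ← Real.mul_rpow (by positivity) (by positivity)]
  congr 1
  field_simp
  ring

/-- Differentiation under the integral sign. The derivative brings down one factor ξ, so cubic
growth of m gives the x-independent majorant M(1+|ξ|)⁴ e^{-t|ξ|²}. -/
theorem hasFDerivAt_multK {m : Sp n → ℂ} (hm : Measurable m) {M : ℝ}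
    (hM : ∀ ξ, ‖m ξ‖ ≤ M * (1 + ‖ξ‖) ^ 3) {t : ℝ} (ht : 0 < t) (x : Sp n) :
    ∃ L : Sp n →L[ℝ] ℂ, HasFDerivAt (multK m t) L x ∧ ∀ k,
      L (EuclideanSpace.single k (1 : ℝ)) = multK (fun ξ => Complex.I * ξ k * m ξ) t x := by
  have hM0 : 0 ≤ M := by
    have := (norm_nonneg _).trans (hM 0)
    simpa using this
  have hM4 : ∀ ξ, ‖m ξ‖ ≤ M * (1 + ‖ξ‖) ^ 4 := fun ξ => (hM ξ).trans (by
    gcongr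
    · linarith [norm_nonneg ξ]
    · norm_num)
  have hc : Continuous fun z : Sp n × Sp n => oscG t z.1 z.2 :=
    continuous_oscG.comp (f := fun z : Sp n × Sp n => ((t, z.1), z.2)) (by fun_prop)
  set F' : Sp n → Sp n → (Sp n →L[ℝ] ℂ) := fun x ξ =>
    (Complex.I * (oscG t x ξ * m ξ)) • (Complex.ofRealCLM.comp (innerSL ℝ ξ)) with hF'
  have hF'm : AEStronglyMeasurable (F' x) volume := by
    have h1 : Measurable fun ξ => Complex.I * (oscG t x ξ * m ξ) :=
      ((hc.comp (f := fun ξ : Sp n => (x, ξ)) (by fun_prop)).measurable.mul hm).const_mul _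
    have h2 : Continuous fun ξ : Sp n => Complex.ofRealCLM.comp (innerSL ℝ ξ) := by fun_prop
    exact h1.aestronglyMeasurable.smul h2.aestronglyMeasurable
  have hbd : ∀ x ξ, ‖F' x ξ‖ ≤ M * ((1 + ‖ξ‖) ^ 4 * Real.exp (-t * ‖ξ‖ ^ 2)) := by
    intro x ξ
    refine ContinuousLinearMap.opNorm_le_bound _ (by positivity) fun v => ?_
    simp only [hF', FunLike.coe_smul, Pi.smul_apply, ContinuousLinearMap.coe_comp,
      Function.comp_apply, innerSL_apply_apply, Complex.ofRealCLM_apply, smul_eq_mul, norm_mul,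
      Complex.norm_I, one_mul, norm_oscG, Complex.norm_real]
    calc Real.exp (-t * ‖ξ‖ ^ 2) * ‖m ξ‖ * ‖inner ℝ ξ v‖
        ≤ Real.exp (-t * ‖ξ‖ ^ 2) * (M * (1 + ‖ξ‖) ^ 3) * (‖ξ‖ * ‖v‖) := by
          gcongr
          · exact hM ξ
          · exact norm_inner_le_norm ξ v
      _ ≤ Real.exp (-t * ‖ξ‖ ^ 2) * (M * (1 + ‖ξ‖) ^ 3) * ((1 + ‖ξ‖) * ‖v‖) := by
          gcongr; linarith
      _ = _ := by ring
  have h := hasFDerivAt_integral_of_dominated_of_fderiv_le (μ := (volume : Measure (Sp n)))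
    (F := fun x ξ => oscG t x ξ * m ξ) (F' := F') (x₀ := x) (s := univ)
    (bound := fun ξ => M * ((1 + ‖ξ‖) ^ 4 * Real.exp (-t * ‖ξ‖ ^ 2))) univ_mem
    (Eventually.of_forall fun y => (integrable_oscG_mul hm hM4 ht y).1)
    (integrable_oscG_mul hm hM4 ht x) hF'm (ae_of_all _ fun ξ y _ => hbd y ξ)
    ((integrable_one_add_pow ht).const_mul M) (ae_of_all _ fun ξ y _ => by
      have h1 := ((Complex.ofRealCLM.comp (innerSL ℝ ξ)).hasFDerivAt (x := y)).const_mul Complex.I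
      have h2 := ((h1.sub_const ((t : ℂ) * ((‖ξ‖ ^ 2 : ℝ) : ℂ))).cexp).mul_const (m ξ)
      have e : (fun y => oscG t y ξ * m ξ) = fun y => Complex.exp (Complex.I *
          (Complex.ofRealCLM.comp (innerSL ℝ ξ)) y - (t : ℂ) * ((‖ξ‖ ^ 2 : ℝ) : ℂ)) * m ξ := by
        ext y; simp [oscG, real_inner_comm]
      rw [e]
      refine h2.congr_fderiv ?_
      ext v
      simp [hF', oscG, real_inner_comm]
      ring)
  have hint : Integrable (F' x) := ((integrable_one_add_pow ht).const_mul M).mono' hF'm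
    (ae_of_all _ fun ξ => hbd x ξ)
  refine ⟨_, h.const_mul (1 / (2 * (Real.pi : ℂ)) ^ n), fun k => ?_⟩
  rw [smul_apply, ContinuousLinearMap.integral_apply hint, multK, smul_eq_mul]
  congr 2
  ext ξ
  simp [hF', EuclideanSpace.inner_single_right]
  ring

end NSLorentz

end

/-! ### The heat kernel, its gradient, and the convolution rule for multipliers -/

noncomputable section

open MeasureTheory Set Filter
open scoped ENNReal Topology

namespace NSLorentz

variable {n : ℕ}

theorem norm_coord_le (ξ : Sp n) (i : Fin n) : |ξ i| ≤ ‖ξ‖ := by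
  simpa using PiLp.norm_apply_le ξ i

theorem measurable_coord (k : Fin n) : Measurable fun ξ : Sp n => ξ k := by fun_prop

theorem measurable_coordC (k : Fin n) : Measurable fun ξ : Sp n => (ξ k : ℂ) :=
  Complex.measurable_ofReal.comp (measurable_coord k)

theorem multK_congr {m m' : Sp n → ℂ} (h : ∀ ξ, m ξ = m' ξ) (t : ℝ) (x : Sp n) :
    multK m t x = multK m' t x := by
  rw [funext h]

theorem oscG_factor (t : ℝ) (x ξ : Sp n) : oscG t x ξ =
    Complex.exp (Complex.I * ((inner ℝ x ξ : ℝ) : ℂ)) * Complex.exp (-(t * ‖ξ‖ ^ 2 : ℝ)) := by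
  rw [oscG, ← Complex.exp_add]; congr 1; push_cast; ring

/-- The convolution theorem: `hFT` says that g has Fourier transform a(ξ) e^{-s|ξ|²}. Fubini applies
because g is integrable and the symbol integral converges absolutely; the phase e^{iy·ξ} is bounded
by 1. -/
theorem conv_multK {g : Sp n → ℂ} (hg : Integrable g) {a : Sp n → ℂ} {s t : ℝ} (ht : 0 < t)
    (hFT : ∀ ξ, ∫ z, oscG 0 (-ξ) z * g z = a ξ * Complex.exp (-(s * ‖ξ‖ ^ 2 : ℝ)))
    {m : Sp n → ℂ} (hm : Measurable m) {M : ℝ} (hM : ∀ ξ, ‖m ξ‖ ≤ M * (1 + ‖ξ‖) ^ 4) (x : Sp n) :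
    ∫ y, g (x - y) * multK m t y = multK (fun ξ => a ξ * m ξ) (s + t) x := by
  have hG : Integrable fun y => g (x - y) := hg.comp_sub_left x
  have hI := integrable_oscG_mul hm hM ht (0 : Sp n)
  have hprod : Integrable (fun z : Sp n × Sp n => g (x - z.1) * (oscG t z.1 z.2 * m z.2))
      (volume.prod volume) := by
    have h1 := hG.mul_prod hI
    have hc : Continuous fun z : Sp n × Sp n => oscG 0 z.1 z.2 :=
      continuous_oscG.comp (f := fun z : Sp n × Sp n => (((0 : ℝ), z.1), z.2)) (by fun_prop)
    have h2 := h1.bdd_mul (c := 1) hc.aestronglyMeasurable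
      (ae_of_all _ fun z => by rw [norm_oscG]; simp)
    refine h2.congr (ae_of_all _ fun z => ?_)
    simp only [oscG_factor, inner_zero_left]
    simp
    ring
  have hin : ∀ ξ, ∫ y, g (x - y) * (oscG t y ξ * m ξ) = oscG (s + t) x ξ * (a ξ * m ξ) := by
    intro ξ
    have h1 := integral_sub_left_eq_self (μ := (volume : Measure (Sp n)))
      (fun z => oscG 0 (-ξ) z * g z) x
    rw [hFT ξ] at h1
    have h2 : ∀ y, g (x - y) * (oscG t y ξ * m ξ)
        = oscG t x ξ * m ξ * (oscG 0 (-ξ) (x - y) * g (x - y)) := by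
      intro y
      have : oscG t y ξ = oscG t x ξ * oscG 0 (-ξ) (x - y) := by
        simp only [oscG, ← Complex.exp_add, inner_sub_right, inner_neg_left, real_inner_comm]
        congr 1
        push_cast
        ring
      rw [this]; ring
    simp_rw [h2]
    rw [integral_const_mul, h1]
    have : oscG (s + t) x ξ = oscG t x ξ * Complex.exp (-(s * ‖ξ‖ ^ 2 : ℝ)) := by
      rw [oscG, oscG, ← Complex.exp_add]; congr 1; push_cast; ring
    rw [this]; ring
  calc ∫ y, g (x - y) * multK m t y
      = 1 / (2 * (Real.pi : ℂ)) ^ n * ∫ y, ∫ ξ, g (x - y) * (oscG t y ξ * m ξ) := by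
        rw [← integral_const_mul]
        congr 1; ext y
        rw [multK, integral_const_mul]; ring
    _ = _ := by
        rw [integral_integral_swap hprod, multK]
        simp_rw [hin]

theorem heatK_eq (t : ℝ) (x : Sp n) :
    heatK t x = 1 / (4 * Real.pi * t) ^ ((n : ℝ) / 2) * Real.exp (-(4 * t)⁻¹ * ‖x‖ ^ 2) := by
  rw [heatK]; congr 2; ring

theorem heatK_nonneg {t : ℝ} (ht : 0 ≤ t) (x : Sp n) : 0 ≤ heatK t x := by
  have := Real.pi_pos
  rw [heatK]; positivity

theorem integral_heatK {t : ℝ} (ht : 0 < t) : ∫ x : Sp n, heatK t x = 1 := by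
  have hpi := Real.pi_pos
  simp_rw [heatK_eq]
  rw [integral_const_mul, GaussianFourier.integral_rexp_neg_mul_sq_norm (by positivity),
    finrank_euclideanSpace_fin, one_div]
  have : Real.pi / (4 * t)⁻¹ = 4 * Real.pi * t := by field_simp
  rw [this, inv_mul_cancel₀ (by positivity)]

theorem measurable_heatK : Measurable fun z : ℝ × Sp n => heatK z.1 z.2 := by
  unfold heatK
  fun_prop

theorem integrable_heatK {t : ℝ} (ht : 0 < t) : Integrable fun x : Sp n => heatK t x := by
  simp_rw [heatK_eq]
  exact (integrable_exp_neg_mul_sq (by positivity)).const_mul _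

theorem lintegral_heatK {t : ℝ} (ht : 0 < t) :
    ∫⁻ x : Sp n, ENNReal.ofReal (heatK t x) = 1 := by
  rw [← ofReal_integral_eq_lintegral_ofReal (integrable_heatK ht)
    (ae_of_all _ fun x => heatK_nonneg ht.le x), integral_heatK ht, ENNReal.ofReal_one]

theorem oscG_mul_heatK (s : ℝ) (ξ z : Sp n) : oscG 0 (-ξ) z * (heatK s z : ℂ)
    = ((1 / (4 * Real.pi * s) ^ ((n : ℝ) / 2) : ℝ) : ℂ) * oscG (4 * s)⁻¹ (-ξ) z := by
  rw [heatK_eq, oscG_factor (4 * s)⁻¹, oscG_factor 0]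
  push_cast
  simp
  ring

theorem fourier_heatK {s : ℝ} (hs : 0 < s) (ξ : Sp n) :
    ∫ z, oscG 0 (-ξ) z * (heatK s z : ℂ) = 1 * Complex.exp (-(s * ‖ξ‖ ^ 2 : ℝ)) := by
  have hpi := Real.pi_pos
  simp_rw [oscG_mul_heatK s]
  rw [integral_const_mul, integral_oscG (by positivity), ← Complex.ofReal_mul, ← mul_assoc, one_mul,
    ← Complex.ofReal_neg, ← Complex.ofReal_exp]
  congr 1
  have : Real.pi / (4 * s)⁻¹ = 4 * Real.pi * s := by field_simp
  rw [this, one_div, inv_mul_cancel₀ (by positivity), one_mul, norm_neg]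
  congr 1
  field_simp

theorem hasFDerivAt_heatK (t : ℝ) (x : Sp n) : ∃ L : Sp n →L[ℝ] ℝ,
    HasFDerivAt (fun x => heatK t x) L x ∧ ∀ k,
      L (EuclideanSpace.single k (1 : ℝ)) = -(x k) / (2 * t) * heatK t x := by
  have h1 := (hasStrictFDerivAt_norm_sq x).hasFDerivAt
  have h2 := ((h1.const_mul (-(4 * t)⁻¹)).exp).const_mul (1 / (4 * Real.pi * t) ^ ((n : ℝ) / 2))
  simp_rw [heatK_eq]
  refine ⟨_, h2, fun k => ?_⟩
  simp [EuclideanSpace.inner_single_right]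
  ring

/-- The heat kernel is differentiated twice, once under the Fourier integral and once in closed
form; uniqueness of the derivative identifies the results. -/
theorem multK_coord {t : ℝ} (ht : 0 < t) (k : Fin n) (x : Sp n) :
    multK (fun ξ => Complex.I * ξ k) t x = ((-(x k) / (2 * t) * heatK t x : ℝ) : ℂ) := by
  obtain ⟨L, hL, hLk⟩ := hasFDerivAt_multK (n := n) (m := fun _ => 1) measurable_const (M := 1)
    (fun ξ => by
      rw [norm_one, one_mul]
      exact one_le_pow₀ (by linarith [norm_nonneg ξ])) ht x
  obtain ⟨L', hL', hLk'⟩ := hasFDerivAt_heatK t x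
  have e : multK (fun _ => 1) t = fun x : Sp n => Complex.ofRealCLM (heatK t x) := by
    ext y; rw [multK_one ht]; rfl
  rw [e] at hL
  have hu := hL.unique (Complex.ofRealCLM.hasFDerivAt.comp x hL')
  have := hLk k
  simp only [mul_one] at this
  rw [← this, hu, ContinuousLinearMap.comp_apply, hLk', Complex.ofRealCLM_apply]

/-- Half of the Gaussian exponent absorbs the factor |x|; the other half remains integrable. -/
theorem norm_multK_coord_le {t : ℝ} (ht : 0 < t) (k : Fin n) (x : Sp n) :
    ‖multK (fun ξ => Complex.I * ξ k) t x‖ ≤ (√((8 * t)⁻¹))⁻¹ / (2 * t) *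
      (1 / (4 * Real.pi * t) ^ ((n : ℝ) / 2) * Real.exp (-(8 * t)⁻¹ * ‖x‖ ^ 2)) := by
  have hpi := Real.pi_pos
  have h0 : 0 ≤ 1 / (4 * Real.pi * t) ^ ((n : ℝ) / 2) * Real.exp (-(4 * t)⁻¹ * ‖x‖ ^ 2) := by
    positivity
  rw [multK_coord ht, Complex.norm_real, norm_mul, norm_div, norm_neg, heatK_eq,
    Real.norm_of_nonneg (show (0 : ℝ) ≤ 2 * t by positivity), Real.norm_of_nonneg h0]
  have h1 := mul_exp_neg_sq_le (show 0 < (8 * t)⁻¹ by positivity) ‖x‖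
  have h2 : Real.exp (-(4 * t)⁻¹ * ‖x‖ ^ 2)
      = Real.exp (-(8 * t)⁻¹ * ‖x‖ ^ 2) * Real.exp (-(8 * t)⁻¹ * ‖x‖ ^ 2) := by
    rw [← Real.exp_add]; congr 1; field_simp; ring
  calc ‖x k‖ / (2 * t) * (1 / (4 * Real.pi * t) ^ ((n : ℝ) / 2) * Real.exp (-(4 * t)⁻¹ * ‖x‖ ^ 2))
      ≤ ‖x‖ / (2 * t) * (1 / (4 * Real.pi * t) ^ ((n : ℝ) / 2) *
          Real.exp (-(4 * t)⁻¹ * ‖x‖ ^ 2)) := by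
        gcongr; exact norm_coord_le x k
    _ = (‖x‖ * Real.exp (-(8 * t)⁻¹ * ‖x‖ ^ 2)) / (2 * t) *
          (1 / (4 * Real.pi * t) ^ ((n : ℝ) / 2) * Real.exp (-(8 * t)⁻¹ * ‖x‖ ^ 2)) := by
        rw [h2]; ring
    _ ≤ _ := by gcongr

theorem integrable_multK_coord {t : ℝ} (ht : 0 < t) (k : Fin n) :
    Integrable fun x : Sp n => multK (fun ξ => Complex.I * ξ k) t x := by
  have hm : Measurable fun ξ : Sp n => Complex.I * (ξ k : ℂ) := (measurable_coordC k).const_mul _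
  exact (((integrable_exp_neg_mul_sq (show 0 < (8 * t)⁻¹ by positivity)).const_mul _).const_mul
    _).mono' ((measurable_multK hm).comp measurable_prodMk_left).aestronglyMeasurable
    (ae_of_all _ fun x => norm_multK_coord_le ht k x)

theorem exists_lintegral_multK_coord (n : ℕ) : ∃ C : ℝ, 0 < C ∧ ∀ t : ℝ, 0 < t → ∀ k : Fin n,
    ∫⁻ x : Sp n, ‖multK (fun ξ => Complex.I * ξ k) t x‖ₑ
      ≤ ENNReal.ofReal C * ENNReal.ofReal t ^ (-(1 / 2) : ℝ) := by
  have hpi := Real.pi_pos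
  -- √8/2 comes from absorbing |x| into half of the Gaussian, and 2^{n/2} from integrating the
  -- remaining Gaussian of doubled variance.
  refine ⟨√8 / 2 * 2 ^ ((n : ℝ) / 2), by positivity, fun t ht k => ?_⟩
  have hb : 0 < (8 * t)⁻¹ := by positivity
  have hi := ((integrable_exp_neg_mul_sq (n := n) hb).const_mul
    (1 / (4 * Real.pi * t) ^ ((n : ℝ) / 2))).const_mul ((√((8 * t)⁻¹))⁻¹ / (2 * t))
  calc _ ≤ ∫⁻ x : Sp n, ENNReal.ofReal ((√((8 * t)⁻¹))⁻¹ / (2 * t) *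
      (1 / (4 * Real.pi * t) ^ ((n : ℝ) / 2) * Real.exp (-(8 * t)⁻¹ * ‖x‖ ^ 2))) := by
        refine lintegral_mono fun x => ?_
        rw [← ofReal_norm]
        exact ENNReal.ofReal_le_ofReal (norm_multK_coord_le ht k x)
    _ = _ := by
        rw [← ofReal_integral_eq_lintegral_ofReal hi (ae_of_all _ fun x => by positivity),
          integral_const_mul, integral_const_mul,
          GaussianFourier.integral_rexp_neg_mul_sq_norm hb, finrank_euclideanSpace_fin,
          ENNReal.ofReal_rpow_of_pos ht, ← ENNReal.ofReal_mul (by positivity)]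
        congr 1
        have e1 : Real.pi / (8 * t)⁻¹ = 2 * (4 * Real.pi * t) := by field_simp; norm_num
        rw [e1, Real.mul_rpow (x := 2) (y := 4 * Real.pi * t) (by positivity) (by positivity),
          Real.sqrt_inv, inv_inv,
          Real.sqrt_mul (by norm_num), Real.rpow_neg ht.le, ← Real.sqrt_eq_rpow]
        have h3 : (4 * Real.pi * t) ^ ((n : ℝ) / 2) ≠ 0 := by positivity
        have h4 : √t * √t = t := Real.mul_self_sqrt ht.le
        have h5 : √t ≠ 0 := by positivity
        generalize (4 * Real.pi * t) ^ ((n : ℝ) / 2) = P at h3 ⊢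
        generalize (2 : ℝ) ^ ((n : ℝ) / 2) = Q
        generalize √t = y at h4 h5 ⊢
        subst h4
        field_simp

/-- Gaussians are self-dual: up to a constant the heat kernel at time s is the Fourier-side Gaussian
at time 1/(4s). The first moment needed here is therefore `multK_coord` at that dual time, and
Fourier inversion is not used. -/
theorem fourier_multK_coord {s : ℝ} (hs : 0 < s) (k : Fin n) (ξ : Sp n) :
    ∫ z, oscG 0 (-ξ) z * multK (fun ξ => Complex.I * ξ k) s z
      = Complex.I * ξ k * Complex.exp (-(s * ‖ξ‖ ^ 2 : ℝ)) := by
  have hpi := Real.pi_pos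
  have hb : 0 < (4 * s)⁻¹ := by positivity
  set c : ℂ := ((1 / (4 * Real.pi * s) ^ ((n : ℝ) / 2) : ℝ) : ℂ)
  have h1 : ∀ z, oscG 0 (-ξ) z * multK (fun ξ => Complex.I * ξ k) s z
      = Complex.I / (2 * s) * c * (oscG (4 * s)⁻¹ (-ξ) z * (Complex.I * z k)) := by
    intro z
    have := oscG_mul_heatK s ξ z
    rw [multK_coord hs]
    calc _ = ((-(z k) / (2 * s) : ℝ) : ℂ) * (oscG 0 (-ξ) z * (heatK s z : ℂ)) := by
          push_cast; ring
      _ = -(Complex.I * Complex.I) * ((-(z k) / (2 * s) : ℝ) : ℂ) * -1 * -1 *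
          (c * oscG (4 * s)⁻¹ (-ξ) z) := by rw [this, Complex.I_mul_I]; ring
      _ = _ := by push_cast; ring
  simp_rw [h1]
  rw [integral_const_mul]
  have h2 := multK_coord hb k (-ξ)
  rw [multK] at h2
  have h3 : ∫ z, oscG (4 * s)⁻¹ (-ξ) z * (Complex.I * (z k : ℂ))
      = ((-((-ξ) k) / (2 * (4 * s)⁻¹) : ℝ) : ℂ) * ∫ z, oscG (4 * s)⁻¹ (-ξ) z := by
    have h4 := multK_one hb (-ξ)
    rw [multK] at h4
    simp only [mul_one] at h4
    rw [Complex.ofReal_mul, ← h4, mul_left_comm] at h2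
    exact mul_left_cancel₀ (one_div_ne_zero pi_pow_ne_zero) h2
  have h5 := fourier_heatK hs ξ
  simp_rw [oscG_mul_heatK s] at h5
  rw [integral_const_mul, one_mul] at h5
  rw [h3, ← h5]
  have hs' : (s : ℂ) ≠ 0 := by exact_mod_cast hs.ne'
  change _ = Complex.I * ξ k * (c * _)
  clear_value c
  generalize ∫ z, oscG (4 * s)⁻¹ (-ξ) z = J
  simp
  field_simp
  ring

theorem lintegral_enorm_conv_le {F g h : Sp n → ℂ} (hg : Measurable g) (hh : Measurable h)
    (H : ∀ x, F x = ∫ y, g (x - y) * h y) :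
    ∫⁻ x, ‖F x‖ₑ ≤ (∫⁻ x, ‖g x‖ₑ) * ∫⁻ x, ‖h x‖ₑ := by
  calc ∫⁻ x, ‖F x‖ₑ ≤ ∫⁻ x, ∫⁻ y, ‖g (x - y)‖ₑ * ‖h y‖ₑ := by
        refine lintegral_mono fun x => ?_
        rw [H x]
        refine (enorm_integral_le_lintegral_enorm _).trans_eq ?_
        simp_rw [enorm_mul]
    _ = ∫⁻ y, ∫⁻ x, ‖g (x - y)‖ₑ * ‖h y‖ₑ := by
        refine lintegral_lintegral_swap ?_
        exact ((hg.comp measurable_sub).enorm.mul (hh.comp measurable_snd).enorm).aemeasurable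
    _ = ∫⁻ y, (∫⁻ x, ‖g x‖ₑ) * ‖h y‖ₑ := by
        refine lintegral_congr fun y => ?_
        rw [lintegral_mul_const _ (by fun_prop), lintegral_sub_right_eq_self (fun x => ‖g x‖ₑ)]
    _ = _ := lintegral_const_mul _ hh.enorm

end NSLorentz

end

/-! ### Bounds for the kernels ∂_k 𝒯_ij -/

noncomputable section

open MeasureTheory Set Filter
open scoped ENNReal Topology

namespace NSLorentz

variable {n : ℕ}

/-- The symbol `δ_{ij} - ξ_i ξ_j / |ξ|²` of the Leray projection. -/
def lerayM (i j : Fin n) (ξ : Sp n) : ℝ := (if i = j then 1 else 0) - ξ i * ξ j / ‖ξ‖ ^ 2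

theorem abs_lerayM_le (i j : Fin n) (ξ : Sp n) : |lerayM i j ξ| ≤ 2 := by
  have h1 : |ξ i * ξ j / ‖ξ‖ ^ 2| ≤ 1 := by
    rw [abs_div, abs_mul, abs_of_nonneg (sq_nonneg ‖ξ‖), sq]
    exact div_le_one_of_le₀ (mul_le_mul (norm_coord_le ξ i) (norm_coord_le ξ j) (abs_nonneg _)
      (norm_nonneg _)) (by positivity)
  have h2 : |(if i = j then (1 : ℝ) else 0)| ≤ 1 := by split_ifs <;> simp
  rw [lerayM]
  linarith [abs_sub (if i = j then (1 : ℝ) else 0) (ξ i * ξ j / ‖ξ‖ ^ 2)]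

theorem measurable_lerayM (i j : Fin n) : Measurable (lerayM i j) := by
  unfold lerayM; fun_prop

theorem measurable_lerayC (i j : Fin n) : Measurable fun ξ : Sp n => (lerayM i j ξ : ℂ) :=
  Complex.measurable_ofReal.comp (measurable_lerayM i j)

/-- The symbol of `∂_k 𝒯_{ij}`. -/
def gradM (i j k : Fin n) (ξ : Sp n) : ℂ := Complex.I * ξ k * lerayM i j ξ

theorem measurable_gradM (i j k : Fin n) : Measurable (gradM i j k) :=
  ((measurable_coordC k).const_mul _).mul (measurable_lerayC i j)

theorem norm_gradM_le (i j k : Fin n) (ξ : Sp n) : ‖gradM i j k ξ‖ ≤ 2 * ‖ξ‖ := by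
  rw [gradM, norm_mul, norm_mul, Complex.norm_I, one_mul, Complex.norm_real, Complex.norm_real,
    mul_comm]
  exact mul_le_mul (abs_lerayM_le i j ξ) (norm_coord_le ξ k) (abs_nonneg _) zero_le_two

theorem norm_gradM_le' (i j k : Fin n) (ξ : Sp n) : ‖gradM i j k ξ‖ ≤ 2 * (1 + ‖ξ‖) ^ 4 :=
  (norm_gradM_le i j k ξ).trans (by
    have h : 1 + ‖ξ‖ ≤ (1 + ‖ξ‖) ^ 4 := le_self_pow₀ (by linarith [norm_nonneg ξ]) (by norm_num)
    linarith)

/-- The kernel `∂_k 𝒯_{ij}`, as an explicit Fourier integral. -/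
def gradK (i j k : Fin n) (t : ℝ) (x : Sp n) : ℝ := (multK (gradM i j k) t x).re

/-- The Leray symbol is bounded, so the derivative may be taken under the Fourier integral; the real
part is a continuous linear map and commutes with it. -/
theorem gradOseenK_eq (i j k : Fin n) {t : ℝ} (ht : 0 < t) (x : Sp n) :
    gradOseenK i j k t x = gradK i j k t x := by
  obtain ⟨L, hL, hLk⟩ := hasFDerivAt_multK (measurable_lerayC i j) (M := 2) (fun ξ => by
    rw [Complex.norm_real]
    refine (abs_lerayM_le i j ξ).trans ?_
    have : 1 ≤ (1 + ‖ξ‖) ^ 3 := one_le_pow₀ (by linarith [norm_nonneg ξ])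
    linarith) ht x
  have h : HasFDerivAt (fun z => oseenK i j t z) (Complex.reCLM.comp L) x :=
    Complex.reCLM.hasFDerivAt.comp x hL
  rw [gradOseenK, h.fderiv, ContinuousLinearMap.comp_apply, hLk]
  rfl

theorem measurable_gradK (i j k : Fin n) : Measurable fun z : ℝ × Sp n => gradK i j k z.1 z.2 :=
  Complex.measurable_re.comp (measurable_multK (measurable_gradM i j k))

/-- The modulus of the Fourier integrand is at most 2|ξ| e^{-t|ξ|²}; half of the Gaussian absorbs
|ξ| at the price t^{-1/2}, and the other half integrates to a multiple of t^{-n/2}. -/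
theorem norm_multK_grad_le (i j k : Fin n) {t : ℝ} (ht : 0 < t) (x : Sp n) :
    ‖multK (gradM i j k) t x‖ ≤
      2 * √2 * (1 / (2 * Real.pi)) ^ n * (2 * Real.pi) ^ ((n : ℝ) / 2) * t ^ (-((n : ℝ) + 1) / 2) := by
  have hpi := Real.pi_pos
  have hb : 0 < t / 2 := half_pos ht
  have hi := (integrable_exp_neg_mul_sq (n := n) hb).const_mul (2 * (√(t / 2))⁻¹)
  rw [multK, norm_mul]
  have h1 : ‖(1 : ℂ) / (2 * (Real.pi : ℂ)) ^ n‖ = (1 / (2 * Real.pi)) ^ n := by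
    rw [norm_div, norm_pow, norm_mul, Complex.norm_real, Real.norm_of_nonneg hpi.le, one_div_pow]
    simp
  rw [h1]
  have h2 : ‖∫ ξ, oscG t x ξ * gradM i j k ξ‖ ≤ ∫ ξ : Sp n, 2 * (√(t / 2))⁻¹ *
      Real.exp (-(t / 2) * ‖ξ‖ ^ 2) := by
    refine norm_integral_le_of_norm_le hi (ae_of_all _ fun ξ => ?_)
    rw [norm_mul, norm_oscG]
    have h3 := mul_exp_neg_sq_le hb ‖ξ‖
    have h4 : Real.exp (-t * ‖ξ‖ ^ 2)
        = Real.exp (-(t / 2) * ‖ξ‖ ^ 2) * Real.exp (-(t / 2) * ‖ξ‖ ^ 2) := by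
      rw [← Real.exp_add]; congr 1; ring
    calc _ ≤ Real.exp (-t * ‖ξ‖ ^ 2) * (2 * ‖ξ‖) := by gcongr; exact norm_gradM_le i j k ξ
      _ = 2 * (‖ξ‖ * Real.exp (-(t / 2) * ‖ξ‖ ^ 2)) * Real.exp (-(t / 2) * ‖ξ‖ ^ 2) := by
          rw [h4]; ring
      _ ≤ _ := by gcongr
  rw [integral_const_mul, GaussianFourier.integral_rexp_neg_mul_sq_norm hb,
    finrank_euclideanSpace_fin] at h2
  refine (mul_le_mul_of_nonneg_left h2 (by positivity)).trans_eq ?_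
  have e1 : Real.pi / (t / 2) = 2 * Real.pi * t⁻¹ := by field_simp
  rw [e1, Real.mul_rpow (by positivity) (by positivity), Real.sqrt_div ht.le, inv_div,
    Real.inv_rpow ht.le, ← Real.rpow_neg ht.le]
  have e2 : t ^ (-((n : ℝ) + 1) / 2) = t ^ (-((n : ℝ) / 2)) * (√t)⁻¹ := by
    rw [Real.sqrt_eq_rpow, ← Real.rpow_neg ht.le, ← Real.rpow_add ht]; congr 1; ring
  rw [e2]; ring

/-- The symbol `i ξ_k ξ_i ξ_j`. -/
def cubM (i j k : Fin n) (ξ : Sp n) : ℂ := Complex.I * ξ k * (ξ i * ξ j)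

theorem measurable_cubM (i j k : Fin n) : Measurable (cubM i j k) :=
  ((measurable_coordC k).const_mul _).mul ((measurable_coordC i).mul (measurable_coordC j))

theorem norm_cubM_le (i j k : Fin n) (ξ : Sp n) : ‖cubM i j k ξ‖ ≤ ‖ξ‖ ^ 3 := by
  rw [cubM, norm_mul, norm_mul, norm_mul, Complex.norm_I, one_mul, Complex.norm_real,
    Complex.norm_real, Complex.norm_real]
  calc _ ≤ ‖ξ‖ * (‖ξ‖ * ‖ξ‖) := by
        gcongr
        exacts [norm_coord_le ξ k, norm_coord_le ξ i, norm_coord_le ξ j]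
    _ = _ := by ring

theorem norm_coordI_le (k : Fin n) (ξ : Sp n) : ‖Complex.I * (ξ k : ℂ)‖ ≤ ‖ξ‖ := by
  rw [norm_mul, Complex.norm_I, one_mul, Complex.norm_real]
  exact norm_coord_le ξ k

theorem measurable_multK_right {m : Sp n → ℂ} (hm : Measurable m) (t : ℝ) :
    Measurable (multK m t) := by
  have h : Measurable (Function.uncurry (multK m)) := measurable_multK hm
  exact h.of_uncurry_left

/-- Distributing e^{-t|ξ|²} in three equal parts writes the kernel, up to the sign from i³ = -i, as
a convolution of three first derivatives of the heat kernel at time t/3. Each has L¹ norm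
O(t^{-1/2}). -/
theorem exists_lintegral_cub (n : ℕ) : ∃ C : ℝ, 0 < C ∧ ∀ t : ℝ, 0 < t → ∀ i j k : Fin n,
    ∫⁻ x : Sp n, ‖multK (cubM i j k) t x‖ₑ
      ≤ ENNReal.ofReal C * ENNReal.ofReal t ^ (-(3 / 2) : ℝ) := by
  obtain ⟨C, hC, H⟩ := exists_lintegral_multK_coord n
  refine ⟨C ^ 3 * (1 / 3 : ℝ) ^ (-(3 / 2) : ℝ), by positivity, fun t ht i j k => ?_⟩
  have ht3 : 0 < t / 3 := by positivity
  have mc : ∀ k : Fin n, Measurable fun ξ : Sp n => Complex.I * (ξ k : ℂ) := fun k =>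
    (measurable_coordC k).const_mul _
  have mm : ∀ k : Fin n, Measurable fun x : Sp n => multK (fun ξ => Complex.I * (ξ k : ℂ)) (t / 3) x :=
    fun k => measurable_multK_right (mc k) _
  have mij : Measurable fun ξ : Sp n => Complex.I * (ξ i : ℂ) * (Complex.I * (ξ j : ℂ)) :=
    (mc i).mul (mc j)
  have e1 : ∀ x, multK (fun ξ => Complex.I * (ξ i : ℂ) * (Complex.I * (ξ j : ℂ))) (t / 3 + t / 3) x
      = ∫ y, multK (fun ξ => Complex.I * (ξ i : ℂ)) (t / 3) (x - y) *
        multK (fun ξ => Complex.I * (ξ j : ℂ)) (t / 3) y := fun x =>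
    (conv_multK (integrable_multK_coord ht3 i) ht3 (a := fun ξ => Complex.I * (ξ i : ℂ))
      (fun ξ => fourier_multK_coord ht3 i ξ) (mc j) (M := 1) (fun ξ => by
        refine (norm_coordI_le j ξ).trans ?_
        have h : 1 + ‖ξ‖ ≤ (1 + ‖ξ‖) ^ 4 :=
          le_self_pow₀ (by linarith [norm_nonneg ξ]) (by norm_num)
        linarith) x).symm
  have e2 : ∀ x, multK (fun ξ => Complex.I * (ξ k : ℂ) *
        (Complex.I * (ξ i : ℂ) * (Complex.I * (ξ j : ℂ)))) (t / 3 + (t / 3 + t / 3)) x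
      = ∫ y, multK (fun ξ => Complex.I * (ξ k : ℂ)) (t / 3) (x - y) *
        multK (fun ξ => Complex.I * (ξ i : ℂ) * (Complex.I * (ξ j : ℂ))) (t / 3 + t / 3) y := fun x =>
    (conv_multK (integrable_multK_coord ht3 k) (by positivity) (a := fun ξ => Complex.I * (ξ k : ℂ))
      (fun ξ => fourier_multK_coord ht3 k ξ) mij (M := 1) (fun ξ => by
        rw [norm_mul]
        have h : (1 + ‖ξ‖) ^ 2 ≤ (1 + ‖ξ‖) ^ 4 :=
          pow_le_pow_right₀ (by linarith [norm_nonneg ξ]) (by norm_num)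
        have h' : ‖Complex.I * (ξ i : ℂ)‖ * ‖Complex.I * (ξ j : ℂ)‖ ≤ ‖ξ‖ * ‖ξ‖ := by
          gcongr
          exacts [norm_coordI_le i ξ, norm_coordI_le j ξ]
        nlinarith [norm_nonneg ξ]) x).symm
  have e3 : ∀ x, ‖multK (cubM i j k) t x‖ₑ = ‖multK (fun ξ => Complex.I * (ξ k : ℂ) *
        (Complex.I * (ξ i : ℂ) * (Complex.I * (ξ j : ℂ)))) (t / 3 + (t / 3 + t / 3)) x‖ₑ := by
    intro x
    have : t / 3 + (t / 3 + t / 3) = t := by ring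
    rw [this]
    have h : ∀ ξ : Sp n, Complex.I * (ξ k : ℂ) * (Complex.I * (ξ i : ℂ) * (Complex.I * (ξ j : ℂ)))
        = -1 * cubM i j k ξ := fun ξ => by
      rw [cubM, ← Complex.I_mul_I]; ring
    rw [multK_congr h]
    have : multK (fun ξ => -1 * cubM i j k ξ) t x = - multK (cubM i j k) t x := by
      simp only [multK, neg_one_mul, mul_neg, integral_neg]
    rw [this, enorm_neg]
  have m2 : Measurable fun x : Sp n =>
      multK (fun ξ => Complex.I * (ξ i : ℂ) * (Complex.I * (ξ j : ℂ))) (t / 3 + t / 3) x :=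
    measurable_multK_right mij _
  simp_rw [e3]
  refine (lintegral_enorm_conv_le (mm k) m2 e2).trans ?_
  have hb : ENNReal.ofReal C * ENNReal.ofReal (t / 3) ^ (-(1 / 2) : ℝ)
      = ENNReal.ofReal (C * (t / 3) ^ (-(1 / 2) : ℝ)) := by
    rw [ENNReal.ofReal_rpow_of_pos ht3, ENNReal.ofReal_mul hC.le]
  calc _ ≤ ENNReal.ofReal (C * (t / 3) ^ (-(1 / 2) : ℝ)) *
        (ENNReal.ofReal (C * (t / 3) ^ (-(1 / 2) : ℝ)) *
          ENNReal.ofReal (C * (t / 3) ^ (-(1 / 2) : ℝ))) := by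
        rw [← hb]
        gcongr
        · exact H _ ht3 k
        · refine (lintegral_enorm_conv_le (mm i) (mm j) e1).trans ?_
          gcongr
          exacts [H _ ht3 i, H _ ht3 j]
    _ = _ := by
        rw [← ENNReal.ofReal_mul (by positivity), ← ENNReal.ofReal_mul (by positivity),
          ENNReal.ofReal_rpow_of_pos ht, ← ENNReal.ofReal_mul (by positivity)]
        congr 1
        have : t / 3 = 1 / 3 * t := by ring
        rw [this]
        have e : ∀ x : ℝ, 0 < x → x ^ (-(1 / 2) : ℝ) * (x ^ (-(1 / 2) : ℝ) * x ^ (-(1 / 2) : ℝ))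
            = x ^ (-(3 / 2) : ℝ) := fun x hx => by
          rw [← Real.rpow_add hx, ← Real.rpow_add hx]; norm_num
        rw [mul_assoc (C ^ 3), ← Real.mul_rpow (by norm_num) ht.le, ← e _ (by positivity)]
        ring

theorem integral_Ioi_oscG {t : ℝ} (x : Sp n) {ξ : Sp n} (hξ : ξ ≠ 0) :
    IntegrableOn (fun τ => oscG τ x ξ) (Ioi t) ∧
      ∫ τ in Ioi t, oscG τ x ξ = oscG t x ξ / (‖ξ‖ ^ 2 : ℝ) ∧
      ∫ τ in Ioi t, ‖oscG τ x ξ‖ = Real.exp (-t * ‖ξ‖ ^ 2) / ‖ξ‖ ^ 2 := by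
  have hpos : 0 < ‖ξ‖ ^ 2 := by positivity
  have hneg : -‖ξ‖ ^ 2 < 0 := by linarith
  have e : ∀ τ : ℝ, oscG τ x ξ = Complex.exp (Complex.I * ((inner ℝ x ξ : ℝ) : ℂ)) *
      ((Real.exp (-‖ξ‖ ^ 2 * τ) : ℝ) : ℂ) := fun τ => by
    rw [oscG_factor, Complex.ofReal_exp]; congr 2; push_cast; ring
  have hI := integrableOn_exp_mul_Ioi hneg t
  have hv := integral_exp_mul_Ioi hneg t
  refine ⟨?_, ?_, ?_⟩
  · simp_rw [e]
    exact hI.ofReal.const_mul _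
  · simp_rw [e]
    rw [integral_const_mul, integral_complex_ofReal, hv]
    push_cast
    rw [neg_div_neg_eq, mul_div_assoc]
  · have e2 : ∀ τ : ℝ, ‖oscG τ x ξ‖ = Real.exp (-‖ξ‖ ^ 2 * τ) := fun τ => by
      rw [norm_oscG]; congr 1; ring
    simp_rw [e2]
    rw [hv, neg_div_neg_eq]
    congr 2; ring

/-- The singular factor is removed by |ξ|^{-2} e^{-t|ξ|²} = ∫_t^∞ e^{-τ|ξ|²} dτ, leaving only
polynomial symbols. Fubini is justified since integrating the modulus in τ leaves at most |ξ|
e^{-t|ξ|²}. -/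
theorem multK_grad_eq (i j k : Fin n) {t : ℝ} (ht : 0 < t) (x : Sp n) :
    multK (gradM i j k) t x = (if i = j then 1 else 0) * multK (fun ξ => Complex.I * ξ k) t x
      - ∫ τ in Ioi t, multK (cubM i j k) τ x := by
  have hpt : ∀ ξ : Sp n, ∫ τ in Ioi t, oscG τ x ξ * cubM i j k ξ
      = oscG t x ξ * (Complex.I * ξ k * ((ξ i * ξ j / ‖ξ‖ ^ 2 : ℝ) : ℂ)) := by
    intro ξ
    rcases eq_or_ne ξ 0 with rfl | hξ
    · simp [cubM]
    · rw [integral_mul_const, (integral_Ioi_oscG x hξ).2.1, cubM]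
      push_cast
      ring
  have hc : Continuous fun z : ℝ × Sp n => oscG z.1 x z.2 :=
    continuous_oscG.comp (f := fun z : ℝ × Sp n => ((z.1, x), z.2)) (by fun_prop)
  have hint : Integrable (fun z : ℝ × Sp n => oscG z.1 x z.2 * cubM i j k z.2)
      ((volume.restrict (Ioi t)).prod volume) := by
    have hmeas : Measurable fun z : ℝ × Sp n => oscG z.1 x z.2 * cubM i j k z.2 :=
      hc.measurable.mul ((measurable_cubM i j k).comp measurable_snd)
    rw [integrable_prod_iff' hmeas.aestronglyMeasurable]
    constructor
    · refine ae_of_all _ fun ξ => ?_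
      rcases eq_or_ne ξ 0 with rfl | hξ
      · simp [cubM]
      · exact (integral_Ioi_oscG (t := t) x hξ).1.mul_const (cubM i j k ξ)
    · have hb : Integrable fun ξ : Sp n => (1 + ‖ξ‖) ^ 4 * Real.exp (-t * ‖ξ‖ ^ 2) :=
        integrable_one_add_pow ht
      refine hb.mono' ?_ (ae_of_all _ fun ξ => ?_)
      · exact ((hc.measurable.mul ((measurable_cubM i j k).comp
          measurable_snd)).norm.stronglyMeasurable.integral_prod_left').aestronglyMeasurable
      · simp only [norm_mul]
        rw [integral_mul_const, norm_mul, norm_norm]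
        rcases eq_or_ne ξ 0 with rfl | hξ
        · simp [cubM]
        · have hpos : 0 < ‖ξ‖ := norm_pos_iff.2 hξ
          rw [(integral_Ioi_oscG x hξ).2.2, Real.norm_of_nonneg (by positivity)]
          calc _ ≤ Real.exp (-t * ‖ξ‖ ^ 2) / ‖ξ‖ ^ 2 * ‖ξ‖ ^ 3 := by
                gcongr; exact norm_cubM_le i j k ξ
            _ = ‖ξ‖ * Real.exp (-t * ‖ξ‖ ^ 2) := by field_simp
            _ ≤ _ := by
                gcongr
                have h : 1 + ‖ξ‖ ≤ (1 + ‖ξ‖) ^ 4 :=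
                  le_self_pow₀ (by linarith [norm_nonneg ξ]) (by norm_num)
                linarith
  have hswap : ∫ τ in Ioi t, multK (cubM i j k) τ x
      = multK (fun ξ => Complex.I * ξ k * ((ξ i * ξ j / ‖ξ‖ ^ 2 : ℝ) : ℂ)) t x := by
    simp only [multK]
    rw [integral_const_mul, integral_integral_swap hint]
    simp_rw [hpt]
  have hm1 : Measurable fun ξ : Sp n => Complex.I * (ξ k : ℂ) := (measurable_coordC k).const_mul _
  have hm2 : Measurable fun ξ : Sp n => Complex.I * ξ k * ((ξ i * ξ j / ‖ξ‖ ^ 2 : ℝ) : ℂ) :=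
    hm1.mul (Complex.measurable_ofReal.comp (by fun_prop))
  have hle : ∀ ξ : Sp n, ‖Complex.I * (ξ k : ℂ)‖ ≤ 1 * (1 + ‖ξ‖) ^ 4 := fun ξ => by
    refine (norm_coordI_le k ξ).trans ?_
    have h : 1 + ‖ξ‖ ≤ (1 + ‖ξ‖) ^ 4 := le_self_pow₀ (by linarith [norm_nonneg ξ]) (by norm_num)
    linarith
  have i1 := integrable_oscG_mul hm1 hle ht x
  have i2 : Integrable fun ξ => oscG t x ξ *
      (Complex.I * ξ k * ((ξ i * ξ j / ‖ξ‖ ^ 2 : ℝ) : ℂ)) := by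
    refine integrable_oscG_mul hm2 (M := 1) (fun ξ => ?_) ht x
    rw [norm_mul, Complex.norm_real]
    refine le_trans ?_ (hle ξ)
    refine mul_le_of_le_one_right (norm_nonneg _) ?_
    rw [norm_div, norm_mul, Real.norm_of_nonneg (sq_nonneg ‖ξ‖), sq]
    exact div_le_one_of_le₀ (mul_le_mul (norm_coord_le ξ i) (norm_coord_le ξ j) (abs_nonneg _)
      (norm_nonneg _)) (by positivity)
  rw [hswap]
  simp only [multK]
  rw [mul_left_comm, ← mul_sub]
  congr 1
  rw [← integral_const_mul, ← integral_sub (i1.const_mul _) i2]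
  refine integral_congr_ae (ae_of_all _ fun ξ => ?_)
  simp only [gradM, lerayM]
  push_cast
  split_ifs <;> push_cast <;> ring

theorem exists_lintegral_grad (n : ℕ) : ∃ C : ℝ, 0 < C ∧ ∀ t : ℝ, 0 < t → ∀ i j k : Fin n,
    ∫⁻ x : Sp n, ‖multK (gradM i j k) t x‖ₑ
      ≤ ENNReal.ofReal C * ENNReal.ofReal t ^ (-(1 / 2) : ℝ) := by
  obtain ⟨C, hC, H⟩ := exists_lintegral_multK_coord n
  obtain ⟨C', hC', H'⟩ := exists_lintegral_cub n
  -- The 2 is the value of t^{1/2} ∫_t^∞ τ^{-3/2} dτ.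
  refine ⟨C + C' * 2, by positivity, fun t ht i j k => ?_⟩
  have mc : Measurable fun ξ : Sp n => Complex.I * (ξ k : ℂ) := (measurable_coordC k).const_mul _
  have m1 : Measurable fun x : Sp n => multK (fun ξ => Complex.I * (ξ k : ℂ)) t x :=
    measurable_multK_right mc _
  have m2 : Measurable fun z : ℝ × Sp n => multK (cubM i j k) z.1 z.2 :=
    measurable_multK (measurable_cubM i j k)
  calc _ ≤ ∫⁻ x : Sp n, (‖multK (fun ξ => Complex.I * (ξ k : ℂ)) t x‖ₑ
          + ∫⁻ τ in Ioi t, ‖multK (cubM i j k) τ x‖ₑ) := by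
        refine lintegral_mono fun x => ?_
        rw [multK_grad_eq i j k ht]
        refine (enorm_sub_le).trans ?_
        gcongr
        · rw [enorm_mul]
          refine mul_le_of_le_one_left' ?_
          split_ifs <;> simp
        · exact enorm_integral_le_lintegral_enorm _
    _ = (∫⁻ x : Sp n, ‖multK (fun ξ => Complex.I * (ξ k : ℂ)) t x‖ₑ)
          + ∫⁻ τ in Ioi t, ∫⁻ x : Sp n, ‖multK (cubM i j k) τ x‖ₑ := by
        rw [lintegral_add_left m1.enorm, lintegral_lintegral_swap]
        exact (m2.comp measurable_swap).enorm.aemeasurable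
    _ ≤ ENNReal.ofReal C * ENNReal.ofReal t ^ (-(1 / 2) : ℝ) + ∫⁻ τ in Ioi t,
          ENNReal.ofReal C' * ENNReal.ofReal τ ^ (-(3 / 2) : ℝ) := by
        gcongr ?_ + ?_
        · exact H t ht k
        · exact setLIntegral_mono' measurableSet_Ioi fun τ hτ => H' τ (ht.trans hτ) i j k
    _ = _ := by
        rw [lintegral_const_mul _ (measurable_weight _), setLIntegral_Ioi_rpow (by norm_num) ht,
          ENNReal.ofReal_add hC.le (by positivity), add_mul]
        congr 1
        rw [ENNReal.ofReal_mul hC'.le, mul_assoc, ENNReal.ofReal_rpow_of_pos ht,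
          ← ENNReal.ofReal_mul zero_le_two]
        congr 2
        norm_num
        ring

/-- A majorant of all the kernels `∂_k 𝒯_{ij}`. -/
def gradMaj (t : ℝ) (x : Sp n) : ℝ≥0∞ := ∑ i : Fin n, ∑ j : Fin n, ∑ k : Fin n, ‖gradK i j k t x‖ₑ

theorem measurable_gradMaj : Measurable fun z : ℝ × Sp n => gradMaj z.1 z.2 := by
  unfold gradMaj
  exact Finset.measurable_sum _ fun i _ => Finset.measurable_sum _ fun j _ =>
    Finset.measurable_sum _ fun k _ => (measurable_gradK i j k).enorm

theorem exists_gradMaj_bound (n : ℕ) : ∃ C : ℝ, 0 < C ∧ ∀ t : ℝ, 0 < t →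
    (∫⁻ x : Sp n, gradMaj t x ≤ ENNReal.ofReal C * ENNReal.ofReal t ^ (-(1 / 2) : ℝ)) ∧
    ∀ x : Sp n, gradMaj t x ≤ ENNReal.ofReal C * ENNReal.ofReal t ^ (-((n : ℝ) + 1) / 2) := by
  obtain ⟨C, hC, H⟩ := exists_lintegral_grad n
  have hpi := Real.pi_pos
  set D : ℝ := 2 * √2 * (1 / (2 * Real.pi)) ^ n * (2 * Real.pi) ^ ((n : ℝ) / 2) with hD
  have hD0 : 0 < D := by positivity
  have hre : ∀ i j k (t : ℝ) (x : Sp n), ‖gradK i j k t x‖ₑ ≤ ‖multK (gradM i j k) t x‖ₑ := by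
    intro i j k t x
    rw [← ofReal_norm, ← ofReal_norm]
    exact ENNReal.ofReal_le_ofReal (Complex.abs_re_le_norm _)
  have hcard : ∀ A : ℝ≥0∞, ∑ _i : Fin n, ∑ _j : Fin n, ∑ _k : Fin n, A = (n : ℝ≥0∞) ^ 3 * A := by
    intro A
    simp only [Finset.sum_const, Finset.card_univ, Fintype.card_fin, nsmul_eq_mul]
    ring
  have hK : ∀ A : ℝ, 0 < A → A ≤ C + D → (n : ℝ≥0∞) ^ 3 * ENNReal.ofReal A
      ≤ ENNReal.ofReal (((n : ℝ) ^ 3 + 1) * (C + D)) := by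
    intro A hA hAC
    rw [ENNReal.ofReal_mul (by positivity), ENNReal.ofReal_add (by positivity) zero_le_one]
    gcongr
    rw [ENNReal.ofReal_pow (by positivity), ENNReal.ofReal_natCast]
    exact le_self_add
  -- n³ counts the index triples; the `+ 1` keeps the constant positive when n = 0.
  refine ⟨((n : ℝ) ^ 3 + 1) * (C + D), by positivity, fun t ht => ⟨?_, fun x => ?_⟩⟩
  · unfold gradMaj
    have hm : ∀ i j k : Fin n, Measurable fun x : Sp n => ‖gradK i j k t x‖ₑ := fun i j k =>
      ((measurable_gradK i j k).comp measurable_prodMk_left).enorm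
    rw [lintegral_finsetSum _ fun i _ => Finset.measurable_fun_sum _ fun j _ =>
      Finset.measurable_fun_sum _ fun k _ => hm i j k]
    calc _ ≤ ∑ i : Fin n, ∑ j : Fin n, ∑ k : Fin n,
          ENNReal.ofReal C * ENNReal.ofReal t ^ (-(1 / 2) : ℝ) := by
          refine Finset.sum_le_sum fun i _ => ?_
          rw [lintegral_finsetSum _ fun j _ =>
            Finset.measurable_fun_sum _ fun k _ => hm i j k]
          refine Finset.sum_le_sum fun j _ => ?_
          rw [lintegral_finsetSum _ fun k _ => hm i j k]
          exact Finset.sum_le_sum fun k _ =>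
            (lintegral_mono fun x => hre i j k t x).trans (H t ht i j k)
      _ ≤ _ := by
          rw [hcard, ← mul_assoc]
          gcongr
          exact hK C hC (by linarith)
  · calc gradMaj t x ≤ ∑ i : Fin n, ∑ j : Fin n, ∑ k : Fin n,
          ENNReal.ofReal D * ENNReal.ofReal t ^ (-((n : ℝ) + 1) / 2) := by
          refine Finset.sum_le_sum fun i _ => Finset.sum_le_sum fun j _ =>
            Finset.sum_le_sum fun k _ => (hre i j k t x).trans ?_
          rw [ENNReal.ofReal_rpow_of_pos ht, ← ENNReal.ofReal_mul hD0.le, ← ofReal_norm]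
          exact ENNReal.ofReal_le_ofReal (norm_multK_grad_le i j k ht x)
      _ ≤ _ := by
          rw [hcard, ← mul_assoc]
          gcongr
          exact hK D hD0 (by linarith)

/-- The semigroup law for the Oseen kernel, which is what makes the integral equation restartable.
-/
theorem conv_heatK_gradK (i j k : Fin n) {s t : ℝ} (hs : 0 < s) (ht : 0 < t) (x : Sp n) :
    ∫ y, heatK s (x - y) * gradK i j k t y = gradK i j k (s + t) x := by
  have h := conv_multK (g := fun z => (heatK s z : ℂ)) (integrable_heatK hs).ofReal
    (a := fun _ => 1) ht (fun ξ => fourier_heatK hs ξ) (measurable_gradM i j k)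
    (norm_gradM_le' i j k) x
  simp only [one_mul] at h
  rw [gradK, ← h]
  have hi : Integrable fun y => (heatK s (x - y) : ℂ) * multK (gradM i j k) t y := by
    refine ((integrable_heatK hs).comp_sub_left x).ofReal.mul_bdd
      (c := 2 * √2 * (1 / (2 * Real.pi)) ^ n * (2 * Real.pi) ^ ((n : ℝ) / 2) *
        t ^ (-((n : ℝ) + 1) / 2))
      (measurable_multK_right (measurable_gradM i j k) t).aestronglyMeasurable
      (ae_of_all _ fun y => norm_multK_grad_le i j k ht y)
  have h2 := Complex.reCLM.integral_comp_comm hi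
  simp only [Complex.reCLM_apply] at h2
  rw [← h2]
  refine integral_congr_ae (ae_of_all _ fun y => ?_)
  simp [gradK]

theorem conv_heatK_heatK {s t : ℝ} (hs : 0 < s) (ht : 0 < t) (x : Sp n) :
    ∫ y, heatK s (x - y) * heatK t y = heatK (s + t) x := by
  have h := conv_multK (g := fun z => (heatK s z : ℂ)) (integrable_heatK hs).ofReal
    (a := fun _ => 1) ht (fun ξ => fourier_heatK hs ξ) (m := fun _ => 1) measurable_const (M := 1)
    (fun ξ => by
      rw [norm_one, one_mul]
      exact one_le_pow₀ (by linarith [norm_nonneg ξ])) x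
  simp only [mul_one] at h
  rw [multK_one (by positivity)] at h
  rw [← Complex.ofReal_inj, ← h, ← integral_complex_ofReal]
  refine integral_congr_ae (ae_of_all _ fun y => ?_)
  simp [multK_one ht]

end NSLorentz

end

noncomputable section

open MeasureTheory Set Filter
open scoped ENNReal Topology

namespace NSLorentz

variable {n : ℕ}

/-! ### Positive majorants of the two integral operators -/

/-- The heat flow of `|f|`. -/
def heatMaj (f : Sp n → Sp n) (t : ℝ) (x : Sp n) : ℝ≥0∞ :=
  ∫⁻ y, ENNReal.ofReal (heatK t (x - y)) * ‖f y‖ₑ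

/-- The Duhamel integral of a nonnegative function against `gradMaj`. -/
def duhMaj (F : ℝ → Sp n → ℝ≥0∞) (t : ℝ) (x : Sp n) : ℝ≥0∞ :=
  ∫⁻ s in Ioo 0 t, ∫⁻ y, gradMaj (t - s) (x - y) * F s y

theorem measurable_heatMaj {f : Sp n → Sp n} (hf : Measurable f) :
    Measurable fun z : ℝ × Sp n => heatMaj f z.1 z.2 := by
  unfold heatMaj
  refine Measurable.lintegral_prod_right' (f := fun z : (ℝ × Sp n) × Sp n =>
    ENNReal.ofReal (heatK z.1.1 (z.1.2 - z.2)) * ‖f z.2‖ₑ) ?_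
  refine Measurable.mul (ENNReal.measurable_ofReal.comp
    (measurable_heatK.comp (f := fun z : (ℝ × Sp n) × Sp n => (z.1.1, z.1.2 - z.2))
      (by fun_prop))) (by fun_prop)

theorem measurable_duhMaj_inner {F : ℝ → Sp n → ℝ≥0∞} (hF : Measurable (Function.uncurry F)) :
    Measurable fun z : (ℝ × Sp n) × ℝ =>
      ∫⁻ y, gradMaj (z.1.1 - z.2) (z.1.2 - y) * F z.2 y := by
  refine Measurable.lintegral_prod_right' (f := fun w : ((ℝ × Sp n) × ℝ) × Sp n =>
    gradMaj (w.1.1.1 - w.1.2) (w.1.1.2 - w.2) * F w.1.2 w.2) ?_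
  refine Measurable.mul (measurable_gradMaj.comp
    (f := fun w : ((ℝ × Sp n) × ℝ) × Sp n => (w.1.1.1 - w.1.2, w.1.1.2 - w.2)) (by fun_prop))
    (hF.comp (f := fun w : ((ℝ × Sp n) × ℝ) × Sp n => (w.1.2, w.2)) (by fun_prop))

theorem measurableSet_time : MeasurableSet {z : (ℝ × Sp n) × ℝ | z.2 ∈ Ioo 0 z.1.1} :=
  (measurableSet_lt measurable_const measurable_snd).inter
    (measurableSet_lt measurable_snd (measurable_fst.comp measurable_fst))

theorem measurable_duhMaj {F : ℝ → Sp n → ℝ≥0∞} (hF : Measurable (Function.uncurry F)) :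
    Measurable fun z : ℝ × Sp n => duhMaj F z.1 z.2 := by
  have e : ∀ z : ℝ × Sp n, duhMaj F z.1 z.2 = ∫⁻ s, {w : (ℝ × Sp n) × ℝ | w.2 ∈ Ioo 0 w.1.1}.indicator
      (fun w => ∫⁻ y, gradMaj (w.1.1 - w.2) (w.1.2 - y) * F w.2 y) (z, s) := fun z => by
    rw [duhMaj, ← lintegral_indicator measurableSet_Ioo]
    rfl
  simp_rw [e]
  exact Measurable.lintegral_prod_right'
    ((measurable_duhMaj_inner hF).indicator measurableSet_time)

theorem duhMaj_mono {F F' : ℝ → Sp n → ℝ≥0∞} {t : ℝ} {x : Sp n}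
    (H : ∀ s ∈ Ioo 0 t, ∀ᵐ y, F s y ≤ F' s y) : duhMaj F t x ≤ duhMaj F' t x := by
  refine setLIntegral_mono' measurableSet_Ioo fun s hs => lintegral_mono_ae ?_
  filter_upwards [H s hs] with y hy
  gcongr

theorem measurable_duhMaj_slice {F : ℝ → Sp n → ℝ≥0∞} (hF : Measurable (Function.uncurry F))
    (t : ℝ) (x : Sp n) : Measurable fun s => ∫⁻ y, gradMaj (t - s) (x - y) * F s y :=
  (measurable_duhMaj_inner hF).comp (f := fun s : ℝ => ((t, x), s)) (by fun_prop)

theorem measurable_duhMaj_int {F : ℝ → Sp n → ℝ≥0∞} (hF : Measurable (Function.uncurry F))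
    (t s : ℝ) (x : Sp n) : Measurable fun y => gradMaj (t - s) (x - y) * F s y :=
  Measurable.mul (measurable_gradMaj.comp (f := fun y : Sp n => (t - s, x - y)) (by fun_prop))
    (hF.comp (f := fun y : Sp n => (s, y)) (by fun_prop))

theorem duhMaj_add {F F' : ℝ → Sp n → ℝ≥0∞} (hF : Measurable (Function.uncurry F)) (t : ℝ)
    (x : Sp n) : duhMaj (fun s y => F s y + F' s y) t x = duhMaj F t x + duhMaj F' t x := by
  unfold duhMaj
  rw [← lintegral_add_left (measurable_duhMaj_slice hF t x)]
  refine lintegral_congr fun s => ?_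
  rw [← lintegral_add_left (measurable_duhMaj_int hF t s x)]
  simp_rw [mul_add]

theorem duhMaj_iSup {F : ℕ → ℝ → Sp n → ℝ≥0∞} (hF : ∀ m, Measurable (Function.uncurry (F m)))
    (hmono : Monotone F) (t : ℝ) (x : Sp n) :
    duhMaj (fun s y => ⨆ m, F m s y) t x = ⨆ m, duhMaj (F m) t x := by
  unfold duhMaj
  rw [← lintegral_iSup (fun m => measurable_duhMaj_slice (hF m) t x) fun i j hij s =>
    lintegral_mono fun y => by have := hmono hij s y; gcongr]
  refine lintegral_congr fun s => ?_
  rw [← lintegral_iSup (fun m => measurable_duhMaj_int (hF m) t s x) fun i j hij y => by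
    have := hmono hij s y
    dsimp only; gcongr]
  simp_rw [ENNReal.mul_iSup]

/-- The constant in the kernel bounds. -/
def kerC (n : ℕ) : ℝ := (exists_gradMaj_bound n).choose

theorem kerC_pos (n : ℕ) : 0 < kerC n := (exists_gradMaj_bound n).choose_spec.1

theorem lintegral_gradMaj_le {t : ℝ} (ht : 0 < t) :
    ∫⁻ x : Sp n, gradMaj t x ≤ ENNReal.ofReal (kerC n) * ENNReal.ofReal t ^ (-(1 / 2) : ℝ) :=
  ((exists_gradMaj_bound n).choose_spec.2 t ht).1

theorem gradMaj_le {t : ℝ} (ht : 0 < t) (x : Sp n) :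
    gradMaj t x ≤ ENNReal.ofReal (kerC n) * ENNReal.ofReal t ^ (-((n : ℝ) + 1) / 2) :=
  ((exists_gradMaj_bound n).choose_spec.2 t ht).2 x

theorem rpow_ne_zero_of_pos {t : ℝ} (ht : 0 < t) (a : ℝ) : ENNReal.ofReal t ^ a ≠ 0 :=
  (ENNReal.rpow_pos (by simpa using ht) ENNReal.ofReal_ne_top).ne'

theorem rpow_ne_top_of_pos {t : ℝ} (ht : 0 < t) (a : ℝ) : ENNReal.ofReal t ^ a ≠ ∞ := by
  rw [ENNReal.ofReal_rpow_of_pos ht]; exact ENNReal.ofReal_ne_top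

theorem measurable_gradMaj_right (t : ℝ) : Measurable fun x : Sp n => gradMaj t x := by
  have h : Measurable (Function.uncurry (gradMaj (n := n))) := measurable_gradMaj
  exact h.of_uncurry_left

theorem measurable_heatK_right (t : ℝ) : Measurable fun x : Sp n => heatK t x := by
  have h : Measurable (Function.uncurry (heatK (n := n))) := measurable_heatK
  exact h.of_uncurry_left

theorem kfun_heatMaj_le {f : Sp n → Sp n} (hf : Measurable f) {t : ℝ} (ht : 0 < t) (τ : ℝ≥0∞) :
    kfun volume τ (heatMaj f t) ≤ kfun volume τ fun y => ‖f y‖ₑ := by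
  have h := kfun_conv_le (μ := (volume : Measure (Sp n))) (τ := τ) one_ne_zero ENNReal.one_ne_top
    (k := fun x => ENNReal.ofReal (heatK t x)) (measurable_heatK_right t).ennreal_ofReal
    hf.enorm (lintegral_heatK ht).le
  rwa [one_mul] at h

/-- The K-functional is taken under the time integral, and at each time the L¹ bound of the kernel
is used. -/
theorem kfun_duhMaj_le {F : ℝ → Sp n → ℝ≥0∞} (hF : Measurable (Function.uncurry F)) (t : ℝ)
    (τ : ℝ≥0∞) : kfun volume τ (duhMaj F t) ≤ ∫⁻ s in Ioo 0 t,
      ENNReal.ofReal (kerC n) * ENNReal.ofReal (t - s) ^ (-(1 / 2) : ℝ) * kfun volume τ (F s) := by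
  have hm : Measurable (Function.uncurry fun (s : ℝ) (x : Sp n) =>
      ∫⁻ y, gradMaj (t - s) (x - y) * F s y) :=
    (measurable_duhMaj_inner hF).comp (f := fun z : ℝ × Sp n => ((t, z.2), z.1)) (by fun_prop)
  refine (kfun_lintegral_le hm).trans (setLIntegral_mono' measurableSet_Ioo fun s hs => ?_)
  have hts : 0 < t - s := sub_pos.2 hs.2
  exact kfun_conv_le (mul_ne_zero (ofReal_ne_zero (kerC_pos n)) (rpow_ne_zero_of_pos hts _))
    (ENNReal.mul_ne_top ENNReal.ofReal_ne_top (rpow_ne_top_of_pos hts _))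
    (measurable_gradMaj_right _) hF.of_uncurry_left (lintegral_gradMaj_le hts)

theorem duhMaj_le_of_le {F : ℝ → Sp n → ℝ≥0∞} {c : ℝ → ℝ≥0∞} {t : ℝ}
    (H : ∀ s ∈ Ioo 0 t, ∀ᵐ y, F s y ≤ c s) (x : Sp n) : duhMaj F t x ≤ ∫⁻ s in Ioo 0 t,
      ENNReal.ofReal (kerC n) * ENNReal.ofReal (t - s) ^ (-(1 / 2) : ℝ) * c s := by
  refine setLIntegral_mono' measurableSet_Ioo fun s hs => ?_
  have hts : 0 < t - s := sub_pos.2 hs.2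
  have hm : Measurable fun y : Sp n => gradMaj (t - s) (x - y) :=
    (measurable_gradMaj_right _).comp (measurable_const.sub measurable_id)
  calc ∫⁻ y, gradMaj (t - s) (x - y) * F s y ≤ ∫⁻ y, gradMaj (t - s) (x - y) * c s := by
        refine lintegral_mono_ae ?_
        filter_upwards [H s hs] with y hy
        gcongr
    _ = (∫⁻ y : Sp n, gradMaj (t - s) y) * c s := by
        rw [lintegral_mul_const _ hm, lintegral_sub_left_eq_self]
    _ ≤ _ := by gcongr; exact lintegral_gradMaj_le hts

/-- The heat kernel has mass 1 and height m comparable to t^{-n/2}, so the value at x is at most m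
K(1/m, |f|). Inserting K(τ) ≤ r' ‖f‖ τ^{1-1/r} leaves m^{1/r}. -/
theorem heatMaj_le {r : ℝ≥0∞} {f : Sp n → Sp n} (hf : Measurable f) {t : ℝ} (ht : 0 < t)
    (x : Sp n) : heatMaj f t x ≤ hardyC r * lorentzNorm volume r ∞ (fun y => ‖f y‖ₑ) *
      ENNReal.ofReal t ^ (-(n * (r⁻¹).toReal) / 2) := by
  have hpi := Real.pi_gt_three
  set a := (r⁻¹).toReal
  have ha : 0 ≤ a := ENNReal.toReal_nonneg
  set m : ℝ := 1 / (4 * Real.pi * t) ^ ((n : ℝ) / 2) with hm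
  have hm0 : 0 < m := by positivity
  have hle : ∀ y : Sp n, ENNReal.ofReal (heatK t y) ≤ ENNReal.ofReal m := fun y => by
    refine ENNReal.ofReal_le_ofReal ?_
    rw [heatK]
    refine mul_le_of_le_one_right hm0.le (Real.exp_le_one_iff.2 ?_)
    rw [neg_div]
    exact neg_nonpos.2 (by positivity)
  have h := conv_le_kfun (μ := (volume : Measure (Sp n))) (ofReal_ne_zero hm0) ENNReal.ofReal_ne_top
    (k := fun x => ENNReal.ofReal (heatK t x)) (g := fun y => ‖f y‖ₑ)
    (measurable_heatK_right t).ennreal_ofReal hle (lintegral_heatK ht).le x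
  have e : (1 : ℝ≥0∞) / ENNReal.ofReal m = ENNReal.ofReal m⁻¹ := by
    rw [one_div, ENNReal.ofReal_inv_of_pos hm0]
  rw [e] at h
  refine h.trans ?_
  calc _ ≤ ENNReal.ofReal m * (hardyC r * lorentzNorm volume r ∞ (fun y => ‖f y‖ₑ) *
        ENNReal.ofReal m⁻¹ ^ (1 - a)) := by
        gcongr
        exact kfun_le_of_weak hf.enorm (inv_pos.2 hm0)
    _ = hardyC r * lorentzNorm volume r ∞ (fun y => ‖f y‖ₑ) * ENNReal.ofReal (m ^ a) := by
        rw [mul_left_comm]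
        congr 1
        rw [ENNReal.ofReal_rpow_of_pos (inv_pos.2 hm0), ← ENNReal.ofReal_mul hm0.le]
        congr 1
        rw [Real.inv_rpow hm0.le, ← Real.rpow_neg hm0.le]
        conv_lhs => enter [1]; rw [← Real.rpow_one m]
        rw [← Real.rpow_add hm0]; congr 1; ring
    _ ≤ _ := by
        gcongr
        rw [ENNReal.ofReal_rpow_of_pos ht]
        refine ENNReal.ofReal_le_ofReal ?_
        have h1 : m ≤ t ^ (-((n : ℝ) / 2)) := by
          rw [Real.rpow_neg ht.le, hm, one_div]
          gcongr
          nlinarith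
        calc m ^ a ≤ (t ^ (-((n : ℝ) / 2))) ^ a := by gcongr
          _ = _ := by rw [← Real.rpow_mul ht.le]; congr 1; ring

/-! ### Comparison of the integral operators with their majorants -/

theorem enorm_toLp_le (a : Fin n → ℝ) : ‖(WithLp.toLp 2 a : Sp n)‖ₑ ≤ ∑ i, ‖a i‖ₑ := by
  have h : (WithLp.toLp 2 a : Sp n) = ∑ i, EuclideanSpace.single i (a i) := by
    ext j; simp [Finset.sum_apply]
  rw [h]
  refine (enorm_sum_le _ _).trans_eq (Finset.sum_congr rfl fun i _ => ?_)
  rw [← ofReal_norm, ← ofReal_norm, PiLp.norm_single]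

theorem heatDefined_of_lt_top {f : Sp n → Sp n} (hf : Measurable f) {t : ℝ} (ht : 0 < t) {x : Sp n}
    (h : heatMaj f t x < ∞) : HeatDefined f t x := by
  intro i
  have hm : Measurable fun y : Sp n => heatK t (x - y) * f y i :=
    ((measurable_heatK_right t).comp (measurable_const.sub measurable_id)).mul (by fun_prop)
  refine ⟨hm.aestronglyMeasurable, lt_of_le_of_lt (lintegral_mono fun y => ?_) h⟩
  rw [enorm_mul, Real.enorm_of_nonneg (heatK_nonneg ht.le _)]
  gcongr
  rw [← ofReal_norm, ← ofReal_norm]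
  exact ENNReal.ofReal_le_ofReal (norm_coord_le _ _)

theorem enorm_heatS_le (f : Sp n → Sp n) {t : ℝ} (ht : 0 < t) (x : Sp n) :
    ‖heatS f t x‖ₑ ≤ n * heatMaj f t x := by
  refine (enorm_toLp_le _).trans ?_
  calc _ ≤ ∑ _i : Fin n, heatMaj f t x := by
        refine Finset.sum_le_sum fun i _ => ?_
        refine (enorm_integral_le_lintegral_enorm _).trans (lintegral_mono fun y => ?_)
        rw [enorm_mul, Real.enorm_of_nonneg (heatK_nonneg ht.le _)]
        gcongr
        rw [← ofReal_norm, ← ofReal_norm]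
        exact ENNReal.ofReal_le_ofReal (norm_coord_le _ _)
    _ = _ := by simp

/-- The integrand of `B`, with the kernel in the form `gradK`. -/
theorem bilinIntegrand_eq (u v : ℝ → Sp n → Sp n) (i : Fin n) {t s : ℝ} (hs : s < t) (x y : Sp n) :
    bilinIntegrand u v i t x s y =
      ∑ j : Fin n, ∑ k : Fin n, gradK i j k (t - s) (x - y) * (u s y j * v s y k) := by
  unfold bilinIntegrand
  simp_rw [gradOseenK_eq _ _ _ (sub_pos.2 hs)]

theorem sum_enorm_gradK_le (w : Fin n → Fin n → ℝ) {c : ℝ≥0∞} (hw : ∀ j k, ‖w j k‖ₑ ≤ c) (t : ℝ)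
    (x : Sp n) :
    ∑ i : Fin n, ‖∑ j : Fin n, ∑ k : Fin n, gradK i j k t x * w j k‖ₑ ≤ gradMaj t x * c := by
  rw [gradMaj, Finset.sum_mul]
  refine Finset.sum_le_sum fun i _ => (enorm_sum_le _ _).trans ?_
  rw [Finset.sum_mul]
  refine Finset.sum_le_sum fun j _ => (enorm_sum_le _ _).trans ?_
  rw [Finset.sum_mul]
  refine Finset.sum_le_sum fun k _ => ?_
  rw [enorm_mul]
  gcongr
  exact hw j k

theorem enorm_coord_le (v : Sp n) (j : Fin n) : ‖v j‖ₑ ≤ ‖v‖ₑ := by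
  rw [← ofReal_norm, ← ofReal_norm]
  exact ENNReal.ofReal_le_ofReal (norm_coord_le _ _)

theorem sum_enorm_bilinIntegrand_le (u v : ℝ → Sp n → Sp n) {t s : ℝ} (hs : s < t) (x y : Sp n) :
    ∑ i : Fin n, ‖bilinIntegrand u v i t x s y‖ₑ
      ≤ gradMaj (t - s) (x - y) * (‖u s y‖ₑ * ‖v s y‖ₑ) := by
  simp_rw [bilinIntegrand_eq u v _ hs]
  refine sum_enorm_gradK_le (fun j k => u s y j * v s y k) (fun j k => ?_) _ _
  rw [enorm_mul]
  gcongr <;> exact enorm_coord_le _ _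

/-- With d = u - v, the quadratic terms differ by u_j u_k - v_j v_k = d_j u_k + d_k v_j, so each
entry is at most |d|(|u| + |v|). -/
theorem sum_enorm_bilinIntegrand_sub_le (u v : ℝ → Sp n → Sp n) {t s : ℝ} (hs : s < t)
    (x y : Sp n) :
    ∑ i : Fin n, ‖bilinIntegrand u u i t x s y - bilinIntegrand v v i t x s y‖ₑ
      ≤ gradMaj (t - s) (x - y) * (‖u s y - v s y‖ₑ * (‖u s y‖ₑ + ‖v s y‖ₑ)) := by
  simp_rw [bilinIntegrand_eq _ _ _ hs, ← Finset.sum_sub_distrib, ← mul_sub]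
  refine sum_enorm_gradK_le (fun j k => u s y j * u s y k - v s y j * v s y k)
    (fun j k => ?_) _ _
  have e : u s y j * u s y k - v s y j * v s y k
      = (u s y - v s y) j * u s y k + (u s y - v s y) k * v s y j := by
    simp only [PiLp.sub_apply]; ring
  rw [e, mul_add]
  refine (enorm_add_le _ _).trans ?_
  rw [enorm_mul, enorm_mul]
  gcongr <;> exact enorm_coord_le _ _

theorem sum_lintegral_le {ι X : Type*} [MeasurableSpace X] {μ : Measure X} (s : Finset ι)
    (f : ι → X → ℝ≥0∞) : ∑ i ∈ s, ∫⁻ x, f i x ∂μ ≤ ∫⁻ x, ∑ i ∈ s, f i x ∂μ := by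
  classical
  induction s using Finset.induction_on with
  | empty => simp
  | insert a s ha ih =>
    rw [Finset.sum_insert ha]
    refine (add_le_add_right ih _).trans ((le_lintegral_add _ _).trans (lintegral_mono fun x => ?_))
    rw [Finset.sum_insert ha]

theorem volume_time_prod (t : ℝ) : (volume : Measure (ℝ × Sp n)).restrict (Ioo 0 t ×ˢ univ)
    = (volume.restrict (Ioo 0 t)).prod volume := by
  rw [Measure.volume_eq_prod, ← Measure.prod_restrict, Measure.restrict_univ]

theorem bilinDefined_iff (u v : ℝ → Sp n → Sp n) (t : ℝ) (x : Sp n) : BilinDefined u v t x ↔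
    ∀ i : Fin n, Integrable (fun z : ℝ × Sp n => bilinIntegrand u v i t x z.1 z.2)
      ((volume.restrict (Ioo 0 t)).prod volume) := by
  simp only [BilinDefined, IntegrableOn, volume_time_prod]

theorem ae_time_prod (t : ℝ) :
    ∀ᵐ z ∂((volume.restrict (Ioo 0 t)).prod (volume : Measure (Sp n))), z.1 ∈ Ioo 0 t := by
  rw [← volume_time_prod]
  filter_upwards [ae_restrict_mem (measurableSet_Ioo.prod MeasurableSet.univ)] with z hz using hz.1

theorem bilinDefined_congr {u u' v v' : ℝ → Sp n → Sp n} {t : ℝ} {x : Sp n}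
    (hu : ∀ s ∈ Ioo 0 t, ∀ y, u s y = u' s y) (hv : ∀ s ∈ Ioo 0 t, ∀ y, v s y = v' s y) :
    BilinDefined u v t x ↔ BilinDefined u' v' t x := by
  rw [bilinDefined_iff, bilinDefined_iff]
  refine forall_congr' fun i => integrable_congr ?_
  filter_upwards [ae_time_prod t] with z hz
  simp only [bilinIntegrand, hu z.1 hz, hv z.1 hz]

/-- B sees only almost everywhere classes. Consequently two solutions that agree almost everywhere
agree at each point where both satisfy the equation. -/
theorem bilinB_congr_ae {u u' v v' : ℝ → Sp n → Sp n} {t : ℝ} {x : Sp n}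
    (hu : ∀ᵐ s, s ∈ Ioo 0 t → ∀ᵐ y, u s y = u' s y)
    (hv : ∀ᵐ s, s ∈ Ioo 0 t → ∀ᵐ y, v s y = v' s y) :
    bilinB u v t x = bilinB u' v' t x := by
  unfold bilinB
  congr 1
  ext i
  refine integral_congr_ae ?_
  rw [EventuallyEq, ae_restrict_iff' measurableSet_Ioo]
  filter_upwards [hu, hv] with s h1 h2 hs
  refine integral_congr_ae ?_
  filter_upwards [h1 hs, h2 hs] with y h3 h4
  simp only [bilinIntegrand, h3, h4]

theorem bilinB_congr {u u' v v' : ℝ → Sp n → Sp n} {t : ℝ} {x : Sp n}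
    (hu : ∀ s ∈ Ioo 0 t, ∀ y, u s y = u' s y) (hv : ∀ s ∈ Ioo 0 t, ∀ y, v s y = v' s y) :
    bilinB u v t x = bilinB u' v' t x :=
  bilinB_congr_ae (ae_of_all _ fun s hs => ae_of_all _ (hu s hs))
    (ae_of_all _ fun s hs => ae_of_all _ (hv s hs))

theorem measurable_bilin_kernel {u v : ℝ → Sp n → Sp n} (hu : Measurable (Function.uncurry u))
    (hv : Measurable (Function.uncurry v)) (i : Fin n) :
    Measurable fun w : ((ℝ × Sp n) × ℝ) × Sp n => ∑ j : Fin n, ∑ k : Fin n,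
      gradK i j k (w.1.1.1 - w.1.2) (w.1.1.2 - w.2) * (u w.1.2 w.2 j * v w.1.2 w.2 k) := by
  refine Finset.measurable_fun_sum _ fun j _ => Finset.measurable_fun_sum _ fun k _ => ?_
  have h1 : Measurable fun w : ((ℝ × Sp n) × ℝ) × Sp n => u w.1.2 w.2 :=
    hu.comp (f := fun w : ((ℝ × Sp n) × ℝ) × Sp n => (w.1.2, w.2)) (by fun_prop)
  have h2 : Measurable fun w : ((ℝ × Sp n) × ℝ) × Sp n => v w.1.2 w.2 :=
    hv.comp (f := fun w : ((ℝ × Sp n) × ℝ) × Sp n => (w.1.2, w.2)) (by fun_prop)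
  exact ((measurable_gradK i j k).comp
    (f := fun w : ((ℝ × Sp n) × ℝ) × Sp n => (w.1.1.1 - w.1.2, w.1.1.2 - w.2)) (by fun_prop)).mul
    (((measurable_coord j).comp h1).mul ((measurable_coord k).comp h2))

theorem bilinDefined_of_lt_top {u v : ℝ → Sp n → Sp n} (hu : Measurable (Function.uncurry u))
    (hv : Measurable (Function.uncurry v)) {t : ℝ} {x : Sp n}
    (h : duhMaj (fun s y => ‖u s y‖ₑ * ‖v s y‖ₑ) t x < ∞) : BilinDefined u v t x := by
  rw [bilinDefined_iff]
  intro i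
  have hm : Measurable fun z : ℝ × Sp n => ∑ j : Fin n, ∑ k : Fin n,
      gradK i j k (t - z.1) (x - z.2) * (u z.1 z.2 j * v z.1 z.2 k) :=
    (measurable_bilin_kernel hu hv i).comp
      (f := fun z : ℝ × Sp n => (((t, x), z.1), z.2)) (by fun_prop)
  have he : (fun z : ℝ × Sp n => bilinIntegrand u v i t x z.1 z.2)
      =ᵐ[(volume.restrict (Ioo 0 t)).prod volume] fun z : ℝ × Sp n => ∑ j : Fin n, ∑ k : Fin n,
      gradK i j k (t - z.1) (x - z.2) * (u z.1 z.2 j * v z.1 z.2 k) := by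
    filter_upwards [ae_time_prod t] with z hz
    exact bilinIntegrand_eq u v i hz.2 x z.2
  rw [integrable_congr he]
  refine ⟨hm.aestronglyMeasurable, lt_of_le_of_lt ?_ h⟩
  rw [lintegral_prod _ hm.enorm.aemeasurable]
  refine setLIntegral_mono' measurableSet_Ioo fun s hs => lintegral_mono fun y => ?_
  have h1 := sum_enorm_bilinIntegrand_le u v hs.2 x y
  have h2 := Finset.single_le_sum (f := fun i => ‖bilinIntegrand u v i t x s y‖ₑ)
    (fun _ _ => bot_le) (Finset.mem_univ i)
  have h3 := bilinIntegrand_eq u v i hs.2 x y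
  simp only at h2 ⊢
  rw [← h3]
  exact h2.trans h1

theorem enorm_bilinB_sub_le {u v : ℝ → Sp n → Sp n} {t : ℝ} {x : Sp n}
    (hu : BilinDefined u u t x) (hv : BilinDefined v v t x) :
    ‖bilinB u u t x - bilinB v v t x‖ₑ
      ≤ duhMaj (fun s y => ‖u s y - v s y‖ₑ * (‖u s y‖ₑ + ‖v s y‖ₑ)) t x := by
  rw [bilinDefined_iff] at hu hv
  have e : bilinB u u t x - bilinB v v t x = WithLp.toLp 2 fun i =>
      (∫ s in Ioo 0 t, ∫ y : Sp n, bilinIntegrand u u i t x s y) -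
        ∫ s in Ioo 0 t, ∫ y : Sp n, bilinIntegrand v v i t x s y := by
    ext i; simp [bilinB]
  rw [e]
  refine (enorm_toLp_le _).trans ?_
  calc _ ≤ ∑ i : Fin n, ∫⁻ s in Ioo 0 t, ∫⁻ y : Sp n,
          ‖bilinIntegrand u u i t x s y - bilinIntegrand v v i t x s y‖ₑ := by
        refine Finset.sum_le_sum fun i _ => ?_
        rw [← integral_prod _ (hu i), ← integral_prod _ (hv i), ← integral_sub (hu i) (hv i)]
        refine (enorm_integral_le_lintegral_enorm _).trans_eq ?_
        exact lintegral_prod _ ((hu i).sub (hv i)).1.enorm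
    _ ≤ ∫⁻ s in Ioo 0 t, ∫⁻ y : Sp n, ∑ i : Fin n,
          ‖bilinIntegrand u u i t x s y - bilinIntegrand v v i t x s y‖ₑ :=
        (sum_lintegral_le _ _).trans (lintegral_mono fun s => sum_lintegral_le _ _)
    _ ≤ _ := setLIntegral_mono' measurableSet_Ioo fun s hs => lintegral_mono fun y =>
        sum_enorm_bilinIntegrand_sub_le u v hs.2 x y

theorem measurable_heatS {f : Sp n → Sp n} (hf : Measurable f) :
    Measurable fun z : ℝ × Sp n => heatS f z.1 z.2 := by
  refine (WithLp.measurable_toLp 2 _).comp (measurable_pi_lambda _ fun i => ?_)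
  refine (StronglyMeasurable.integral_prod_right' (f := fun w : (ℝ × Sp n) × Sp n =>
    heatK w.1.1 (w.1.2 - w.2) * f w.2 i) ?_).measurable
  refine (Measurable.mul (measurable_heatK.comp
    (f := fun z : (ℝ × Sp n) × Sp n => (z.1.1, z.1.2 - z.2)) (by fun_prop))
    (by fun_prop)).stronglyMeasurable

theorem measurable_bilinB {u v : ℝ → Sp n → Sp n} (hu : Measurable (Function.uncurry u))
    (hv : Measurable (Function.uncurry v)) :
    Measurable fun z : ℝ × Sp n => bilinB u v z.1 z.2 := by
  refine (WithLp.measurable_toLp 2 _).comp (measurable_pi_lambda _ fun i => ?_)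
  set G : (ℝ × Sp n) × ℝ → ℝ := fun w => ∫ y, ∑ j : Fin n, ∑ k : Fin n,
      gradK i j k (w.1.1 - w.2) (w.1.2 - y) * (u w.2 y j * v w.2 y k) with hG
  have hGm : StronglyMeasurable G :=
    (measurable_bilin_kernel hu hv i).stronglyMeasurable.integral_prod_right'
  have e : ∀ z : ℝ × Sp n, ∫ s in Ioo 0 z.1, ∫ y, bilinIntegrand u v i z.1 z.2 s y
      = ∫ s, {w : (ℝ × Sp n) × ℝ | w.2 ∈ Ioo 0 w.1.1}.indicator G (z, s) := by
    intro z
    have : ∀ s, {w : (ℝ × Sp n) × ℝ | w.2 ∈ Ioo 0 w.1.1}.indicator G (z, s)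
        = (Ioo 0 z.1).indicator (fun s => G (z, s)) s := fun s => rfl
    simp_rw [this]
    rw [integral_indicator measurableSet_Ioo]
    refine setIntegral_congr_fun measurableSet_Ioo fun s hs => ?_
    simp only [hG]
    congr 1; ext y
    exact bilinIntegrand_eq u v i hs.2 z.2 y
  simp_rw [e]
  exact (hGm.indicator measurableSet_time).integral_prod_right'.measurable

end NSLorentz

end

noncomputable section

open MeasureTheory Set Filter
open scoped ENNReal Topology

namespace NSLorentz

variable {n : ℕ}

/-! ### Beta integrals -/

/-- The beta integral `∫₀¹ (1-σ)^{-a} σ^{-b} dσ`. -/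
def betaL (a b : ℝ) : ℝ≥0∞ :=
  ∫⁻ σ in Ioo (0 : ℝ) 1, ENNReal.ofReal (1 - σ) ^ (-a) * ENNReal.ofReal σ ^ (-b)

theorem integrableOn_beta {a b : ℝ} (ha : a < 1) (hb : b < 1) :
    IntegrableOn (fun s : ℝ => (1 - s) ^ (-a) * s ^ (-b)) (Ioo 0 1) := by
  have h := Complex.betaIntegral_convergent (u := ((1 - b : ℝ) : ℂ)) (v := ((1 - a : ℝ) : ℂ))
    (by simpa using hb) (by simpa using ha)
  rw [intervalIntegrable_iff_integrableOn_Ioo_of_le zero_le_one] at h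
  refine IntegrableOn.congr_fun (Integrable.norm h) (fun s hs => ?_) measurableSet_Ioo
  have h1 : (0 : ℝ) < 1 - s := sub_pos.2 hs.2
  have e1 : ((1 - b : ℝ) : ℂ) - 1 = ((-b : ℝ) : ℂ) := by push_cast; ring
  have e2 : ((1 - a : ℝ) : ℂ) - 1 = ((-a : ℝ) : ℂ) := by push_cast; ring
  have e3 : (1 : ℂ) - s = ((1 - s : ℝ) : ℂ) := by push_cast; ring
  simp only [e1, e2, e3]
  rw [norm_mul, Complex.norm_cpow_eq_rpow_re_of_pos hs.1, Complex.norm_cpow_eq_rpow_re_of_pos h1,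
    Complex.ofReal_re, Complex.ofReal_re, mul_comm]

theorem betaL_eq {a b : ℝ} (ha : a < 1) (hb : b < 1) :
    betaL a b = ENNReal.ofReal (∫ s in Ioo (0 : ℝ) 1, (1 - s) ^ (-a) * s ^ (-b)) := by
  rw [ofReal_integral_eq_lintegral_ofReal (integrableOn_beta ha hb)]
  · refine setLIntegral_congr_fun measurableSet_Ioo fun s hs => ?_
    have h1 : (0 : ℝ) < 1 - s := sub_pos.2 hs.2
    rw [ENNReal.ofReal_rpow_of_pos h1, ENNReal.ofReal_rpow_of_pos hs.1,
      ENNReal.ofReal_mul (Real.rpow_nonneg h1.le _)]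
  · refine (ae_restrict_iff' measurableSet_Ioo).2 (ae_of_all _ fun s hs => ?_)
    exact mul_nonneg (Real.rpow_nonneg (sub_pos.2 hs.2).le _) (Real.rpow_nonneg hs.1.le _)

theorem betaL_ne_top {a b : ℝ} (ha : a < 1) (hb : b < 1) : betaL a b ≠ ∞ := by
  rw [betaL_eq ha hb]; exact ENNReal.ofReal_ne_top

theorem integral_beta_pos {a b : ℝ} (ha : a < 1) (hb : b < 1) :
    0 < ∫ s in Ioo (0 : ℝ) 1, (1 - s) ^ (-a) * s ^ (-b) := by
  rw [setIntegral_pos_iff_support_of_nonneg_ae _ (integrableOn_beta ha hb)]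
  · have : Function.support (fun s : ℝ => (1 - s) ^ (-a) * s ^ (-b)) ∩ Ioo 0 1 = Ioo 0 1 := by
      refine inter_eq_right.2 fun s hs => ?_
      exact (mul_pos (Real.rpow_pos_of_pos (sub_pos.2 hs.2) _) (Real.rpow_pos_of_pos hs.1 _)).ne'
    rw [this]; simp
  · refine (ae_restrict_iff' measurableSet_Ioo).2 (ae_of_all _ fun s hs => ?_)
    exact mul_nonneg (Real.rpow_nonneg (sub_pos.2 hs.2).le _) (Real.rpow_nonneg hs.1.le _)

theorem lintegral_beta {t : ℝ} (ht : 0 < t) (a b : ℝ) :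
    ∫⁻ s in Ioo 0 t, ENNReal.ofReal (t - s) ^ (-a) * ENNReal.ofReal s ^ (-b)
      = ENNReal.ofReal t ^ (1 - a - b) * betaL a b := by
  have h0 := ofReal_ne_zero ht
  rw [setLIntegral_Ioo_scale ht (by fun_prop), betaL, ← lintegral_const_mul _ (by fun_prop),
    ← lintegral_const_mul _ (by fun_prop)]
  refine setLIntegral_congr_fun measurableSet_Ioo fun s hs => ?_
  have e1 : t - s * t = t * (1 - s) := by ring
  have h1 : (0 : ℝ) < 1 - s := sub_pos.2 hs.2
  simp only [e1]
  rw [mul_comm s t, ENNReal.ofReal_mul ht.le, ENNReal.ofReal_mul ht.le,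
    ENNReal.mul_rpow_of_ne_top ENNReal.ofReal_ne_top ENNReal.ofReal_ne_top,
    ENNReal.mul_rpow_of_ne_top ENNReal.ofReal_ne_top ENNReal.ofReal_ne_top]
  have : ENNReal.ofReal t ^ (1 - a - b)
      = ENNReal.ofReal t * ENNReal.ofReal t ^ (-a) * ENNReal.ofReal t ^ (-b) := by
    nth_rewrite 2 [← ENNReal.rpow_one (ENNReal.ofReal t)]
    rw [← ENNReal.rpow_add _ _ h0 ENNReal.ofReal_ne_top,
      ← ENNReal.rpow_add _ _ h0 ENNReal.ofReal_ne_top]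
    congr 1
  rw [this]; ring

theorem rpow_le_of_le {s t a : ℝ} (ha : 0 ≤ a) (hst : s ≤ t) :
    ENNReal.ofReal s ^ a ≤ ENNReal.ofReal t ^ a :=
  ENNReal.rpow_le_rpow (ENNReal.ofReal_le_ofReal hst) ha

theorem ofReal_rpow_mul {t : ℝ} (ht : 0 < t) (a b : ℝ) :
    ENNReal.ofReal t ^ a * ENNReal.ofReal t ^ b = ENNReal.ofReal t ^ (a + b) :=
  (ENNReal.rpow_add _ _ (ofReal_ne_zero ht) ENNReal.ofReal_ne_top).symm

theorem ofReal_exp_neg_le {δ x : ℝ} (hδ : 0 < δ) (hδ1 : δ ≤ 1) (hx : 0 < x) :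
    ENNReal.ofReal (Real.exp (-x)) ≤ ENNReal.ofReal x ^ (-δ) := by
  rw [ENNReal.ofReal_rpow_of_pos hx]
  refine ENNReal.ofReal_le_ofReal ?_
  rw [Real.exp_neg, Real.rpow_neg hx.le]
  refine inv_anti₀ (Real.rpow_pos_of_pos hx _) ?_
  rcases le_total x 1 with h | h
  · exact (Real.rpow_le_one hx.le h hδ.le).trans (Real.one_le_exp hx.le)
  · calc x ^ δ ≤ x ^ (1 : ℝ) := Real.rpow_le_rpow_of_exponent_le h hδ1
      _ = x := Real.rpow_one x
      _ ≤ Real.exp x := by linarith [Real.add_one_le_exp x]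

theorem exists_rpow_neg_mul_le {δ : ℝ} (hδ : 0 < δ) {K ε : ℝ≥0∞} (hK : K ≠ ∞) (hε : ε ≠ 0) :
    ∃ l : ℝ, 0 < l ∧ ENNReal.ofReal l ^ (-δ) * K ≤ ε := by
  have h : Tendsto (fun l : ℝ => ENNReal.ofReal (l ^ (-δ)) * K) atTop (𝓝 (ENNReal.ofReal 0 * K)) :=
    ENNReal.Tendsto.mul_const (ENNReal.tendsto_ofReal (tendsto_rpow_neg_atTop hδ)) (Or.inr hK)
  rw [ENNReal.ofReal_zero, zero_mul] at h
  obtain ⟨l, hl, hl0⟩ := ((h.eventually_le_const (pos_iff_ne_zero.2 hε)).and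
    (eventually_gt_atTop 0)).exists
  exact ⟨l, hl0, by rwa [ENNReal.ofReal_rpow_of_pos hl0]⟩

/-- The weighted beta integrals are uniformly small for a large weight. -/
theorem exists_weight {a T : ℝ} (ha0 : 0 ≤ a) (ha : a < 1 / 2) {ε : ℝ≥0∞} (hε : ε ≠ 0) :
    ∃ l : ℝ, 0 < l ∧ ∀ t, 0 < t → t ≤ T →
      ∫⁻ s in Ioo 0 t, ENNReal.ofReal (t - s) ^ (-(1 / 2) : ℝ) * ENNReal.ofReal s ^ (-a) *
        ENNReal.ofReal (Real.exp (-(l * (t - s)))) ≤ ε := by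
  -- Half of the available room. By e^{-x} ≤ x^{-δ} the weight yields l^{-δ} and worsens the
  -- singularity to (t-s)^{-1/2-δ}, which is still integrable, while the resulting power of t keeps
  -- a nonnegative exponent.
  set δ := (1 / 2 - a) / 2 with hδ
  have hδ0 : 0 < δ := by rw [hδ]; linarith
  have hδ1 : δ ≤ 1 / 4 := by rw [hδ]; linarith
  obtain ⟨l, hl, H⟩ := exists_rpow_neg_mul_le (K := ENNReal.ofReal T ^ (1 - (1 / 2 + δ) - a) *
    betaL (1 / 2 + δ) a) hδ0 (ENNReal.mul_ne_top (ENNReal.rpow_ne_top_of_nonneg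
      (by rw [hδ]; linarith) ENNReal.ofReal_ne_top)
      (betaL_ne_top (by linarith) (by linarith))) hε
  refine ⟨l, hl, fun t ht htT => le_trans ?_ H⟩
  calc _ ≤ ∫⁻ s in Ioo 0 t, ENNReal.ofReal l ^ (-δ) *
        (ENNReal.ofReal (t - s) ^ (-(1 / 2 + δ)) * ENNReal.ofReal s ^ (-a)) := by
        refine setLIntegral_mono' measurableSet_Ioo fun s hs => ?_
        have hts : 0 < t - s := sub_pos.2 hs.2
        refine (mul_le_mul_right (ofReal_exp_neg_le hδ0 (by linarith) (mul_pos hl hts)) _).trans_eq ?_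
        rw [ENNReal.ofReal_mul hl.le, ENNReal.mul_rpow_of_ne_top ENNReal.ofReal_ne_top
          ENNReal.ofReal_ne_top, neg_add, ← ofReal_rpow_mul hts]
        ring
    _ = ENNReal.ofReal l ^ (-δ) * (ENNReal.ofReal t ^ (1 - (1 / 2 + δ) - a) *
          betaL (1 / 2 + δ) a) := by
        rw [lintegral_const_mul _ (by fun_prop), lintegral_beta ht]
    _ ≤ _ := by
        refine mul_le_mul' le_rfl (mul_le_mul' ?_ le_rfl)
        exact rpow_le_of_le (by linarith) htT

/-! ### Majorants of the Picard iteration -/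

/-- The iterates of `U ↦ A + Q(U²)`, starting from `0`. -/
def majSeq (A : ℝ → Sp n → ℝ≥0∞) : ℕ → ℝ → Sp n → ℝ≥0∞
  | 0 => fun _ _ => 0
  | m + 1 => fun t x => A t x + duhMaj (fun s y => majSeq A m s y * majSeq A m s y) t x

/-- The limit of `majSeq A`. -/
def majLim (A : ℝ → Sp n → ℝ≥0∞) (t : ℝ) (x : Sp n) : ℝ≥0∞ := ⨆ m, majSeq A m t x

section

variable {A : ℝ → Sp n → ℝ≥0∞}

theorem measurable_majSeq (hA : Measurable (Function.uncurry A)) (m : ℕ) :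
    Measurable (Function.uncurry (majSeq A m)) := by
  induction m with
  | zero => exact measurable_const
  | succ m ih =>
    refine hA.add (measurable_duhMaj (F := fun s y => majSeq A m s y * majSeq A m s y) ?_)
    exact ih.mul ih

theorem majSeq_le_succ (m : ℕ) (t : ℝ) (x : Sp n) : majSeq A m t x ≤ majSeq A (m + 1) t x := by
  induction m generalizing t x with
  | zero => exact zero_le
  | succ m ih =>
    exact add_le_add le_rfl (duhMaj_mono fun s _ => ae_of_all _ fun y =>
      mul_le_mul' (ih s y) (ih s y))

theorem majSeq_mono : Monotone (majSeq A) :=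
  monotone_nat_of_le_succ fun m t x => majSeq_le_succ m t x

theorem majSeq_le_majLim (m : ℕ) (t : ℝ) (x : Sp n) : majSeq A m t x ≤ majLim A t x :=
  le_iSup (fun m => majSeq A m t x) m

theorem measurable_majLim (hA : Measurable (Function.uncurry A)) :
    Measurable (Function.uncurry (majLim A)) := by
  have : Function.uncurry (majLim A) = fun z => ⨆ m, Function.uncurry (majSeq A m) z := rfl
  rw [this]
  exact Measurable.iSup fun m => measurable_majSeq hA m

/-- Monotone convergence; the identity holds in [0,∞], with no finiteness assumed. Monotonicity in m
lets the product of two suprema be read as the supremum along the diagonal. -/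
theorem majLim_eq (hA : Measurable (Function.uncurry A)) (t : ℝ) (x : Sp n) :
    majLim A t x = A t x + duhMaj (fun s y => majLim A s y * majLim A s y) t x := by
  have e : (fun s y => majLim A s y * majLim A s y)
      = fun s y => ⨆ m, majSeq A m s y * majSeq A m s y := by
    ext s y
    refine le_antisymm ?_ (iSup_le fun m => mul_le_mul' (majSeq_le_majLim m s y)
      (majSeq_le_majLim m s y))
    rw [majLim, ENNReal.iSup_mul]
    refine iSup_le fun i => ?_
    rw [ENNReal.mul_iSup]
    refine iSup_le fun j => le_iSup_of_le (max i j) ?_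
    exact mul_le_mul' (majSeq_mono (le_max_left i j) s y) (majSeq_mono (le_max_right i j) s y)
  rw [e, duhMaj_iSup (F := fun m s y => majSeq A m s y * majSeq A m s y)
    (fun m => (measurable_majSeq hA m).mul (measurable_majSeq hA m))
    (fun i j hij s y => mul_le_mul' (majSeq_mono hij s y) (majSeq_mono hij s y)),
    ENNReal.add_iSup, majLim]
  refine le_antisymm (iSup_le fun m => ?_) (iSup_le fun m => le_iSup_of_le (m + 1) le_rfl)
  exact (majSeq_le_succ m t x).trans (le_iSup_of_le m le_rfl)

/-- The pointwise inequality that drives the Picard iteration. -/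
theorem mul_add_sq_le {d a b U V : ℝ≥0∞} (hd : d + U ≤ V) (ha : a ≤ V) (hb : b ≤ U) :
    d * (a + b) + U * U ≤ V * V := by
  calc d * (a + b) + U * U ≤ d * (V + U) + U * U := by gcongr
    _ = d * V + (d + U) * U := by ring
    _ ≤ d * V + V * U := by gcongr
    _ = (d + U) * V := by ring
    _ ≤ V * V := by gcongr

theorem enorm_bilinB_le (u v : ℝ → Sp n → Sp n) (t : ℝ) (x : Sp n) :
    ‖bilinB u v t x‖ₑ ≤ duhMaj (fun s y => ‖u s y‖ₑ * ‖v s y‖ₑ) t x := by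
  refine (enorm_toLp_le _).trans ?_
  calc _ ≤ ∑ i : Fin n, ∫⁻ s in Ioo 0 t, ∫⁻ y : Sp n, ‖bilinIntegrand u v i t x s y‖ₑ :=
        Finset.sum_le_sum fun i _ => (enorm_integral_le_lintegral_enorm _).trans
          (lintegral_mono fun s => enorm_integral_le_lintegral_enorm _)
    _ ≤ ∫⁻ s in Ioo 0 t, ∫⁻ y : Sp n, ∑ i : Fin n, ‖bilinIntegrand u v i t x s y‖ₑ :=
        (sum_lintegral_le _ _).trans (lintegral_mono fun s => sum_lintegral_le _ _)
    _ ≤ _ := setLIntegral_mono' measurableSet_Ioo fun s hs => lintegral_mono fun y =>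
        sum_enorm_bilinIntegrand_le u v hs.2 x y

end

/-! ### The Picard iteration -/

/-- The Picard iterates. -/
def picSeq (f : Sp n → Sp n) : ℕ → ℝ → Sp n → Sp n
  | 0 => fun _ _ => 0
  | m + 1 => fun t x => if 0 < t then heatS f t x - bilinB (picSeq f m) (picSeq f m) t x else 0

/-- The majorant `n Φ * |f|` of `S[f]`. -/
def heatA (f : Sp n → Sp n) (t : ℝ) (x : Sp n) : ℝ≥0∞ := n * heatMaj f t x

theorem measurable_heatA {f : Sp n → Sp n} (hf : Measurable f) :
    Measurable (Function.uncurry (heatA f)) :=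
  (measurable_heatMaj hf).const_mul _

section

variable {f : Sp n → Sp n}

theorem picSeq_succ {m : ℕ} {t : ℝ} (ht : 0 < t) (x : Sp n) : picSeq f (m + 1) t x
    = heatS f t x - bilinB (picSeq f m) (picSeq f m) t x := if_pos ht

theorem measurable_picSeq (hf : Measurable f) (m : ℕ) :
    Measurable (Function.uncurry (picSeq f m)) := by
  induction m with
  | zero => exact measurable_const
  | succ m ih =>
    refine Measurable.ite (measurableSet_lt measurable_const measurable_fst) ?_ measurable_const
    exact (measurable_heatS hf).sub (measurable_bilinB ih ih)

theorem enorm_picSeq_le (m : ℕ) (t : ℝ) (x : Sp n) :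
    ‖picSeq f m t x‖ₑ ≤ majSeq (heatA f) m t x := by
  induction m generalizing t x with
  | zero => simp [picSeq]
  | succ m ih =>
    by_cases ht : 0 < t
    · simp only [picSeq, if_pos ht, majSeq]
      refine enorm_sub_le.trans (add_le_add (enorm_heatS_le f ht x) ?_)
      refine (enorm_bilinB_le _ _ t x).trans (duhMaj_mono fun s _ => ae_of_all _ fun y => ?_)
      exact mul_le_mul' (ih s y) (ih s y)
    · simp [picSeq, ht]

theorem bilinDefined_of_le {u : ℝ → Sp n → Sp n} (hu : Measurable (Function.uncurry u))
    {V : ℝ → Sp n → ℝ≥0∞} {t : ℝ} {x : Sp n} (hV : ∀ s ∈ Ioo 0 t, ∀ y, ‖u s y‖ₑ ≤ V s y)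
    (h : duhMaj (fun s y => V s y * V s y) t x < ∞) : BilinDefined u u t x :=
  bilinDefined_of_lt_top hu hu (lt_of_le_of_lt (duhMaj_mono fun s hs => ae_of_all _ fun y =>
    mul_le_mul' (hV s hs y) (hV s hs y)) h)

/-- One step of the comparison between the Picard iteration and its majorants. -/
theorem enorm_bilinB_sub_add_le {u v : ℝ → Sp n → Sp n} (hu : Measurable (Function.uncurry u))
    (hv : Measurable (Function.uncurry v)) {U V : ℝ → Sp n → ℝ≥0∞}
    {t : ℝ} {x : Sp n}
    (hd : ∀ s ∈ Ioo 0 t, ∀ y, ‖u s y - v s y‖ₑ + U s y ≤ V s y)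
    (huV : ∀ s ∈ Ioo 0 t, ∀ y, ‖u s y‖ₑ ≤ V s y) (hvU : ∀ s ∈ Ioo 0 t, ∀ y, ‖v s y‖ₑ ≤ U s y) :
    ‖bilinB u u t x - bilinB v v t x‖ₑ + duhMaj (fun s y => U s y * U s y) t x
      ≤ duhMaj (fun s y => V s y * V s y) t x := by
  rcases eq_or_ne (duhMaj (fun s y => V s y * V s y) t x) ∞ with h | h
  · rw [h]; exact le_top
  have h := h.lt_top
  have hUV : ∀ s ∈ Ioo 0 t, ∀ y, U s y ≤ V s y := fun s hs y => le_add_self.trans (hd s hs y)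
  have h1 := bilinDefined_of_le hu huV h
  have h2 := bilinDefined_of_le hv hvU (lt_of_le_of_lt (duhMaj_mono fun s hs => ae_of_all _ fun y =>
    mul_le_mul' (hUV s hs y) (hUV s hs y)) h)
  refine (add_le_add (enorm_bilinB_sub_le h1 h2) le_rfl).trans ?_
  rw [← duhMaj_add]
  · exact duhMaj_mono fun s hs => ae_of_all _ fun y => mul_add_sq_le (hd s hs y) (huV s hs y)
      (hvU s hs y)
  · exact (hu.sub hv).enorm.mul (hu.enorm.add hv.enorm)

/-- Increments of the Picard iteration are dominated by increments of the majorants. The additive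
form avoids subtracting possibly infinite quantities and is exactly what the inductive step
reproduces. -/
theorem enorm_picSeq_sub_add_le (hf : Measurable f) (m : ℕ) (t : ℝ) (x : Sp n) :
    ‖picSeq f (m + 1) t x - picSeq f m t x‖ₑ + majSeq (heatA f) m t x
      ≤ majSeq (heatA f) (m + 1) t x := by
  induction m generalizing t x with
  | zero =>
    have := enorm_picSeq_le (f := f) 1 t x
    simpa [picSeq, majSeq] using this
  | succ m ih =>
    by_cases ht : 0 < t
    · have e : picSeq f (m + 1 + 1) t x - picSeq f (m + 1) t x
          = -(bilinB (picSeq f (m + 1)) (picSeq f (m + 1)) t x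
            - bilinB (picSeq f m) (picSeq f m) t x) := by
        rw [picSeq_succ ht, picSeq_succ ht]; abel
      rw [e, enorm_neg]
      have := enorm_bilinB_sub_add_le (measurable_picSeq hf (m + 1)) (measurable_picSeq hf m)
        (U := majSeq (heatA f) m) (V := majSeq (heatA f) (m + 1)) (t := t)
        (x := x) (fun s _ y => ih s y) (fun s _ y => enorm_picSeq_le _ s y)
        (fun s _ y => enorm_picSeq_le _ s y)
      calc _ = heatA f t x + (‖bilinB (picSeq f (m + 1)) (picSeq f (m + 1)) t x
            - bilinB (picSeq f m) (picSeq f m) t x‖ₑ +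
              duhMaj (fun s y => majSeq (heatA f) m s y * majSeq (heatA f) m s y) t x) := by
            rw [majSeq]; ring
        _ ≤ _ := add_le_add le_rfl this
    · simp only [picSeq, if_neg ht, sub_self, enorm_zero, zero_add]
      exact majSeq_le_succ _ _ _

theorem enorm_picSeq_sub_add_le_of_le (hf : Measurable f) {m k : ℕ} (hmk : m ≤ k) (t : ℝ)
    (x : Sp n) : ‖picSeq f k t x - picSeq f m t x‖ₑ + majSeq (heatA f) m t x
      ≤ majSeq (heatA f) k t x := by
  induction k, hmk using Nat.le_induction with
  | base => simp
  | succ k _ ih =>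
    have e : picSeq f (k + 1) t x - picSeq f m t x
        = (picSeq f (k + 1) t x - picSeq f k t x) + (picSeq f k t x - picSeq f m t x) := by abel
    rw [e]
    calc _ ≤ ‖picSeq f (k + 1) t x - picSeq f k t x‖ₑ + (‖picSeq f k t x - picSeq f m t x‖ₑ +
          majSeq (heatA f) m t x) := by
          rw [← add_assoc]; gcongr; exact enorm_add_le _ _
      _ ≤ _ := (add_le_add le_rfl ih).trans (enorm_picSeq_sub_add_le hf k t x)

/-- The sum of the increments telescopes against the majorants and is bounded by their finite limit.
-/
theorem cauchySeq_picSeq (hf : Measurable f) {t : ℝ} {x : Sp n} (h : majLim (heatA f) t x < ∞) :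
    CauchySeq fun m => picSeq f m t x := by
  refine cauchySeq_of_edist_le_of_tsum_ne_top
    (fun m => ‖picSeq f (m + 1) t x - picSeq f m t x‖ₑ) (fun m => ?_) ?_
  · rw [edist_comm, edist_eq_enorm_sub]
  · refine ne_top_of_le_ne_top h.ne ?_
    rw [ENNReal.tsum_eq_iSup_nat]
    refine iSup_le fun N => le_trans ?_ (majSeq_le_majLim N t x)
    induction N with
    | zero => simp
    | succ N ih =>
      rw [Finset.sum_range_succ, add_comm]
      exact (add_le_add le_rfl ih).trans (enorm_picSeq_sub_add_le hf N t x)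

/-- If the majorants of the Picard iteration stay finite, then it converges to a solution. -/
theorem exists_mild_of_majLim_lt_top (hf : Measurable f) {T : ℝ≥0∞}
    (hT : ∀ t ∈ timeI T, ∀ x, majLim (heatA f) t x < ∞) :
    ∃ u : ℝ → Sp n → Sp n, Measurable (Function.uncurry u) ∧
      (∀ t x, ‖u t x‖ₑ ≤ majLim (heatA f) t x) ∧ MildEverywhere f T u := by
  set U := majLim (heatA f)
  have hUm : Measurable (Function.uncurry U) := measurable_majLim (measurable_heatA hf)
  have hS : MeasurableSet {z : ℝ × Sp n | U z.1 z.2 < ∞} := measurableSet_lt hUm measurable_const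
  -- Cutting the iterates off where the majorant is infinite makes them converge at every point, so
  -- the limit is measurable on all of ℝ × ℝⁿ.
  have hex : ∀ z : ℝ × Sp n, ∃ l, Tendsto (fun m => {z : ℝ × Sp n | U z.1 z.2 < ∞}.indicator
      (fun z => picSeq f m z.1 z.2) z) atTop (𝓝 l) := by
    intro z
    by_cases hz : U z.1 z.2 < ∞
    · simp only [indicator, mem_ofPred_eq, hz, if_true]
      exact cauchySeq_tendsto_of_complete (cauchySeq_picSeq hf hz)
    · simp only [indicator, mem_ofPred_eq, hz, if_false]
      exact ⟨0, tendsto_const_nhds⟩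
  choose w hw using hex
  have hwm : Measurable w := measurable_of_tendsto_metrizable
    (fun m => (measurable_picSeq hf m).indicator hS) (tendsto_pi_nhds.2 hw)
  have hlim : ∀ {t x}, U t x < ∞ → Tendsto (fun m => picSeq f m t x) atTop (𝓝 (w (t, x))) := by
    intro t x h
    have := hw (t, x)
    simpa only [indicator, mem_ofPred_eq, h, if_true] using this
  have hd : ∀ m {t x}, U t x < ∞ →
      ‖w (t, x) - picSeq f m t x‖ₑ + majSeq (heatA f) m t x ≤ U t x := by
    intro m t x h
    refine le_of_tendsto (((hlim h).sub_const _).enorm.add_const _) ?_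
    filter_upwards [eventually_ge_atTop m] with k hk
    exact (enorm_picSeq_sub_add_le_of_le hf hk t x).trans (majSeq_le_majLim k t x)
  have hle : ∀ t x, ‖w (t, x)‖ₑ ≤ U t x := by
    intro t x
    by_cases h : U t x < ∞
    · simpa [picSeq, majSeq] using hd 0 h
    · rw [not_lt_top_iff.1 h]; exact le_top
  refine ⟨fun t x => w (t, x), hwm, hle, fun t ht x => ?_⟩
  have hx := hT t ht x
  have hfix : U t x = heatA f t x + duhMaj (fun s y => U s y * U s y) t x :=
    majLim_eq (measurable_heatA hf) t x
  have hQ : duhMaj (fun s y => U s y * U s y) t x < ∞ :=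
    lt_of_le_of_lt (le_add_self.trans_eq hfix.symm) hx
  have htime : ∀ s ∈ Ioo 0 t, s ∈ timeI T := fun s hs =>
    ⟨hs.1, lt_of_le_of_lt (ENNReal.ofReal_le_ofReal hs.2.le) ht.2⟩
  have hwm' : Measurable (Function.uncurry fun t x => w (t, x)) := hwm
  have hn : (n : ℝ≥0∞) * heatMaj f t x < ∞ := lt_of_le_of_lt (le_self_add.trans_eq hfix.symm) hx
  refine ⟨?_, bilinDefined_of_le hwm' (fun s _ y => hle s y) hQ, ?_⟩
  · rcases Nat.eq_zero_or_pos n with h0 | h0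
    · subst h0; exact fun i => i.elim0
    · refine heatDefined_of_lt_top hf ht.1 (lt_of_le_of_lt ?_ hn)
      exact le_mul_of_one_le_left' (by exact_mod_cast h0)
  -- In the limit m → ∞ this inequality reads |w - (S[f] - B[w,w])| + U ≤ U, and U is finite at this
  -- point.
  · have h1 : ∀ m, ‖picSeq f (m + 1) t x - (heatS f t x - bilinB (fun t x => w (t, x))
        (fun t x => w (t, x)) t x)‖ₑ + majSeq (heatA f) (m + 1) t x ≤ U t x := by
      intro m
      have e : picSeq f (m + 1) t x - (heatS f t x - bilinB (fun t x => w (t, x))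
        (fun t x => w (t, x)) t x) = bilinB (fun t x => w (t, x)) (fun t x => w (t, x)) t x
          - bilinB (picSeq f m) (picSeq f m) t x := by
        rw [picSeq_succ ht.1]; abel
      have := enorm_bilinB_sub_add_le hwm' (measurable_picSeq hf m)
        (U := majSeq (heatA f) m) (V := U) (t := t) (x := x)
        (fun s hs y => hd m (hT s (htime s hs) y)) (fun s _ y => hle s y)
        (fun s _ y => enorm_picSeq_le _ s y)
      rw [e, hfix, majSeq]
      calc _ = heatA f t x + (‖bilinB (fun t x => w (t, x)) (fun t x => w (t, x)) t x
          - bilinB (picSeq f m) (picSeq f m) t x‖ₑ +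
              duhMaj (fun s y => majSeq (heatA f) m s y * majSeq (heatA f) m s y) t x) := by ring
        _ ≤ _ := add_le_add le_rfl this
    have h2 := (((hlim hx).comp (tendsto_add_atTop_nat 1)).sub_const
      (heatS f t x - bilinB (fun t x => w (t, x)) (fun t x => w (t, x)) t x)).enorm
    have h3 : Tendsto (fun m => majSeq (heatA f) (m + 1) t x) atTop (𝓝 (U t x)) :=
      (tendsto_atTop_iSup fun i j hij => majSeq_mono hij t x).comp (tendsto_add_atTop_nat 1)
    have h4 := le_of_tendsto (h2.add h3) (Eventually.of_forall h1)
    have h5 : ‖w (t, x) - (heatS f t x - bilinB (fun t x => w (t, x))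
        (fun t x => w (t, x)) t x)‖ₑ ≤ 0 := by
      refine ENNReal.le_of_add_le_add_right hx.ne ?_
      rw [zero_add]; exact h4
    exact sub_eq_zero.1 (enorm_eq_zero.1 (le_antisymm h5 zero_le))

end

end NSLorentz

end

noncomputable section

open MeasureTheory Set Filter
open scoped ENNReal Topology

namespace NSLorentz

variable {n : ℕ}

/-! ### Local existence -/

theorem spNorm_top (q : ℝ≥0∞) (f : Sp n → Sp n) : spNorm ⊤ q f = ⨆ x, ‖f x‖ₑ := rfl

theorem spNorm_coe (p q : ℝ≥0∞) (f : Sp n → Sp n) :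
    spNorm (p : Expo) q f = lorentzNorm volume p q fun x => ‖f x‖ₑ := rfl

theorem inv_coe (p : ℝ≥0∞) : Expo.inv (p : Expo) = (p⁻¹).toReal := rfl

theorem measurableSet_timeI (T : ℝ≥0∞) : MeasurableSet (timeI T) :=
  (measurableSet_lt measurable_const measurable_id).inter
    (measurableSet_lt ENNReal.measurable_ofReal measurable_const)

theorem mem_timeI_ofReal {T t : ℝ} : t ∈ timeI (ENNReal.ofReal T) ↔ 0 < t ∧ t < T := by
  constructor
  · rintro ⟨h, h'⟩
    exact ⟨h, (ENNReal.ofReal_lt_ofReal_iff_of_nonneg h.le).1 h'⟩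
  · rintro ⟨h, h'⟩
    exact ⟨h, (ENNReal.ofReal_lt_ofReal_iff_of_nonneg h.le).2 h'⟩

theorem measOn_of_measurable {u : ℝ → Sp n → Sp n} (hu : Measurable (Function.uncurry u))
    (T : ℝ≥0∞) : MeasOn T u :=
  hu.indicator ((measurableSet_timeI T).prod MeasurableSet.univ)

theorem inv_toReal_nonneg (r : ℝ≥0∞) : 0 ≤ (r⁻¹).toReal := ENNReal.toReal_nonneg

theorem nat_mul_inv_lt_one {r : ℝ≥0∞} (hr : (n : ℝ≥0∞) < r) : n * (r⁻¹).toReal < 1 := by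
  rcases eq_or_ne r ∞ with rfl | hr'
  · simp
  · have h0 : 0 < r.toReal := ENNReal.toReal_pos (ne_bot_of_gt hr) hr'
    rw [ENNReal.toReal_inv, ← div_eq_mul_inv, div_lt_one h0]
    have := (ENNReal.toReal_lt_toReal (ENNReal.natCast_ne_top n) hr').2 hr
    simpa using this

/-- If U ≤ 2α t^{-a}, then Q(U²) ≤ α t^{-a} times 4α K B(1/2,2a) t^{1/2-a}, where B denotes the beta
integral. The smallness hypothesis bounds this last factor by 1, so the bound with constant 2α
reproduces itself. -/
theorem majSeq_le_rpow {A : ℝ → Sp n → ℝ≥0∞} {α : ℝ≥0∞} {a T : ℝ} (ha : a ≤ 1 / 2)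
    (hA : ∀ t, 0 < t → t < T → ∀ x, A t x ≤ α * ENNReal.ofReal t ^ (-a))
    (hα : 4 * α * ENNReal.ofReal (kerC n) * betaL (1 / 2) (2 * a) * ENNReal.ofReal T ^ (1 / 2 - a)
      ≤ 1) (m : ℕ) {t : ℝ} (ht : 0 < t) (htT : t < T) (x : Sp n) :
    majSeq A m t x ≤ 2 * α * ENNReal.ofReal t ^ (-a) := by
  induction m generalizing t x with
  | zero => exact zero_le
  | succ m ih =>
    have h1 := duhMaj_le_of_le (F := fun s y => majSeq A m s y * majSeq A m s y) (t := t)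
      (c := fun s => 4 * α ^ 2 * ENNReal.ofReal s ^ (-(2 * a))) (fun s hs => ae_of_all _ fun y => by
        refine (mul_le_mul' (ih hs.1 (hs.2.trans htT) y) (ih hs.1 (hs.2.trans htT) y)).trans_eq ?_
        rw [show -(2 * a) = -a + -a by ring, ← ofReal_rpow_mul hs.1]
        ring) x
    have h2 : ∫⁻ s in Ioo 0 t, ENNReal.ofReal (kerC n) * ENNReal.ofReal (t - s) ^ (-(1 / 2) : ℝ) *
        (4 * α ^ 2 * ENNReal.ofReal s ^ (-(2 * a)))
        = α * ENNReal.ofReal t ^ (-a) * (4 * α * ENNReal.ofReal (kerC n) *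
          betaL (1 / 2) (2 * a) * ENNReal.ofReal t ^ (1 / 2 - a)) := by
      have e : ∀ s : ℝ, ENNReal.ofReal (kerC n) * ENNReal.ofReal (t - s) ^ (-(1 / 2) : ℝ) *
        (4 * α ^ 2 * ENNReal.ofReal s ^ (-(2 * a))) = 4 * α ^ 2 * ENNReal.ofReal (kerC n) *
          (ENNReal.ofReal (t - s) ^ (-(1 / 2) : ℝ) * ENNReal.ofReal s ^ (-(2 * a))) := fun s => by
        ring
      simp_rw [e]
      rw [lintegral_const_mul _ (by fun_prop), lintegral_beta ht,
        show (1 : ℝ) - 1 / 2 - 2 * a = -a + (1 / 2 - a) by ring, ← ofReal_rpow_mul ht]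
      ring
    rw [h2] at h1
    have h3 : 4 * α * ENNReal.ofReal (kerC n) * betaL (1 / 2) (2 * a) *
        ENNReal.ofReal t ^ (1 / 2 - a) ≤ 1 :=
      le_trans (mul_le_mul' le_rfl (rpow_le_of_le (by linarith) htT.le)) hα
    calc majSeq A (m + 1) t x ≤ α * ENNReal.ofReal t ^ (-a) + α * ENNReal.ofReal t ^ (-a) * 1 :=
          add_le_add (hA t ht htT x) (h1.trans (mul_le_mul' le_rfl h3))
      _ = _ := by ring

theorem lorN_heatA_le {f : Sp n → Sp n} (hf : Measurable f) {p q : ℝ≥0∞} (h1 : 1 ≤ q) {t : ℝ}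
    (ht : 0 < t) : lorN volume p q (heatA f t) ≤ n * lorN volume p q fun y => ‖f y‖ₑ := by
  have hm : Measurable (heatMaj f t) := by
    have h : Measurable (Function.uncurry (heatMaj f)) := measurable_heatMaj hf
    exact h.of_uncurry_left
  rw [lorN, lorN, ← lorGauge_const_mul h1 (ENNReal.natCast_ne_top n)]
  refine lorGauge_mono fun τ _ => ?_
  rw [← mul_div_assoc]
  refine ENNReal.div_le_div_right ((kfun_const_mul_le hm).trans ?_) _
  gcongr
  exact kfun_heatMaj_le hf ht _

/-- Propagation of the `L^{p,q}` norm along the majorants. -/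
theorem exists_lorN_majSeq_le {A : ℝ → Sp n → ℝ≥0∞} (hA : Measurable (Function.uncurry A))
    {α M₀ : ℝ≥0∞} (hα : α ≠ ∞) {a T : ℝ} (ha0 : 0 ≤ a) (ha : a < 1 / 2)
    (hU : ∀ m t, 0 < t → t < T → ∀ x, majSeq A m t x ≤ α * ENNReal.ofReal t ^ (-a))
    {p q : ℝ≥0∞} (hp : 1 < p) (hq : 1 ≤ q) (hM₀ : M₀ ≠ ∞)
    (hAM : ∀ t, 0 < t → t < T → lorN volume p q (A t) ≤ M₀) :
    ∃ M : ℝ≥0∞, M ≠ ∞ ∧ ∀ m t, 0 < t → t < T → lorN volume p q (majSeq A m t) ≤ M := by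
  set D : ℝ≥0∞ := hardyC p * (ENNReal.ofReal (kerC n) * α) with hD
  have hDt : D ≠ ∞ := ENNReal.mul_ne_top (hardyC_ne_top hp)
    (ENNReal.mul_ne_top ENNReal.ofReal_ne_top hα)
  -- The weighted Duhamel operator is to have norm at most 1/2 for the norm weighted by e^{-lt}. The
  -- length T is arbitrary: smallness comes from l.
  obtain ⟨ε, hε0, hε⟩ : ∃ ε : ℝ≥0∞, ε ≠ 0 ∧ D * ε ≤ 2⁻¹ := by
    rcases eq_or_ne D 0 with h | h
    · exact ⟨1, one_ne_zero, by simp [h]⟩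
    · exact ⟨D⁻¹ * 2⁻¹, mul_ne_zero (ENNReal.inv_ne_zero.2 hDt) (by simp), by
        rw [← mul_assoc, ENNReal.mul_inv_cancel h hDt, one_mul]⟩
  obtain ⟨l, hl, hw⟩ := exists_weight (T := T) ha0 ha hε0
  set E : ℝ → ℝ≥0∞ := fun t => ENNReal.ofReal (Real.exp (l * t)) with hE
  have hEm : Measurable E := by fun_prop
  have hE1 : ∀ {t}, 0 < t → 1 ≤ E t := fun {t} ht => by
    rw [hE, ENNReal.one_le_ofReal]; exact Real.one_le_exp (by positivity)
  have key : ∀ m t, 0 < t → t < T → lorN volume p q (majSeq A m t) ≤ E t * (2 * M₀) := by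
    intro m
    induction m with
    | zero =>
      intro t _ _
      have h0 : majSeq A 0 t = fun _ => 0 := rfl
      rw [h0]
      refine (lorN_le hq measurable_const).trans ?_
      -- Homogeneity under the factor 1/2 together with finiteness forces this norm to vanish.
      have : lorentzNorm (volume : Measure (Sp n)) p q (fun _ => 0) = 0 := by
        have h := lorentzNorm_const_mul (μ := (volume : Measure (Sp n))) (p := p) (q := q)
          (c := 2⁻¹) hq (by simp) (by simp) fun _ => 0
        have hfin : lorentzNorm (volume : Measure (Sp n)) p q (fun _ => 0) ≠ ∞ := by
          have hr : ∀ s, rearr (volume : Measure (Sp n)) (fun _ => 0) s = 0 := fun s => by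
            refine le_antisymm (sSup_le fun y hy => ?_) zero_le
            have := hy.2.2
            simp [distrib] at this
          have hq0 : 0 < q := lt_of_lt_of_le one_pos hq
          unfold lorentzNorm
          split_ifs with h
          · simp [hr]
          · have hq' := ENNReal.toReal_pos hq0.ne' h
            simp [hr, ENNReal.zero_rpow_of_pos, hq']
        simp only [mul_zero] at h
        by_contra hne
        have h2 : lorentzNorm (volume : Measure (Sp n)) p q (fun _ => 0) * 2⁻¹
            < lorentzNorm (volume : Measure (Sp n)) p q (fun _ => 0) := by
          rw [← div_eq_mul_inv]; exact ENNReal.half_lt_self hne hfin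
        rw [mul_comm, ← h] at h2
        exact lt_irrefl _ h2
      rw [this, mul_zero]; exact zero_le
    | succ m ih =>
      intro t ht htT
      have hUm := measurable_majSeq hA m
      set w : ℝ → ℝ≥0∞ := (Ioo 0 t).indicator fun s => ENNReal.ofReal (kerC n) *
        ENNReal.ofReal (t - s) ^ (-(1 / 2) : ℝ) * (α * ENNReal.ofReal s ^ (-a)) * E s with hwdef
      have hwm : Measurable w := Measurable.indicator (by fun_prop) measurableSet_Ioo
      -- The iterates divided by the weight. The cutoff to (0,T) makes the bound 2M₀ hold for every
      -- s, as the parametrized Hardy estimate requires.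
      set g : ℝ → Sp n → ℝ≥0∞ := fun s y =>
        (Ioo 0 T).indicator (fun s => (E s)⁻¹) s * majSeq A m s y with hg
      have hgm : Measurable (Function.uncurry g) :=
        ((Measurable.indicator (by fun_prop) measurableSet_Ioo).comp measurable_fst).mul hUm
      have hEne : ∀ s, E s ≠ 0 := fun s => ofReal_ne_zero (Real.exp_pos _)
      have hEtop : ∀ s, E s ≠ ∞ := fun s => ENNReal.ofReal_ne_top
      have hgM : ∀ s, lorentzNorm volume p q (g s) ≤ 2 * M₀ := by
        intro s
        by_cases hs : s ∈ Ioo 0 T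
        · have e : g s = fun y => (E s)⁻¹ * majSeq A m s y := by
            ext y; simp [hg, hs]
          rw [e, lorentzNorm_const_mul hq (ENNReal.inv_ne_zero.2 (hEtop s))
            (ENNReal.inv_ne_top.2 (hEne s))]
          calc _ ≤ (E s)⁻¹ * (E s * (2 * M₀)) := by
                gcongr
                exact (lorentzNorm_le_lorN (by exact hUm.of_uncurry_left)).trans (ih s hs.1 hs.2)
            _ = 2 * M₀ := by
                rw [← mul_assoc, ENNReal.inv_mul_cancel (hEne s) (hEtop s), one_mul]
        · have e : g s = fun y => 0 * majSeq A m t y := by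
            ext y; simp [hg, hs]
          rw [e]
          calc _ ≤ lorentzNorm volume p q fun y => (E t)⁻¹ * majSeq A m t y :=
                lorentzNorm_mono (ae_of_all _ fun y => by gcongr; exact zero_le)
            _ = (E t)⁻¹ * lorentzNorm volume p q (majSeq A m t) :=
                lorentzNorm_const_mul hq (ENNReal.inv_ne_zero.2 (hEtop t))
                  (ENNReal.inv_ne_top.2 (hEne t)) _
            _ ≤ (E t)⁻¹ * (E t * (2 * M₀)) := by
                gcongr
                exact (lorentzNorm_le_lorN (by exact hUm.of_uncurry_left)).trans (ih t ht htT)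
            _ = 2 * M₀ := by
                rw [← mul_assoc, ENNReal.inv_mul_cancel (hEne t) (hEtop t), one_mul]
      have hwint : ∫⁻ s, w s ≤ ENNReal.ofReal (kerC n) * α * E t * ε := by
        rw [hwdef, lintegral_indicator measurableSet_Ioo]
        calc _ = ∫⁻ s in Ioo 0 t, ENNReal.ofReal (kerC n) * α * E t *
              (ENNReal.ofReal (t - s) ^ (-(1 / 2) : ℝ) * ENNReal.ofReal s ^ (-a) *
                ENNReal.ofReal (Real.exp (-(l * (t - s))))) := by
              refine lintegral_congr fun s => ?_
              have : E s = E t * ENNReal.ofReal (Real.exp (-(l * (t - s)))) := by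
                rw [hE, ← ENNReal.ofReal_mul (Real.exp_pos _).le, ← Real.exp_add]
                ring_nf
              rw [this]; ring
          _ = ENNReal.ofReal (kerC n) * α * E t * ∫⁻ s in Ioo 0 t,
              (ENNReal.ofReal (t - s) ^ (-(1 / 2) : ℝ) * ENNReal.ofReal s ^ (-a) *
                ENNReal.ofReal (Real.exp (-(l * (t - s))))) :=
              lintegral_const_mul _ (by fun_prop)
          _ ≤ _ := by gcongr; exact hw t ht htT.le
      -- One factor of the square is bounded pointwise by α s^{-a}; only the other is measured in
      -- L^{p,q}. This makes the estimate linear in the propagated norm.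
      have hstep : lorN volume p q (duhMaj (fun s y => majSeq A m s y * majSeq A m s y) t)
          ≤ hardyC p * (∫⁻ s, w s) * (2 * M₀) := by
        refine lorN_le_of_kfun_le hq hwm hgm (fun τ _ => ?_) hgM
        refine (kfun_duhMaj_le (F := fun s y => majSeq A m s y * majSeq A m s y)
          (hUm.mul hUm) t _).trans ?_
        rw [← lintegral_indicator measurableSet_Ioo]
        refine lintegral_mono fun s => ?_
        by_cases hs : s ∈ Ioo 0 t
        · have hsT : s ∈ Ioo 0 T := ⟨hs.1, hs.2.trans htT⟩
          have hge : ∀ y, E s * g s y = majSeq A m s y := fun y => by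
            simp only [hg, indicator_of_mem hsT]
            rw [← mul_assoc, ENNReal.mul_inv_cancel (hEne s) (hEtop s), one_mul]
          have hgs : Measurable (g s) := hgm.of_uncurry_left
          simp only [hwdef, indicator_of_mem hs]
          calc _ ≤ ENNReal.ofReal (kerC n) * ENNReal.ofReal (t - s) ^ (-(1 / 2) : ℝ) *
                kfun volume (ENNReal.ofReal τ)
                  (fun y => (α * ENNReal.ofReal s ^ (-a) * E s) * g s y) := by
                gcongr
                refine kfun_mono (ae_of_all _ fun y => ?_)
                rw [mul_assoc, hge]
                gcongr
                exact hU m s hs.1 hsT.2 y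
            _ ≤ ENNReal.ofReal (kerC n) * ENNReal.ofReal (t - s) ^ (-(1 / 2) : ℝ) *
                ((α * ENNReal.ofReal s ^ (-a) * E s) * kfun volume (ENNReal.ofReal τ) (g s)) := by
                gcongr
                exact kfun_const_mul_le hgs
            _ = _ := by ring
        · simp [hs]
      have e : majSeq A (m + 1) t = fun x => A t x +
        duhMaj (fun s y => majSeq A m s y * majSeq A m s y) t x := rfl
      rw [e]
      refine (lorN_add_le hq (by exact hA.of_uncurry_left)).trans ?_
      calc _ ≤ E t * M₀ + hardyC p * (ENNReal.ofReal (kerC n) * α * E t * ε) * (2 * M₀) := by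
            refine add_le_add ((hAM t ht htT).trans (le_mul_of_one_le_left' (hE1 ht))) ?_
            exact hstep.trans (by gcongr)
        _ = E t * M₀ + E t * (D * ε) * (2 * M₀) := by rw [hD]; ring
        _ ≤ E t * M₀ + E t * 2⁻¹ * (2 * M₀) := by gcongr
        _ = E t * M₀ + E t * M₀ * (2⁻¹ * 2) := by ring
        _ = _ := by rw [ENNReal.inv_mul_cancel (by simp) (by simp)]; ring
  refine ⟨E T * (2 * M₀), ENNReal.mul_ne_top ENNReal.ofReal_ne_top
    (ENNReal.mul_ne_top (by simp) hM₀), fun m t ht htT => (key m t ht htT).trans ?_⟩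
  exact mul_le_mul' (ENNReal.ofReal_le_ofReal (Real.exp_le_exp.2 (by gcongr))) le_rfl

/-- The constant of the local existence theory. -/
def existC (n : ℕ) (r : ℝ≥0∞) : ℝ :=
  kerC n * n * ((1 - Expo.inv r)⁻¹ *
    ∫ s in Ioo (0 : ℝ) 1, (1 - s) ^ (-(1 / 2) : ℝ) * s ^ (-(n * Expo.inv r)))

theorem inv_lt_one_of_nat_lt (hn : 1 ≤ n) {r : ℝ≥0∞} (hr : (n : ℝ≥0∞) < r) : (r⁻¹).toReal < 1 := by
  have h := nat_mul_inv_lt_one hr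
  have h1 : (1 : ℝ) ≤ n := by exact_mod_cast hn
  nlinarith [inv_toReal_nonneg r]

theorem existC_pos (hn : 1 ≤ n) {r : ℝ≥0∞} (hr : (n : ℝ≥0∞) < r) : 0 < existC n r := by
  have h1 : (0 : ℝ) < n := by exact_mod_cast hn
  have h2 : 0 < 1 - Expo.inv r := sub_pos.2 (inv_lt_one_of_nat_lt hn hr)
  have h3 := integral_beta_pos (a := 1 / 2) (b := n * Expo.inv r) (by norm_num)
    (nat_mul_inv_lt_one hr)
  have := kerC_pos n
  unfold existC
  positivity

theorem isExistenceConst_existC (hn : 1 ≤ n) {r : ℝ≥0∞} (hr : (n : ℝ≥0∞) < r) :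
    IsExistenceConst n r (existC n r) := by
  intro p q hp hq _ T hT f hfp hfr hsmall
  set b := (r⁻¹).toReal with hb
  have hb0 : 0 ≤ b := inv_toReal_nonneg r
  have hnb : n * b < 1 := nat_mul_inv_lt_one hr
  have hnb0 : 0 ≤ n * b := by positivity
  have hn1 : (1 : ℝ≥0∞) ≤ n := by exact_mod_cast hn
  have hr1 : 1 < r := lt_of_le_of_lt hn1 hr
  set a : ℝ := n * b / 2 with ha
  have hf := hfp.1
  set α : ℝ≥0∞ := n * (hardyC r * spNorm r ∞ f) with hα
  have hαt : α ≠ ∞ := ENNReal.mul_ne_top (ENNReal.natCast_ne_top n)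
    (ENNReal.mul_ne_top (hardyC_ne_top hr1) hfr.2.ne)
  have hA : ∀ t, 0 < t → t < T → ∀ x, heatA f t x ≤ α * ENNReal.ofReal t ^ (-a) := by
    intro t ht _ x
    rw [hα, mul_assoc, show -a = -(n * (r⁻¹).toReal) / 2 by rw [ha, hb]; ring]
    exact mul_le_mul' le_rfl (heatMaj_le hf ht x)
  have hpos1 : 0 < 1 - b := sub_pos.2 (inv_lt_one_of_nat_lt hn hr)
  -- With α = n r' ‖f‖ and a = n/(2r), the left side is exactly the smallness quantity 4 η
  -- T^{(1-n/r)/2} ‖f‖; this dictates the value of `existC`.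
  have hsm : 4 * α * ENNReal.ofReal (kerC n) * betaL (1 / 2) (2 * a) *
      ENNReal.ofReal T ^ (1 / 2 - a) ≤ 1 := by
    refine le_trans (le_of_eq ?_) hsmall.le
    have e2 : 2 * a = n * b := by rw [ha]; ring
    have hI := integral_beta_pos (a := 1 / 2) (b := n * b) (by norm_num) hnb
    rw [e2, betaL_eq (by norm_num) hnb, hα, hardyC_eq hr1, existC, inv_coe, ← hb]
    rw [show (1 - n * b) / 2 = 1 / 2 - a by rw [ha]; ring]
    have hk := kerC_pos n
    rw [ENNReal.ofReal_mul (by positivity), ENNReal.ofReal_mul (by norm_num),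
      ENNReal.ofReal_mul (by positivity), ENNReal.ofReal_mul (by positivity),
      ENNReal.ofReal_mul (by positivity), ENNReal.ofReal_natCast, ENNReal.ofReal_rpow_of_pos hT,
      ENNReal.ofReal_ofNat]
    ring
  have hle := fun m t ht htT x => majSeq_le_rpow (n := n) (by rw [ha]; linarith) hA hsm m
    (t := t) ht htT x
  have hlim : ∀ t, 0 < t → t < T → ∀ x,
      majLim (heatA f) t x ≤ 2 * α * ENNReal.ofReal t ^ (-a) := fun t ht htT x =>
    iSup_le fun m => hle m t ht htT x
  have hfin : ∀ t, 0 < t → 2 * α * ENNReal.ofReal t ^ (-a) < ∞ := fun t ht =>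
    ENNReal.mul_lt_top (ENNReal.mul_lt_top (by simp) hαt.lt_top) (rpow_ne_top_of_pos ht _).lt_top
  obtain ⟨u, hu, huU, hmild⟩ := exists_mild_of_majLim_lt_top hf (T := ENNReal.ofReal T)
    fun t ht x => (hlim t (mem_timeI_ofReal.1 ht).1 (mem_timeI_ofReal.1 ht).2 x).trans_lt
      (hfin t ht.1)
  have hM₀ : (n : ℝ≥0∞) * lorN volume p q (fun y => ‖f y‖ₑ) ≠ ∞ := by
    refine ENNReal.mul_ne_top (ENNReal.natCast_ne_top n) (ne_top_of_le_ne_top ?_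
      (lorN_le hq hf.enorm))
    exact ENNReal.mul_ne_top (hardyC_ne_top hp) hfp.2.ne
  obtain ⟨M, hM, hMle⟩ := exists_lorN_majSeq_le (measurable_heatA hf) (α := 2 * α)
    (ENNReal.mul_ne_top (by simp) hαt) (a := a) (T := T) (by rw [ha]; linarith)
    (by rw [ha]; linarith) hle hp hq hM₀ fun t ht _ => lorN_heatA_le hf hq ht
  refine ⟨u, ⟨measOn_of_measurable hu _, ?_⟩, ⟨measOn_of_measurable hu _, ?_⟩, hmild⟩
  · refine lt_of_le_of_lt (iSup₂_le fun t ht => ?_) hM.lt_top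
    obtain ⟨ht0, htT⟩ := mem_timeI_ofReal.1 ht
    rw [neg_zero, zero_div, ENNReal.rpow_zero, one_mul, spNorm_coe]
    have hUt : ∀ m, Measurable (majSeq (heatA f) m t) := fun m => by
      exact (measurable_majSeq (measurable_heatA hf) m).of_uncurry_left
    have hut : Measurable (u t) := hu.of_uncurry_left
    calc _ ≤ lorN volume p q (fun x => ‖u t x‖ₑ) := lorentzNorm_le_lorN hut.enorm
      _ ≤ lorN volume p q (fun x => ⨆ m, majSeq (heatA f) m t x) :=
          lorN_mono (ae_of_all _ fun x => huU t x)
      _ ≤ ⨆ m, lorN volume p q (majSeq (heatA f) m t) :=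
          lorN_iSup_le hq hUt fun i j hij x => majSeq_mono hij t x
      _ ≤ M := iSup_le fun m => hMle m t ht0 htT
  · refine lt_of_le_of_lt (iSup₂_le fun t ht => ?_)
      (ENNReal.mul_lt_top (by simp) hαt.lt_top : 2 * α < ∞)
    obtain ⟨ht0, htT⟩ := mem_timeI_ofReal.1 ht
    rw [spNorm_top, inv_coe, ← hb, neg_neg, ← ha]
    calc _ ≤ ENNReal.ofReal t ^ a * (2 * α * ENNReal.ofReal t ^ (-a)) := by
          gcongr
          exact iSup_le fun x => (huU t x).trans (hlim t ht0 htT x)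
      _ = 2 * α * (ENNReal.ofReal t ^ a * ENNReal.ofReal t ^ (-a)) := by ring
      _ = _ := by rw [ofReal_rpow_mul ht0, add_neg_cancel, ENNReal.rpow_zero, mul_one]

end NSLorentz

end

noncomputable section

open MeasureTheory Set Filter
open scoped ENNReal Topology

namespace NSLorentz

/-! ### Fractional integration in weak Lebesgue spaces on the line -/

/-- The kernel of fractional integration of order `b`. -/
def fracK (b s : ℝ) : ℝ≥0∞ := (Ioi (0 : ℝ)).indicator (fun s => ENNReal.ofReal s ^ (-(1 - b))) s

theorem measurable_fracK (b : ℝ) : Measurable (fracK b) :=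
  Measurable.indicator (by fun_prop) measurableSet_Ioi

theorem fracK_of_pos (b : ℝ) {s : ℝ} (hs : 0 < s) : fracK b s = ENNReal.ofReal s ^ (-(1 - b)) :=
  indicator_of_mem (show s ∈ Ioi 0 from hs) _

theorem fracK_of_nonpos (b : ℝ) {s : ℝ} (hs : s ≤ 0) : fracK b s = 0 :=
  indicator_of_notMem (show s ∉ Ioi 0 from not_lt.2 hs) _

/-- The tail of s^{-(1-b)} is a superposition of indicators of (0,ρ), ρ > τ, with density
(1-b)ρ^{b-2}. Each one integrates F over an interval of length ρ, which costs K(ρ,F) ≤ H ρ^{1-2b},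
and the integral of ρ^{-1-b} over ρ > τ is τ^{-b}/b. -/
theorem lintegral_fracK_tail_le {b : ℝ} (hb0 : 0 < b) (hb1 : b < 1) {F : ℝ → ℝ≥0∞}
    (hF : Measurable F) {H : ℝ≥0∞} (hH : ∀ τ : ℝ, 0 < τ →
      kfun volume (ENNReal.ofReal τ) F ≤ H * ENNReal.ofReal τ ^ (1 - 2 * b))
    {τ : ℝ} (hτ : 0 < τ) (t : ℝ) :
    ∫⁻ s, (Ici τ).indicator (fracK b) (t - s) * F s
      ≤ ENNReal.ofReal (1 / b) * H * ENNReal.ofReal τ ^ (-b) := by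
  have h1b : 0 < 1 - b := by linarith
  have hk : ∀ s, (Ici τ).indicator (fracK b) s ≤ ENNReal.ofReal (1 - b) *
      ∫⁻ ρ in Ioi τ, ENNReal.ofReal ρ ^ (b - 2) * (Ioo 0 ρ).indicator 1 s := by
    intro s
    by_cases hs : τ ≤ s
    · have hs0 : 0 < s := hτ.trans_le hs
      rw [indicator_of_mem (show s ∈ Ici τ from hs), fracK_of_pos b hs0]
      calc _ = ENNReal.ofReal (1 - b) * ∫⁻ ρ in Ioi s, ENNReal.ofReal ρ ^ (b - 2) := by
            rw [setLIntegral_Ioi_rpow (by linarith) hs0, ← ENNReal.ofReal_mul h1b.le,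
              ENNReal.ofReal_rpow_of_pos hs0]
            congr 1
            rw [show b - 2 + 1 = -(1 - b) by ring]
            field_simp
        _ = ENNReal.ofReal (1 - b) *
            ∫⁻ ρ in Ioi s, ENNReal.ofReal ρ ^ (b - 2) * (Ioo 0 ρ).indicator 1 s := by
            congr 1
            refine setLIntegral_congr_fun measurableSet_Ioi fun ρ hρ => ?_
            have : s ∈ Ioo 0 ρ := ⟨hs0, hρ⟩
            simp [this]
        _ ≤ _ := by
            gcongr
    · rw [indicator_of_notMem (show s ∉ Ici τ from hs)]
      exact zero_le
  have hjm : Measurable (Function.uncurry fun (s ρ : ℝ) =>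
      ENNReal.ofReal ρ ^ (b - 2) * (Ioo 0 ρ).indicator (1 : ℝ → ℝ≥0∞) (t - s) * F s) := by
    have hS : MeasurableSet {z : ℝ × ℝ | t - z.1 ∈ Ioo 0 z.2} :=
      MeasurableSet.inter (s₁ := {z : ℝ × ℝ | 0 < t - z.1}) (s₂ := {z | t - z.1 < z.2})
        (measurableSet_lt (by fun_prop) (by fun_prop))
        (measurableSet_lt (by fun_prop) (by fun_prop))
    have e : (fun z : ℝ × ℝ => (Ioo 0 z.2).indicator (1 : ℝ → ℝ≥0∞) (t - z.1))
        = {z : ℝ × ℝ | t - z.1 ∈ Ioo 0 z.2}.indicator 1 := rfl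
    have := (measurable_one (α := ℝ≥0∞)).indicator hS
    rw [← e] at this
    exact ((by fun_prop : Measurable fun z : ℝ × ℝ => ENNReal.ofReal z.2 ^ (b - 2)).mul this).mul
      (hF.comp measurable_fst)
  have hρm : ∀ s, Measurable fun ρ : ℝ =>
      ENNReal.ofReal ρ ^ (b - 2) * (Ioo 0 ρ).indicator (1 : ℝ → ℝ≥0∞) (t - s) := fun s => by
    have e : (fun ρ : ℝ => (Ioo 0 ρ).indicator (1 : ℝ → ℝ≥0∞) (t - s))
        = {ρ : ℝ | t - s ∈ Ioo 0 ρ}.indicator 1 := rfl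
    have hS : MeasurableSet {ρ : ℝ | t - s ∈ Ioo 0 ρ} :=
      MeasurableSet.inter (s₁ := {ρ : ℝ | 0 < t - s}) (s₂ := {ρ | t - s < ρ})
        (measurableSet_lt (by fun_prop) (by fun_prop))
        (measurableSet_lt (by fun_prop) (by fun_prop))
    have := (measurable_one (α := ℝ≥0∞)).indicator hS
    rw [← e] at this
    exact (by fun_prop : Measurable fun ρ : ℝ => ENNReal.ofReal ρ ^ (b - 2)).mul this
  calc _ ≤ ∫⁻ s, (ENNReal.ofReal (1 - b) *
        ∫⁻ ρ in Ioi τ, ENNReal.ofReal ρ ^ (b - 2) * (Ioo 0 ρ).indicator 1 (t - s)) * F s := by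
        gcongr with s; exact hk _
    _ = ENNReal.ofReal (1 - b) * ∫⁻ s, ∫⁻ ρ in Ioi τ,
          ENNReal.ofReal ρ ^ (b - 2) * (Ioo 0 ρ).indicator 1 (t - s) * F s := by
        rw [← lintegral_const_mul' _ _ ENNReal.ofReal_ne_top]
        refine lintegral_congr fun s => ?_
        rw [lintegral_mul_const _ (hρm s), mul_assoc]
    _ = ENNReal.ofReal (1 - b) * ∫⁻ ρ in Ioi τ, ∫⁻ s,
          ENNReal.ofReal ρ ^ (b - 2) * (Ioo 0 ρ).indicator 1 (t - s) * F s := by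
        rw [lintegral_lintegral_swap hjm.aemeasurable]
    _ ≤ ENNReal.ofReal (1 - b) * ∫⁻ ρ in Ioi τ, H * ENNReal.ofReal ρ ^ (-1 - b) := by
        refine mul_le_mul' le_rfl ?_
        refine setLIntegral_mono' measurableSet_Ioi fun ρ hρ => ?_
        have hρ0 : 0 < ρ := hτ.trans hρ
        have e : ∀ s, ENNReal.ofReal ρ ^ (b - 2) * (Ioo 0 ρ).indicator 1 (t - s) * F s
            = ENNReal.ofReal ρ ^ (b - 2) * (F s * (Ioo (t - ρ) t).indicator 1 s) := fun s => by
          have : (Ioo 0 ρ).indicator (1 : ℝ → ℝ≥0∞) (t - s)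
              = (Ioo (t - ρ) t).indicator (1 : ℝ → ℝ≥0∞) s := by
            simp only [indicator, mem_Ioo]
            refine if_congr ⟨fun h => ⟨by linarith [h.2], by linarith [h.1]⟩,
              fun h => ⟨by linarith [h.2], by linarith [h.1]⟩⟩ rfl rfl
          rw [this]; ring
        simp_rw [e]
        rw [lintegral_const_mul' _ _ (rpow_ne_top_of_pos hρ0 _)]
        calc _ ≤ ENNReal.ofReal ρ ^ (b - 2) * (H * ENNReal.ofReal ρ ^ (1 - 2 * b)) := by
              gcongr
              refine (le_kfun (measurable_one.indicator measurableSet_Ioo)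
                (fun s => indicator_le_self' (fun _ _ => zero_le) s) ?_).trans (hH ρ hρ0)
              rw [lintegral_indicator_one measurableSet_Ioo, Real.volume_Ioo]
              simp
          _ = H * (ENNReal.ofReal ρ ^ (b - 2) * ENNReal.ofReal ρ ^ (1 - 2 * b)) := by ring
          _ = _ := by rw [ofReal_rpow_mul hρ0]; congr 2; ring
    _ = H * (ENNReal.ofReal (1 - b) * ENNReal.ofReal (1 / b) * ENNReal.ofReal τ ^ (-b)) := by
        rw [lintegral_const_mul _ (by fun_prop), setLIntegral_Ioi_rpow (by linarith) hτ,
          ENNReal.ofReal_rpow_of_pos hτ, show -1 - b + 1 = -b by ring, neg_div_neg_eq, mul_assoc,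
          ← ENNReal.ofReal_mul (by positivity)]
        rw [show 1 / b * τ ^ (-b) = τ ^ (-b) / b by ring]
        ring
    _ ≤ H * (1 * ENNReal.ofReal (1 / b) * ENNReal.ofReal τ ^ (-b)) := by
        gcongr
        rw [ENNReal.ofReal_le_one]; linarith
    _ = _ := by ring

/-- Fractional integration maps weak `L^{1/(2b)}` to weak `L^{1/b}`. -/
theorem kfun_fracK_le {b : ℝ} (hb0 : 0 < b) (hb1 : b < 1) {F : ℝ → ℝ≥0∞} (hF : Measurable F)
    {H : ℝ≥0∞} (hH : ∀ τ : ℝ, 0 < τ →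
      kfun volume (ENNReal.ofReal τ) F ≤ H * ENNReal.ofReal τ ^ (1 - 2 * b)) {τ : ℝ} (hτ : 0 < τ) :
    kfun volume (ENNReal.ofReal τ) (fun t => ∫⁻ s, fracK b (t - s) * F s)
      ≤ 2 * ENNReal.ofReal (1 / b) * H * ENNReal.ofReal τ ^ (1 - b) := by
  -- The kernel is split at s = τ: its head has mass τ^b/b and acts by Young's inequality, its tail
  -- gives a bounded function. Both contributions are of order τ^{1-b}.
  have e : ∀ s, fracK b s = (Iio τ).indicator (fracK b) s + (Ici τ).indicator (fracK b) s :=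
    fun s => by
      have := indicator_compl_add_self (Ici τ) (fracK b)
      rw [compl_Ici] at this
      exact (congrFun this s).symm
  have hm1 : Measurable ((Iio τ).indicator (fracK b)) :=
    (measurable_fracK b).indicator measurableSet_Iio
  have hm2 : Measurable ((Ici τ).indicator (fracK b)) :=
    (measurable_fracK b).indicator measurableSet_Ici
  have hc : ∀ {k : ℝ → ℝ≥0∞}, Measurable k → ∀ t, Measurable fun s => k (t - s) * F s :=
    fun hk t => (hk.comp (by fun_prop)).mul hF
  have hc' : ∀ {k : ℝ → ℝ≥0∞}, Measurable k → Measurable fun t => ∫⁻ s, k (t - s) * F s :=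
    fun {k} hk => Measurable.lintegral_prod_right' (f := fun z : ℝ × ℝ => k (z.1 - z.2) * F z.2)
      ((hk.comp (by fun_prop)).mul (hF.comp measurable_snd))
  have hsplit : (fun t => ∫⁻ s, fracK b (t - s) * F s) = fun t =>
      (∫⁻ s, (Iio τ).indicator (fracK b) (t - s) * F s) +
        ∫⁻ s, (Ici τ).indicator (fracK b) (t - s) * F s := by
    ext t
    rw [← lintegral_add_left (hc hm1 t)]
    refine lintegral_congr fun s => ?_
    rw [e (t - s), add_mul]
  have hκ : ∫⁻ s, (Iio τ).indicator (fracK b) s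
      ≤ ENNReal.ofReal (1 / b) * ENNReal.ofReal τ ^ b := by
    refine le_of_eq ?_
    have : (Iio τ).indicator (fracK b)
        = (Ioo 0 τ).indicator fun s => ENNReal.ofReal s ^ (-(1 - b)) := by
      ext s
      rcases le_or_gt s 0 with h | h
      · simp [indicator, fracK_of_nonpos b h, h.not_gt]
      · simp [indicator, fracK_of_pos b h, h]
    rw [this, lintegral_indicator measurableSet_Ioo, setLIntegral_Ioo_rpow (by linarith) hτ,
      ENNReal.ofReal_rpow_of_pos hτ, ← ENNReal.ofReal_mul (by positivity)]
    rw [show -(1 - b) + 1 = b by ring, div_eq_mul_inv, mul_comm, one_div]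
  have hκ0 : ENNReal.ofReal (1 / b) * ENNReal.ofReal τ ^ b ≠ 0 :=
    mul_ne_zero (ofReal_ne_zero (by positivity)) (rpow_ne_zero_of_pos hτ _)
  have hκt : ENNReal.ofReal (1 / b) * ENNReal.ofReal τ ^ b ≠ ∞ :=
    ENNReal.mul_ne_top ENNReal.ofReal_ne_top (rpow_ne_top_of_pos hτ _)
  rw [hsplit]
  refine (kfun_add_le (hc' hm1)).trans ?_
  calc _ ≤ (ENNReal.ofReal (1 / b) * ENNReal.ofReal τ ^ b) *
        (H * ENNReal.ofReal τ ^ (1 - 2 * b)) +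
        ENNReal.ofReal (1 / b) * H * ENNReal.ofReal τ ^ (-b) * ENNReal.ofReal τ := by
        refine add_le_add ((kfun_conv_le hκ0 hκt hm1 hF hκ).trans ?_) (kfun_le_of_le ?_)
        · gcongr; exact hH τ hτ
        · exact ae_of_all _ fun t => lintegral_fracK_tail_le hb0 hb1 hF hH hτ t
    _ = ENNReal.ofReal (1 / b) * H * (ENNReal.ofReal τ ^ b * ENNReal.ofReal τ ^ (1 - 2 * b)) +
        ENNReal.ofReal (1 / b) * H * (ENNReal.ofReal τ ^ (-b) * ENNReal.ofReal τ ^ (1 : ℝ)) := by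
        rw [ENNReal.rpow_one]; ring
    _ = _ := by
        rw [ofReal_rpow_mul hτ, ofReal_rpow_mul hτ, show b + (1 - 2 * b) = 1 - b by ring,
          show -b + 1 = 1 - b by ring]
        ring

/-! ### A uniqueness principle for singular Volterra inequalities -/

/-- The weak `L^α` norms of `ψ` on short subintervals of `(0,T)` are small. -/
def SmallWeak (α : ℝ≥0∞) (T : ℝ) (ψ : ℝ → ℝ≥0∞) : Prop :=
  ∀ ε : ℝ≥0∞, ε ≠ 0 → ∃ δ : ℝ, 0 < δ ∧ ∀ a b : ℝ, 0 ≤ a → b ≤ T → b - a ≤ δ →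
    lorentzNorm volume α ∞ ((Ioo a b).indicator ψ) ≤ ε

theorem inv_toReal_pos {α : ℝ≥0∞} (h0 : α ≠ 0) (h : α ≠ ∞) : 0 < (α⁻¹).toReal :=
  ENNReal.toReal_pos (ENNReal.inv_ne_zero.2 h) (ENNReal.inv_ne_top.2 h0)

theorem exists_mul_lt_one {D : ℝ≥0∞} (hD : D ≠ ∞) : ∃ ε : ℝ≥0∞, ε ≠ 0 ∧ ε ≠ ∞ ∧ D * ε ≤ 2⁻¹ := by
  rcases eq_or_ne D 0 with h | h
  · exact ⟨1, one_ne_zero, by simp, by simp [h]⟩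
  · exact ⟨D⁻¹ * 2⁻¹, mul_ne_zero (ENNReal.inv_ne_zero.2 hD) (by simp),
      ENNReal.mul_ne_top (ENNReal.inv_ne_top.2 h) (by simp), by
        rw [← mul_assoc, ENNReal.mul_inv_cancel h hD, one_mul]⟩

theorem eq_zero_of_le_half {N : ℝ≥0∞} (hN : N ≠ ∞) (h : N ≤ 2⁻¹ * N) : N = 0 := by
  by_contra h0
  have := ENNReal.half_lt_self h0 hN
  rw [div_eq_mul_inv, mul_comm] at this
  exact lt_irrefl _ (h.trans_lt this)

/-- On an interval of length δ the product ψφ lies in L^{α/2,∞} and fractional integration returns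
to L^{α,∞}, so the weak norm of φ is at most half of itself. It is finite because φ ≤ ψ, hence zero;
finitely many such intervals cover (0,T). -/
theorem ae_eq_zero_of_volterra {α : ℝ≥0∞} (hα2 : 2 < α) (hα : α ≠ ∞) {φ ψ : ℝ → ℝ≥0∞}
    (hφ : Measurable φ) (hψ : Measurable ψ) {T : ℝ} {C : ℝ≥0∞} (hC : C ≠ ∞)
    (hsmall : SmallWeak α T ψ) (hle : ∀ t ∈ Ioo 0 T, φ t ≤ ψ t)
    (H : ∀ᵐ t, t ∈ Ioo 0 T → φ t ≤ C * ∫⁻ s in Ioo 0 t,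
      ENNReal.ofReal (t - s) ^ (-(1 - (α⁻¹).toReal)) * (ψ s * φ s)) :
    ∀ᵐ t, t ∈ Ioo 0 T → φ t = 0 := by
  set b := (α⁻¹).toReal with hb
  have hα0 : α ≠ 0 := (zero_lt_two.trans hα2).ne'
  have hb0 : 0 < b := inv_toReal_pos hα0 hα
  have hb1 : b < 1 := by
    have := inv_toReal_lt_one (lt_trans (by norm_num : (1 : ℝ≥0∞) < 2) hα2)
    exact this
  set D : ℝ≥0∞ := C * (2 * ENNReal.ofReal (1 / b) * hardyC (α / 2)) with hD
  have hDt : D ≠ ∞ := ENNReal.mul_ne_top hC (ENNReal.mul_ne_top (ENNReal.mul_ne_top (by simp)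
    ENNReal.ofReal_ne_top) (hardyC_ne_top (one_lt_half hα2)))
  obtain ⟨ε, hε0, hεt, hε⟩ := exists_mul_lt_one hDt
  obtain ⟨δ, hδ0, hδ⟩ := hsmall ε hε0
  have key : ∀ k : ℕ, ∀ᵐ t, t ∈ Ioo 0 (min (k * δ) T) → φ t = 0 := by
    intro k
    induction k with
    | zero =>
      refine ae_of_all _ fun t ht => ?_
      have := lt_min_iff.1 ht.2
      simp only [Nat.cast_zero, zero_mul] at this
      exact absurd ht.1 this.1.not_gt
    | succ k ih =>
      set a : ℝ := k * δ with ha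
      have ha0 : 0 ≤ a := by positivity
      set c : ℝ := min ((k + 1 : ℕ) * δ) T with hc
      have hca : c - a ≤ δ := by
        have : c ≤ (k + 1 : ℕ) * δ := min_le_left _ _
        push_cast at this
        rw [ha]; linarith
      have hcT : c ≤ T := min_le_right _ _
      set g := (Ioo a c).indicator φ with hg
      set p := (Ioo a c).indicator ψ with hp
      have hgm : Measurable g := hφ.indicator measurableSet_Ioo
      have hpm : Measurable p := hψ.indicator measurableSet_Ioo
      have hpε : lorentzNorm volume α ∞ p ≤ ε := hδ a c ha0 hcT hca
      have hgp : ∀ t, g t ≤ p t := fun t => by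
        by_cases ht : t ∈ Ioo a c
        · rw [hg, hp, indicator_of_mem ht, indicator_of_mem ht]
          exact hle t ⟨ha0.trans_lt ht.1, ht.2.trans_le hcT⟩
        · rw [hg, indicator_of_notMem ht]; exact zero_le
      have hgε : lorentzNorm volume α ∞ g ≠ ∞ :=
        ne_top_of_le_ne_top hεt ((lorentzNorm_mono (ae_of_all _ hgp)).trans hpε)
      have hna : ∀ᵐ s : ℝ, s ≠ a := by
        simp [ae_iff]
      have hconv : ∀ᵐ t, g t ≤ C * ∫⁻ s, fracK b (t - s) * (p s * g s) := by
        filter_upwards [H] with t hH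
        by_cases ht : t ∈ Ioo a c
        · rw [hg, indicator_of_mem ht]
          refine (hH ⟨ha0.trans_lt ht.1, ht.2.trans_le hcT⟩).trans ?_
          refine mul_le_mul' le_rfl ?_
          rw [← lintegral_indicator measurableSet_Ioo]
          refine lintegral_mono_ae ?_
          filter_upwards [ih, hna] with s hs hsa
          by_cases hst : s ∈ Ioo 0 t
          · rw [indicator_of_mem hst, fracK_of_pos b (sub_pos.2 hst.2)]
            refine mul_le_mul' le_rfl ?_
            rcases lt_or_gt_of_ne hsa with h | h
            · have : φ s = 0 := hs ⟨hst.1, lt_min h (hst.2.trans (ht.2.trans_le hcT))⟩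
              rw [this, mul_zero]; exact zero_le
            · have hs' : s ∈ Ioo a c := ⟨h, hst.2.trans ht.2⟩
              exact (congrArg₂ _ (indicator_of_mem hs' ψ) (indicator_of_mem hs' φ)).ge
          · rw [indicator_of_notMem hst]; exact zero_le
        · rw [hg, indicator_of_notMem ht]; exact zero_le
      have hN : lorentzNorm volume α ∞ g ≤ 2⁻¹ * lorentzNorm volume α ∞ g := by
        have h1 : ∀ τ : ℝ, 0 < τ → kfun volume (ENNReal.ofReal τ) (fun s => p s * g s)
            ≤ hardyC (α / 2) * (lorentzNorm volume α ∞ p * lorentzNorm volume α ∞ g) *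
              ENNReal.ofReal τ ^ (1 - 2 * b) := fun τ hτ => kfun_mul_le_weak hpm hgm hτ
        refine (lorentzNorm_top_le_of_kfun hgm (A := C * (2 * ENNReal.ofReal (1 / b) *
          (hardyC (α / 2) * (lorentzNorm volume α ∞ p * lorentzNorm volume α ∞ g))))
          fun τ hτ => ?_).trans ?_
        · refine (kfun_mono hconv).trans ?_
          have hm : Measurable fun t => ∫⁻ s, fracK b (t - s) * (p s * g s) :=
            Measurable.lintegral_prod_right' (f := fun z : ℝ × ℝ => fracK b (z.1 - z.2) *
              (p z.2 * g z.2)) (((measurable_fracK b).comp (by fun_prop)).mul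
                ((hpm.comp measurable_snd).mul (hgm.comp measurable_snd)))
          refine (kfun_const_mul_le hm).trans ?_
          rw [mul_assoc C]
          gcongr
          exact kfun_fracK_le hb0 hb1 (hpm.mul hgm) h1 hτ
        · calc _ = D * lorentzNorm volume α ∞ p * lorentzNorm volume α ∞ g := by rw [hD]; ring
            _ ≤ D * ε * lorentzNorm volume α ∞ g := by gcongr
            _ ≤ _ := by gcongr
      have hg0 := ae_eq_zero_of_lorentzNorm (eq_zero_of_le_half hgε hN)
      filter_upwards [ih, hg0, hna] with t h1 h2 h3 ht
      rcases lt_or_gt_of_ne h3 with h | h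
      · exact h1 ⟨ht.1, lt_min h (ht.2.trans_le hcT)⟩
      · rwa [hg, indicator_of_mem (show t ∈ Ioo a c from ⟨h, ht.2⟩)] at h2
  obtain ⟨k, hk⟩ := exists_nat_ge (T / δ)
  have := key k
  rwa [min_eq_right ((div_le_iff₀ hδ0).1 hk)] at this

end NSLorentz

end

noncomputable section

open MeasureTheory Set Filter
open scoped ENNReal Topology

namespace NSLorentz

variable {n : ℕ}

/-! ### Uniqueness -/

/-- In one dimension the Leray symbol 1 - ξ²/|ξ|² vanishes off the origin, and at the origin the
factor ξ_k does. Dimension one must be treated apart in the uniqueness theorem because r > n then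
allows r ≤ 2. -/
theorem gradMaj_eq_zero (hn : n = 1) (t : ℝ) (x : Sp n) : gradMaj t x = 0 := by
  subst hn
  have h0 : ∀ i j k : Fin 1, gradM i j k = fun _ => 0 := by
    intro i j k
    ext ξ
    have hi := Subsingleton.elim i 0
    have hj := Subsingleton.elim j 0
    have hk := Subsingleton.elim k 0
    subst hi hj hk
    have h2 : ‖ξ‖ ^ 2 = ξ 0 * ξ 0 := by
      rw [EuclideanSpace.real_norm_sq_eq]; simp [sq]
    unfold gradM lerayM
    by_cases h : ξ 0 = 0
    · simp [h]
    · rw [h2, div_self (mul_ne_zero h h)]; simp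
  simp [gradMaj, gradK, multK, h0]

/-- The weak `L^r` smoothing estimate for the Oseen kernel, on products. -/
theorem kfun_gradMaj_conv_le (hn : 1 ≤ n) {r : ℝ≥0∞} {g h : Sp n → ℝ≥0∞}
    (hg : Measurable g) (hh : Measurable h) {t τ : ℝ} (ht : 0 < t) (hτ : 0 < τ) :
    kfun volume (ENNReal.ofReal τ) (fun x => ∫⁻ y, gradMaj t (x - y) * (g y * h y))
      ≤ ENNReal.ofReal (kerC n) * hardyC (r / 2) *
        (lorentzNorm volume r ∞ g * lorentzNorm volume r ∞ h) *
        ENNReal.ofReal t ^ (-(1 / 2 + n * (r⁻¹).toReal / 2)) *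
        ENNReal.ofReal τ ^ (1 - (r⁻¹).toReal) := by
  rcases hn.eq_or_lt with h1 | h1
  · simp only [gradMaj_eq_zero h1.symm, zero_mul, lintegral_zero]
    refine (kfun_le_of_le (ae_of_all _ fun _ => le_rfl)).trans ?_
    rw [zero_mul]; exact zero_le
  set b := (r⁻¹).toReal with hb
  set H := hardyC (r / 2) * (lorentzNorm volume r ∞ g * lorentzNorm volume r ∞ h) with hH
  set K := ENNReal.ofReal (kerC n) with hK
  have hKF : ∀ {σ : ℝ}, 0 < σ → kfun volume (ENNReal.ofReal σ) (fun y => g y * h y)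
      ≤ H * ENNReal.ofReal σ ^ (1 - 2 * b) := fun hσ => kfun_mul_le_weak hg hh hσ
  have hK0 : K ≠ 0 := ofReal_ne_zero (kerC_pos n)
  have hKt : K ≠ ∞ := ENNReal.ofReal_ne_top
  have hgm := measurable_gradMaj_right (n := n) t
  set G : Sp n → ℝ≥0∞ := fun x => ∫⁻ y, gradMaj t (x - y) * (g y * h y) with hG
  have hκ0 : K * ENNReal.ofReal t ^ (-(1 / 2) : ℝ) ≠ 0 := mul_ne_zero hK0 (rpow_ne_zero_of_pos ht _)
  have hκt : K * ENNReal.ofReal t ^ (-(1 / 2) : ℝ) ≠ ∞ :=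
    ENNReal.mul_ne_top hKt (rpow_ne_top_of_pos ht _)
  have hM0 : K * ENNReal.ofReal t ^ (-((n : ℝ) + 1) / 2) ≠ 0 :=
    mul_ne_zero hK0 (rpow_ne_zero_of_pos ht _)
  have hMt : K * ENNReal.ofReal t ^ (-((n : ℝ) + 1) / 2) ≠ ∞ :=
    ENNReal.mul_ne_top hKt (rpow_ne_top_of_pos ht _)
  have hA : kfun volume (ENNReal.ofReal τ) G ≤ (K * H * ENNReal.ofReal t ^ (-(1 / 2) : ℝ)) *
      ENNReal.ofReal τ ^ (1 - 2 * b) := by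
    refine (kfun_conv_le hκ0 hκt hgm (hg.mul hh) (lintegral_gradMaj_le ht)).trans ?_
    calc _ ≤ K * ENNReal.ofReal t ^ (-(1 / 2) : ℝ) * (H * ENNReal.ofReal τ ^ (1 - 2 * b)) := by
          gcongr; exact hKF hτ
      _ = _ := by ring
  have hB : kfun volume (ENNReal.ofReal τ) G ≤ (K * H * ENNReal.ofReal t ^ (-(1 / 2) - n * b)) *
      ENNReal.ofReal τ := by
    refine kfun_le_of_le (ae_of_all _ fun x => ?_)
    refine (conv_le_kfun hM0 hMt hgm (fun y => gradMaj_le ht y) (lintegral_gradMaj_le ht) x).trans ?_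
    have e : K * ENNReal.ofReal t ^ (-(1 / 2) : ℝ) / (K * ENNReal.ofReal t ^ (-((n : ℝ) + 1) / 2))
        = ENNReal.ofReal (t ^ ((n : ℝ) / 2)) := by
      rw [ENNReal.mul_div_mul_left _ _ hK0 hKt, div_eq_mul_inv, ← ENNReal.rpow_neg,
        ofReal_rpow_mul ht, ← ENNReal.ofReal_rpow_of_pos ht]
      congr 1; ring
    rw [e]
    calc _ ≤ K * ENNReal.ofReal t ^ (-((n : ℝ) + 1) / 2) *
          (H * ENNReal.ofReal (t ^ ((n : ℝ) / 2)) ^ (1 - 2 * b)) := by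
          gcongr; exact hKF (Real.rpow_pos_of_pos ht _)
      _ = K * H * (ENNReal.ofReal t ^ (-((n : ℝ) + 1) / 2) *
          ENNReal.ofReal t ^ ((n : ℝ) / 2 * (1 - 2 * b))) := by
          rw [← ENNReal.ofReal_rpow_of_pos ht, ← ENNReal.rpow_mul]; ring
      _ = _ := by rw [ofReal_rpow_mul ht]; congr 2; ring
  -- The geometric mean of the bounds from the L¹ norm and from the supremum of the kernel. The
  -- powers τ^{1-2b} and τ average to τ^{1-b}, which is weak L^r, and the powers of t average to
  -- -(1/2 + nb/2).
  calc kfun volume (ENNReal.ofReal τ) G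
      = kfun volume (ENNReal.ofReal τ) G ^ (1 / 2 : ℝ) *
        kfun volume (ENNReal.ofReal τ) G ^ (1 / 2 : ℝ) := by
        rw [← ENNReal.rpow_add_of_nonneg _ _ (by norm_num) (by norm_num)]; norm_num
    _ ≤ ((K * H * ENNReal.ofReal t ^ (-(1 / 2) : ℝ)) * ENNReal.ofReal τ ^ (1 - 2 * b)) ^ (1 / 2 : ℝ)
        * ((K * H * ENNReal.ofReal t ^ (-(1 / 2) - n * b)) * ENNReal.ofReal τ) ^ (1 / 2 : ℝ) := by
        gcongr
    _ = (K * H) ^ (1 / 2 : ℝ) * (K * H) ^ (1 / 2 : ℝ) *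
        (ENNReal.ofReal t ^ (-(1 / 2) * (1 / 2) : ℝ) *
          ENNReal.ofReal t ^ ((-(1 / 2) - n * b) * (1 / 2))) *
        (ENNReal.ofReal τ ^ ((1 - 2 * b) * (1 / 2)) * ENNReal.ofReal τ ^ (1 / 2 : ℝ)) := by
        have m : ∀ x y : ℝ≥0∞, (x * y) ^ (1 / 2 : ℝ) = x ^ (1 / 2 : ℝ) * y ^ (1 / 2 : ℝ) :=
          fun x y => ENNReal.mul_rpow_of_nonneg x y (by norm_num)
        generalize K * H = X
        simp only [m, ← ENNReal.rpow_mul]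
        ring
    _ = _ := by
        rw [← ENNReal.rpow_add_of_nonneg _ _ (by norm_num) (by norm_num), ofReal_rpow_mul ht,
          ofReal_rpow_mul hτ]
        rw [show (1 / 2 + 1 / 2 : ℝ) = 1 by norm_num, ENNReal.rpow_one, hH]
        rw [show -(1 / 2) * (1 / 2) + (-(1 / 2) - n * b) * (1 / 2) = -(1 / 2 + n * b / 2) by ring,
          show (1 - 2 * b) * (1 / 2) + 1 / 2 = 1 - b by ring]
        ring

theorem lorentzNorm_add_le {X : Type*} [MeasurableSpace X] {μ : Measure X} [SigmaFinite μ]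
    {p q : ℝ≥0∞} (h1 : 1 ≤ q) {g g' : X → ℝ≥0∞}
    (hg : Measurable g) (hg' : Measurable g') : lorentzNorm μ p q (fun x => g x + g' x)
      ≤ hardyC p * (lorentzNorm μ p q g + lorentzNorm μ p q g') := by
  rw [mul_add]
  exact (lorentzNorm_le_lorN (hg.add hg')).trans ((lorN_add_le h1 hg).trans
    (add_le_add (lorN_le h1 hg) (lorN_le h1 hg')))

theorem SmallWeak.add {α : ℝ≥0∞} (hα : 1 < α) {T : ℝ} {φ ψ : ℝ → ℝ≥0∞} (hφm : Measurable φ)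
    (hψm : Measurable ψ) (hφ : SmallWeak α T φ) (hψ : SmallWeak α T ψ) :
    SmallWeak α T fun t => φ t + ψ t := by
  intro ε hε
  obtain ⟨ε', h0, _, hε'⟩ := exists_mul_lt_one (D := hardyC α * 4) (ENNReal.mul_ne_top (hardyC_ne_top hα) (by simp))
  have hm0 : min ε 1 ≠ 0 := (lt_min (pos_iff_ne_zero.2 hε) one_pos).ne'
  obtain ⟨δ₁, h1, H1⟩ := hφ (ε' * min ε 1) (mul_ne_zero h0 hm0)
  obtain ⟨δ₂, h2, H2⟩ := hψ (ε' * min ε 1) (mul_ne_zero h0 hm0)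
  refine ⟨min δ₁ δ₂, lt_min h1 h2, fun a b ha hb hab => ?_⟩
  have e : (Ioo a b).indicator (fun t => φ t + ψ t)
      = fun t => (Ioo a b).indicator φ t + (Ioo a b).indicator ψ t := by
    rw [← Pi.add_def, ← indicator_add]; rfl
  rw [e]
  refine (lorentzNorm_add_le le_top (hφm.indicator measurableSet_Ioo)
    (hψm.indicator measurableSet_Ioo)).trans ?_
  calc _ ≤ hardyC α * (ε' * min ε 1 + ε' * min ε 1) := by
        gcongr
        · exact H1 a b ha hb (hab.trans (min_le_left _ _))
        · exact H2 a b ha hb (hab.trans (min_le_right _ _))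
    _ = hardyC α * 2 * ε' * min ε 1 := by ring
    _ ≤ hardyC α * 4 * ε' * min ε 1 := by gcongr; norm_num
    _ ≤ 2⁻¹ * min ε 1 := by gcongr
    _ ≤ 1 * ε := by
        gcongr
        · simp
        · exact min_le_left _ _
    _ = ε := one_mul _

theorem SmallWeak.const_mul {α : ℝ≥0∞} {T : ℝ} {φ : ℝ → ℝ≥0∞} {c : ℝ≥0∞} (hc : c ≠ ∞)
    (hφ : SmallWeak α T φ) : SmallWeak α T fun t => c * φ t := by
  intro ε hε
  set c' := max c 1 with hc'
  have h0 : c' ≠ 0 := (lt_of_lt_of_le one_pos (le_max_right _ _)).ne'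
  have ht : c' ≠ ∞ := by simp [hc', hc]
  obtain ⟨δ, h1, H⟩ := hφ (c'⁻¹ * ε) (mul_ne_zero (ENNReal.inv_ne_zero.2 ht) hε)
  refine ⟨δ, h1, fun a b ha hb hab => ?_⟩
  calc _ ≤ lorentzNorm volume α ∞ fun t => c' * (Ioo a b).indicator φ t := by
        refine lorentzNorm_mono (ae_of_all _ fun t => ?_)
        by_cases h : t ∈ Ioo a b
        · rw [indicator_of_mem h, indicator_of_mem h]
          gcongr
          exact le_max_left _ _
        · rw [indicator_of_notMem h]; exact zero_le
    _ = c' * lorentzNorm volume α ∞ ((Ioo a b).indicator φ) :=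
        lorentzNorm_const_mul le_top h0 ht _
    _ ≤ c' * (c'⁻¹ * ε) := by gcongr; exact H a b ha hb hab
    _ = ε := by rw [← mul_assoc, ENNReal.mul_inv_cancel h0 ht, one_mul]

theorem enorm_sub_le_duhMaj {f : Sp n → Sp n} {u v : ℝ → Sp n → Sp n} {t : ℝ} {x : Sp n}
    (hu : MildAt f u t x) (hv : MildAt f v t x) : ‖u t x - v t x‖ₑ
      ≤ duhMaj (fun s y => ‖u s y - v s y‖ₑ * (‖u s y‖ₑ + ‖v s y‖ₑ)) t x := by
  have e : u t x - v t x = -(bilinB u u t x - bilinB v v t x) := by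
    rw [hu.2.2, hv.2.2]; abel
  rw [e, enorm_neg]
  exact enorm_bilinB_sub_le hu.2.1 hv.2.1

theorem two_lt_of_nat_lt {r : ℝ≥0∞} (h1 : 1 < n) (hr : (n : ℝ≥0∞) < r) : 2 < r :=
  lt_of_le_of_lt (by exact_mod_cast h1) hr

/-- Uniqueness of mild solutions in `L^α` in time with values in weak `L^r`. -/
theorem mild_ae_unique (hn : 1 ≤ n) {r α : ℝ≥0∞} (hr : (n : ℝ≥0∞) < r) (hα2 : 2 < α) (hα : α ≠ ∞)
    (hrα : 2 * (α⁻¹).toReal + n * (r⁻¹).toReal ≤ 1) {f : Sp n → Sp n} {u v : ℝ → Sp n → Sp n}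
    (hu : Measurable (Function.uncurry u)) (hv : Measurable (Function.uncurry v)) {T : ℝ}
    (hus : SmallWeak α T fun t => lorentzNorm volume r ∞ fun x => ‖u t x‖ₑ)
    (hvs : SmallWeak α T fun t => lorentzNorm volume r ∞ fun x => ‖v t x‖ₑ)
    (hmu : ∀ᵐ t, t ∈ Ioo 0 T → ∀ᵐ x, MildAt f u t x)
    (hmv : ∀ᵐ t, t ∈ Ioo 0 T → ∀ᵐ x, MildAt f v t x) :
    ∀ᵐ t, t ∈ Ioo 0 T → ∀ᵐ x, u t x = v t x := by
  set a := (α⁻¹).toReal with ha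
  set b := (r⁻¹).toReal with hb
  have hn1 : (1 : ℝ≥0∞) ≤ n := by exact_mod_cast hn
  have hr1 : 1 < r := lt_of_le_of_lt hn1 hr
  have hum : ∀ t, Measurable (u t) := fun t => hu.of_uncurry_left
  have hvm : ∀ t, Measurable (v t) := fun t => hv.of_uncurry_left
  set φ : ℝ → ℝ≥0∞ := fun t => lorentzNorm volume r ∞ fun x => ‖u t x - v t x‖ₑ with hφ
  set N : ℝ → ℝ≥0∞ := fun t => lorentzNorm volume r ∞ (fun x => ‖u t x‖ₑ) +
    lorentzNorm volume r ∞ fun x => ‖v t x‖ₑ with hN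
  set ψ : ℝ → ℝ≥0∞ := fun t => hardyC r * N t with hψ
  have hm1 := measurable_lorentzNorm_weak (μ := (volume : Measure (Sp n))) r
    (g := fun t x => ‖u t x‖ₑ) hu.enorm
  have hm2 := measurable_lorentzNorm_weak (μ := (volume : Measure (Sp n))) r
    (g := fun t x => ‖v t x‖ₑ) hv.enorm
  have hφm : Measurable φ := measurable_lorentzNorm_weak (μ := (volume : Measure (Sp n))) r
    (g := fun t x => ‖u t x - v t x‖ₑ) (hu.sub hv).enorm
  have hψm : Measurable ψ := (hm1.add hm2).const_mul _
  have hsmall : SmallWeak α T ψ :=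
    ((hus.add (lt_trans (by norm_num) hα2) hm1 hm2 hvs)).const_mul (hardyC_ne_top hr1)
  have hsum : ∀ t, lorentzNorm volume r ∞ (fun x => ‖u t x‖ₑ + ‖v t x‖ₑ) ≤ ψ t := fun t =>
    lorentzNorm_add_le le_top (hum t).enorm (hvm t).enorm
  have hle : ∀ t, φ t ≤ ψ t := fun t =>
    (lorentzNorm_mono (ae_of_all _ fun x => enorm_sub_le)).trans (hsum t)
  by_cases hT : 0 < T
  swap
  · exact ae_of_all _ fun t ht => absurd (ht.1.trans ht.2) hT
  -- Here r may be at most 2, where the Hardy constant of L^{r/2} is infinite; but the nonlinear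
  -- term vanishes and the equation determines u.
  by_cases h1n : n = 1
  · filter_upwards [hmu, hmv] with t h1 h2 ht
    filter_upwards [h1 ht, h2 ht] with x hx hy
    have := enorm_sub_le_duhMaj hx hy
    rw [duhMaj] at this
    simp only [gradMaj_eq_zero h1n, zero_mul, lintegral_zero, nonpos_iff_eq_zero,
      enorm_eq_zero] at this
    exact sub_eq_zero.1 this
  have hr2 : 2 < r := two_lt_of_nat_lt (lt_of_le_of_ne hn (Ne.symm h1n)) hr
  -- The hypothesis 2/α + n/r ≤ 1 says that the kernel singularity 1/2 + n/(2r) is at most 1 - 1/α;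
  -- the power of T absorbs the difference.
  set C : ℝ≥0∞ := ENNReal.ofReal (kerC n) * hardyC (r / 2) *
    ENNReal.ofReal T ^ (1 - a - (1 / 2 + n * b / 2)) with hC
  have hCt : C ≠ ∞ := ENNReal.mul_ne_top (ENNReal.mul_ne_top ENNReal.ofReal_ne_top
    (hardyC_ne_top (one_lt_half hr2))) (rpow_ne_top_of_pos hT _)
  have hvolt : ∀ᵐ t, t ∈ Ioo 0 T → φ t ≤ C * ∫⁻ s in Ioo 0 t,
      ENNReal.ofReal (t - s) ^ (-(1 - a)) * (ψ s * φ s) := by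
    filter_upwards [hmu, hmv] with t h1 h2 ht
    refine lorentzNorm_top_le_of_kfun ((hum t).sub (hvm t)).enorm fun τ hτ => ?_
    have hF : Measurable (Function.uncurry fun s y =>
        ‖u s y - v s y‖ₑ * (‖u s y‖ₑ + ‖v s y‖ₑ)) :=
      (hu.sub hv).enorm.mul (hu.enorm.add hv.enorm)
    have hi : Measurable (Function.uncurry fun (s : ℝ) (x : Sp n) =>
        ∫⁻ y, gradMaj (t - s) (x - y) * (‖u s y - v s y‖ₑ * (‖u s y‖ₑ + ‖v s y‖ₑ))) :=
      (measurable_duhMaj_inner hF).comp (f := fun z : ℝ × Sp n => ((t, z.2), z.1)) (by fun_prop)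
    calc kfun volume (ENNReal.ofReal τ) (fun x => ‖u t x - v t x‖ₑ)
        ≤ kfun volume (ENNReal.ofReal τ)
          (duhMaj (fun s y => ‖u s y - v s y‖ₑ * (‖u s y‖ₑ + ‖v s y‖ₑ)) t) := by
          refine kfun_mono ?_
          filter_upwards [h1 ht, h2 ht] with x hx hy using enorm_sub_le_duhMaj hx hy
      _ ≤ ∫⁻ s in Ioo 0 t, kfun volume (ENNReal.ofReal τ) fun x =>
          ∫⁻ y, gradMaj (t - s) (x - y) * (‖u s y - v s y‖ₑ * (‖u s y‖ₑ + ‖v s y‖ₑ)) :=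
          kfun_lintegral_le hi
      _ ≤ ∫⁻ s in Ioo 0 t, C * ENNReal.ofReal τ ^ (1 - b) *
          (ENNReal.ofReal (t - s) ^ (-(1 - a)) * (ψ s * φ s)) := by
          refine setLIntegral_mono' measurableSet_Ioo fun s hs => ?_
          have hts : 0 < t - s := sub_pos.2 hs.2
          refine (kfun_gradMaj_conv_le (r := r) hn ((hum s).sub (hvm s)).enorm
            ((hum s).enorm.add (hvm s).enorm) hts hτ).trans ?_
          calc _ ≤ ENNReal.ofReal (kerC n) * hardyC (r / 2) * (φ s * ψ s) *
                (ENNReal.ofReal T ^ (1 - a - (1 / 2 + n * b / 2)) *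
                  ENNReal.ofReal (t - s) ^ (-(1 - a))) * ENNReal.ofReal τ ^ (1 - b) := by
                gcongr
                · exact le_rfl
                · exact hsum s
                · rw [show -(1 / 2 + n * b / 2) = (1 - a - (1 / 2 + n * b / 2)) + -(1 - a) by ring,
                    ← ofReal_rpow_mul hts]
                  have hts' : t - s ≤ T := by linarith [hs.1, ht.2]
                  exact mul_le_mul' (rpow_le_of_le (by linarith) hts') le_rfl
            _ = _ := by rw [hC]; ring
      _ = _ := by
          rw [lintegral_const_mul _ (by fun_prop)]
          ring
  have h0 := ae_eq_zero_of_volterra hα2 hα hφm hψm hCt hsmall (fun t _ => hle t) hvolt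
  filter_upwards [h0] with t ht htT
  filter_upwards [ae_eq_zero_of_lorentzNorm (ht htT)] with x hx
  exact sub_eq_zero.1 (enorm_eq_zero.1 hx)

end NSLorentz

end

noncomputable section

open MeasureTheory Set Filter
open scoped ENNReal Topology

namespace NSLorentz

variable {n : ℕ}

/-! ### The semigroup property of the integral equation -/

theorem lintegral_heatK_sub {s : ℝ} (hs : 0 < s) (x : Sp n) :
    ∫⁻ y, ENNReal.ofReal (heatK s (x - y)) = 1 := by
  rw [lintegral_sub_left_eq_self (μ := (volume : Measure (Sp n)))
    (fun y => ENNReal.ofReal (heatK s y)) x]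
  exact lintegral_heatK hs

theorem integrable_heatK_sub {s : ℝ} (hs : 0 < s) (x : Sp n) :
    Integrable fun y => heatK s (x - y) :=
  (integrable_heatK hs).comp_sub_left x

theorem integrable_heatK_mul {s : ℝ} (hs : 0 < s) (x : Sp n) {g : Sp n → ℝ} (hg : Measurable g)
    {c : ℝ≥0∞} (hc : c ≠ ∞) (h : ∀ y, ‖g y‖ₑ ≤ c) : Integrable fun y => heatK s (x - y) * g y := by
  refine (integrable_heatK_sub hs x).mul_bdd (c := c.toReal) hg.aestronglyMeasurable
    (ae_of_all _ fun y => ?_)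
  have := ENNReal.toReal_mono hc (h y)
  rwa [toReal_enorm] at this

/-- Fubini's theorem for the heat flow of a parametrized integral. -/
theorem integral_heatK_mul_integral {s : ℝ} (hs : 0 < s) (x : Sp n) {Z : Type*} [MeasurableSpace Z]
    {ν : Measure Z} [SFinite ν] {K : Sp n → Z → ℝ} (hK : Measurable (Function.uncurry K))
    {c : ℝ≥0∞} (hc : c ≠ ∞) (h : ∀ y, ∫⁻ z, ‖K y z‖ₑ ∂ν ≤ c) :
    ∫ y, heatK s (x - y) * ∫ z, K y z ∂ν = ∫ z, (∫ y, heatK s (x - y) * K y z) ∂ν := by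
  have hm : Measurable (Function.uncurry fun y z => heatK s (x - y) * K y z) :=
    (((measurable_heatK_right s).comp (by fun_prop : Measurable fun y : Sp n => x - y)).comp
      measurable_fst).mul hK
  rw [← integral_integral_swap]
  · refine integral_congr_ae (ae_of_all _ fun y => ?_)
    exact (integral_const_mul _ _).symm
  · refine ⟨hm.aestronglyMeasurable, ?_⟩
    rw [hasFiniteIntegral_iff_enorm, lintegral_prod _ hm.enorm.aemeasurable]
    calc _ ≤ ∫⁻ y, ENNReal.ofReal (heatK s (x - y)) * c := by
          refine lintegral_mono fun y => ?_
          simp only [Function.uncurry, enorm_mul]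
          rw [lintegral_const_mul' _ _ enorm_ne_top, Real.enorm_of_nonneg (heatK_nonneg hs.le _)]
          gcongr
          exact h y
      _ = c := by
          rw [lintegral_mul_const' _ _ hc, lintegral_heatK_sub hs, one_mul]
      _ < ∞ := hc.lt_top

theorem integral_heatK_mul_heatK {s t : ℝ} (hs : 0 < s) (ht : 0 < t) (x z : Sp n) :
    ∫ y, heatK s (x - y) * heatK t (y - z) = heatK (s + t) (x - z) := by
  rw [← conv_heatK_heatK hs ht]
  refine Eq.trans ?_ (integral_sub_right_eq_self (fun y => heatK s (x - z - y) * heatK t y) z)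
  refine integral_congr_ae (ae_of_all _ fun y => ?_)
  simp only [sub_sub_sub_cancel_right]

theorem integral_heatK_mul_gradK (i j k : Fin n) {s t : ℝ} (hs : 0 < s) (ht : 0 < t) (x z : Sp n) :
    ∫ y, heatK s (x - y) * gradK i j k t (y - z) = gradK i j k (s + t) (x - z) := by
  rw [← conv_heatK_gradK i j k hs ht]
  refine Eq.trans ?_ (integral_sub_right_eq_self
    (fun y => heatK s (x - z - y) * gradK i j k t y) z)
  refine integral_congr_ae (ae_of_all _ fun y => ?_)
  simp only [sub_sub_sub_cancel_right]

theorem enorm_gradK_le (i j k : Fin n) (t : ℝ) (x : Sp n) : ‖gradK i j k t x‖ₑ ≤ gradMaj t x := by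
  have h1 := Finset.single_le_sum (f := fun k => ‖gradK i j k t x‖ₑ) (fun _ _ => bot_le)
    (Finset.mem_univ k)
  have h2 := Finset.single_le_sum (f := fun j => ∑ k, ‖gradK i j k t x‖ₑ) (fun _ _ => bot_le)
    (Finset.mem_univ j)
  have h3 := Finset.single_le_sum (f := fun i => ∑ j, ∑ k, ‖gradK i j k t x‖ₑ)
    (fun _ _ => bot_le) (Finset.mem_univ i)
  exact h1.trans (h2.trans h3)

theorem measurable_gradK_right (i j k : Fin n) (t : ℝ) : Measurable fun x : Sp n => gradK i j k t x := by
  have h : Measurable (Function.uncurry (gradK i j k)) := measurable_gradK i j k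
  exact h.of_uncurry_left

theorem integrable_heatK_mul_gradK (i j k : Fin n) {s t : ℝ} (hs : 0 < s) (ht : 0 < t)
    (x z : Sp n) : Integrable fun y => heatK s (x - y) * gradK i j k t (y - z) :=
  integrable_heatK_mul hs x (g := fun y => gradK i j k t (y - z))
    ((measurable_gradK_right i j k t).comp (by fun_prop))
    (c := ENNReal.ofReal (kerC n) * ENNReal.ofReal t ^ (-((n : ℝ) + 1) / 2))
    (ENNReal.mul_ne_top ENNReal.ofReal_ne_top (rpow_ne_top_of_pos ht _))
    fun y => (enorm_gradK_le i j k t _).trans (gradMaj_le ht _)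

theorem heatS_heatS {f : Sp n → Sp n} (hf : Measurable f) {s t : ℝ} (hs : 0 < s) (ht : 0 < t)
    {c : ℝ≥0∞} (hc : c ≠ ∞) (h : ∀ y, heatMaj f t y ≤ c) (x : Sp n) :
    heatS (heatS f t) s x = heatS f (s + t) x := by
  unfold heatS
  congr 1
  ext i
  have hm : Measurable (Function.uncurry fun (y z : Sp n) => heatK t (y - z) * f z i) :=
    ((measurable_heatK_right t).comp (by fun_prop : Measurable fun w : Sp n × Sp n => w.1 - w.2)).mul
      ((measurable_coord i).comp (hf.comp measurable_snd))
  have := integral_heatK_mul_integral hs x hm hc fun y => by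
    refine le_trans (lintegral_mono fun z => ?_) (h y)
    rw [enorm_mul, Real.enorm_of_nonneg (heatK_nonneg ht.le _)]
    gcongr
    exact enorm_coord_le _ _
  rw [this]
  refine integral_congr_ae (ae_of_all _ fun z => ?_)
  simp only
  rw [← integral_heatK_mul_heatK hs ht x z, ← integral_mul_const]
  refine integral_congr_ae (ae_of_all _ fun y => ?_)
  simp only
  ring

theorem bilinB_apply_eq {u : ℝ → Sp n → Sp n} {t : ℝ} {x : Sp n} (h : BilinDefined u u t x)
    (i : Fin n) : bilinB u u t x i = ∫ z, bilinIntegrand u u i t x z.1 z.2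
      ∂((volume.restrict (Ioo 0 t)).prod (volume : Measure (Sp n))) := by
  rw [integral_prod _ ((bilinDefined_iff u u t x).1 h i)]
  rfl

theorem enorm_bilinIntegrand_le (u : ℝ → Sp n → Sp n) (i : Fin n) {s t : ℝ} (hs : s < t)
    (x y : Sp n) : ‖bilinIntegrand u u i t x s y‖ₑ
      ≤ gradMaj (t - s) (x - y) * (‖u s y‖ₑ * ‖u s y‖ₑ) :=
  (Finset.single_le_sum (f := fun i => ‖bilinIntegrand u u i t x s y‖ₑ)
    (fun _ _ => bot_le) (Finset.mem_univ i)).trans (sum_enorm_bilinIntegrand_le u u hs x y)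

/-- The heat flow of `B[u,u](t₀)` is the part of `B[u,u](t)` that comes from times before `t₀`. -/
theorem heatS_bilinB {u : ℝ → Sp n → Sp n} (hu : Measurable (Function.uncurry u)) {s t₀ : ℝ}
    (hs : 0 < s) {c : ℝ≥0∞} (hc : c ≠ ∞)
    (h : ∀ y, duhMaj (fun s y => ‖u s y‖ₑ * ‖u s y‖ₑ) t₀ y ≤ c) (x : Sp n) (i : Fin n) :
    heatS (bilinB u u t₀) s x i = ∫ z, bilinIntegrand u u i (s + t₀) x z.1 z.2
      ∂((volume.restrict (Ioo 0 t₀)).prod (volume : Measure (Sp n))) := by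
  set ν := (volume.restrict (Ioo 0 t₀)).prod (volume : Measure (Sp n)) with hν
  set K : Sp n → ℝ × Sp n → ℝ := fun y z => ∑ j : Fin n, ∑ k : Fin n,
    gradK i j k (t₀ - z.1) (y - z.2) * (u z.1 z.2 j * u z.1 z.2 k) with hK
  have hKm : Measurable (Function.uncurry K) := (measurable_bilin_kernel hu hu i).comp
    (f := fun w : Sp n × (ℝ × Sp n) => (((t₀, w.1), w.2.1), w.2.2)) (by fun_prop)
  have hbd : ∀ y, BilinDefined u u t₀ y := fun y =>
    bilinDefined_of_lt_top hu hu ((h y).trans_lt hc.lt_top)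
  have hKeq : ∀ y, ∀ᵐ z ∂ν, bilinIntegrand u u i t₀ y z.1 z.2 = K y z := fun y => by
    filter_upwards [ae_time_prod t₀] with z hz
    exact bilinIntegrand_eq u u i hz.2 y z.2
  have hKc : ∀ y, ∫⁻ z, ‖K y z‖ₑ ∂ν ≤ c := fun y => by
    refine le_trans ?_ (h y)
    rw [lintegral_prod _ (hKm.of_uncurry_left (x := y)).enorm.aemeasurable]
    refine setLIntegral_mono' measurableSet_Ioo fun s hs => lintegral_mono fun z => ?_
    simp only [hK]
    rw [← bilinIntegrand_eq u u i hs.2 y z]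
    exact enorm_bilinIntegrand_le u i hs.2 y z
  have e1 : heatS (bilinB u u t₀) s x i = ∫ y, heatK s (x - y) * ∫ z, K y z ∂ν := by
    refine integral_congr_ae (ae_of_all _ fun y => ?_)
    simp only
    rw [bilinB_apply_eq (hbd y), integral_congr_ae (hKeq y)]
  rw [e1, integral_heatK_mul_integral hs x hKm hc hKc]
  refine integral_congr_ae ?_
  filter_upwards [ae_time_prod t₀] with z hz
  have hz' : 0 < t₀ - z.1 := sub_pos.2 hz.2
  rw [bilinIntegrand_eq u u i (by linarith [hz.2] : z.1 < s + t₀) x z.2]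
  have hint : ∀ j k, Integrable fun y => heatK s (x - y) *
      (gradK i j k (t₀ - z.1) (y - z.2) * (u z.1 z.2 j * u z.1 z.2 k)) := fun j k => by
    simp_rw [← mul_assoc (heatK _ _)]
    exact (integrable_heatK_mul_gradK i j k hs hz' x z.2).mul_const _
  simp only [hK, Finset.mul_sum]
  rw [integral_finsetSum _ fun j _ => integrable_finsetSum _ fun k _ => hint j k]
  refine Finset.sum_congr rfl fun j _ => ?_
  rw [integral_finsetSum _ fun k _ => hint j k]
  refine Finset.sum_congr rfl fun k _ => ?_
  simp_rw [← mul_assoc (heatK _ _)]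
  rw [integral_mul_const, integral_heatK_mul_gradK i j k hs hz', add_sub_assoc]

theorem duhMaj_shift_le (F : ℝ → Sp n → ℝ≥0∞) {t₀ : ℝ} (ht₀ : 0 ≤ t₀) (t : ℝ) (x : Sp n) :
    duhMaj (fun s y => F (t₀ + s) y) t x ≤ duhMaj F (t₀ + t) x := by
  unfold duhMaj
  have e : ∀ s : ℝ, t - s = t₀ + t - (t₀ + s) := fun s => by ring
  simp_rw [e]
  rw [← lintegral_indicator measurableSet_Ioo, ← lintegral_indicator measurableSet_Ioo]
  refine le_trans ?_ (lintegral_add_left_eq_self (μ := (volume : Measure ℝ)) _ t₀).le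
  refine lintegral_mono fun s => ?_
  by_cases hs : s ∈ Ioo 0 t
  · rw [indicator_of_mem hs, indicator_of_mem (show t₀ + s ∈ Ioo 0 (t₀ + t) from
      ⟨by linarith [hs.1], by linarith [hs.2]⟩)]
  · rw [indicator_of_notMem hs]; exact zero_le

theorem integral_bilin_split {u : ℝ → Sp n → Sp n} {t₀ t : ℝ} (ht₀ : 0 < t₀) (ht : 0 < t)
    {x : Sp n} (h : BilinDefined u u (t₀ + t) x) (i : Fin n) :
    bilinB u u (t₀ + t) x i = (∫ z, bilinIntegrand u u i (t₀ + t) x z.1 z.2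
      ∂((volume.restrict (Ioo 0 t₀)).prod (volume : Measure (Sp n)))) +
      bilinB (fun s => u (t₀ + s)) (fun s => u (t₀ + s)) t x i := by
  have hi := (bilinDefined_iff u u (t₀ + t) x).1 h i
  have hi₀ : Integrable (fun z : ℝ × Sp n => bilinIntegrand u u i (t₀ + t) x z.1 z.2)
      ((volume.restrict (Ioo 0 t₀)).prod (volume : Measure (Sp n))) := by
    refine hi.mono_measure ?_
    exact Measure.prod_mono (Measure.restrict_mono (Ioo_subset_Ioo_right (by linarith)) le_rfl) le_rfl
  have hg : IntegrableOn (fun s => ∫ y : Sp n, bilinIntegrand u u i (t₀ + t) x s y)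
    (Ioo 0 (t₀ + t)) := hi.integral_prod_left
  rw [integral_prod _ hi₀]
  have e1 : bilinB u u (t₀ + t) x i
      = ∫ s in Ioo 0 (t₀ + t), ∫ y : Sp n, bilinIntegrand u u i (t₀ + t) x s y := rfl
  have e2 : bilinB (fun s => u (t₀ + s)) (fun s => u (t₀ + s)) t x i
      = ∫ s in Ioo 0 t, ∫ y : Sp n, bilinIntegrand u u i (t₀ + t) x (t₀ + s) y := by
    refine integral_congr_ae (ae_of_all _ fun s => ?_)
    simp only [bilinIntegrand]
    rw [show t₀ + t - (t₀ + s) = t - s by ring]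
  have e3 : ∫ s in Ioo 0 t, ∫ y : Sp n, bilinIntegrand u u i (t₀ + t) x (t₀ + s) y
      = ∫ s in Ioo t₀ (t₀ + t), ∫ y : Sp n, bilinIntegrand u u i (t₀ + t) x s y := by
    rw [← integral_indicator measurableSet_Ioo, ← integral_indicator measurableSet_Ioo]
    refine Eq.trans ?_ (integral_add_left_eq_self (μ := (volume : Measure ℝ)) _ t₀)
    congr 1
    ext s
    simp only [indicator, mem_Ioo]
    refine if_congr ⟨fun h => ⟨by linarith [h.1], by linarith [h.2]⟩,
      fun h => ⟨by linarith [h.1], by linarith [h.2]⟩⟩ rfl rfl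
  rw [e1, e2, e3]
  have hU : Ioo 0 (t₀ + t) = Ioc 0 t₀ ∪ Ioo t₀ (t₀ + t) := by
    rw [Ioc_union_Ioo_eq_Ioo ht₀.le (by linarith)]
  rw [hU] at hg ⊢
  rw [setIntegral_union _ measurableSet_Ioo hg.left_of_union hg.right_of_union,
    integral_Ioc_eq_integral_Ioo]
  exact disjoint_left.2 fun s h1 h2 => h2.1.not_ge h1.2

theorem enorm_le_of_mildAt {f : Sp n → Sp n} {u : ℝ → Sp n → Sp n} {t : ℝ} (ht : 0 < t) {x : Sp n}
    (h : MildAt f u t x) : ‖u t x‖ₑ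
      ≤ n * heatMaj f t x + duhMaj (fun s y => ‖u s y‖ₑ * ‖u s y‖ₑ) t x := by
  rw [h.2.2]
  exact enorm_sub_le.trans (add_le_add (enorm_heatS_le f ht x) (enorm_bilinB_le u u t x))

/-- The integral equation may be restarted at a later time. -/
theorem mildAt_restart {f : Sp n → Sp n} (hf : Measurable f) {u : ℝ → Sp n → Sp n}
    (hu : Measurable (Function.uncurry u)) {t₀ t : ℝ} (ht₀ : 0 < t₀) (ht : 0 < t) {x : Sp n}
    {c : ℝ≥0∞} (hc : c ≠ ∞) (h1 : ∀ y, heatMaj f t₀ y ≤ c)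
    (h2 : ∀ y, duhMaj (fun s y => ‖u s y‖ₑ * ‖u s y‖ₑ) t₀ y ≤ c) (h0 : ∀ y, MildAt f u t₀ y)
    (h3 : heatMaj f (t₀ + t) x < ∞)
    (h4 : duhMaj (fun s y => ‖u s y‖ₑ * ‖u s y‖ₑ) (t₀ + t) x < ∞) :
    MildAt f u (t₀ + t) x ↔ MildAt (u t₀) (fun s => u (t₀ + s)) t x := by
  have hus : Measurable (Function.uncurry fun s => u (t₀ + s)) :=
    hu.comp (f := fun z : ℝ × Sp n => (t₀ + z.1, z.2)) (by fun_prop)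
  have hut : Measurable (u t₀) := hu.of_uncurry_left
  have hb : BilinDefined u u (t₀ + t) x := bilinDefined_of_lt_top hu hu h4
  have hbs : BilinDefined (fun s => u (t₀ + s)) (fun s => u (t₀ + s)) t x :=
    bilinDefined_of_lt_top hus hus ((duhMaj_shift_le (fun s y => ‖u s y‖ₑ * ‖u s y‖ₑ) ht₀.le t
      x).trans_lt h4)
  have hd : HeatDefined f (t₀ + t) x := heatDefined_of_lt_top hf (by linarith) h3
  have hub : ∀ y, ‖u t₀ y‖ₑ ≤ n * c + c := fun y =>
    (enorm_le_of_mildAt ht₀ (h0 y)).trans (add_le_add (by gcongr; exact h1 y) (h2 y))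
  have hct : (n : ℝ≥0∞) * c + c ≠ ∞ :=
    ENNReal.add_ne_top.2 ⟨ENNReal.mul_ne_top (ENNReal.natCast_ne_top n) hc, hc⟩
  have hds : HeatDefined (u t₀) t x := fun i => integrable_heatK_mul ht x
    ((measurable_coord i).comp hut) hct fun y => (enorm_coord_le _ i).trans (hub y)
  -- Applying the heat flow to u(t₀) = S[f](t₀) - B[u,u](t₀) gives S[f](t₀+t) minus the part of the
  -- Duhamel integral over (0,t₀); the shifted bilinear term is the part over (t₀, t₀+t).
  have key : heatS (u t₀) t x - bilinB (fun s => u (t₀ + s)) (fun s => u (t₀ + s)) t x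
      = heatS f (t₀ + t) x - bilinB u u (t₀ + t) x := by
    have hB : Measurable (Function.uncurry (bilinB u u)) := measurable_bilinB hu hu
    have hS : Measurable (Function.uncurry (heatS f)) := measurable_heatS hf
    have e : heatS (u t₀) t x = heatS (heatS f t₀) t x - heatS (bilinB u u t₀) t x := by
      ext i
      have i1 : Integrable fun y => heatK t (x - y) * heatS f t₀ y i :=
        integrable_heatK_mul ht x ((measurable_coord i).comp hS.of_uncurry_left)
          (c := n * c) (ENNReal.mul_ne_top (ENNReal.natCast_ne_top n) hc) fun y =>
          (enorm_coord_le _ i).trans ((enorm_heatS_le f ht₀ y).trans (by gcongr; exact h1 y))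
      have i2 : Integrable fun y => heatK t (x - y) * bilinB u u t₀ y i :=
        integrable_heatK_mul ht x ((measurable_coord i).comp hB.of_uncurry_left) hc fun y =>
          (enorm_coord_le _ i).trans ((enorm_bilinB_le u u t₀ y).trans (h2 y))
      have := integral_sub i1 i2
      refine Eq.trans ?_ this
      refine integral_congr_ae (ae_of_all _ fun y => ?_)
      simp only
      rw [(h0 y).2.2, PiLp.sub_apply, mul_sub]
    rw [e, heatS_heatS hf ht ht₀ hc h1, add_comm t t₀]
    ext i
    have h5 := heatS_bilinB hu ht hc h2 x i
    have h6 := integral_bilin_split ht₀ ht hb i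
    rw [add_comm t t₀] at h5
    simp only [PiLp.sub_apply]
    rw [h5, h6]
    ring
  constructor
  · rintro ⟨_, _, h⟩
    exact ⟨hds, hbs, h.trans key.symm⟩
  · rintro ⟨_, _, h⟩
    exact ⟨hd, hb, h.trans key⟩

end NSLorentz

end

noncomputable section

open MeasureTheory Set Filter
open scoped ENNReal Topology

namespace NSLorentz

variable {n : ℕ}

/-! ### Bounded-rate solutions -/

theorem exists_rpow_mul_le {e : ℝ} (he : 0 < e) {K ε : ℝ≥0∞} (hK : K ≠ ∞) (hε : ε ≠ 0) :
    ∃ δ : ℝ, 0 < δ ∧ ENNReal.ofReal δ ^ e * K ≤ ε := by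
  obtain ⟨l, hl, h⟩ := exists_rpow_neg_mul_le he hK hε
  refine ⟨l⁻¹, inv_pos.2 hl, ?_⟩
  rwa [ENNReal.ofReal_inv_of_pos hl, ENNReal.inv_rpow, ← ENNReal.rpow_neg]

/-- The rearrangement at t is at most M t^{1/α-a} t^{-1/α}, and the first power is small for t < δ.
For t ≥ δ it vanishes, since the interval has length at most δ. -/
theorem smallWeak_of_le {α : ℝ≥0∞} {T a : ℝ} {M : ℝ≥0∞} (hM : M ≠ ∞) (ha0 : 0 ≤ a)
    (ha : a < (α⁻¹).toReal) {ψ : ℝ → ℝ≥0∞}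
    (h : ∀ t ∈ Ioo 0 T, ψ t ≤ M * ENNReal.ofReal t ^ (-a)) : SmallWeak α T ψ := by
  intro ε hε
  obtain ⟨δ, hδ, H⟩ := exists_rpow_mul_le (sub_pos.2 ha) hM hε
  refine ⟨δ, hδ, fun x y hx hy hxy => lorentzNorm_top_le fun t ht => ?_⟩
  rcases lt_or_ge t δ with htδ | htδ
  · calc rearr volume ((Ioo x y).indicator ψ) t ≤ M * ENNReal.ofReal t ^ (-a) := by
          rw [rearr_le_iff]
          calc _ ≤ volume (Ioo 0 t) := by
                refine measure_mono fun s hs => ?_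
                by_cases hsI : s ∈ Ioo x y
                · rw [mem_ofPred_eq, indicator_of_mem hsI] at hs
                  have hs0 : 0 < s := hx.trans_lt hsI.1
                  refine ⟨hs0, lt_of_not_ge fun hts => hs.not_ge ?_⟩
                  refine (h s ⟨hs0, hsI.2.trans_le hy⟩).trans ?_
                  rw [ENNReal.rpow_neg, ENNReal.rpow_neg]
                  gcongr
                · rw [mem_ofPred_eq, indicator_of_notMem hsI] at hs
                  exact absurd hs not_lt_zero
            _ = ENNReal.ofReal t := by rw [Real.volume_Ioo, sub_zero]
      _ = ENNReal.ofReal t ^ ((α⁻¹).toReal - a) * M * ENNReal.ofReal t ^ (-(α⁻¹).toReal) := by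
          rw [show -a = ((α⁻¹).toReal - a) + -(α⁻¹).toReal by ring, ← ofReal_rpow_mul ht]; ring
      _ ≤ ENNReal.ofReal δ ^ ((α⁻¹).toReal - a) * M * ENNReal.ofReal t ^ (-(α⁻¹).toReal) := by
          exact mul_le_mul' (mul_le_mul' (rpow_le_of_le (sub_pos.2 ha).le htδ.le) le_rfl) le_rfl
      _ ≤ _ := by gcongr
  · refine le_trans (b := 0) ?_ zero_le
    rw [rearr_le_iff]
    calc _ ≤ volume (Ioo x y) := measure_mono fun s hs => by
          by_contra hsI
          rw [mem_ofPred_eq, indicator_of_notMem hsI] at hs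
          exact lt_irrefl _ hs
      _ ≤ ENNReal.ofReal t := by
          rw [Real.volume_Ioo]; exact ENNReal.ofReal_le_ofReal (hxy.trans htδ)

/-- `|u(t,x)| ≤ M t^{-a}` on `(0,T) × ℝⁿ`. -/
def RateBound (a : ℝ) (M : ℝ≥0∞) (T : ℝ) (u : ℝ → Sp n → Sp n) : Prop :=
  ∀ t ∈ Ioo 0 T, ∀ x, ‖u t x‖ₑ ≤ M * ENNReal.ofReal t ^ (-a)

theorem RateBound.weaken {a a' T : ℝ} {M : ℝ≥0∞} {u : ℝ → Sp n → Sp n} (h : RateBound a M T u)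
    (haa : a ≤ a') : RateBound a' (M * ENNReal.ofReal T ^ (a' - a)) T u := by
  intro t ht x
  refine (h t ht x).trans ?_
  rw [show -a = (a' - a) + -a' by ring, ← ofReal_rpow_mul ht.1, ← mul_assoc]
  exact mul_le_mul' (mul_le_mul' le_rfl (rpow_le_of_le (sub_nonneg.2 haa) ht.2.le)) le_rfl

theorem RateBound.mono {a T T' : ℝ} {M : ℝ≥0∞} {u : ℝ → Sp n → Sp n} (h : RateBound a M T u)
    (hT : T' ≤ T) : RateBound a M T' u :=
  fun t ht x => h t ⟨ht.1, ht.2.trans_le hT⟩ x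

/-- The square of the rate is s^{-2a}, integrable against (t-s)^{-1/2} because a < 1/2. This is why
σ > -1 is the natural class. -/
theorem RateBound.exists_duhMaj_le {a M T} {u : ℝ → Sp n → Sp n} (h : RateBound a M T u)
    (hM : M ≠ ∞) (ha : a < 1 / 2) {t : ℝ} (ht : 0 < t) (htT : t ≤ T) :
    ∃ c : ℝ≥0∞, c ≠ ∞ ∧ ∀ x, duhMaj (fun s y => ‖u s y‖ₑ * ‖u s y‖ₑ) t x ≤ c := by
  refine ⟨ENNReal.ofReal (kerC n) * M ^ 2 * (ENNReal.ofReal t ^ (1 - 1 / 2 - 2 * a) *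
    betaL (1 / 2) (2 * a)), ENNReal.mul_ne_top (ENNReal.mul_ne_top ENNReal.ofReal_ne_top
      (ENNReal.pow_ne_top hM)) (ENNReal.mul_ne_top (rpow_ne_top_of_pos ht _)
        (betaL_ne_top (by norm_num) (by linarith))), fun x => ?_⟩
  refine (duhMaj_le_of_le (c := fun s => M ^ 2 * ENNReal.ofReal s ^ (-(2 * a)))
    (fun s hs => ae_of_all _ fun y => ?_) x).trans_eq ?_
  · have := h s ⟨hs.1, hs.2.trans_le htT⟩ y
    refine (mul_le_mul' this this).trans_eq ?_
    rw [show -(2 * a) = -a + -a by ring, ← ofReal_rpow_mul hs.1]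
    ring
  · rw [← lintegral_beta ht, ← lintegral_const_mul _ (by fun_prop)]
    refine lintegral_congr fun s => ?_
    ring

/-- Globally measurable solutions on `(0,T)` with `|u(t,x)| ≤ M t^{-a}`, `a < 1/2`, locally in
time. -/
def RateSol (f : Sp n → Sp n) (T : ℝ≥0∞) (u : ℝ → Sp n → Sp n) : Prop :=
  Measurable (Function.uncurry u) ∧ MildEverywhere f T u ∧ ∃ a : ℝ, 0 ≤ a ∧ a < 1 / 2 ∧
    ∀ T' : ℝ, 0 < T' → ENNReal.ofReal T' < T → ∃ M : ℝ≥0∞, M ≠ ∞ ∧ RateBound a M T' u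

theorem exists_between_time {T : ℝ≥0∞} {t : ℝ} (ht : t ∈ timeI T) :
    ∃ T' : ℝ, t < T' ∧ ENNReal.ofReal T' < T := by
  obtain ⟨r, _, h1, h2⟩ := ENNReal.lt_iff_exists_real_btwn.1 ht.2
  exact ⟨r, (ENNReal.ofReal_lt_ofReal_iff_of_nonneg ht.1.le).1 h1, h2⟩

theorem mem_timeI_of_lt {T : ℝ≥0∞} {t T' : ℝ} (ht : 0 < t) (htT : t ≤ T')
    (hT : ENNReal.ofReal T' < T) : t ∈ timeI T :=
  ⟨ht, (ENNReal.ofReal_le_ofReal htT).trans_lt hT⟩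

theorem mildAt_congr {f : Sp n → Sp n} {u v : ℝ → Sp n → Sp n} {t : ℝ} {x : Sp n}
    (h : ∀ s ∈ Ioc 0 t, ∀ y, u s y = v s y) (ht : 0 < t) : MildAt f u t x ↔ MildAt f v t x := by
  have h' : ∀ s ∈ Ioo 0 t, ∀ y, u s y = v s y := fun s hs => h s ⟨hs.1, hs.2.le⟩
  unfold MildAt
  rw [bilinDefined_congr h' h', bilinB_congr h' h', h t ⟨ht, le_rfl⟩ x]

theorem mildEverywhere_congr {f : Sp n → Sp n} {T : ℝ≥0∞} {u v : ℝ → Sp n → Sp n}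
    (h : ∀ t ∈ timeI T, ∀ x, u t x = v t x) (hu : MildEverywhere f T u) : MildEverywhere f T v :=
  fun t ht x => (mildAt_congr (fun s hs => h s ⟨hs.1,
    (ENNReal.ofReal_le_ofReal hs.2).trans_lt ht.2⟩) ht.1).1 (hu t ht x)

/-- The restriction of `u` to `(0,T) × ℝⁿ`, extended by zero. -/
def cutTime (T : ℝ≥0∞) (u : ℝ → Sp n → Sp n) (t : ℝ) (x : Sp n) : Sp n :=
  (timeI T ×ˢ (univ : Set (Sp n))).indicator (fun z : ℝ × Sp n => u z.1 z.2) (t, x)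

theorem cutTime_eq {T : ℝ≥0∞} (u : ℝ → Sp n → Sp n) {t : ℝ} (ht : t ∈ timeI T) (x : Sp n) :
    cutTime T u t x = u t x :=
  indicator_of_mem (show (t, x) ∈ timeI T ×ˢ univ from ⟨ht, mem_univ x⟩) _

theorem cutTime_eq_zero {T : ℝ≥0∞} (u : ℝ → Sp n → Sp n) {t : ℝ} (ht : t ∉ timeI T) (x : Sp n) :
    cutTime T u t x = 0 :=
  indicator_of_notMem (show (t, x) ∉ timeI T ×ˢ univ from fun h => ht h.1) _

theorem measurable_cutTime {T : ℝ≥0∞} {u : ℝ → Sp n → Sp n}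
    (h : ∀ T' : ℝ≥0∞, 0 < T' → T' < T → MeasOn T' u) : Measurable (Function.uncurry (cutTime T u)) := by
  rcases eq_or_ne T 0 with rfl | hT
  · have : Function.uncurry (cutTime 0 u) = fun _ => 0 := by
      ext1 z
      exact cutTime_eq_zero u (fun hz => not_lt_zero hz.2) z.2
    rw [this]; exact measurable_const
  obtain ⟨τ, hτ, hτI, hlim⟩ := exists_seq_strictMono_tendsto' (pos_iff_ne_zero.2 hT)
  refine measurable_of_tendsto_metrizable (f := fun k => Function.uncurry (cutTime (τ k) u))
    (fun k => h (τ k) (hτI k).1 (hτI k).2) (tendsto_pi_nhds.2 fun z => ?_)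
  by_cases hz : z.1 ∈ timeI T
  · refine tendsto_const_nhds.congr' ?_
    filter_upwards [hlim.eventually_const_lt hz.2] with k hk
    exact (cutTime_eq u hz z.2).trans (cutTime_eq u ⟨hz.1, hk⟩ z.2).symm
  · have e : Function.uncurry (cutTime T u) z = 0 := cutTime_eq_zero u hz z.2
    rw [e]
    refine tendsto_const_nhds.congr fun k => ?_
    exact (cutTime_eq_zero u (fun h => hz ⟨h.1, h.2.trans (hτI k).2⟩) z.2).symm

theorem rpow_mul_le_iff_le_mul {t : ℝ} (ht : 0 < t) (σ : ℝ) (N M : ℝ≥0∞) :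
    ENNReal.ofReal t ^ (-σ / 2) * N ≤ M ↔ N ≤ M * ENNReal.ofReal t ^ (σ / 2) := by
  have := rpow_mul_le_iff ht (-σ / 2) (x := N) (y := M)
  rwa [show -(-σ / 2) = σ / 2 by ring] at this

/-- If `u ∈ 𝓙^σ_{p,q}(T)`, then `‖u(t)‖ ≤ M t^{σ/2}` on `(0,T)`. -/
theorem MemJ.exists_le {σ T : ℝ} {p : Expo} {q : ℝ≥0∞} {u : ℝ → Sp n → Sp n}
    (h : MemJ σ p q (ENNReal.ofReal T) u) : ∃ M : ℝ≥0∞, M ≠ ∞ ∧ ∀ t ∈ Ioo 0 T,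
      spNorm p q (u t) ≤ M * ENNReal.ofReal t ^ (σ / 2) := by
  refine ⟨_, h.2.ne, fun t ht => (rpow_mul_le_iff_le_mul ht.1 _ _ _).1 ?_⟩
  exact le_iSup₂ (f := fun (t : ℝ) (_ : t ∈ timeI (ENNReal.ofReal T)) =>
    ENNReal.ofReal t ^ (-σ / 2) * spNorm p q (u t)) t (mem_timeI_ofReal.2 ht)

/-- Characterization of the spaces `𝓙^σ_{p,q}(T₋)` for globally measurable functions. -/
theorem memJm_iff {σ : ℝ} {p : Expo} {q T : ℝ≥0∞} {u : ℝ → Sp n → Sp n}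
    (hu : Measurable (Function.uncurry u)) : MemJm σ p q T u ↔
      ∀ T' : ℝ, 0 < T' → ENNReal.ofReal T' < T → ∃ M : ℝ≥0∞, M ≠ ∞ ∧ ∀ t ∈ Ioo 0 T',
        spNorm p q (u t) ≤ M * ENNReal.ofReal t ^ (σ / 2) := by
  constructor
  · intro h T' hT' hT
    exact (h (ENNReal.ofReal T') (ENNReal.ofReal_pos.2 hT') hT).exists_le
  · intro h T' hT' hT
    have hTt : T' ≠ ∞ := hT.ne_top
    have e := ENNReal.ofReal_toReal hTt
    obtain ⟨M, hM, H⟩ := h T'.toReal (ENNReal.toReal_pos hT'.ne' hTt) (by rwa [e])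
    refine ⟨measOn_of_measurable hu _, lt_of_le_of_lt (iSup₂_le fun t ht => ?_) hM.lt_top⟩
    rw [← e] at ht
    exact (rpow_mul_le_iff_le_mul ht.1 _ _ _).2 (H t (mem_timeI_ofReal.1 ht))

theorem rateBound_iff {a T : ℝ} {M : ℝ≥0∞} {u : ℝ → Sp n → Sp n} : RateBound a M T u ↔
    ∀ t ∈ Ioo 0 T, spNorm ⊤ ∞ (u t) ≤ M * ENNReal.ofReal t ^ (-a) :=
  ⟨fun h t ht => iSup_le fun x => h t ht x, fun h t ht x =>
    (le_iSup (fun x => ‖u t x‖ₑ) x).trans (h t ht)⟩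

theorem memJm_congr {σ : ℝ} {p : Expo} {q T : ℝ≥0∞} {u v : ℝ → Sp n → Sp n}
    (h : ∀ t ∈ timeI T, ∀ x, u t x = v t x) (hu : MemJm σ p q T u) : MemJm σ p q T v := by
  intro T' h0 hT
  have hs : ∀ t ∈ timeI T', u t = v t := fun t ht => funext (h t ⟨ht.1, ht.2.trans hT⟩)
  obtain ⟨h1, h2⟩ := hu T' h0 hT
  refine ⟨?_, ?_⟩
  · unfold MeasOn at h1 ⊢
    convert h1 using 1
    refine indicator_congr fun z hz => ?_
    rw [hs z.1 hz.1]
  · refine lt_of_le_of_lt (le_of_eq ?_) h2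
    exact iSup_congr fun t => iSup_congr fun ht => by rw [hs t ht]

theorem IsSol.exists_rateSol {f : Sp n → Sp n} {T : ℝ≥0∞} {u : ℝ → Sp n → Sp n} (h : IsSol f T u) :
    ∃ w, RateSol f T w ∧ ∀ t ∈ timeI T, ∀ x, w t x = u t x := by
  obtain ⟨⟨σ, hσ, hJ⟩, hmild⟩ := h
  have hm := measurable_cutTime fun T' h0 hT => (hJ T' h0 hT).1
  have hc : ∀ t ∈ timeI T, ∀ x, cutTime T u t x = u t x := fun t ht x => cutTime_eq u ht x
  refine ⟨cutTime T u, ⟨hm, mildEverywhere_congr (fun t ht x => (hc t ht x).symm) hmild,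
    -- The rate is -σ/2, raised to 0 when σ is positive; σ > -1 is what keeps it below 1/2.
    max (-σ / 2) 0, le_max_right _ _, max_lt (by linarith) (by norm_num), ?_⟩, hc⟩
  intro T' hT' hT
  obtain ⟨M, hM, H⟩ := (memJm_iff hm).1 (memJm_congr (fun t ht x => (hc t ht x).symm) hJ) T' hT' hT
  have hr : RateBound (-σ / 2) M T' (cutTime T u) := by
    rw [rateBound_iff, show -(-σ / 2) = σ / 2 by ring]; exact H
  exact ⟨_, ENNReal.mul_ne_top hM (rpow_ne_top_of_pos hT' _), hr.weaken (le_max_left _ _)⟩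

theorem RateSol.isSol {f : Sp n → Sp n} {T : ℝ≥0∞} {u : ℝ → Sp n → Sp n} (h : RateSol f T u) :
    IsSol f T u := by
  obtain ⟨hm, hmild, a, ha0, ha, H⟩ := h
  refine ⟨⟨-(2 * a), by linarith, (memJm_iff hm).2 fun T' hT' hT => ?_⟩, hmild⟩
  obtain ⟨M, hM, hr⟩ := H T' hT' hT
  refine ⟨M, hM, ?_⟩
  rw [show -(2 * a) / 2 = -a by ring]
  exact rateBound_iff.1 hr

theorem RateSol.mono {f : Sp n → Sp n} {T T' : ℝ≥0∞} {u : ℝ → Sp n → Sp n} (h : RateSol f T u)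
    (hT : T' ≤ T) : RateSol f T' u := by
  obtain ⟨hm, hmild, a, ha0, ha, H⟩ := h
  exact ⟨hm, fun t ht x => hmild t ⟨ht.1, ht.2.trans_le hT⟩ x, a, ha0, ha, fun S h0 hS =>
    H S h0 (hS.trans_le hT)⟩

theorem exists_expo {a : ℝ} (ha0 : 0 < a) (ha : a < 1 / 2) :
    ∃ α : ℝ≥0∞, 2 < α ∧ α ≠ ∞ ∧ (α⁻¹).toReal = a := by
  refine ⟨ENNReal.ofReal a⁻¹, ?_, ENNReal.ofReal_ne_top, ?_⟩
  · rw [show (2 : ℝ≥0∞) = ENNReal.ofReal 2 by simp, ENNReal.ofReal_lt_ofReal_iff (inv_pos.2 ha0),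
      lt_inv_comm₀ (by norm_num) ha0]
    linarith
  · rw [ENNReal.ofReal_inv_of_pos ha0, inv_inv, ENNReal.toReal_ofReal ha0.le]

theorem ae_mild_upgrade {f : Sp n → Sp n} {u v : ℝ → Sp n → Sp n} {t : ℝ}
    (h : ∀ᵐ s, s ∈ Ioo 0 t → ∀ᵐ y, u s y = v s y) {x : Sp n} (hu : MildAt f u t x)
    (hv : MildAt f v t x) : u t x = v t x := by
  rw [hu.2.2, hv.2.2, bilinB_congr_ae h h]

theorem RateSol.unique (hn : 1 ≤ n) {f : Sp n → Sp n} {T : ℝ≥0∞} {u v : ℝ → Sp n → Sp n}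
    (hu : RateSol f T u) (hv : RateSol f T v) {t : ℝ} (ht : t ∈ timeI T) (x : Sp n) :
    u t x = v t x := by
  obtain ⟨hum, humild, a, ha0, ha, Hu⟩ := hu
  obtain ⟨hvm, hvmild, b, hb0, hb, Hv⟩ := hv
  obtain ⟨T', htT', hT'⟩ := exists_between_time ht
  have hT0 : 0 < T' := ht.1.trans htT'
  obtain ⟨M, hM, hMu⟩ := Hu T' hT0 hT'
  obtain ⟨N, hN, hNv⟩ := Hv T' hT0 hT'
  have hc : max a b < 1 / 2 := max_lt ha hb
  have hc0 : 0 ≤ max a b := ha0.trans (le_max_left _ _)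
  -- Any 1/α strictly between the two rates and 1/2 works: above the rates gives smallness, below
  -- 1/2 gives α > 2. The spatial exponent is r = ∞.
  obtain ⟨α, hα2, hα, hαe⟩ := exists_expo (a := (max a b + 1 / 2) / 2) (by linarith) (by linarith)
  have hle : ∀ {w : ℝ → Sp n → Sp n} {e : ℝ} {L : ℝ≥0∞}, 0 ≤ e → e ≤ max a b → L ≠ ∞ →
      RateBound e L T' w →
      SmallWeak α T' fun t => lorentzNorm volume ∞ ∞ fun x => ‖w t x‖ₑ := by
    intro w e L he0 he hL hw
    refine smallWeak_of_le hL he0 (by rw [hαe]; linarith) fun s hs => ?_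
    exact lorentzNorm_top_top_le (ae_of_all _ fun x => hw s hs x)
  have hae := mild_ae_unique hn (r := ∞) (ENNReal.natCast_lt_top n) hα2 hα
    (by rw [hαe]; simp only [ENNReal.inv_top, ENNReal.toReal_zero, mul_zero]; linarith) hum hvm
    (hle ha0 (le_max_left _ _) hM hMu) (hle hb0 (le_max_right _ _) hN hNv)
    (ae_of_all _ fun s hs => ae_of_all _ (humild s (mem_timeI_of_lt hs.1 hs.2.le hT')))
    (ae_of_all _ fun s hs => ae_of_all _ (hvmild s (mem_timeI_of_lt hs.1 hs.2.le hT')))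
  refine ae_mild_upgrade ?_ (humild t ht x) (hvmild t ht x)
  filter_upwards [hae] with s hs hst using hs ⟨hst.1, hst.2.trans htT'⟩

/-- The data admitted in the existence theory. -/
def IsData (f : Sp n → Sp n) : Prop := ∃ p : ℝ≥0∞, (n : ℝ≥0∞) < p ∧ MemLorentz p ∞ f

theorem IsData.exists_heatMaj_le (hn : 1 ≤ n) {f : Sp n → Sp n} (h : IsData f) {t : ℝ}
    (ht : 0 < t) : ∃ c : ℝ≥0∞, c ≠ ∞ ∧ ∀ x, heatMaj f t x ≤ c := by
  obtain ⟨p, hp, hf, hfin⟩ := h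
  have hn1 : (1 : ℝ≥0∞) ≤ n := by exact_mod_cast hn
  exact ⟨_, ENNReal.mul_ne_top (ENNReal.mul_ne_top (hardyC_ne_top (hn1.trans_lt hp)) hfin.ne)
    (rpow_ne_top_of_pos ht _), fun x => heatMaj_le hf ht x⟩

theorem spNorm_infty_le_top (q : ℝ≥0∞) (f : Sp n → Sp n) :
    spNorm ((∞ : ℝ≥0∞) : Expo) ∞ f ≤ spNorm ⊤ q f :=
  lorentzNorm_top_top_le (ae_of_all _ fun x => le_iSup (fun x => ‖f x‖ₑ) x)

theorem RateSol.spNorm_top_lt {f : Sp n → Sp n} {T : ℝ≥0∞} {u : ℝ → Sp n → Sp n}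
    (h : RateSol f T u) {t : ℝ} (ht : t ∈ timeI T) : spNorm ⊤ ∞ (u t) < ∞ := by
  obtain ⟨_, _, a, _, _, H⟩ := h
  obtain ⟨T', htT', hT'⟩ := exists_between_time ht
  obtain ⟨M, hM, hMu⟩ := H T' (ht.1.trans htT') hT'
  exact (rateBound_iff.1 hMu t ⟨ht.1, htT'⟩).trans_lt
    (ENNReal.mul_lt_top hM.lt_top (rpow_ne_top_of_pos ht.1 _).lt_top)

theorem RateSol.memLorentz_infty {f : Sp n → Sp n} {T : ℝ≥0∞} {u : ℝ → Sp n → Sp n}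
    (h : RateSol f T u) {t : ℝ} (ht : t ∈ timeI T) : MemLorentz (∞ : ℝ≥0∞) ∞ (u t) :=
  ⟨h.1.of_uncurry_left, (spNorm_infty_le_top ∞ _).trans_lt (h.spNorm_top_lt ht)⟩

theorem mem_timeI_sub_iff {T : ℝ≥0∞} {t₀ s : ℝ} (ht₀ : 0 ≤ t₀) (hs : 0 < s) :
    s ∈ timeI (T - ENNReal.ofReal t₀) ↔ t₀ + s ∈ timeI T := by
  have e : ENNReal.ofReal s < T - ENNReal.ofReal t₀ ↔ ENNReal.ofReal (t₀ + s) < T := by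
    rw [lt_tsub_iff_left, ENNReal.ofReal_add ht₀ hs.le]
  exact ⟨fun h => ⟨by linarith, e.1 h.2⟩, fun h => ⟨hs, e.2 h.2⟩⟩

theorem RateSol.mildAt_iff (hn : 1 ≤ n) {f : Sp n → Sp n} (hf : IsData f) {t₀ t a : ℝ} {M : ℝ≥0∞}
    {u : ℝ → Sp n → Sp n} (hu : Measurable (Function.uncurry u)) (ht₀ : 0 < t₀) (ht : 0 < t)
    (hM : M ≠ ∞) (ha : a < 1 / 2) (hr : RateBound a M (t₀ + t) u) (h0 : ∀ y, MildAt f u t₀ y)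
    (x : Sp n) : MildAt f u (t₀ + t) x ↔ MildAt (u t₀) (fun s => u (t₀ + s)) t x := by
  obtain ⟨c₁, hc₁, h1⟩ := hf.exists_heatMaj_le hn ht₀
  obtain ⟨c₂, hc₂, h2⟩ := hr.exists_duhMaj_le hM ha ht₀ (by linarith)
  obtain ⟨c₃, hc₃, h3⟩ := hf.exists_heatMaj_le hn (by linarith : 0 < t₀ + t)
  obtain ⟨c₄, hc₄, h4⟩ := hr.exists_duhMaj_le hM ha (by linarith : 0 < t₀ + t) le_rfl
  obtain ⟨p, _, hfm, _⟩ := hf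
  exact mildAt_restart hfm hu ht₀ ht (c := max c₁ c₂) (by simp [hc₁, hc₂])
    (fun y => (h1 y).trans (le_max_left _ _)) (fun y => (h2 y).trans (le_max_right _ _)) h0
    ((h3 x).trans_lt hc₃.lt_top) ((h4 x).trans_lt hc₄.lt_top)

theorem RateSol.restart (hn : 1 ≤ n) {f : Sp n → Sp n} (hf : IsData f) {T : ℝ≥0∞}
    {u : ℝ → Sp n → Sp n} (h : RateSol f T u) {t₀ : ℝ} (ht₀ : t₀ ∈ timeI T) :
    RateSol (u t₀) (T - ENNReal.ofReal t₀) fun s => u (t₀ + s) := by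
  obtain ⟨hm, hmild, a, ha0, ha, H⟩ := h
  refine ⟨hm.comp (f := fun z : ℝ × Sp n => (t₀ + z.1, z.2)) (by fun_prop), fun s hs x => ?_, a,
    ha0, ha, fun S hS0 hST => ?_⟩
  · have hs' := (mem_timeI_sub_iff ht₀.1.le hs.1).1 hs
    obtain ⟨T', h1, h2⟩ := exists_between_time hs'
    obtain ⟨M, hM, hr⟩ := H T' (hs'.1.trans h1) h2
    exact (RateSol.mildAt_iff hn hf hm ht₀.1 hs.1 hM ha (hr.mono h1.le) (hmild t₀ ht₀) x).1
      (hmild _ hs' x)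
  · have hS' := (mem_timeI_sub_iff (T := T) ht₀.1.le hS0).1 ⟨hS0, hST⟩
    obtain ⟨M, hM, hr⟩ := H (t₀ + S) hS'.1 hS'.2
    refine ⟨M, hM, fun t ht x => (hr (t₀ + t) ⟨by linarith [ht.1, ht₀.1], by linarith [ht.2]⟩
      x).trans ?_⟩
    rw [ENNReal.rpow_neg, ENNReal.rpow_neg]
    gcongr
    linarith [ht₀.1]

theorem rateBound_of_parts {a T t₁ : ℝ} {M N : ℝ≥0∞} {u : ℝ → Sp n → Sp n} (ha : 0 ≤ a)
    (h1 : RateBound a M t₁ u) (h2 : ∀ t, t₁ ≤ t → t < T → ∀ x, ‖u t x‖ₑ ≤ N) :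
    RateBound a (M + N * ENNReal.ofReal T ^ a) T u := by
  intro t ht x
  rw [add_mul]
  rcases lt_or_ge t t₁ with h | h
  · exact (h1 t ⟨ht.1, h⟩ x).trans le_self_add
  · refine le_trans ?_ le_add_self
    calc ‖u t x‖ₑ ≤ N * (ENNReal.ofReal t ^ a * ENNReal.ofReal t ^ (-a)) := by
          rw [ofReal_rpow_mul ht.1, add_neg_cancel, ENNReal.rpow_zero, mul_one]
          exact h2 t h ht.2 x
      _ = N * ENNReal.ofReal t ^ a * ENNReal.ofReal t ^ (-a) := by ring
      _ ≤ _ := by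
          exact mul_le_mul' (mul_le_mul' le_rfl (rpow_le_of_le ha ht.2.le)) le_rfl

/-- Solutions may be continued by solutions that start from a later value. -/
theorem RateSol.glue (hn : 1 ≤ n) {f : Sp n → Sp n} (hf : IsData f) {T₁ T₂ : ℝ≥0∞}
    {u w : ℝ → Sp n → Sp n} (hu : RateSol f T₁ u) {t₀ : ℝ} (ht₀ : t₀ ∈ timeI T₁)
    (hw : RateSol (u t₀) T₂ w) :
    RateSol f (ENNReal.ofReal t₀ + T₂) fun t => if t ≤ t₀ then u t else w (t - t₀) := by
  -- The bound on w alone degenerates as t ↓ t₀. On the overlap w agrees with u, which is bounded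
  -- there, so the glued function retains the rate exponent of u.
  have hagree : ∀ t, t ∈ timeI T₁ → t ∈ timeI (ENNReal.ofReal t₀ + T₂) → t₀ < t → ∀ x,
      w (t - t₀) x = u t x := by
    intro t h1 h2 h3 x
    have e : t₀ + (t - t₀) = t := by ring
    have hs : 0 < t - t₀ := sub_pos.2 h3
    have hm1 : t - t₀ ∈ timeI (T₁ - ENNReal.ofReal t₀) :=
      (mem_timeI_sub_iff ht₀.1.le hs).2 (by rwa [e])
    have hm2 : t - t₀ ∈ timeI T₂ := by
      refine ⟨hs, ?_⟩
      have := h2.2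
      rw [← e, ENNReal.ofReal_add ht₀.1.le hs.le] at this
      exact (ENNReal.add_lt_add_iff_left ENNReal.ofReal_ne_top).1 this
    have := RateSol.unique hn (hw.mono (min_le_right (T₁ - ENNReal.ofReal t₀) T₂))
      ((hu.restart hn hf ht₀).mono (min_le_left _ _)) (t := t - t₀)
      ⟨hs, lt_min hm1.2 hm2.2⟩ x
    simp only [e] at this
    exact this
  set U : ℝ → Sp n → Sp n := fun t => if t ≤ t₀ then u t else w (t - t₀) with hU
  have hU1 : ∀ t, t ≤ t₀ → U t = u t := fun t h => if_pos h
  have hU2 : ∀ t, t₀ < t → U t = w (t - t₀) := fun t h => if_neg h.not_ge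
  obtain ⟨hum, humild, a, ha0, ha, Hu⟩ := hu
  obtain ⟨hwm, hwmild, b, hb0, hb, Hw⟩ := hw
  have hUm : Measurable (Function.uncurry U) := by
    have e : Function.uncurry U = fun z : ℝ × Sp n => if z.1 ≤ t₀ then u z.1 z.2 else
        w (z.1 - t₀) z.2 := by
      ext1 z
      simp only [Function.uncurry, hU]
      split_ifs <;> rfl
    rw [e]
    exact Measurable.ite (measurableSet_le measurable_fst measurable_const) hum
      (hwm.comp (f := fun z : ℝ × Sp n => (z.1 - t₀, z.2)) (by fun_prop))
  have hrate : ∀ T' : ℝ, 0 < T' → ENNReal.ofReal T' < ENNReal.ofReal t₀ + T₂ →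
      ∃ M : ℝ≥0∞, M ≠ ∞ ∧ RateBound a M T' U := by
    intro T' hT' hT
    obtain ⟨S, hS1, hS2⟩ := exists_between_time ht₀
    obtain ⟨M, hM, hr⟩ := Hu S (ht₀.1.trans hS1) hS2
    rcases le_or_gt T' t₀ with h | h
    · refine ⟨M, hM, fun t ht x => ?_⟩
      rw [hU1 t (ht.2.le.trans h)]
      exact hr t ⟨ht.1, by linarith [ht.2]⟩ x
    have e : ENNReal.ofReal T' = ENNReal.ofReal t₀ + ENNReal.ofReal (T' - t₀) := by
      rw [← ENNReal.ofReal_add ht₀.1.le (by linarith), add_sub_cancel]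
    rw [e, ENNReal.add_lt_add_iff_left ENNReal.ofReal_ne_top] at hT
    obtain ⟨N, hN, hrw⟩ := Hw (T' - t₀) (by linarith) hT
    have hSt : 0 < S - t₀ := sub_pos.2 hS1
    refine ⟨_, ?_, rateBound_of_parts (t₁ := min S T') (N := N * ENNReal.ofReal (S - t₀) ^ (-b))
      (M := M) ha0 (fun t ht x => ?_) fun t h1 h2 x => ?_⟩
    · exact ENNReal.add_ne_top.2 ⟨hM, ENNReal.mul_ne_top (ENNReal.mul_ne_top hN
        (rpow_ne_top_of_pos hSt _)) (rpow_ne_top_of_pos hT' _)⟩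
    · obtain ⟨htS, htT'⟩ := lt_min_iff.1 ht.2
      have hb := hr t ⟨ht.1, htS⟩ x
      rcases le_or_gt t t₀ with h' | h'
      · rwa [hU1 t h']
      · rw [hU2 t h', hagree t (mem_timeI_of_lt ht.1 htS.le hS2) (mem_timeI_of_lt ht.1 htT'.le
          (by rwa [e, ENNReal.add_lt_add_iff_left ENNReal.ofReal_ne_top])) h']
        exact hb
    · rcases min_le_iff.1 h1 with h' | h'
      · rw [hU2 t (by linarith)]
        refine (hrw (t - t₀) ⟨by linarith, by linarith⟩ x).trans ?_
        rw [ENNReal.rpow_neg, ENNReal.rpow_neg]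
        gcongr
      · exact absurd h2 h'.not_gt
  refine ⟨hUm, fun t ht x => ?_, a, ha0, ha, hrate⟩
  have hbelow : ∀ t, 0 < t → t ≤ t₀ → ∀ x, MildAt f U t x := fun t h0 h x =>
    (mildAt_congr (fun s hs y => by rw [hU1 s (hs.2.trans h)]) h0).1
      (humild t (mem_timeI_of_lt h0 h ht₀.2) x)
  rcases le_or_gt t t₀ with h | h
  · exact hbelow t ht.1 h x
  · have hs : 0 < t - t₀ := sub_pos.2 h
    have e : t₀ + (t - t₀) = t := by ring
    obtain ⟨T', h1, h2⟩ := exists_between_time ht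
    obtain ⟨M, hM, hr⟩ := hrate T' (ht.1.trans h1) h2
    have key := RateSol.mildAt_iff hn hf hUm ht₀.1 hs hM ha (hr.mono (by linarith))
      (hbelow t₀ ht₀.1 le_rfl) x
    rw [e] at key
    refine key.2 ?_
    rw [hU1 t₀ le_rfl]
    have h3 := ht.2
    rw [← e, ENNReal.ofReal_add ht₀.1.le hs.le,
      ENNReal.add_lt_add_iff_left ENNReal.ofReal_ne_top] at h3
    refine (mildAt_congr (fun s hs' y => ?_) hs).1 (hwmild (t - t₀) ⟨hs, h3⟩ x)
    rw [hU2 (t₀ + s) (by linarith [hs'.1]), add_sub_cancel_left]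

end NSLorentz

end

noncomputable section

open MeasureTheory Set Filter
open scoped ENNReal Topology

namespace NSLorentz

variable {n : ℕ}

/-! ### The maximal solution -/

theorem exists_rateSol (hn : 1 ≤ n) {r p q : ℝ≥0∞} (hr : (n : ℝ≥0∞) < r) (hp : 1 < p) (hq : 1 ≤ q)
    (hpq : p = ∞ → q = ∞) {T : ℝ} (hT : 0 < T) {f : Sp n → Sp n} (hfp : MemLorentz p q f)
    (hfr : MemLorentz r ∞ f)
    (hsmall : ENNReal.ofReal (4 * existC n r * T ^ ((1 - n * Expo.inv r) / 2)) * spNorm r ∞ f < 1) :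
    ∃ u, RateSol f (ENNReal.ofReal T) u ∧
      (∃ M : ℝ≥0∞, M ≠ ∞ ∧ ∀ t ∈ Ioo 0 T, spNorm p q (u t) ≤ M) ∧
      ∃ M : ℝ≥0∞, M ≠ ∞ ∧ RateBound (n * Expo.inv r / 2) M T u := by
  obtain ⟨u, h1, h2, hmild⟩ :=
    isExistenceConst_existC hn hr p q hp hq hpq T hT f hfp hfr hsmall
  have hc : ∀ t ∈ Ioo 0 T, cutTime (ENNReal.ofReal T) u t = u t := fun t ht =>
    funext (cutTime_eq u (mem_timeI_ofReal.2 ht))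
  obtain ⟨M₁, hM₁, H1⟩ := h1.exists_le
  obtain ⟨M₂, hM₂, H2⟩ := h2.exists_le
  have hr2 : RateBound (n * Expo.inv r / 2) M₂ T (cutTime (ENNReal.ofReal T) u) := by
    rw [rateBound_iff]
    intro t ht
    rw [hc t ht, show -(n * Expo.inv r / 2) = -(n * Expo.inv r) / 2 by ring]
    exact H2 t ht
  have h0 : 0 ≤ n * Expo.inv r := mul_nonneg (Nat.cast_nonneg n) (inv_toReal_nonneg r)
  have h1' : n * Expo.inv r < 1 := nat_mul_inv_lt_one hr
  refine ⟨cutTime (ENNReal.ofReal T) u, ⟨h1.1, mildEverywhere_congr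
    (fun t ht x => (cutTime_eq u ht x).symm) hmild, _, by positivity, by linarith,
    fun T' h0 hT' => ⟨M₂, hM₂, hr2.mono ?_⟩⟩, ⟨M₁, hM₁, fun t ht => ?_⟩, M₂, hM₂, hr2⟩
  · exact ((ENNReal.ofReal_lt_ofReal_iff_of_nonneg h0.le).1 hT').le
  · rw [hc t ht]
    have := H1 t ht
    rwa [zero_div, ENNReal.rpow_zero, mul_one] at this

theorem expo_pos {r : ℝ≥0∞} (hr : (n : ℝ≥0∞) < r) : 0 < (1 - n * Expo.inv r) / 2 := by
  have : n * Expo.inv r < 1 := nat_mul_inv_lt_one hr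
  linarith

theorem exists_small_time {η e : ℝ} (hη : 0 < η) (he : 0 < e) {N : ℝ≥0∞} (hN : N ≠ ∞) :
    ∃ T : ℝ, 0 < T ∧ ENNReal.ofReal (4 * η * T ^ e) * N < 1 := by
  obtain ⟨T, hT, h⟩ := exists_rpow_mul_le he (K := ENNReal.ofReal (4 * η) * N) (ε := 2⁻¹)
    (ENNReal.mul_ne_top ENNReal.ofReal_ne_top hN) (by simp)
  refine ⟨T, hT, lt_of_le_of_lt (le_trans (le_of_eq ?_) h) (by simp)⟩
  rw [ENNReal.ofReal_mul (by positivity), ENNReal.ofReal_rpow_of_pos hT]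
  ring

theorem one_lt_of_nat_lt (hn : 1 ≤ n) {r : ℝ≥0∞} (hr : (n : ℝ≥0∞) < r) : 1 < r :=
  lt_of_le_of_lt (by exact_mod_cast hn) hr

theorem IsData.exists_rateSol (hn : 1 ≤ n) {f : Sp n → Sp n} (hf : IsData f) :
    ∃ T : ℝ, 0 < T ∧ ∃ u, RateSol f (ENNReal.ofReal T) u := by
  obtain ⟨p, hp, hfp⟩ := hf
  obtain ⟨T, hT, hs⟩ := exists_small_time (existC_pos hn hp) (expo_pos hp) hfp.2.ne
  obtain ⟨u, hu, _⟩ := NSLorentz.exists_rateSol hn hp (one_lt_of_nat_lt hn hp) le_top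
    (fun _ => rfl) hT hfp hfp hs
  exact ⟨T, hT, u, hu⟩

theorem RateSol.exists_bound_after {f : Sp n → Sp n} {T : ℝ≥0∞} {u : ℝ → Sp n → Sp n}
    (h : RateSol f T u) {t₁ T' : ℝ} (ht₁ : 0 < t₁) (hT' : 0 < T') (hT : ENNReal.ofReal T' < T) :
    ∃ N : ℝ≥0∞, N ≠ ∞ ∧ ∀ t, t₁ ≤ t → t < T' → ∀ x, ‖u t x‖ₑ ≤ N := by
  obtain ⟨_, _, a, ha0, _, H⟩ := h
  obtain ⟨M, hM, hr⟩ := H T' hT' hT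
  refine ⟨M * ENNReal.ofReal t₁ ^ (-a), ENNReal.mul_ne_top hM (rpow_ne_top_of_pos ht₁ _),
    fun t h1 h2 x => (hr t ⟨ht₁.trans_le h1, h2⟩ x).trans ?_⟩
  rw [ENNReal.rpow_neg, ENNReal.rpow_neg]
  gcongr

theorem RateSol.unique_min (hn : 1 ≤ n) {f : Sp n → Sp n} {T T' : ℝ≥0∞} {u v : ℝ → Sp n → Sp n}
    (hu : RateSol f T u) (hv : RateSol f T' v) {t : ℝ} (ht : t ∈ timeI T) (ht' : t ∈ timeI T') :
    u t = v t :=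
  funext fun x => (hu.mono (min_le_left T T')).unique hn (hv.mono (min_le_right T T'))
    ⟨ht.1, lt_min ht.2 ht'.2⟩ x

/-- Uniqueness makes the union of all solutions well defined on (0, Tm), where Tm is the supremum of
their existence times. -/
theorem exists_maximal (hn : 1 ≤ n) {f : Sp n → Sp n} (hf : IsData f) :
    ∃ (Tm : ℝ≥0∞) (um : ℝ → Sp n → Sp n), 0 < Tm ∧ RateSol f Tm um ∧
      ∀ T v, IsSol f T v → T ≤ Tm := by
  classical
  set S : Set ℝ≥0∞ := {T | ∃ v, RateSol f T v} with hS
  set Tm := sSup S with hTm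
  set u₀ : ℝ → Sp n → Sp n := fun t =>
    if h : ∃ (T : ℝ≥0∞) (v : ℝ → Sp n → Sp n), RateSol f T v ∧ ENNReal.ofReal t < T then
      h.choose_spec.choose t else 0 with hu₀
  have hagree : ∀ {T v}, RateSol f T v → ∀ t ∈ timeI T, u₀ t = v t := by
    intro T v hv t ht
    have h : ∃ (T : ℝ≥0∞) (v : ℝ → Sp n → Sp n), RateSol f T v ∧ ENNReal.ofReal t < T :=
      ⟨T, v, hv, ht.2⟩
    have e : u₀ t = h.choose_spec.choose t := dif_pos h
    rw [e]
    exact h.choose_spec.choose_spec.1.unique_min hn hv ⟨ht.1, h.choose_spec.choose_spec.2⟩ ht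
  have hex : ∀ {T'}, T' < Tm → ∃ T v, RateSol f T v ∧ T' < T := by
    intro T' h
    obtain ⟨T, ⟨v, hv⟩, hT⟩ := lt_sSup_iff.1 h
    exact ⟨T, v, hv, hT⟩
  have hmeas : Measurable (Function.uncurry (cutTime Tm u₀)) := by
    refine measurable_cutTime fun T' _ hT' => ?_
    obtain ⟨T, v, hv, hT⟩ := hex hT'
    have h := measOn_of_measurable hv.1 T'
    unfold MeasOn at h ⊢
    convert h using 1
    refine indicator_congr fun z hz => ?_
    rw [hagree hv z.1 ⟨hz.1.1, hz.1.2.trans hT⟩]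
  have hcut : ∀ {T v}, RateSol f T v → ∀ t ∈ timeI T, cutTime Tm u₀ t = v t := by
    intro T v hv t ht
    have hT : T ≤ Tm := le_sSup ⟨v, hv⟩
    rw [← hagree hv t ht]
    exact funext (cutTime_eq u₀ ⟨ht.1, ht.2.trans_le hT⟩)
  obtain ⟨T₀, hT₀, v₀, hv₀⟩ := hf.exists_rateSol hn
  have hpos : 0 < Tm := (ENNReal.ofReal_pos.2 hT₀).trans_le (le_sSup ⟨v₀, hv₀⟩)
  refine ⟨Tm, cutTime Tm u₀, hpos, ⟨hmeas, fun t ht x => ?_, ?_⟩, fun T v hv => ?_⟩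
  · obtain ⟨T, v, hv, hT⟩ := hex ht.2
    exact mildEverywhere_congr (fun s hs y => by rw [hcut hv s hs]) hv.2.1 t ⟨ht.1, hT⟩ x
  -- A single rate exponent must serve all T' < Tm. It is taken from one short-time solution; the
  -- others are used only away from t = 0, where they are bounded.
  · obtain ⟨_, _, a, ha0, ha, H⟩ := id hv₀
    refine ⟨a, ha0, ha, fun T' hT' hT => ?_⟩
    obtain ⟨T, v, hv, hTv⟩ := hex hT
    have ht₁ : 0 < T₀ / 2 := by linarith
    obtain ⟨M, hM, hr⟩ := H (T₀ / 2) ht₁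
      ((ENNReal.ofReal_lt_ofReal_iff_of_nonneg ht₁.le).2 (by linarith))
    obtain ⟨N, hN, hb⟩ := hv.exists_bound_after ht₁ hT' hTv
    refine ⟨_, ?_, rateBound_of_parts (t₁ := T₀ / 2) (M := M) (N := N) ha0 (fun t ht x => ?_)
      fun t h1 h2 x => ?_⟩
    · exact ENNReal.add_ne_top.2 ⟨hM, ENNReal.mul_ne_top hN (rpow_ne_top_of_pos hT' _)⟩
    · rw [hcut hv₀ t (mem_timeI_ofReal.2 ⟨ht.1, by linarith [ht.2]⟩)]
      exact hr t ht x
    · rw [hcut hv t (mem_timeI_of_lt (ht₁.trans_le h1) h2.le hTv)]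
      exact hb t h1 h2 x
  · obtain ⟨w, hw, _⟩ := hv.exists_rateSol
    exact le_sSup ⟨w, hw⟩

/-- The lower bound on the rate of blow-up. -/
theorem RateSol.blowup_rate (hn : 1 ≤ n) {f : Sp n → Sp n} (hf : IsData f) {Tm : ℝ≥0∞}
    {um : ℝ → Sp n → Sp n} (hu : RateSol f Tm um) (hmax : ∀ T v, IsSol f T v → T ≤ Tm)
    (hTm : Tm < ∞) {r : ℝ≥0∞} (hr : (n : ℝ≥0∞) < r) {t₀ : ℝ} (ht₀ : t₀ ∈ timeI Tm) :
    ENNReal.ofReal (1 / (4 * existC n r * (Tm.toReal - t₀) ^ ((1 - n * Expo.inv r) / 2)))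
      ≤ spNorm r ∞ (um t₀) := by
  by_contra! hlt
  set e := (1 - n * Expo.inv r) / 2 with he
  have he0 : 0 < e := expo_pos hr
  have hη := existC_pos hn hr
  have hd : 0 < Tm.toReal - t₀ := sub_pos.2 ((ENNReal.ofReal_lt_iff_lt_toReal ht₀.1.le hTm.ne).1 ht₀.2)
  set d := Tm.toReal - t₀ with hdd
  set N := spNorm r ∞ (um t₀) with hN
  have hNt : N ≠ ∞ := hlt.ne_top
  have hde : 0 < d ^ e := Real.rpow_pos_of_pos hd _
  have h1 : 4 * existC n r * d ^ e * N.toReal < 1 := by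
    have := (ENNReal.lt_ofReal_iff_toReal_lt hNt).1 hlt
    rw [lt_div_iff₀ (by positivity)] at this
    linarith
  -- A strict failure of the bound leaves room, by continuity, for an existence time T₂ longer than
  -- Tm - t₀; gluing then contradicts maximality.
  have hcont : ContinuousAt (fun T : ℝ => 4 * existC n r * T ^ e * N.toReal) d :=
    ((Real.continuousAt_rpow_const d e (Or.inl hd.ne')).const_mul _).mul_const _
  obtain ⟨T₂, h2, h3⟩ := ((hcont.eventually_lt_const h1).filter_mono
    (nhdsWithin_le_nhds (s := Ioi d))).and self_mem_nhdsWithin |>.exists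
  have hT₂ : 0 < T₂ := hd.trans h3
  have hmem : MemLorentz r ∞ (um t₀) := ⟨hu.1.of_uncurry_left, hNt.lt_top⟩
  have hsmall : ENNReal.ofReal (4 * existC n r * T₂ ^ e) * spNorm r ∞ (um t₀) < 1 := by
    rw [← hN, ← ENNReal.ofReal_toReal hNt, ← ENNReal.ofReal_mul
      (mul_nonneg (by positivity) (Real.rpow_nonneg hT₂.le _)), ← ENNReal.ofReal_one,
      ENNReal.ofReal_lt_ofReal_iff one_pos]
    exact h2
  obtain ⟨w, hw, _⟩ := exists_rateSol hn hr (one_lt_of_nat_lt hn hr) le_top (fun _ => rfl) hT₂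
    hmem hmem hsmall
  have h4 := hmax _ _ (hu.glue hn hf ht₀ hw).isSol
  rw [← ENNReal.ofReal_add ht₀.1.le hT₂.le] at h4
  have h5 := (ENNReal.ofReal_le_iff_le_toReal hTm.ne).1 h4
  have h6 : d < T₂ := h3
  linarith

/-- Propagation of the `L^{p,q}` norm. -/
theorem RateSol.propagate (hn : 1 ≤ n) {f : Sp n → Sp n} (hf : IsData f) {T : ℝ≥0∞}
    {u : ℝ → Sp n → Sp n} (hu : RateSol f T u) {p q : ℝ≥0∞} (hp : 1 < p) (hq : 1 ≤ q)
    (hpq : p = ∞ → q = ∞) {t₀ T' : ℝ} (ht₀ : 0 < t₀) (ht₀' : t₀ < T') (hT : ENNReal.ofReal T' < T)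
    (h0 : spNorm p q (u t₀) < ∞) :
    ∃ M : ℝ≥0∞, M ≠ ∞ ∧ ∀ t, t₀ ≤ t → t < T' → spNorm p q (u t) ≤ M := by
  have hT' : 0 < T' := ht₀.trans ht₀'
  have hinf : (n : ℝ≥0∞) < ∞ := ENNReal.natCast_lt_top n
  obtain ⟨N, hN, hb⟩ := hu.exists_bound_after ht₀ hT' hT
  obtain ⟨δ, hδ, hsm⟩ := exists_small_time (existC_pos hn hinf) (expo_pos hinf) hN
  -- The local existence time δ is uniform because u is bounded on [t₀,T'). Steps of length δ/2 stay
  -- strictly inside each local interval and reach T' after finitely many restarts.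
  have key : ∀ k : ℕ, ∃ M : ℝ≥0∞, M ≠ ∞ ∧ ∀ t, t₀ ≤ t → t ≤ t₀ + k * (δ / 2) → t < T' →
      spNorm p q (u t) ≤ M := by
    intro k
    induction k with
    | zero =>
      refine ⟨_, h0.ne, fun t h1 h2 _ => ?_⟩
      have : t = t₀ := le_antisymm (by simpa using h2) h1
      rw [this]
    | succ k ih =>
      obtain ⟨M, hM, H⟩ := ih
      set t₁ := t₀ + k * (δ / 2) with ht₁
      have h01 : t₀ ≤ t₁ := by rw [ht₁]; have : 0 ≤ k * (δ / 2) := by positivity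
                               linarith
      rcases le_or_gt T' t₁ with h | h
      · exact ⟨M, hM, fun t h1 _ h3 => H t h1 (h3.le.trans h) h3⟩
      have hm₁ : t₁ ∈ timeI T := mem_timeI_of_lt (ht₀.trans_le h01) h.le hT
      have hmem : MemLorentz p q (u t₁) :=
        ⟨hu.1.of_uncurry_left, (H t₁ h01 le_rfl h).trans_lt hM.lt_top⟩
      have hsm₁ : ENNReal.ofReal (4 * existC n ∞ * δ ^ ((1 - n * Expo.inv (∞ : ℝ≥0∞)) / 2)) *
          spNorm (∞ : ℝ≥0∞) ∞ (u t₁) < 1 := by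
        refine lt_of_le_of_lt (mul_le_mul' le_rfl ?_) hsm
        exact (spNorm_infty_le_top ∞ _).trans (iSup_le fun x => hb t₁ h01 h x)
      obtain ⟨w, hw, ⟨M', hM', Hw⟩, _⟩ := exists_rateSol hn hinf hp hq hpq hδ hmem
        (hu.memLorentz_infty hm₁) hsm₁
      refine ⟨max M M', by simp [hM, hM'], fun t h1 h2 h3 => ?_⟩
      rcases le_or_gt t t₁ with h4 | h4
      · exact (H t h1 h4 h3).trans (le_max_left _ _)
      · have hs : 0 < t - t₁ := sub_pos.2 h4
        have e : t₁ + (t - t₁) = t := by ring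
        have hsδ : t - t₁ < δ := by
          push_cast at h2
          rw [ht₁]; linarith
        have hm : t - t₁ ∈ timeI (T - ENNReal.ofReal t₁) :=
          (mem_timeI_sub_iff hm₁.1.le hs).2 (by
            rw [e]; exact mem_timeI_of_lt (hm₁.1.trans h4) h3.le hT)
        have := (hu.restart hn hf hm₁).unique_min hn hw hm (mem_timeI_ofReal.2 ⟨hs, hsδ⟩)
        simp only [e] at this
        rw [this]
        exact (Hw _ ⟨hs, hsδ⟩).trans (le_max_right _ _)
  obtain ⟨k, hk⟩ := exists_nat_ge ((T' - t₀) / (δ / 2))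
  obtain ⟨M, hM, H⟩ := key k
  have hk' := (div_le_iff₀ (by linarith : 0 < δ / 2)).1 hk
  exact ⟨M, hM, fun t h1 h2 => H t h1 (by linarith) h2⟩

/-- Near t = 0 the solution coincides, by uniqueness, with the one from local existence and inherits
its bounds. At later times the norm propagates and the solution is bounded. -/
theorem RateSol.exists_bounds (hn : 1 ≤ n) {f : Sp n → Sp n} {T : ℝ≥0∞}
    {u : ℝ → Sp n → Sp n} (hu : RateSol f T u) {r p q : ℝ≥0∞} (hr : (n : ℝ≥0∞) < r) (hp : 1 < p)
    (hq : 1 ≤ q) (hpq : p = ∞ → q = ∞) (hfp : MemLorentz p q f) (hfr : MemLorentz r ∞ f) {T' : ℝ}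
    (hT' : 0 < T') (hT : ENNReal.ofReal T' < T) :
    (∃ M : ℝ≥0∞, M ≠ ∞ ∧ ∀ t ∈ Ioo 0 T', spNorm p q (u t) ≤ M) ∧
      ∃ M : ℝ≥0∞, M ≠ ∞ ∧ RateBound (n * Expo.inv r / 2) M T' u := by
  have hf : IsData f := ⟨r, hr, hfr⟩
  obtain ⟨T₀, hT₀, hs⟩ := exists_small_time (existC_pos hn hr) (expo_pos hr) hfr.2.ne
  obtain ⟨v, hv, ⟨M₁, hM₁, H₁⟩, M₂, hM₂, H₂⟩ := NSLorentz.exists_rateSol hn hr hp hq hpq hT₀ hfp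
    hfr hs
  set t₁ := min T₀ T' / 2 with ht₁
  have hmin : 0 < min T₀ T' := lt_min hT₀ hT'
  have ht₁0 : 0 < t₁ := by rw [ht₁]; linarith
  have ht₁T₀ : t₁ < T₀ := by have := min_le_left T₀ T'; rw [ht₁]; linarith
  have ht₁T' : t₁ < T' := by have := min_le_right T₀ T'; rw [ht₁]; linarith
  have huv : ∀ t, 0 < t → t ≤ t₁ → u t = v t := fun t h0 h1 =>
    hu.unique_min hn hv (mem_timeI_of_lt h0 (h1.trans ht₁T'.le) hT)
      (mem_timeI_ofReal.2 ⟨h0, h1.trans_lt ht₁T₀⟩)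
  constructor
  · obtain ⟨M, hM, H⟩ := hu.propagate hn hf hp hq hpq ht₁0 ht₁T' hT (by
      rw [huv t₁ ht₁0 le_rfl]
      exact (H₁ t₁ ⟨ht₁0, ht₁T₀⟩).trans_lt hM₁.lt_top)
    refine ⟨max M M₁, by simp [hM, hM₁], fun t ht => ?_⟩
    rcases le_or_gt t t₁ with h | h
    · rw [huv t ht.1 h]
      exact (H₁ t ⟨ht.1, h.trans_lt ht₁T₀⟩).trans (le_max_right _ _)
    · exact (H t h.le ht.2).trans (le_max_left _ _)
  · obtain ⟨N, hN, hb⟩ := hu.exists_bound_after ht₁0 hT' hT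
    refine ⟨_, ?_, rateBound_of_parts (t₁ := t₁) (M := M₂) (N := N) ?_ (fun t ht x => ?_) hb⟩
    · exact ENNReal.add_ne_top.2 ⟨hM₂, ENNReal.mul_ne_top hN (rpow_ne_top_of_pos hT' _)⟩
    · exact div_nonneg (mul_nonneg (Nat.cast_nonneg n) (inv_toReal_nonneg r)) (by norm_num)
    · rw [huv t ht.1 ht.2.le]
      exact H₂ t ⟨ht.1, ht.2.trans ht₁T₀⟩ x

end NSLorentz

end

noncomputable section

open MeasureTheory Set Filter
open scoped ENNReal Topology

namespace NSLorentz

variable {n : ℕ}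

/-! ### Uniqueness in Lorentz spaces in time -/

/-- For β < ∞ the rearrangement is o(t^{-1/α}) at 0, and only t below the length of the interval
matters. For β = ∞ this fails, as t^{-1/α} shows. -/
theorem smallWeak_of_lorentzNorm {α β : ℝ≥0∞} (hα0 : α ≠ 0) (hα : α ≠ ∞) (hβ1 : 1 ≤ β)
    (hβ : β ≠ ∞) {g ψ : ℝ → ℝ≥0∞} (hg : lorentzNorm volume α β g ≠ ∞) {T : ℝ}
    (h : ∀ t ∈ Ioo 0 T, ψ t ≤ g t) : SmallWeak α T ψ := by
  intro ε hε
  obtain ⟨δ, hδ, H⟩ := exists_rpow_rearr_le hβ1 hβ hα0 hα hg (pos_iff_ne_zero.2 hε)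
  refine ⟨δ / 2, half_pos hδ, fun x y hx hy hxy => lorentzNorm_top_le fun t ht => ?_⟩
  rcases lt_or_ge t δ with htδ | htδ
  · refine (rearr_mono (ae_of_all _ fun s => ?_) t).trans ((rpow_mul_le_iff ht _).1 (H t ht htδ))
    by_cases hs : s ∈ Ioo x y
    · rw [indicator_of_mem hs]
      exact h s ⟨hx.trans_lt hs.1, hs.2.trans_le hy⟩
    · rw [indicator_of_notMem hs]; exact zero_le
  · refine le_trans (b := 0) ?_ zero_le
    rw [rearr_le_iff]
    calc _ ≤ volume (Ioo x y) := measure_mono fun s hs => by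
          by_contra hsI
          rw [mem_ofPred_eq, indicator_of_notMem hsI] at hs
          exact lt_irrefl _ hs
      _ ≤ ENNReal.ofReal t := by
          rw [Real.volume_Ioo]; exact ENNReal.ofReal_le_ofReal (by linarith)

/-- A function with a blow-up of rate at least `(T-t)^{-1/α}` is not in `L^{α,β}`, `β < ∞`. -/
theorem lorentzNorm_eq_top_of_blowup {α β : ℝ≥0∞} (hα0 : α ≠ 0) (hα : α ≠ ∞) (hβ1 : 1 ≤ β)
    (hβ : β ≠ ∞) {g : ℝ → ℝ≥0∞} {T c e : ℝ} (hT : 0 < T) (hc : 0 < c) (he : (α⁻¹).toReal ≤ e)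
    (h : ∀ᵐ t, t ∈ Ioo 0 T → ENNReal.ofReal (c * (T - t) ^ (-e)) ≤ g t) :
    lorentzNorm volume α β g = ∞ := by
  by_contra hg
  have ha : 0 < (α⁻¹).toReal := inv_toReal_pos hα0 hα
  have h2e : 0 < (2 : ℝ) ^ (-e) := Real.rpow_pos_of_pos two_pos _
  have hε : 0 < ENNReal.ofReal (c * 2 ^ (-e) / 2) := ENNReal.ofReal_pos.2 (by positivity)
  obtain ⟨δ, hδ, H⟩ := exists_rpow_rearr_le hβ1 hβ hα0 hα hg hε
  set s := min (min (δ / 2) (T / 4)) 1 with hs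
  have hs0 : 0 < s := lt_min (lt_min (by linarith) (by linarith)) one_pos
  have hsδ : s < δ := by
    have : s ≤ δ / 2 := (min_le_left _ _).trans (min_le_left _ _)
    linarith
  have hsT : 2 * s < T := by
    have : s ≤ T / 4 := (min_le_left _ _).trans (min_le_right _ _)
    linarith
  have hs1 : s ≤ 1 := min_le_right _ _
  -- Up to a null set g exceeds this value on (T-2s, T), whose length 2s is more than s. Since e ≥
  -- 1/α, this contradicts g^*(s) = o(s^{-1/α}).
  have hy : ENNReal.ofReal (c * (2 * s) ^ (-e)) ≤ rearr volume g s := by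
    refine le_of_lt ?_
    rw [lt_rearr_iff, distrib]
    calc ENNReal.ofReal s < ENNReal.ofReal (2 * s) :=
          (ENNReal.ofReal_lt_ofReal_iff (by linarith)).2 (by linarith)
      _ = volume (Ioo (T - 2 * s) T) := by rw [Real.volume_Ioo]; congr 1; ring
      _ ≤ _ := by
          refine measure_mono_ae ?_
          filter_upwards [h] with t ht htI
          have h1 : 0 < T - t := sub_pos.2 htI.2
          have h2 : T - t < 2 * s := by linarith [htI.1]
          refine lt_of_lt_of_le ?_ (ht ⟨by linarith [htI.1], htI.2⟩)
          have h3 : (2 * s) ^ (-e) < (T - t) ^ (-e) :=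
            Real.rpow_lt_rpow_of_neg h1 h2 (by linarith)
          exact (ENNReal.ofReal_lt_ofReal_iff (mul_pos hc (Real.rpow_pos_of_pos h1 _))).2
            (by gcongr)
  have h1 := (mul_le_mul' le_rfl hy).trans (H s hs0 hsδ)
  rw [ENNReal.ofReal_rpow_of_pos hs0, ← ENNReal.ofReal_mul (Real.rpow_nonneg hs0.le _),
    ENNReal.ofReal_le_ofReal_iff (by positivity), Real.mul_rpow two_pos.le hs0.le] at h1
  have h4 : 1 ≤ s ^ (α⁻¹).toReal * s ^ (-e) := by
    rw [← Real.rpow_add hs0]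
    exact Real.one_le_rpow_of_pos_of_le_one_of_nonpos hs0 hs1 (by linarith)
  have h5 : c * 2 ^ (-e) * 1 ≤ c * 2 ^ (-e) * (s ^ (α⁻¹).toReal * s ^ (-e)) := by gcongr
  have h6 : 0 < c * 2 ^ (-e) := by positivity
  nlinarith

theorem lorentzNorm_infty_weak_le_of_rateBound {a T : ℝ} {M : ℝ≥0∞} {u : ℝ → Sp n → Sp n}
    (h : RateBound a M T u) {t : ℝ} (ht : t ∈ Ioo 0 T) :
    spNorm (∞ : ℝ≥0∞) ∞ (u t) ≤ M * ENNReal.ofReal t ^ (-a) :=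
  (spNorm_infty_le_top ∞ _).trans (rateBound_iff.1 h t ht)

/-- The `L^{r,1}` norms of a solution with data in weak `L^{r₀}`, `r₀ < r < ∞`. -/
theorem RateSol.exists_lorentz_one_bound (hn : 1 ≤ n) {f : Sp n → Sp n} {T : ℝ≥0∞}
    {u : ℝ → Sp n → Sp n} (hu : RateSol f T u) {r₀ r : ℝ≥0∞} (hr₀ : (n : ℝ≥0∞) < r₀)
    (hfr : MemLorentz r₀ ∞ f) (h0r : r₀ < r) (hr : r < ∞) {T' : ℝ} (hT' : 0 < T')
    (hT : ENNReal.ofReal T' < T) : ∃ M : ℝ≥0∞, M ≠ ∞ ∧ ∀ t ∈ Ioo 0 T',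
      spNorm r 1 (u t) ≤ M * ENNReal.ofReal t ^ ((n * Expo.inv r - n * Expo.inv r₀) / 2) := by
  obtain ⟨⟨M₁, hM₁, H₁⟩, M₂, hM₂, H₂⟩ := hu.exists_bounds hn hr₀ (one_lt_of_nat_lt hn hr₀) le_top
    (fun _ => rfl) hfr hfr hT' hT
  obtain ⟨C, hC, H⟩ := lorentzNorm_one_le (μ := (volume : Measure (Sp n))) (p₁ := ∞)
    (ne_bot_of_gt hr₀) h0r hr
  refine ⟨C * (M₂ + M₁), ENNReal.mul_ne_top hC (ENNReal.add_ne_top.2 ⟨hM₂, hM₁⟩), fun t ht => ?_⟩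
  -- Splitting at b = t^{n/2}, the parabolic volume scale, gives both terms of the interpolation the
  -- same power t^{(n/r - n/r₀)/2}.
  have hb : 0 < t ^ ((n : ℝ) / 2) := Real.rpow_pos_of_pos ht.1 _
  have e : ∀ a : ℝ, ENNReal.ofReal (t ^ ((n : ℝ) / 2)) ^ a = ENNReal.ofReal t ^ ((n : ℝ) / 2 * a) :=
    fun a => by rw [← ENNReal.ofReal_rpow_of_pos ht.1, ← ENNReal.rpow_mul]
  refine (H _ _ hb).trans ?_
  rw [mul_assoc, add_mul]
  gcongr C * (?_ + ?_)
  · calc _ ≤ M₂ * ENNReal.ofReal t ^ (-(n * Expo.inv r₀ / 2)) *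
          ENNReal.ofReal (t ^ ((n : ℝ) / 2)) ^ ((r⁻¹).toReal - ((∞ : ℝ≥0∞)⁻¹).toReal) := by
          gcongr
          exact lorentzNorm_infty_weak_le_of_rateBound H₂ ht
      _ = _ := by
          rw [e, mul_assoc, ofReal_rpow_mul ht.1, ENNReal.inv_top, ENNReal.toReal_zero, inv_coe,
            inv_coe]
          congr 2; ring
  · calc _ ≤ M₁ * ENNReal.ofReal (t ^ ((n : ℝ) / 2)) ^ ((r⁻¹).toReal - (r₀⁻¹).toReal) := by
          gcongr
          exact H₁ t ht
      _ = _ := by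
          rw [e, inv_coe, inv_coe]
          congr 2; ring

theorem RateSol.exists_weak_bound (hn : 1 ≤ n) {f : Sp n → Sp n} {T : ℝ≥0∞}
    {u : ℝ → Sp n → Sp n} (hu : RateSol f T u) {r₀ r : ℝ≥0∞} (hr₀ : (n : ℝ≥0∞) < r₀)
    (hfr : MemLorentz r₀ ∞ f) (h0r : r₀ ≤ r) {T' : ℝ} (hT' : 0 < T')
    (hT : ENNReal.ofReal T' < T) : ∃ M : ℝ≥0∞, M ≠ ∞ ∧ ∀ t ∈ Ioo 0 T',
      spNorm r ∞ (u t) ≤ M * ENNReal.ofReal t ^ ((n * Expo.inv r - n * Expo.inv r₀) / 2) := by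
  rcases h0r.eq_or_lt with rfl | h
  · obtain ⟨⟨M₁, hM₁, H₁⟩, _⟩ := hu.exists_bounds hn hr₀ (one_lt_of_nat_lt hn hr₀) le_top
      (fun _ => rfl) hfr hfr hT' hT
    refine ⟨M₁, hM₁, fun t ht => (H₁ t ht).trans_eq ?_⟩
    rw [sub_self, zero_div, ENNReal.rpow_zero, mul_one]
  rcases eq_or_ne r ∞ with rfl | hr
  · obtain ⟨_, M₂, hM₂, H₂⟩ := hu.exists_bounds hn hr₀ (one_lt_of_nat_lt hn hr₀) le_top
      (fun _ => rfl) hfr hfr hT' hT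
    refine ⟨M₂, hM₂, fun t ht => (lorentzNorm_infty_weak_le_of_rateBound H₂ ht).trans_eq ?_⟩
    rw [inv_coe (∞ : ℝ≥0∞), ENNReal.inv_top, ENNReal.toReal_zero]
    congr 2; ring
  · obtain ⟨M, hM, H⟩ := hu.exists_lorentz_one_bound hn hr₀ hfr h hr.lt_top hT' hT
    exact ⟨M, hM, fun t ht => (lorentzNorm_weak_le le_rfl (ne_bot_of_gt h)
      (fun h => absurd h hr) _).trans (H t ht)⟩

/-- Weak-strong uniqueness for the maximal solution. -/
theorem RateSol.unique_lorentz (hn : 1 ≤ n) {f : Sp n → Sp n} {Tm : ℝ≥0∞}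
    {um : ℝ → Sp n → Sp n} (hu : RateSol f Tm um) (hTm : 0 < Tm)
    (hmax : ∀ T v, IsSol f T v → T ≤ Tm) {r₀ r α β : ℝ≥0∞} (hr₀ : (n : ℝ≥0∞) < r₀)
    (hfr : MemLorentz r₀ ∞ f) (h0r : r₀ ≤ r) (hα2 : 2 < α) (hα : α ≠ ∞) (hβ1 : 1 ≤ β) (hβ : β ≠ ∞)
    (hlow : n * Expo.inv r₀ < 2 * Expo.inv α + n * Expo.inv r)
    (hup : 2 * Expo.inv α + n * Expo.inv r ≤ 1) {T : ℝ≥0∞} {v : ℝ → Sp n → Sp n}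
    (hvm : ∀ T' : ℝ≥0∞, 0 < T' → T' < T → MeasOn T' v)
    (hvL : ∀ T' : ℝ≥0∞, 0 < T' → T' < T → lorentzNorm (volume : Measure ℝ) α β
      ((timeI T').indicator fun t => spNorm r ∞ (v t)) < ∞)
    (hv : ∀ᵐ t, t ∈ timeI T → ∀ᵐ x, MildAt f v t x) :
    T ≤ Tm ∧ ∀ᵐ t, t ∈ timeI T → ∀ᵐ x, um t x = v t x := by
  have hα0 : α ≠ 0 := (zero_lt_two.trans hα2).ne'
  have hr : (n : ℝ≥0∞) < r := hr₀.trans_le h0r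
  have hf : IsData f := ⟨r₀, hr₀, hfr⟩
  have hloc : ∀ S : ℝ, 0 < S → ENNReal.ofReal S < Tm → ENNReal.ofReal S < T →
      ∀ᵐ t, t ∈ Ioo 0 S → ∀ᵐ x, um t x = v t x := by
    intro S hS hSm hST
    have hw := measurable_cutTime hvm
    have hc : ∀ t ∈ Ioo 0 S, ∀ x, cutTime T v t x = v t x := fun t ht x =>
      cutTime_eq v (mem_timeI_of_lt ht.1 ht.2.le hST) x
    obtain ⟨M, hM, H⟩ := hu.exists_weak_bound hn hr₀ hfr h0r hS hSm
    have hinv : r⁻¹ ≤ r₀⁻¹ := ENNReal.inv_le_inv.2 h0r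
    have hinv' : (r⁻¹).toReal ≤ (r₀⁻¹).toReal :=
      ENNReal.toReal_mono (ENNReal.inv_ne_top.2 (ne_bot_of_gt hr₀)) hinv
    -- The strict inequality n/r₀ < 2/α + n/r says that the rate (n/r₀ - n/r)/2 of u_* in weak L^r
    -- is below 1/α.
    have h1 : SmallWeak α S fun t => lorentzNorm volume r ∞ fun x => ‖um t x‖ₑ := by
      refine smallWeak_of_le hM (a := (n * Expo.inv r₀ - n * Expo.inv r) / 2) ?_ ?_ fun t ht => ?_
      · have : n * Expo.inv r ≤ n * Expo.inv r₀ :=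
          mul_le_mul_of_nonneg_left hinv' (Nat.cast_nonneg n)
        linarith
      · rw [inv_coe α] at hlow
        linarith
      · refine (H t ht).trans_eq ?_
        congr 2; ring
    have h2 : SmallWeak α S fun t => lorentzNorm volume r ∞ fun x => ‖cutTime T v t x‖ₑ := by
      refine smallWeak_of_lorentzNorm hα0 hα hβ1 hβ
        (hvL (ENNReal.ofReal S) (ENNReal.ofReal_pos.2 hS) hST).ne fun t ht => ?_
      rw [indicator_of_mem (mem_timeI_ofReal.2 ht), spNorm_coe]
      simp_rw [hc t ht]
      exact le_rfl
    have h3 := mild_ae_unique hn hr hα2 hα hup hu.1 hw h1 h2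
      (ae_of_all _ fun t ht => ae_of_all _ (hu.2.1 t (mem_timeI_of_lt ht.1 ht.2.le hSm)))
      (by
        filter_upwards [hv] with t ht htS
        have htT := mem_timeI_of_lt htS.1 htS.2.le hST
        filter_upwards [ht htT] with x hx
        exact (mildAt_congr (fun s hs y => (hc s ⟨hs.1, hs.2.trans_lt htS.2⟩ y).symm) htS.1).1 hx)
    filter_upwards [h3] with t ht htS
    filter_upwards [ht htS] with x hx
    rw [hx, hc t htS]
  have hmin : ∀ᵐ t, t ∈ timeI (min T Tm) → ∀ᵐ x, um t x = v t x := by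
    rcases eq_or_ne (min T Tm) 0 with h | h
    · exact ae_of_all _ fun t ht => absurd ht.2 (by rw [h]; exact not_lt_zero)
    obtain ⟨τ, _, hτI, hlim⟩ := exists_seq_strictMono_tendsto' (pos_iff_ne_zero.2 h)
    have hk : ∀ k, ∀ᵐ t, t ∈ Ioo 0 (τ k).toReal → ∀ᵐ x, um t x = v t x := fun k => by
      have ht := (hτI k).2.ne_top
      have e := ENNReal.ofReal_toReal ht
      exact hloc _ (ENNReal.toReal_pos (hτI k).1.ne' ht) (e.symm ▸ (hτI k).2.trans_le (min_le_right _ _))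
        (e.symm ▸ (hτI k).2.trans_le (min_le_left _ _))
    filter_upwards [ae_all_iff.2 hk] with t ht htI
    obtain ⟨k, hk'⟩ := (hlim.eventually_const_lt htI.2).exists
    exact ht k ⟨htI.1, (ENNReal.ofReal_lt_iff_lt_toReal htI.1.le (hτI k).2.ne_top).1 hk'⟩
  have hle : T ≤ Tm := by
    -- If v outlived Tm, it would agree with u_* on (0,Tm) and inherit the blow-up rate (1 - n/r)/2
    -- ≥ 1/α, which is incompatible with L^{α,β} for β < ∞.
    by_contra! hlt
    have hTmt : Tm < ∞ := hlt.trans_le le_top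
    obtain ⟨T', h1, h2⟩ := exists_between hlt
    have hpos : 0 < Tm.toReal := ENNReal.toReal_pos hTm.ne' hTmt.ne
    have he := expo_pos hr
    refine (hvL T' (hTm.trans h1) h2).ne (lorentzNorm_eq_top_of_blowup hα0 hα hβ1 hβ
      (e := (1 - n * Expo.inv r) / 2) (c := 1 / (4 * existC n r)) hpos ?_ ?_ ?_)
    · have := existC_pos hn hr
      positivity
    · rw [inv_coe α] at hup
      linarith
    · rw [min_eq_right hlt.le] at hmin
      filter_upwards [hmin] with t ht htI
      have htm : t ∈ timeI Tm :=
        ⟨htI.1, (ENNReal.ofReal_lt_iff_lt_toReal htI.1.le hTmt.ne).2 htI.2⟩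
      rw [indicator_of_mem (show t ∈ timeI T' from ⟨htm.1, htm.2.trans h1⟩)]
      have h3 := hu.blowup_rate hn hf hmax hTmt hr htm
      have h4 : spNorm r ∞ (um t) ≤ spNorm r ∞ (v t) := lorentzNorm_mono (by
        filter_upwards [ht htm] with x hx using by rw [hx])
      refine le_trans (le_of_eq ?_) (h3.trans h4)
      rw [Real.rpow_neg (sub_pos.2 htI.2).le]
      congr 1
      rw [one_div, one_div, mul_inv (4 * existC n r)]
  refine ⟨hle, ?_⟩
  rwa [min_eq_left hle] at hmin

end NSLorentz

end

/-! ### Assembly of the theorem -/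

theorem corollary2p6 (n : ℕ) (hn : 1 ≤ n) :
    -- the constants `η_{n,r}`, `r ∈ (n,∞]`, of the local existence theory
    ∃ (C : ℝ) (η : ℝ≥0∞ → ℝ),
      (∀ r : ℝ≥0∞, (n : ℝ≥0∞) < r →
        0 < η r ∧
        η r ≤ C * ((1 - Expo.inv r)⁻¹ *
          ∫ s in Ioo (0 : ℝ) 1, (1 - s) ^ (-(1 / 2) : ℝ) * s ^ (-(n * Expo.inv r))) ∧
        IsExistenceConst n r (η r)) ∧
      ∀ f : Sp n → Sp n, (∃ p : ℝ≥0∞, (n : ℝ≥0∞) < p ∧ MemLorentz p ∞ f) →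
        ∃ (Tm : ℝ≥0∞) (um : ℝ → Sp n → Sp n),
          IsMaximalSol f Tm um ∧
          -- (i)
          (Tm < ∞ → ∀ r : ℝ≥0∞, (n : ℝ≥0∞) < r → ∀ t₀ ∈ timeI Tm,
            ENNReal.ofReal (1 / (4 * η r * (Tm.toReal - t₀) ^ ((1 - n * Expo.inv r) / 2)))
              ≤ spNorm r ∞ (um t₀)) ∧
          -- (ii)
          (∀ r₀ : ℝ≥0∞, (n : ℝ≥0∞) < r₀ → MemLorentz r₀ ∞ f →
            (MemJm 0 r₀ ∞ Tm um ∧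
              MemJm (-(n * Expo.inv r₀)) ⊤ ∞ Tm um ∧
              ∀ r : ℝ≥0∞, r₀ < r → r < ∞ →
                MemJm (n * Expo.inv r - n * Expo.inv r₀) r 1 Tm um) ∧
            ∀ (r : Expo) (α β : ℝ≥0∞), (r₀ : Expo) ≤ r → 2 < α → α < ∞ → 1 ≤ β → β < ∞ →
              n * Expo.inv r₀ < 2 * Expo.inv α + n * Expo.inv r →
              2 * Expo.inv α + n * Expo.inv r ≤ 1 →
              ∀ (T : ℝ≥0∞) (v : ℝ → Sp n → Sp n), 0 < T → MemLm α β r ∞ T v → MildAE r f T v →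
                T ≤ Tm ∧
                ∀ᵐ t ∂(volume : Measure ℝ), t ∈ timeI T → Holds r fun x => um t x = v t x) ∧
          -- (iii)
          (∀ r₀ p q : ℝ≥0∞, (n : ℝ≥0∞) < r₀ → 1 < p → p ≤ r₀ → 1 ≤ q → (p = ∞ → q = ∞) →
            MemLorentz p q f → MemLorentz r₀ ∞ f →
            MemJm 0 p q Tm um ∧
            ∀ r : ℝ≥0∞, p < r → r < r₀ → MemJm 0 r 1 Tm um) := by
  -- The upper bound on η holds with equality, since `existC` is this constant times r' and the beta
  -- integral.
  refine ⟨kerC n * n, existC n, fun r hr => ⟨existC_pos hn hr, le_rfl,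
    isExistenceConst_existC hn hr⟩, fun f hf => ?_⟩
  obtain ⟨Tm, um, hpos, hu, hmax⟩ := exists_maximal hn hf
  refine ⟨Tm, um, ⟨hpos, hu.isSol, hmax, fun v hv t ht x => ?_⟩,
    fun hTm r hr t₀ ht₀ => hu.blowup_rate hn hf hmax hTm hr ht₀,
    fun r₀ hr₀ hfr => ⟨⟨?_, ?_, fun r h0r hr => ?_⟩, ?_⟩,
    fun r₀ p q hr₀ hp hpr hq hpq hfp hfr => ⟨?_, fun r hpr' hr => ?_⟩⟩
  · obtain ⟨w, hw, hwv⟩ := hv.exists_rateSol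
    rw [← hwv t ht x]
    exact hw.unique hn hu ht x
  · refine (memJm_iff hu.1).2 fun T' hT' hT => ?_
    simp only [zero_div, ENNReal.rpow_zero, mul_one]
    exact (hu.exists_bounds hn hr₀ (one_lt_of_nat_lt hn hr₀) le_top (fun _ => rfl) hfr hfr hT' hT).1
  · refine (memJm_iff hu.1).2 fun T' hT' hT => ?_
    obtain ⟨_, M, hM, H⟩ :=
      hu.exists_bounds hn hr₀ (one_lt_of_nat_lt hn hr₀) le_top (fun _ => rfl) hfr hfr hT' hT
    rw [neg_div]
    exact ⟨M, hM, rateBound_iff.1 H⟩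
  · exact (memJm_iff hu.1).2 fun T' hT' hT => hu.exists_lorentz_one_bound hn hr₀ hfr h0r hr hT' hT
  · intro r α β h0r hα2 hα hβ1 hβ hlow hup T v _ hvL hv
    induction r using WithTop.recTopCoe with
    | coe r =>
      exact hu.unique_lorentz hn hpos hmax hr₀ hfr (WithTop.coe_le_coe.1 h0r) hα2 hα.ne hβ1 hβ.ne
        hlow hup (fun T' h h' => (hvL T' h h').1) (fun T' h h' => (hvL T' h h').2) hv
    | top =>
      -- The exponent ∞̄ has the same reciprocal as ∞ and a stronger norm, so the case r = ∞ gives T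
      -- ≤ T_* and equality almost everywhere.
      have hinv : Expo.inv ((∞ : ℝ≥0∞) : Expo) = Expo.inv ⊤ := by
        rw [inv_coe, ENNReal.inv_top, ENNReal.toReal_zero]; rfl
      have hLv : ∀ T' : ℝ≥0∞, 0 < T' → T' < T → lorentzNorm (volume : Measure ℝ) α β
          ((timeI T').indicator fun t => spNorm ((∞ : ℝ≥0∞) : Expo) ∞ (v t)) < ∞ := by
        intro T' h0 h1
        refine lt_of_le_of_lt (lorentzNorm_mono (ae_of_all _ fun t => ?_)) (hvL T' h0 h1).2
        by_cases ht : t ∈ timeI T'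
        · rw [indicator_of_mem ht, indicator_of_mem ht]
          exact spNorm_infty_le_top ∞ (v t)
        · rw [indicator_of_notMem ht, indicator_of_notMem ht]
      obtain ⟨hT, h⟩ := hu.unique_lorentz hn hpos hmax hr₀ hfr le_top hα2 hα.ne hβ1 hβ.ne
        (r := ∞) (by rw [hinv]; exact hlow) (by rw [hinv]; exact hup)
        (fun T' h h' => (hvL T' h h').1)
        hLv (hv.mono fun t ht htT => ae_of_all _ (ht htT))
      -- At almost every t both functions satisfy the equation at all x, and B does not see null
      -- sets, so equality holds at every x.
      refine ⟨hT, hv.mono fun t ht htT x => ae_mild_upgrade (h.mono fun s hs hst => hs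
        ⟨hst.1, (ENNReal.ofReal_le_ofReal hst.2.le).trans_lt htT.2⟩)
        (hu.2.1 t ⟨htT.1, htT.2.trans_le hT⟩ x) (ht htT x)⟩
  · refine (memJm_iff hu.1).2 fun T' hT' hT => ?_
    simp only [zero_div, ENNReal.rpow_zero, mul_one]
    exact (hu.exists_bounds hn hr₀ hp hq hpq hfp hfr hT' hT).1
  · refine (memJm_iff hu.1).2 fun T' hT' hT => ?_
    simp only [zero_div, ENNReal.rpow_zero, mul_one]
    have hp0 : p ≠ 0 := (zero_lt_one.trans hp).ne'
    obtain ⟨M₀, hM₀, H₀⟩ := (hu.exists_bounds hn hr₀ hp hq hpq hfp hfr hT' hT).1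
    obtain ⟨M₁, hM₁, H₁⟩ := (hu.exists_bounds hn hr₀ (one_lt_of_nat_lt hn hr₀) le_top
      (fun _ => rfl) hfr hfr hT' hT).1
    obtain ⟨C, hC, H⟩ := lorentzNorm_one_le (μ := (volume : Measure (Sp n))) hp0 hpr' hr
    refine ⟨C * (M₁ + M₀), ENNReal.mul_ne_top hC (ENNReal.add_ne_top.2 ⟨hM₁, hM₀⟩), fun t ht => ?_⟩
    -- Both endpoint norms are bounded on (0,T'), so no balancing is needed and the splitting point
    -- is 1.
    refine (H _ 1 one_pos).trans ?_
    simp only [ENNReal.ofReal_one, ENNReal.one_rpow, mul_one]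
    exact mul_le_mul' le_rfl (add_le_add (H₁ t ht)
      ((lorentzNorm_weak_le hq hp0 hpq _).trans (H₀ t ht)))
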